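/- Let $(N,\tilde g)$ be a smooth $n$-dimensional Riemannian manifold without boundary (Hausdorff, second countable), and let $M$ be a smooth $\ell$-dimensional manifold without boundary, smoothly embedded in $\mathbb R^m$. Let $U\subset N$ be open and precompact with Lipschitz boundary, i.e. every point of $\partial U$ lies in a smooth coordinate system of $N$ in which, near that point and after a rotation, $U$ is the region $\{x_n>\gamma(x_1,\dots,x_{n-1})\}$ for a Lipschitz function $\gamma$. Let $f\colon U\to M$ be continuous, with $f\in W^{1,\infty}(U,\mathbb R^m)$ and weak differential $df$, and suppose that there is a constant $\Lambda_0>0$ with $$\Lambda_0^{-1}\,\tilde g(v,v)\le |df_x(v)|^2\le \Lambda_0\,\tilde g(v,v)\qquad\text{for a.e. } x\in U\text{ and all } v\in T_xN$$ (that is, $f$ is a $W^{1,\infty}$ weak immersion of $U$ into $M$). Suppose moreover that $df\in VMO(U)$, i.e. for every smooth coordinate system $(V,\phi)$ of $N$ and every $\xi\in C^\infty_c(V)$ the weak gradient $G=\nabla((\xi f)\circ\phi^{-1})$ on $\Omega=\phi(V\cap U)$ satisfies $$\sup\Big\{\frac1{|B|}\int_{B}\Big|G-\frac1{|B|}\int_{B}G\Big|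 : B\subset\Omega \text{ a ball of radius }\rho\le r\Big\}\longrightarrow 0\qquad (r\to0).$$ Then there are a constant $\Lambda>0$ and a sequence of $C^\infty$ immersions $f_k\in C^\infty(\overline U,M)$, $k\in\mathbb N$ (each $f_k$ is the restriction of a smooth map into $M$ defined on an open neighbourhood of $\overline U$, and its differential is injective at every point of $\overline U$) such that $f_k\to f$ uniformly on $U$, $df_k\to df$ a.e. on $U$, and $$\Lambda^{-1}|v|_{\tilde g}\le |d(f_k)_x(v)|_{\mathbb R^m}\le\Lambda|v|_{\tilde g}\qquad\text{for all }x\in U,\ v\in T_xN,\ k\in\mathbb N.$$ Moreover, the sequence can be chosen such that, for every $1\le p<\infty$ with $f\in W^{2,p}(U)$, $f_k\to f$ strongly in $W^{2,p}(U)$. -/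

import Mathlib

open Set Filter MeasureTheory Metric
open scoped Manifold ContDiff Topology ENNReal NNReal RealInnerProductSpace

noncomputable section

/-! ### Sobolev spaces, mean oscillation and Lipschitz boundaries in Euclidean space -/

section Euclidean

variable {n : ℕ} {F : Type*} [NormedAddCommGroup F] [NormedSpace ℝ F]

/-- `G` is the weak derivative (gradient) of `u` on the open set `Ω ⊆ ℝⁿ`: both are locally
integrable on `Ω` and `∫ (∂_v ψ) u = - ∫ ψ G v` for all test functions `ψ ∈ C_c^∞(Ω)` and all
directions `v`. -/
def HasWeakDeriv (Ω : Set (EuclideanSpace ℝ (Fin n))) (u : EuclideanSpace ℝ (Fin n) → F)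
    (G : EuclideanSpace ℝ (Fin n) → EuclideanSpace ℝ (Fin n) →L[ℝ] F) : Prop :=
  LocallyIntegrableOn u Ω volume ∧ LocallyIntegrableOn G Ω volume ∧
    ∀ ψ : EuclideanSpace ℝ (Fin n) → ℝ, ContDiff ℝ ∞ ψ → HasCompactSupport ψ → tsupport ψ ⊆ Ω →
      ∀ v : EuclideanSpace ℝ (Fin n),
        ∫ x in Ω, (fderiv ℝ ψ x v) • u x = - ∫ x in Ω, ψ x • G x v

/-- The `W^{1,p}(Ω)`-norm of `u`, equal to `∞` if `u` has no weak derivative. (The weak derivative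
is unique up to null sets, so the infimum ranges over copies of one number.) -/
def sobolevNormOne (p : ℝ≥0∞) (Ω : Set (EuclideanSpace ℝ (Fin n)))
    (u : EuclideanSpace ℝ (Fin n) → F) : ℝ≥0∞ :=
  ⨅ (G : EuclideanSpace ℝ (Fin n) → EuclideanSpace ℝ (Fin n) →L[ℝ] F) (_ : HasWeakDeriv Ω u G),
    eLpNorm u p (volume.restrict Ω) + eLpNorm G p (volume.restrict Ω)

/-- The `W^{2,p}(Ω)`-norm of `u`, equal to `∞` if `u` does not have weak derivatives of first and
second order. -/
def sobolevNormTwo (p : ℝ≥0∞) (Ω : Set (EuclideanSpace ℝ (Fin n)))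
    (u : EuclideanSpace ℝ (Fin n) → F) : ℝ≥0∞ :=
  ⨅ (G : EuclideanSpace ℝ (Fin n) → EuclideanSpace ℝ (Fin n) →L[ℝ] F) (_ : HasWeakDeriv Ω u G),
    eLpNorm u p (volume.restrict Ω) + sobolevNormOne p Ω G

/-- The modulus of mean oscillation
`β_r(f) = sup { ⨍_B |f - ⨍_B f| : B ⊆ Ω a ball of radius ρ ≤ r }`. -/
def oscModulus (Ω : Set (EuclideanSpace ℝ (Fin n))) (f : EuclideanSpace ℝ (Fin n) → F) (r : ℝ) :
    ℝ≥0∞ :=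
  ⨆ (x : EuclideanSpace ℝ (Fin n)) (ρ : ℝ) (_ : 0 < ρ) (_ : ρ ≤ r) (_ : ball x ρ ⊆ Ω),
    ⨍⁻ y in ball x ρ, ‖f y - ⨍ z in ball x ρ, f z ∂volume‖ₑ ∂volume

/-- `f ∈ VMO(Ω)`: `f` is locally integrable on `Ω` and `β_r(f) → 0` as `r → 0`. -/
def MemVMO (Ω : Set (EuclideanSpace ℝ (Fin n))) (f : EuclideanSpace ℝ (Fin n) → F) : Prop :=
  LocallyIntegrableOn f Ω volume ∧ Tendsto (oscModulus Ω f) (𝓝[>] 0) (𝓝 0)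

/-- Near the point `y`, and after a rotation which takes the unit vector `e` to the last coordinate
direction, the set `Ω` is the region strictly above the graph of a Lipschitz function `γ`. -/
def IsLipschitzGraphNear (Ω : Set (EuclideanSpace ℝ (Fin n))) (y : EuclideanSpace ℝ (Fin n)) :
    Prop :=
  ∃ r : ℝ, 0 < r ∧ ∃ e : EuclideanSpace ℝ (Fin n), ‖e‖ = 1 ∧
    ∃ γ : (ℝ ∙ e)ᗮ → ℝ, (∃ K : ℝ≥0, LipschitzWith K γ) ∧
      ∀ x ∈ ball y r, x ∈ Ω ↔ γ ((ℝ ∙ e)ᗮ.orthogonalProjectionOnto x) < ⟪e, x⟫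

end Euclidean

/-! ### The same notions on a smooth manifold -/

section OnManifold

variable {n : ℕ} {N : Type*} [TopologicalSpace N] [ChartedSpace (EuclideanSpace ℝ (Fin n)) N]
  {F : Type*} [NormedAddCommGroup F] [NormedSpace ℝ F]

/-- `φ(V ∩ U)` for a coordinate system `(V, φ)`. -/
def chartImage (φ : OpenPartialHomeomorph N (EuclideanSpace ℝ (Fin n))) (U : Set N) :
    Set (EuclideanSpace ℝ (Fin n)) :=
  φ '' (φ.source ∩ U)

/-- `ξ ∈ C_c^∞(V)` for a coordinate system `(V, φ)`. -/
def IsCutoff (φ : OpenPartialHomeomorph N (EuclideanSpace ℝ (Fin n))) (ξ : N → ℝ) : Prop :=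
  ContMDiff (𝓡 n) 𝓘(ℝ, ℝ) ∞ ξ ∧ HasCompactSupport ξ ∧ tsupport ξ ⊆ φ.source

/-- The localized coordinate representation `(ξ f) ∘ φ⁻¹`. -/
def localRep (φ : OpenPartialHomeomorph N (EuclideanSpace ℝ (Fin n))) (ξ : N → ℝ) (f : N → F) :
    EuclideanSpace ℝ (Fin n) → F :=
  fun z => ξ (φ.symm z) • f (φ.symm z)

/-- The boundary of `U` is Lipschitz: around each boundary point there is a smooth coordinate
system in which `U` is locally the region above a Lipschitz graph. -/
def HasLipschitzBoundary (U : Set N) : Prop :=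
  ∀ y ∈ frontier U, ∃ φ ∈ IsManifold.maximalAtlas (𝓡 n) ∞ N,
    y ∈ φ.source ∧ IsLipschitzGraphNear (chartImage φ U) (φ y)

/-- `P` holds almost everywhere on `U` (null sets are tested in smooth coordinate systems). -/
def AlmostEverywhereOn (n : ℕ) {N : Type*} [TopologicalSpace N]
    [ChartedSpace (EuclideanSpace ℝ (Fin n)) N] (U : Set N) (P : N → Prop) : Prop :=
  ∀ φ ∈ IsManifold.maximalAtlas (𝓡 n) ∞ N,
    ∀ᵐ z ∂(volume.restrict (chartImage φ U)), P (φ.symm z)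

/-- The section `df` of `T*N ⊗ F` is the weak differential of `f` on `U`: in all smooth coordinate
systems it is represented by the weak derivative of `f ∘ φ⁻¹`. -/
def IsWeakDifferential (U : Set N) (f : N → F) (df : ∀ x : N, TangentSpace (𝓡 n) x →L[ℝ] F) :
    Prop :=
  ∀ φ ∈ IsManifold.maximalAtlas (𝓡 n) ∞ N,
    HasWeakDeriv (chartImage φ U) (fun z => f (φ.symm z))
      (fun z => (df (φ.symm z)).comp (mfderiv (𝓡 n) (𝓡 n) φ.symm z))

/-- `f ∈ W^{1,p}(U)` for precompact open `U`. -/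
def MemSobolevOne (n : ℕ) {N : Type*} [TopologicalSpace N]
    [ChartedSpace (EuclideanSpace ℝ (Fin n)) N] (p : ℝ≥0∞) (U : Set N) (f : N → F) : Prop :=
  ∀ φ ∈ IsManifold.maximalAtlas (𝓡 n) ∞ N, ∀ ξ : N → ℝ, IsCutoff φ ξ →
    sobolevNormOne p (chartImage φ U) (localRep φ ξ f) < ⊤

/-- `f ∈ W^{2,p}(U)` for precompact open `U`. -/
def MemSobolevTwo (n : ℕ) {N : Type*} [TopologicalSpace N]
    [ChartedSpace (EuclideanSpace ℝ (Fin n)) N] (p : ℝ≥0∞) (U : Set N) (f : N → F) : Prop :=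
  ∀ φ ∈ IsManifold.maximalAtlas (𝓡 n) ∞ N, ∀ ξ : N → ℝ, IsCutoff φ ξ →
    sobolevNormTwo p (chartImage φ U) (localRep φ ξ f) < ⊤

/-- Strong convergence `f_k → f` in `W^{2,p}(U)` for precompact open `U`. -/
def TendstoSobolevTwo (n : ℕ) {N : Type*} [TopologicalSpace N]
    [ChartedSpace (EuclideanSpace ℝ (Fin n)) N] (p : ℝ≥0∞) (U : Set N) (fk : ℕ → N → F)
    (f : N → F) : Prop :=
  ∀ φ ∈ IsManifold.maximalAtlas (𝓡 n) ∞ N, ∀ ξ : N → ℝ, IsCutoff φ ξ →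
    Tendsto (fun k => sobolevNormTwo p (chartImage φ U) (localRep φ ξ (fk k - f))) atTop (𝓝 0)

/-- `df ∈ VMO(U)`: for all smooth coordinate systems `(V, φ)` and all `ξ ∈ C_c^∞(V)`, the weak
derivative of `(ξ f) ∘ φ⁻¹` belongs to `VMO(φ(V ∩ U))`. -/
def DifferentialMemVMO (n : ℕ) {N : Type*} [TopologicalSpace N]
    [ChartedSpace (EuclideanSpace ℝ (Fin n)) N] (U : Set N) (f : N → F) : Prop :=
  ∀ φ ∈ IsManifold.maximalAtlas (𝓡 n) ∞ N, ∀ ξ : N → ℝ, IsCutoff φ ξ →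
    ∃ G, HasWeakDeriv (chartImage φ U) (localRep φ ξ f) G ∧ MemVMO (chartImage φ U) G

/-- The classical differential at `x` of a map from `N` into a normed space. -/
def classicalDifferential (f : N → F) (x : N) : TangentSpace (𝓡 n) x →L[ℝ] F :=
  mfderiv (𝓡 n) 𝓘(ℝ, F) f x

/-- `f ∈ W^{1,∞}_imm(U, F)` with weak differential `df`: `f ∈ W^{1,∞}(U)` and, for some `Λ > 0`,
`Λ⁻¹ g(v, v) ≤ |df_x(v)|² ≤ Λ g(v, v)` for almost every `x ∈ U` and all `v ∈ T_x N`. -/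
structure IsWeakImmersion [IsManifold (𝓡 n) ∞ N]
    (g : Bundle.ContMDiffRiemannianMetric (𝓡 n) ∞ (EuclideanSpace ℝ (Fin n))
      (fun x : N => TangentSpace (𝓡 n) x))
    (U : Set N) (f : N → F) (df : ∀ x : N, TangentSpace (𝓡 n) x →L[ℝ] F) : Prop where
  memSobolev : MemSobolevOne n ∞ U f
  isWeakDifferential : IsWeakDifferential U f df
  bounds : ∃ Λ : ℝ, 0 < Λ ∧ AlmostEverywhereOn n U fun x =>
    ∀ v : TangentSpace (𝓡 n) x,
      Λ⁻¹ * g.inner x v v ≤ ‖df x v‖ ^ 2 ∧ ‖df x v‖ ^ 2 ≤ Λ * g.inner x v v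

end OnManifold

end

/-!
The approximating maps are `f_k = P ∘ g_m ∘ Φ_ε`, with `ε = ε_k` and `m = m(k)`, where

* `Φ_ε` is a smooth isotopy of `N` which maps `closure U` into `U` for `ε > 0`;
* `g_m` is a smooth approximation of `ι ∘ f` in the interior of `U`, glued by a partition of unity
  from mollifications in charts;
* `P` is a smooth map of the ambient Euclidean space which fixes the points of `ι(M)` and maps a
  neighbourhood of a given compact subset of `ι(M)` into `ι(M)`.

*The isotopy.* Above a Lipschitz graph, translation along the axis of the graph, multiplied by a
cutoff function, moves the closure of the region into the region. Finitely many such flows are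
composed (`exists_isPush`). Since `df` is bounded, `ι ∘ f` changes by `O(ε)` along the isotopy.

*Injectivity of the differential.* A mollification of `df` need not be injective where `df` is,
since injective linear maps with the given bounds do not form a convex set. Vanishing mean
oscillation is what excludes cancellation: the derivative of the mollification at `x` is close to
`df` in the mean over the ball around `x` whose radius is the mollification scale, uniformly for `x`
in a compact subset of `U`. This is `MeanDerivConvAt`. The property survives the change of charts,
as small balls are distorted by a bounded factor, the gluing by a partition of unity, as the glued
functions have the same limit, and the composition with `P`, as `DP` at a point of `ι(M)` fixes the
values of `df`. Some point `y` near `x` therefore has `df_y` both admissible and close to the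
derivative at `x`, and the two-sided bound passes from `df_y` to the approximation, at the cost of a
constant factor (`LocalApprox.eventually_bounds`).

*The two scales.* As `M` need not be closed in `ℝ^m`, a neighbourhood of `ι(f(U))` need not retract
onto `ι(M)`. For fixed `ε`, however, `Φ_ε(closure U)` is compact in `U`, and its image under `ι ∘ f`
has a neighbourhood which does (`Manifold.IsSmoothEmbedding.exists_retraction`). Hence `P` and then
`m` are chosen after `ε`, with `g_m` so close to `ι ∘ f` on `Φ_ε(closure U)` that the remaining
error tends to zero in all norms in question (`exists_approxSeq`). Being immersions with values in
`ι(M)` near `closure U`, the maps `f_k` lift through `ι`.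

*Convergence.* Convergence in `L^p` of derivatives together with uniform bounds is an algebra-like
notion, stable under products, under composition with smooth maps on either side, and under
composition with maps tending to the identity (`JetConv`, `JetTwoConvAt`, `TendstoIdC2`). The
exponents `p` with `f ∈ W^{2,p}` are all handled by one diagonal choice of `m(k)`, since convergence
on bounded sets for one exponent implies convergence for the smaller ones, so that countably many
exponents suffice. Along a subsequence the derivatives converge almost everywhere.
-/

set_option linter.unusedSectionVars false
set_option maxSynthPendingDepth 3

noncomputable section

/-! ### Convergence in `L^p` of sequences of functions -/

section LpTendsto

variable {α : Type*} [MeasurableSpace α] {F F₁ F₂ : Type*} [NormedAddCommGroup F]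
  [NormedAddCommGroup F₁] [NormedAddCommGroup F₂] {μ ν : Measure α} {p : ℝ≥0∞}

/-- Convergence of the functions `w k` to `w₀` in `L^p(μ)`. Only `w₀` is required to lie in `L^p`
and the functions `w k` need only be measurable for large `k`. -/
def LpTendsto (p : ℝ≥0∞) (μ : Measure α) (w : ℕ → α → F) (w₀ : α → F) : Prop :=
  MemLp w₀ p μ ∧ (∀ᶠ k in atTop, AEStronglyMeasurable (w k) μ) ∧
    Tendsto (fun k => eLpNorm (fun x => w k x - w₀ x) p μ) atTop (𝓝 0)

theorem tendsto_eLpNorm_zero_of_dominated (hp0 : p ≠ 0) (hp : p ≠ ⊤) {f : ℕ → α → F} {b : α → ℝ}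
    (hb : MemLp b p μ) (hf : ∀ k, AEStronglyMeasurable (f k) μ)
    (hle : ∀ k, ∀ᵐ x ∂μ, ‖f k x‖ ≤ b x)
    (hlim : ∀ᵐ x ∂μ, Tendsto (fun k => f k x) atTop (𝓝 0)) :
    Tendsto (fun k => eLpNorm (f k) p μ) atTop (𝓝 0) := by
  have hpr : 0 < p.toReal := ENNReal.toReal_pos hp0 hp
  simp only [eLpNorm_eq_lintegral_rpow_enorm_toReal hp0 hp]
  have h1 : Tendsto (fun k => ∫⁻ x, ‖f k x‖ₑ ^ p.toReal ∂μ) atTop (𝓝 (∫⁻ _, 0 ∂μ)) := by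
    refine tendsto_lintegral_of_dominated_convergence' (fun x => ‖b x‖ₑ ^ p.toReal)
      (fun k => (hf k).enorm.pow_const _) (fun k => ?_) ?_ ?_
    · filter_upwards [hle k] with x hx
      gcongr
      exact enorm_le_iff_norm_le.2 (hx.trans (le_abs_self _))
    · exact (lintegral_rpow_enorm_lt_top_of_eLpNorm_lt_top hp0 hp hb.2).ne
    · filter_upwards [hlim] with x hx
      have h2 : Tendsto (fun k => ‖f k x‖ₑ ^ p.toReal) atTop (𝓝 (‖(0 : F)‖ₑ ^ p.toReal)) :=
        (ENNReal.continuous_rpow_const.tendsto _).comp ((continuous_enorm.tendsto _).comp hx)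
      simpa [hpr] using h2
  have h3 := (ENNReal.continuous_rpow_const (y := 1 / p.toReal)).tendsto _ |>.comp h1
  simpa [Function.comp_def, hpr, hpr.ne'] using h3

theorem eLpNorm_sub_le_of_three (hp : 1 ≤ p) {a b c d : α → F} {ε₁ ε₂ ε₃ : ℝ≥0∞}
    (mab : AEStronglyMeasurable (fun x => a x - b x) μ)
    (mbc : AEStronglyMeasurable (fun x => b x - c x) μ)
    (mcd : AEStronglyMeasurable (fun x => c x - d x) μ)
    (hab : eLpNorm (fun x => a x - b x) p μ ≤ ε₁) (hbc : eLpNorm (fun x => b x - c x) p μ ≤ ε₂)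
    (hcd : eLpNorm (fun x => c x - d x) p μ ≤ ε₃) :
    eLpNorm (fun x => a x - d x) p μ ≤ ε₁ + ε₂ + ε₃ := by
  have h : (fun x => a x - d x)
      = ((fun x => a x - b x) + fun x => b x - c x) + fun x => c x - d x := by
    ext x
    simp
  rw [h]
  exact (eLpNorm_add_le (mab.add mbc) mcd hp).trans
    (add_le_add ((eLpNorm_add_le mab mbc hp).trans (add_le_add hab hbc)) hcd)

namespace LpTendsto

variable {w w' : ℕ → α → F} {w₀ w₀' : α → F}

theorem congr (h : LpTendsto p μ w w₀) (hw : ∀ᶠ k in atTop, w k =ᵐ[μ] w' k)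
    (hw₀ : w₀ =ᵐ[μ] w₀') : LpTendsto p μ w' w₀' := by
  refine ⟨(memLp_congr_ae hw₀).1 h.1, ?_, ?_⟩
  · filter_upwards [h.2.1, hw] with k hk hk' using hk.congr hk'
  · refine h.2.2.congr' ?_
    filter_upwards [hw] with k hk
    refine eLpNorm_congr_ae ?_
    filter_upwards [hk, hw₀] with x h1 h2
    rw [h1, h2]

theorem mono_measure (h : LpTendsto p μ w w₀) (hν : ν ≤ μ) : LpTendsto p ν w w₀ :=
  ⟨h.1.mono_measure hν, h.2.1.mono fun _ hk => hk.mono_measure hν,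
    tendsto_of_tendsto_of_tendsto_of_le_of_le tendsto_const_nhds h.2.2 (fun _ => zero_le)
      fun _ => eLpNorm_mono_measure _ hν⟩

theorem comp_subseq (h : LpTendsto p μ w w₀) {σ : ℕ → ℕ} (hσ : Tendsto σ atTop atTop) :
    LpTendsto p μ (fun k => w (σ k)) w₀ :=
  ⟨h.1, hσ.eventually h.2.1, h.2.2.comp hσ⟩

theorem aestronglyMeasurable_sub (h : LpTendsto p μ w w₀) :
    ∀ᶠ k in atTop, AEStronglyMeasurable (fun x => w k x - w₀ x) μ := by
  filter_upwards [h.2.1] with k hk using hk.sub h.1.1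

theorem add (hp : 1 ≤ p) (h : LpTendsto p μ w w₀) (h' : LpTendsto p μ w' w₀') :
    LpTendsto p μ (fun k x => w k x + w' k x) (fun x => w₀ x + w₀' x) := by
  refine ⟨h.1.add h'.1, ?_, ?_⟩
  · filter_upwards [h.2.1, h'.2.1] with k hk hk' using hk.add hk'
  · have h0 : Tendsto (fun k => eLpNorm (fun x => w k x - w₀ x) p μ
        + eLpNorm (fun x => w' k x - w₀' x) p μ) atTop (𝓝 0) := by
      simpa using h.2.2.add h'.2.2
    refine tendsto_of_tendsto_of_tendsto_of_le_of_le' tendsto_const_nhds h0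
      (Eventually.of_forall fun _ => zero_le) ?_
    filter_upwards [h.aestronglyMeasurable_sub, h'.aestronglyMeasurable_sub] with k hk hk'
    refine le_trans (le_of_eq ?_) (eLpNorm_add_le hk hk' hp)
    congr 1
    ext x
    simp only [Pi.add_apply]
    abel

theorem const (h : MemLp w₀ p μ) : LpTendsto p μ (fun _ => w₀) w₀ :=
  ⟨h, Eventually.of_forall fun _ => h.1, by simp⟩

theorem tendstoInMeasure (hp : p ≠ 0) (h : LpTendsto p μ w w₀) : TendstoInMeasure μ w atTop w₀ := by
  obtain ⟨N, hN⟩ := eventually_atTop.1 h.2.1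
  have h1 : TendstoInMeasure μ (fun k => w (k + N)) atTop w₀ :=
    tendstoInMeasure_of_tendsto_eLpNorm hp (fun k => hN _ (by omega)) h.1.1
      ((h.comp_subseq (tendsto_add_atTop_nat N)).2.2)
  intro ε hε
  exact (tendsto_add_atTop_iff_nat N).1 (h1 ε hε)

theorem ae_norm_le (hp : p ≠ 0) (h : LpTendsto p μ w w₀) {C : ℝ}
    (hC : ∀ᶠ k in atTop, ∀ᵐ x ∂μ, ‖w k x‖ ≤ C) : ∀ᵐ x ∂μ, ‖w₀ x‖ ≤ C := by
  obtain ⟨ns, hns, hlim⟩ := (h.tendstoInMeasure hp).exists_seq_tendsto_ae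
  obtain ⟨N, hN⟩ := eventually_atTop.1 (hns.tendsto_atTop.eventually hC)
  have : ∀ᵐ x ∂μ, ∀ k, ‖w (ns (k + N)) x‖ ≤ C := ae_all_iff.2 fun k => hN _ (by omega)
  filter_upwards [hlim, this] with x hx hx'
  exact le_of_tendsto ((hx.comp (tendsto_add_atTop_nat N)).norm) (Eventually.of_forall hx')

theorem mono_exponent [IsFiniteMeasure μ] {q : ℝ≥0∞} (hqp : q ≤ p) (h : LpTendsto p μ w w₀) :
    LpTendsto q μ w w₀ := by
  refine ⟨h.1.mono_exponent hqp, h.2.1, ?_⟩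
  have hC : (μ univ) ^ (1 / q.toReal - 1 / p.toReal) ≠ ⊤ ∨ q = 0 := by
    by_cases hq : q = 0
    · exact Or.inr hq
    left
    refine (ENNReal.rpow_lt_top_of_nonneg ?_ (measure_ne_top _ _)).ne
    by_cases hp : p = ⊤
    · simp [hp]
    rw [sub_nonneg]
    have := ENNReal.toReal_pos hq (ne_top_of_le_ne_top hp hqp)
    exact one_div_le_one_div_of_le this (ENNReal.toReal_mono hp hqp)
  rcases hC with hC | rfl
  · have h0 := ENNReal.Tendsto.mul_const (b := (μ univ) ^ (1 / q.toReal - 1 / p.toReal)) h.2.2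
      (Or.inr hC)
    rw [zero_mul] at h0
    refine tendsto_of_tendsto_of_tendsto_of_le_of_le' tendsto_const_nhds h0
      (Eventually.of_forall fun _ => zero_le) ?_
    filter_upwards [h.aestronglyMeasurable_sub] with k hk
    exact eLpNorm_le_eLpNorm_mul_rpow_measure_univ hqp hk
  · simp

/-- Uniform convergence implies convergence in `L^p` of a finite measure. -/
theorem of_uniform [IsFiniteMeasure μ] (hm : ∀ᶠ k in atTop, AEStronglyMeasurable (w k) μ)
    (h₀ : MemLp w₀ p μ)
    (h : ∀ ε > 0, ∀ᶠ k in atTop, ∀ᵐ x ∂μ, ‖w k x - w₀ x‖ ≤ ε) : LpTendsto p μ w w₀ := by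
  refine ⟨h₀, hm, ENNReal.tendsto_nhds_zero.2 fun ε hε => ?_⟩
  set D : ℝ≥0∞ := μ univ ^ p.toReal⁻¹
  have hD : D ≠ ⊤ := (ENNReal.rpow_lt_top_of_nonneg (by positivity) (measure_ne_top _ _)).ne
  obtain ⟨δ, hδ, hδε⟩ : ∃ δ : ℝ, 0 < δ ∧ D * ENNReal.ofReal δ ≤ ε := by
    have h1 : Tendsto (fun δ : ℝ => D * ENNReal.ofReal δ) (𝓝[>] 0) (𝓝 0) := by
      have := ENNReal.Tendsto.const_mul (a := D)
        ((ENNReal.tendsto_ofReal (a := 0) tendsto_id).mono_left (nhdsWithin_le_nhds (s := Ioi 0)))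
        (Or.inr hD)
      simpa using this
    obtain ⟨δ, h2, h3⟩ := ((ENNReal.tendsto_nhds_zero.1 h1 ε hε).and self_mem_nhdsWithin).exists
    exact ⟨δ, h3, h2⟩
  filter_upwards [h δ hδ] with k hk
  exact (eLpNorm_le_of_ae_bound hk).trans hδε

variable [NormedSpace ℝ F] [NormedSpace ℝ F₁] [NormedSpace ℝ F₂]

/-- The product of a bounded convergent sequence and a convergent sequence in `L^p`. -/
theorem bilin (hp1 : 1 ≤ p) (hp : p ≠ ⊤) (L : F →L[ℝ] F₁ →L[ℝ] F₂) {b : ℕ → α → F₁} {b₀ : α → F₁}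
    {q : ℝ≥0∞} (hq : q ≠ 0)
    (hw : LpTendsto q μ w w₀) (hb : LpTendsto p μ b b₀) {C : ℝ}
    (hC : ∀ᶠ k in atTop, ∀ᵐ x ∂μ, ‖w k x‖ ≤ C) :
    LpTendsto p μ (fun k x => L (w k x) (b k x)) (fun x => L (w₀ x) (b₀ x)) := by
  have hp0 : p ≠ 0 := (zero_lt_one.trans_le hp1).ne'
  have hC₀ := hw.ae_norm_le hq hC
  have hL : ∀ (x : F) (y : F₁) (D : ℝ), ‖x‖ ≤ D → ‖L x y‖ ≤ ‖L‖ * D * ‖y‖ := fun x y D h => by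
    refine (L.le_opNorm₂ x y).trans ?_
    gcongr
  have hm : ∀ {u : α → F} {v : α → F₁}, AEStronglyMeasurable u μ → AEStronglyMeasurable v μ →
      AEStronglyMeasurable (fun x => L (u x) (v x)) μ := fun hu hv =>
    L.aestronglyMeasurable_comp₂ hu hv
  refine ⟨hb.1.of_le_mul (c := ‖L‖ * C) (hm hw.1.1 hb.1.1) ?_, ?_, ?_⟩
  · filter_upwards [hC₀] with x hx using hL _ _ _ hx
  · filter_upwards [hw.2.1, hb.2.1] with k h1 h2 using hm h1 h2
  · have h1 : Tendsto (fun k => eLpNorm (fun x => L (w k x) (b k x - b₀ x)) p μ) atTop (𝓝 0) := by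
      have h0 : Tendsto (fun k => ENNReal.ofReal (‖L‖ * C) *
          eLpNorm (fun x => b k x - b₀ x) p μ) atTop (𝓝 0) := by
        have h := ENNReal.Tendsto.const_mul (a := ENNReal.ofReal (‖L‖ * C)) hb.2.2
          (Or.inr ENNReal.ofReal_ne_top)
        rwa [mul_zero] at h
      refine tendsto_of_tendsto_of_tendsto_of_le_of_le' tendsto_const_nhds h0
        (Eventually.of_forall fun _ => zero_le) ?_
      filter_upwards [hC] with k hk
      refine eLpNorm_le_mul_eLpNorm_of_ae_le_mul ?_ _
      filter_upwards [hk] with x hx using hL _ _ _ hx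
    have h2 : Tendsto (fun k => eLpNorm (fun x => L (w k x - w₀ x) (b₀ x)) p μ) atTop (𝓝 0) := by
      refine tendsto_of_subseq_tendsto fun ns hns => ?_
      have h1 : TendstoInMeasure μ (fun k => w (ns k)) atTop w₀ :=
        fun ε hε => (hw.tendstoInMeasure hq ε hε).comp hns
      obtain ⟨ms, hms, hae⟩ := h1.exists_seq_tendsto_ae
      obtain ⟨N, hN⟩ := eventually_atTop.1
        ((hns.comp hms.tendsto_atTop).eventually (hw.2.1.and hC))
      refine ⟨fun k => ms (k + N), tendsto_eLpNorm_zero_of_dominated hp0 hp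
        (b := fun x => ‖L‖ * (C + C) * ‖b₀ x‖) (hb.1.norm.const_mul _)
        (fun k => hm ((hN _ (by omega)).1.sub hw.1.1) hb.1.1) (fun k => ?_) ?_⟩
      · filter_upwards [(hN (k + N) (by omega)).2, hC₀] with x h1 h2
        exact hL _ _ _ ((norm_sub_le _ _).trans (add_le_add h1 h2))
      · filter_upwards [hae] with x hx
        have h3 : Tendsto (fun k => w (ns (ms (k + N))) x - w₀ x) atTop (𝓝 0) := by
          simpa using ((hx.comp (tendsto_add_atTop_nat N)).sub_const (w₀ x))
        have h4 := ((L.flip (b₀ x)).continuous.tendsto 0).comp h3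
        simpa [Function.comp_def] using h4
    have h3 : Tendsto (fun k => eLpNorm (fun x => L (w k x) (b k x - b₀ x)) p μ
        + eLpNorm (fun x => L (w k x - w₀ x) (b₀ x)) p μ) atTop (𝓝 0) := by
      simpa using h1.add h2
    refine tendsto_of_tendsto_of_tendsto_of_le_of_le' tendsto_const_nhds h3
      (Eventually.of_forall fun _ => zero_le) ?_
    filter_upwards [hw.2.1, hb.2.1] with k hk hk'
    refine le_trans (le_of_eq ?_)
      (eLpNorm_add_le (hm hk (hk'.sub hb.1.1)) (hm (hk.sub hw.1.1) hb.1.1) hp1)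
    congr 1
    ext x
    simp

end LpTendsto

theorem eLpNorm_add_measure_le (hp1 : 1 ≤ p) (hp : p ≠ ⊤) (f : α → F) :
    eLpNorm f p (μ + ν) ≤ eLpNorm f p μ + eLpNorm f p ν := by
  have hp0 : p ≠ 0 := (zero_lt_one.trans_le hp1).ne'
  simp only [eLpNorm_eq_lintegral_rpow_enorm_toReal hp0 hp, lintegral_add_measure]
  refine ENNReal.rpow_add_le_add_rpow _ _ (by positivity) ?_
  rw [div_le_one (ENNReal.toReal_pos hp0 hp)]
  simpa using ENNReal.toReal_mono hp hp1

/-- Convergence in `L^p` on each of two sets implies convergence on their union. -/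
theorem exists_lpTendsto_union (hp : 1 ≤ p) (hp' : p ≠ ⊤) {w : ℕ → α → F} {A B : Set α}
    (hA : MeasurableSet A)
    {wA wB : α → F} (h₁ : LpTendsto p (μ.restrict A) w wA)
    (h₂ : LpTendsto p (μ.restrict B) w wB) :
    ∃ w₀, LpTendsto p (μ.restrict (A ∪ B)) w w₀ := by
  classical
  have hp0 : p ≠ 0 := (zero_lt_one.trans_le hp).ne'
  have hle : μ.restrict (A ∪ B) ≤ μ.restrict A + μ.restrict (B \ A) := by
    rw [← union_sdiff_self]
    exact Measure.restrict_union_le _ _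
  have hBA : μ.restrict (B \ A) ≤ μ.restrict B := Measure.restrict_mono sdiff_subset le_rfl
  set w₀ : α → F := A.piecewise wA wB
  have e1 : w₀ =ᵐ[μ.restrict A] wA := piecewise_ae_eq_restrict hA
  have e2 : w₀ =ᵐ[μ.restrict (B \ A)] wB :=
    ae_mono (Measure.restrict_mono (fun x hx => hx.2) le_rfl) (piecewise_ae_eq_restrict_compl hA)
  have g1 : LpTendsto p (μ.restrict A) w w₀ :=
    h₁.congr (Eventually.of_forall fun _ => ae_eq_rfl) e1.symm
  have g2 : LpTendsto p (μ.restrict (B \ A)) w w₀ :=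
    (h₂.mono_measure hBA).congr (Eventually.of_forall fun _ => ae_eq_rfl) e2.symm
  refine ⟨w₀, LpTendsto.mono_measure ⟨?_, ?_, ?_⟩ hle⟩
  · exact ⟨g1.1.1.add_measure g2.1.1, (eLpNorm_add_measure_le hp hp' _).trans_lt
      (ENNReal.add_lt_top.2 ⟨g1.1.2, g2.1.2⟩)⟩
  · filter_upwards [g1.2.1, g2.2.1] with k h1 h2 using h1.add_measure h2
  · have h3 : Tendsto (fun k => eLpNorm (fun x => w k x - w₀ x) p (μ.restrict A)
        + eLpNorm (fun x => w k x - w₀ x) p (μ.restrict (B \ A))) atTop (𝓝 0) := by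
      simpa using g1.2.2.add g2.2.2
    exact tendsto_of_tendsto_of_tendsto_of_le_of_le tendsto_const_nhds h3 (fun _ => zero_le)
      fun k => eLpNorm_add_measure_le hp hp' _

end LpTendsto

/-! ### Composition with changes of variables in `L^p` -/

section ChangeOfVariables

variable {α β : Type*} [MeasurableSpace α] [MeasurableSpace β] {F : Type*} [NormedAddCommGroup F]
  {μ : Measure α} {ν : Measure β} {p : ℝ≥0∞} {τ : α → β} {K : ℝ≥0∞}

theorem aestronglyMeasurable_comp_of_map_le (hτ : AEMeasurable τ μ) (h : μ.map τ ≤ K • ν)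
    {u : β → F} (hu : AEStronglyMeasurable u ν) : AEStronglyMeasurable (fun x => u (τ x)) μ :=
  (hu.mono_ac (Measure.absolutelyContinuous_of_le_smul h)).comp_aemeasurable hτ

theorem ae_comp_of_map_le (hτ : AEMeasurable τ μ) (h : μ.map τ ≤ K • ν)
    {P : β → Prop} (hP : ∀ᵐ y ∂ν, P y) : ∀ᵐ x ∂μ, P (τ x) :=
  ae_of_ae_map hτ ((Measure.absolutelyContinuous_of_le_smul h).ae_le hP)

theorem eLpNorm_comp_le_of_map_le (hp : p ≠ ⊤) (hτ : AEMeasurable τ μ)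
    (h : μ.map τ ≤ K • ν) {u : β → F} (hu : AEStronglyMeasurable u ν) :
    eLpNorm (fun x => u (τ x)) p μ ≤ K ^ (1 / p.toReal) * eLpNorm u p ν := by
  have hu' := hu.mono_ac (Measure.absolutelyContinuous_of_le_smul h)
  calc eLpNorm (fun x => u (τ x)) p μ = eLpNorm u p (μ.map τ) :=
        (eLpNorm_map_measure hu' hτ).symm
    _ ≤ eLpNorm u p (K • ν) := eLpNorm_mono_measure _ h
    _ = K ^ (1 / p.toReal) * eLpNorm u p ν := by
        rw [eLpNorm_smul_measure_of_ne_top hp]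
        simp [ENNReal.toReal_inv]

/-- Precomposition with a map `τ` which compresses volumes by at most a factor `K`, in the sense
that `μ.map τ ≤ K • ν`, preserves convergence in `L^p`. -/
theorem LpTendsto.comp_of_map_le (hp : p ≠ ⊤) (hK : K ≠ ⊤) (hτ : AEMeasurable τ μ)
    (h : μ.map τ ≤ K • ν) {w : ℕ → β → F} {w₀ : β → F} (hw : LpTendsto p ν w w₀) :
    LpTendsto p μ (fun k x => w k (τ x)) (fun x => w₀ (τ x)) := by
  have hK' : K ^ (1 / p.toReal) ≠ ⊤ := (ENNReal.rpow_lt_top_of_nonneg (by positivity) hK).ne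
  refine ⟨⟨aestronglyMeasurable_comp_of_map_le hτ h hw.1.1, ?_⟩, ?_, ?_⟩
  · exact lt_of_le_of_lt (eLpNorm_comp_le_of_map_le (u := w₀) hp hτ h hw.1.1)
      (ENNReal.mul_lt_top hK'.lt_top hw.1.2)
  · filter_upwards [hw.2.1] with k hk using aestronglyMeasurable_comp_of_map_le hτ h hk
  · have h0 := ENNReal.Tendsto.const_mul hw.2.2 (Or.inr hK')
    rw [mul_zero] at h0
    refine tendsto_of_tendsto_of_tendsto_of_le_of_le' tendsto_const_nhds h0
      (Eventually.of_forall fun _ => zero_le) ?_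
    filter_upwards [hw.aestronglyMeasurable_sub] with k hk
    exact eLpNorm_comp_le_of_map_le (u := fun x => w k x - w₀ x) hp hτ h hk

end ChangeOfVariables

section EuclideanChangeOfVariables

variable {E : Type*} [NormedAddCommGroup E] [NormedSpace ℝ E] [FiniteDimensional ℝ E]
  [MeasureSpace E] [BorelSpace E] [(volume : Measure E).IsAddHaarMeasure]
  {F : Type*} [NormedAddCommGroup F] [NormedSpace ℝ F] {p : ℝ≥0∞}

/-- An injective differentiable map whose Jacobian is bounded below by `c` does not concentrate
Lebesgue measure by more than a factor `c⁻¹`. -/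
theorem map_restrict_le_of_le_abs_det {τ : E → E} {τ' : E → E →L[ℝ] E} {s : Set E}
    (hs : MeasurableSet s) (hτ : ∀ x ∈ s, HasFDerivWithinAt τ (τ' x) s x) (hinj : InjOn τ s)
    {c : ℝ} (hc : 0 < c) (hdet : ∀ x ∈ s, c ≤ |(τ' x).det|) {B : Set E} (hB : MapsTo τ s B) :
    AEMeasurable τ (volume.restrict s) ∧
      (volume.restrict s).map τ ≤ (ENNReal.ofReal c)⁻¹ • volume.restrict B := by
  have hcont : ContinuousOn τ s := fun x hx => (hτ x hx).continuousWithinAt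
  have hae : AEMeasurable τ (volume.restrict s) := hcont.aemeasurable hs
  refine ⟨hae, Measure.le_iff.2 fun t ht => ?_⟩
  rw [Measure.map_apply_of_aemeasurable hae ht, Measure.smul_apply, smul_eq_mul]
  have hm : MeasurableSet (τ ⁻¹' t ∩ s) := by
    have h1 : MeasurableSet (s.domRestrict τ ⁻¹' t) := hcont.domRestrict.measurable ht
    have h2 := hs.subtype_image h1
    convert h2 using 1
    ext x
    exact ⟨fun h => ⟨⟨x, h.2⟩, h.1, rfl⟩, by rintro ⟨y, hy, rfl⟩; exact ⟨hy, y.2⟩⟩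
  rw [Measure.restrict_apply₀' hs.nullMeasurableSet]
  have h1 : ENNReal.ofReal c * volume (τ ⁻¹' t ∩ s) ≤ volume (τ '' (τ ⁻¹' t ∩ s)) := by
    rw [← lintegral_abs_det_fderiv_eq_addHaar_image volume hm
      (fun x hx => (hτ x hx.2).mono inter_subset_right) (hinj.mono inter_subset_right),
      ← setLIntegral_const]
    refine setLIntegral_mono' hm fun x hx => ENNReal.ofReal_le_ofReal (hdet x hx.2)
  have h2 : volume (τ '' (τ ⁻¹' t ∩ s)) ≤ volume.restrict B t := by
    rw [Measure.restrict_apply ht]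
    refine measure_mono ?_
    rintro _ ⟨x, hx, rfl⟩
    exact ⟨hx.1, hB hx.2⟩
  rw [mul_comm, ← div_eq_mul_inv, ENNReal.le_div_iff_mul_le (Or.inl (by simpa using hc))
    (Or.inl ENNReal.ofReal_ne_top), mul_comm]
  exact h1.trans h2

/-- Composition with maps that converge uniformly to the identity, and do not concentrate measure,
converges to the identity operator on `L^p`. The functions `v k` need to be close to `u` only on
sets `B k` which carry the images. -/
theorem lpTendsto_comp_near_id (hp1 : 1 ≤ p) (hp : p ≠ ⊤) {A B : Set E} (hA : MeasurableSet A)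
    (hB : MeasurableSet B) (hAfin : volume A ≠ ⊤) (hAB : A ⊆ B) {τ : ℕ → E → E} {Bk : ℕ → Set E}
    (hBk : ∀ᶠ k in atTop, Bk k ⊆ B) {K : ℝ≥0∞} (hK : K ≠ ⊤)
    (hτ : ∀ᶠ k in atTop, AEMeasurable (τ k) (volume.restrict A) ∧
      (volume.restrict A).map (τ k) ≤ K • volume.restrict (Bk k))
    (hid : ∀ ε > 0, ∀ᶠ k in atTop, ∀ x ∈ A, ‖τ k x - x‖ ≤ ε)
    {u : E → F} (hu : MemLp u p (volume.restrict B)) {v : ℕ → E → F}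
    (hvm : ∀ᶠ k in atTop, AEStronglyMeasurable (v k) (volume.restrict (Bk k)))
    (hv : Tendsto (fun k => eLpNorm (fun x => v k x - u x) p (volume.restrict (Bk k)))
      atTop (𝓝 0)) :
    LpTendsto p (volume.restrict A) (fun k x => v k (τ k x)) u := by
  have hp0 : p ≠ 0 := (zero_lt_one.trans_le hp1).ne'
  have hK' : K ^ (1 / p.toReal) ≠ ⊤ := (ENNReal.rpow_lt_top_of_nonneg (by positivity) hK).ne
  have : IsFiniteMeasure (volume.restrict A) := ⟨by simpa using hAfin.lt_top⟩
  have huA : MemLp u p (volume.restrict A) := hu.mono_measure (Measure.restrict_mono hAB le_rfl)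
  have hBm : ∀ {k}, Bk k ⊆ B → volume.restrict (Bk k) ≤ volume.restrict B :=
    fun h => Measure.restrict_mono h le_rfl
  refine ⟨huA, ?_, ?_⟩
  · filter_upwards [hτ, hvm] with k hk hk'
      using aestronglyMeasurable_comp_of_map_le hk.1 hk.2 hk'
  have h1 : Tendsto (fun k => eLpNorm (fun x => v k (τ k x) - u (τ k x)) p (volume.restrict A))
      atTop (𝓝 0) := by
    have h0 := ENNReal.Tendsto.const_mul hv (Or.inr hK')
    rw [mul_zero] at h0
    refine tendsto_of_tendsto_of_tendsto_of_le_of_le' tendsto_const_nhds h0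
      (Eventually.of_forall fun _ => zero_le) ?_
    filter_upwards [hτ, hvm, hBk] with k hk hk' hk''
    exact eLpNorm_comp_le_of_map_le (u := fun x => v k x - u x) hp hk.1 hk.2
      (hk'.sub (hu.1.mono_measure (hBm hk'')))
  have h2 : Tendsto (fun k => eLpNorm (fun x => u (τ k x) - u x) p (volume.restrict A))
      atTop (𝓝 0) := by
    refine ENNReal.tendsto_nhds_zero.2 fun ε hε => ?_
    obtain ⟨δ, hδ0, hδ⟩ : ∃ δ : ℝ≥0∞, δ ≠ 0 ∧ K ^ (1 / p.toReal) * δ + ε / 3 + δ ≤ ε := by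
      have h3 : Tendsto (fun δ : ℝ≥0∞ => K ^ (1 / p.toReal) * δ + ε / 3 + δ) (𝓝[≠] 0)
          (𝓝 (K ^ (1 / p.toReal) * 0 + ε / 3 + 0)) := by
        refine Tendsto.mono_left ?_ nhdsWithin_le_nhds
        exact ((ENNReal.Tendsto.const_mul tendsto_id (Or.inr hK')).add tendsto_const_nhds).add
          tendsto_id
      simp only [mul_zero, zero_add, add_zero] at h3
      by_cases hεt : ε = ⊤
      · exact ⟨1, one_ne_zero, hεt ▸ le_top⟩
      have h4 : ε / 3 < ε := by
        refine ENNReal.div_lt_of_lt_mul ?_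
        calc ε = ε * 1 := (mul_one _).symm
          _ < ε * 3 := ENNReal.mul_lt_mul_right hε.ne' hεt (by norm_num)
      obtain ⟨δ, h5, h6⟩ := ((h3.eventually (gt_mem_nhds h4)).and self_mem_nhdsWithin).exists
      exact ⟨δ, h6, h5.le⟩
    obtain ⟨g, hgs, hgu, hgc, hgL⟩ :=
      ((memLp_indicator_iff_restrict hB).2 hu).exists_hasCompactSupport_eLpNorm_sub_le hp hδ0
    have hguB : eLpNorm (fun x => u x - g x) p (volume.restrict B) ≤ δ := by
      refine le_trans (le_of_eq ?_)
        ((eLpNorm_mono_measure _ (Measure.restrict_le_self (s := B))).trans hgu)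
      refine eLpNorm_congr_ae ?_
      filter_upwards [ae_restrict_mem hB] with x hx
      simp [hx]
    have hgB : MemLp g p (volume.restrict B) := hgL.mono_measure Measure.restrict_le_self
    have hunif : UniformContinuous g := hgs.uniformContinuous_of_continuous hgc
    set D : ℝ≥0∞ := (volume.restrict A) univ ^ p.toReal⁻¹
    have hD : D ≠ ⊤ := (ENNReal.rpow_lt_top_of_nonneg (by positivity) (measure_ne_top _ _)).ne
    obtain ⟨η, hη, hηε⟩ : ∃ η : ℝ, 0 < η ∧ D * ENNReal.ofReal η ≤ ε / 3 := by
      have h1 : Tendsto (fun δ : ℝ => D * ENNReal.ofReal δ) (𝓝[>] 0) (𝓝 0) := by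
        have := ENNReal.Tendsto.const_mul (a := D)
          ((ENNReal.tendsto_ofReal (a := 0) tendsto_id).mono_left
            (nhdsWithin_le_nhds (s := Ioi 0))) (Or.inr hD)
        simpa using this
      obtain ⟨δ, h2, h3⟩ := ((ENNReal.tendsto_nhds_zero.1 h1 (ε / 3)
        (ENNReal.div_pos hε.ne' (by norm_num))).and self_mem_nhdsWithin).exists
      exact ⟨δ, h3, h2⟩
    obtain ⟨r, hr, hrg⟩ := Metric.uniformContinuous_iff.1 hunif η hη
    filter_upwards [hτ, hBk, hid (r / 2) (by positivity)] with k hk hk' hk''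
    have hmap : (volume.restrict A).map (τ k) ≤ K • volume.restrict B :=
      hk.2.trans (by gcongr)
    have a1 : eLpNorm (fun x => u (τ k x) - g (τ k x)) p (volume.restrict A)
        ≤ K ^ (1 / p.toReal) * δ :=
      (eLpNorm_comp_le_of_map_le (u := fun x => u x - g x) hp hk.1 hmap
        (hu.1.sub hgB.1)).trans (by gcongr)
    have a2 : eLpNorm (fun x => g (τ k x) - g x) p (volume.restrict A) ≤ ε / 3 := by
      refine (eLpNorm_le_of_ae_bound (C := η) ?_).trans hηε
      filter_upwards [ae_restrict_mem hA] with x hx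
      rw [← dist_eq_norm]
      refine (hrg ?_).le
      rw [dist_eq_norm]
      linarith [hk'' x hx]
    have a3 : eLpNorm (fun x => g x - u x) p (volume.restrict A) ≤ δ := by
      refine le_trans (le_of_eq ?_) ((eLpNorm_mono_measure _
        (Measure.restrict_mono hAB le_rfl)).trans hguB)
      exact eLpNorm_sub_comm _ _ _ _
    have m1 : AEStronglyMeasurable (fun x => u (τ k x) - g (τ k x)) (volume.restrict A) :=
      aestronglyMeasurable_comp_of_map_le hk.1 hmap (hu.1.sub hgB.1)
    have m2 : AEStronglyMeasurable (fun x => g (τ k x) - g x) (volume.restrict A) :=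
      (aestronglyMeasurable_comp_of_map_le hk.1 hmap hgB.1).sub
        hgc.aestronglyMeasurable
    have m3 : AEStronglyMeasurable (fun x => g x - u x) (volume.restrict A) :=
      hgc.aestronglyMeasurable.sub huA.1
    exact (eLpNorm_sub_le_of_three hp1 m1 m2 m3 a1 a2 a3).trans hδ
  have h3 : Tendsto (fun k => eLpNorm (fun x => v k (τ k x) - u (τ k x)) p (volume.restrict A)
      + eLpNorm (fun x => u (τ k x) - u x) p (volume.restrict A)) atTop (𝓝 0) := by
    simpa using h1.add h2
  refine tendsto_of_tendsto_of_tendsto_of_le_of_le' tendsto_const_nhds h3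
    (Eventually.of_forall fun _ => zero_le) ?_
  filter_upwards [hτ, hvm, hBk] with k hk hk' hk''
  have m1 := aestronglyMeasurable_comp_of_map_le hk.1 hk.2 hk'
  have m2 := aestronglyMeasurable_comp_of_map_le hk.1 hk.2 (hu.1.mono_measure (hBm hk''))
  refine le_trans (le_of_eq ?_) (eLpNorm_add_le (m1.sub m2) (m2.sub huA.1) hp1)
  congr 1
  ext x
  simp

end EuclideanChangeOfVariables

/-! ### Mollification -/

section Mollify

variable {E : Type*} [NormedAddCommGroup E] [NormedSpace ℝ E] [FiniteDimensional ℝ E]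
  [MeasureSpace E] [BorelSpace E] [(volume : Measure E).IsAddHaarMeasure]
  {F : Type*} [NormedAddCommGroup F] [NormedSpace ℝ F] [CompleteSpace F] {p : ℝ≥0∞}

/-- The radius `1 / (k + 1)` of the `k`-th mollifier. -/
def mollRadius (k : ℕ) : ℝ := 1 / ((k : ℝ) + 1)

theorem mollRadius_pos (k : ℕ) : 0 < mollRadius k := by unfold mollRadius; positivity

theorem mollRadius_le_one (k : ℕ) : mollRadius k ≤ 1 := by
  unfold mollRadius
  rw [div_le_one (by positivity)]
  simp

theorem tendsto_mollRadius : Tendsto mollRadius atTop (𝓝 0) :=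
  tendsto_one_div_add_atTop_nhds_zero_nat

variable (E) in
/-- A smooth bump function supported in the ball of radius `mollRadius k` and equal to one on the
ball of half that radius. -/
def mollBump (k : ℕ) : ContDiffBump (0 : E) where
  rIn := mollRadius k / 2
  rOut := mollRadius k
  rIn_pos := half_pos (mollRadius_pos k)
  rIn_lt_rOut := half_lt_self (mollRadius_pos k)

variable (E) in
/-- The `k`-th mollifier: a smooth probability density supported in the ball of radius
`mollRadius k`. -/
def mollKernel (k : ℕ) : E → ℝ := (mollBump E k).normed volume

/-- The `k`-th mollification of `u`. -/
def mollify (k : ℕ) (u : E → F) (x : E) : F := ∫ t, mollKernel E k (x - t) • u t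

theorem mollify_eq_convolution (k : ℕ) (u : E → F) :
    mollify k u = convolution (mollKernel E k) u (ContinuousLinearMap.lsmul ℝ ℝ) volume := by
  ext x
  rw [convolution_lsmul_swap]
  rfl

theorem mollKernel_nonneg (k : ℕ) (x : E) : 0 ≤ mollKernel E k x :=
  (mollBump E k).nonneg_normed x

theorem contDiff_mollKernel (k : ℕ) : ContDiff ℝ ∞ (mollKernel E k) :=
  (mollBump E k).contDiff_normed

theorem continuous_mollKernel (k : ℕ) : Continuous (mollKernel E k) :=
  (contDiff_mollKernel (E := E) k).continuous

theorem hasCompactSupport_mollKernel (k : ℕ) : HasCompactSupport (mollKernel E k) :=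
  (mollBump E k).hasCompactSupport_normed

theorem integrable_mollKernel (k : ℕ) : Integrable (mollKernel E k) :=
  (continuous_mollKernel k).integrable_of_hasCompactSupport (hasCompactSupport_mollKernel k)

theorem mollKernel_eq_zero (k : ℕ) {x : E} (hx : mollRadius k ≤ ‖x‖) : mollKernel E k x = 0 := by
  have h : x ∉ Function.support (mollKernel E k) := by
    unfold mollKernel
    rw [(mollBump E k).support_normed_eq]
    simpa [mollBump] using hx
  simpa using h

theorem integral_mollKernel_sub (k : ℕ) (x : E) : ∫ t, mollKernel E k (x - t) = 1 := by
  rw [integral_sub_left_eq_self (mollKernel E k)]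
  exact (mollBump E k).integral_normed

theorem integrable_mollKernel_smul (k : ℕ) (x : E) {u : E → F} (hu : LocallyIntegrable u) :
    Integrable (fun t => mollKernel E k (x - t) • u t) := by
  refine LocallyIntegrable.integrable_smul_left_of_hasCompactSupport hu
    ((continuous_mollKernel k).comp (continuous_const.sub continuous_id)) ?_
  exact (hasCompactSupport_mollKernel (E := E) k).comp_homeomorph (Homeomorph.subLeft x)

theorem contDiff_mollify (k : ℕ) {u : E → F} (hu : LocallyIntegrable u) :
    ContDiff ℝ ∞ (mollify k u) := by
  rw [mollify_eq_convolution]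
  exact (hasCompactSupport_mollKernel k).contDiff_convolution_left _ (contDiff_mollKernel k) hu

theorem mollify_sub_eq (k : ℕ) (x : E) {u : E → F} (hu : LocallyIntegrable u) (z : F) :
    mollify k u x - z = ∫ t, mollKernel E k (x - t) • (u t - z) := by
  have h1 : ∫ t, mollKernel E k (x - t) • z = z := by
    rw [integral_smul_const, integral_mollKernel_sub, one_smul]
  conv_lhs => rw [← h1]
  rw [mollify, ← integral_sub (integrable_mollKernel_smul k x hu)
    (integrable_mollKernel_smul k x (locallyIntegrable_const z))]
  simp [smul_sub]

/-- The mollification at `x` is as close to `z` as the function is on the ball around `x`. -/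
theorem norm_mollify_sub_le (k : ℕ) (x : E) {u : E → F} (hu : LocallyIntegrable u) (z : F) {C : ℝ}
    (hC : ∀ᵐ t, t ∈ ball x (mollRadius k) → ‖u t - z‖ ≤ C) : ‖mollify k u x - z‖ ≤ C := by
  rw [mollify_sub_eq k x hu]
  have h1 : ∫ t, mollKernel E k (x - t) * C = C := by
    rw [integral_mul_const, integral_mollKernel_sub, one_mul]
  conv_rhs => rw [← h1]
  refine norm_integral_le_of_norm_le (((integrable_mollKernel k).comp_sub_left x).mul_const C) ?_
  filter_upwards [hC] with t ht
  rw [norm_smul, Real.norm_of_nonneg (mollKernel_nonneg k _)]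
  by_cases h : t ∈ ball x (mollRadius k)
  · exact mul_le_mul_of_nonneg_left (ht h) (mollKernel_nonneg k _)
  · rw [mollKernel_eq_zero]
    · simp
    · rw [← dist_eq_norm, dist_comm]
      simpa using h

theorem norm_mollify_le (k : ℕ) (x : E) {u : E → F} (hu : LocallyIntegrable u) {C : ℝ}
    (hC : ∀ᵐ t, t ∈ ball x (mollRadius k) → ‖u t‖ ≤ C) : ‖mollify k u x‖ ≤ C := by
  simpa using norm_mollify_sub_le k x hu 0 (by simpa using hC)

/-- Jensen's inequality for mollification. -/
theorem enorm_mollify_rpow_le (k : ℕ) (x : E) {u : E → F} (hu : AEStronglyMeasurable u)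
    {r : ℝ} (hr : 1 ≤ r) :
    ‖mollify k u x‖ₑ ^ r ≤ ∫⁻ t, ENNReal.ofReal (mollKernel E k (x - t)) * ‖u t‖ₑ ^ r := by
  set κ : E → ℝ≥0∞ := fun t => ENNReal.ofReal (mollKernel E k (x - t)) with hκ
  have hκm : Measurable κ :=
    ((continuous_mollKernel k).comp (continuous_const.sub continuous_id)).measurable.ennreal_ofReal
  set ν : Measure E := volume.withDensity κ
  have hν : IsProbabilityMeasure ν := by
    refine ⟨?_⟩
    rw [withDensity_apply _ MeasurableSet.univ, Measure.restrict_univ, hκ,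
      ← ofReal_integral_eq_lintegral_ofReal ((integrable_mollKernel k).comp_sub_left x)
      (Eventually.of_forall fun t => mollKernel_nonneg k _), integral_mollKernel_sub]
    simp
  have h1 : ‖mollify k u x‖ₑ ≤ ∫⁻ t, ‖u t‖ₑ ∂ν := by
    refine (enorm_integral_le_lintegral_enorm _).trans (le_of_eq ?_)
    rw [lintegral_withDensity_eq_lintegral_mul₀ hκm.aemeasurable hu.enorm]
    refine lintegral_congr fun t => ?_
    rw [enorm_smul, Pi.mul_apply, hκ, Real.enorm_of_nonneg (mollKernel_nonneg k _)]
  have huν : AEStronglyMeasurable u ν := hu.mono_ac (withDensity_absolutelyContinuous _ _)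
  have h2 : ∫⁻ t, ‖u t‖ₑ ∂ν ≤ (∫⁻ t, ‖u t‖ₑ ^ r ∂ν) ^ (1 / r) := by
    have h3 := eLpNorm_le_eLpNorm_of_exponent_le (p := 1) (q := ENNReal.ofReal r) (μ := ν)
      (by simpa using hr) huν
    rw [eLpNorm_one_eq_lintegral_enorm, eLpNorm_eq_lintegral_rpow_enorm_toReal
      (by simp; linarith) ENNReal.ofReal_ne_top, ENNReal.toReal_ofReal (by linarith)] at h3
    exact h3
  have h4 : ‖mollify k u x‖ₑ ^ r ≤ ∫⁻ t, ‖u t‖ₑ ^ r ∂ν := by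
    calc ‖mollify k u x‖ₑ ^ r ≤ ((∫⁻ t, ‖u t‖ₑ ^ r ∂ν) ^ (1 / r)) ^ r := by
          gcongr
          exact h1.trans h2
      _ = ∫⁻ t, ‖u t‖ₑ ^ r ∂ν := by
          rw [← ENNReal.rpow_mul, one_div_mul_cancel (by linarith), ENNReal.rpow_one]
  refine h4.trans (le_of_eq ?_)
  rw [lintegral_withDensity_eq_lintegral_mul₀ hκm.aemeasurable (hu.enorm.pow_const _)]
  rfl

/-- Mollification does not increase `L^p`-norms. -/
theorem eLpNorm_mollify_le (hp1 : 1 ≤ p) (hp : p ≠ ⊤) (k : ℕ) {u : E → F}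
    (hu : AEStronglyMeasurable u) : eLpNorm (mollify k u) p ≤ eLpNorm u p := by
  have hp0 : p ≠ 0 := (zero_lt_one.trans_le hp1).ne'
  rw [eLpNorm_eq_lintegral_rpow_enorm_toReal hp0 hp, eLpNorm_eq_lintegral_rpow_enorm_toReal hp0 hp]
  refine ENNReal.rpow_le_rpow ?_ (by positivity)
  have hr : 1 ≤ p.toReal := by simpa using ENNReal.toReal_mono hp hp1
  calc ∫⁻ x, ‖mollify k u x‖ₑ ^ p.toReal
      ≤ ∫⁻ x, ∫⁻ t, ENNReal.ofReal (mollKernel E k (x - t)) * ‖u t‖ₑ ^ p.toReal :=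
        lintegral_mono fun x => enorm_mollify_rpow_le k x hu hr
    _ = ∫⁻ t, ∫⁻ x, ENNReal.ofReal (mollKernel E k (x - t)) * ‖u t‖ₑ ^ p.toReal := by
        refine lintegral_lintegral_swap ?_
        refine AEMeasurable.mul ?_ ?_
        · exact (((continuous_mollKernel k).comp
            (continuous_fst.sub continuous_snd)).measurable.ennreal_ofReal).aemeasurable
        · exact (hu.enorm.pow_const p.toReal).comp_snd
    _ = ∫⁻ t, ‖u t‖ₑ ^ p.toReal := by
        refine lintegral_congr fun t => ?_
        rw [lintegral_mul_const]
        · rw [← ofReal_integral_eq_lintegral_ofReal ((integrable_mollKernel k).comp_sub_right t)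
            (Eventually.of_forall fun _ => mollKernel_nonneg k _),
            integral_sub_right_eq_self (mollKernel E k)]
          have : ∫ x, mollKernel E k x = 1 := (mollBump E k).integral_normed
          rw [this]
          simp
        · exact ((continuous_mollKernel k).comp
            (continuous_id.sub continuous_const)).measurable.ennreal_ofReal

theorem mollify_sub (k : ℕ) {u v : E → F} (hu : LocallyIntegrable u) (hv : LocallyIntegrable v)
    (x : E) : mollify k (fun t => u t - v t) x = mollify k u x - mollify k v x := by
  simp only [mollify, smul_sub]
  exact integral_sub (integrable_mollKernel_smul k x hu) (integrable_mollKernel_smul k x hv)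

theorem tendsto_eLpNorm_mollify_sub_of_continuous (hp0 : p ≠ 0) (hp : p ≠ ⊤) {g : E → F}
    (hgc : Continuous g) (hgs : HasCompactSupport g) :
    Tendsto (fun k => eLpNorm (fun x => mollify k g x - g x) p) atTop (𝓝 0) := by
  have hgl : LocallyIntegrable g := hgc.locallyIntegrable
  obtain ⟨C, hC⟩ := hgc.bounded_above_of_compact_support hgs
  obtain ⟨R, hR⟩ := hgs.isCompact.isBounded.subset_closedBall (0 : E)
  refine tendsto_eLpNorm_zero_of_dominated hp0 hp
    (b := (closedBall (0 : E) (R + 1)).indicator fun _ => C + C) ?_ (fun k => ?_) (fun k => ?_) ?_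
  · exact memLp_indicator_const p measurableSet_closedBall _
      (Or.inr measure_closedBall_lt_top.ne)
  · exact ((contDiff_mollify k hgl).continuous.sub hgc).aestronglyMeasurable
  · refine Eventually.of_forall fun x => ?_
    by_cases hx : x ∈ closedBall (0 : E) (R + 1)
    · rw [indicator_of_mem hx]
      exact (norm_sub_le _ _).trans (add_le_add (norm_mollify_le k x hgl
        (Eventually.of_forall fun t _ => hC t)) (hC x))
    · rw [indicator_of_notMem hx]
      have h0 : ∀ t ∈ ball x (mollRadius k), g t = 0 := fun t ht => by
        refine image_eq_zero_of_notMem_tsupport fun h => hx ?_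
        have h1 : dist x 0 ≤ dist x t + dist t 0 := dist_triangle _ _ _
        have h2 := hR h
        rw [mem_closedBall] at h2 ⊢
        rw [mem_ball, dist_comm] at ht
        linarith [mollRadius_le_one k]
      have h1 := norm_mollify_le k x hgl (C := 0)
        (Eventually.of_forall fun t ht => by rw [h0 t ht]; simp)
      rw [h0 x (mem_ball_self (mollRadius_pos k)), sub_zero]
      exact h1
  · refine Eventually.of_forall fun x => ?_
    have h1 := ContDiffBump.convolution_tendsto_right_of_continuous (μ := (volume : Measure E))
      (φ := mollBump E) (l := atTop) tendsto_mollRadius hgc x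
    have h2 : Tendsto (fun k => mollify k g x) atTop (𝓝 (g x)) := by
      simp only [mollify_eq_convolution]
      exact h1
    simpa using h2.sub_const (g x)

/-- Mollifications converge in `L^p`. -/
theorem lpTendsto_mollify (hp1 : 1 ≤ p) (hp : p ≠ ⊤) {u : E → F} (hu : MemLp u p) :
    LpTendsto p volume (fun k => mollify k u) u := by
  have hp0 : p ≠ 0 := (zero_lt_one.trans_le hp1).ne'
  have hloc : ∀ {v : E → F}, MemLp v p → LocallyIntegrable v := fun h => h.locallyIntegrable hp1
  refine ⟨hu, Eventually.of_forall fun k =>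
    (contDiff_mollify k (hloc hu)).continuous.aestronglyMeasurable, ?_⟩
  refine ENNReal.tendsto_nhds_zero.2 fun ε hε => ?_
  have hε3 : ε / 3 ≠ 0 := (ENNReal.div_pos hε.ne' (by norm_num)).ne'
  obtain ⟨g, hgs, hgu, hgc, hgL⟩ := hu.exists_hasCompactSupport_eLpNorm_sub_le hp hε3
  have hg := tendsto_eLpNorm_mollify_sub_of_continuous hp0 hp hgc hgs
  filter_upwards [ENNReal.tendsto_nhds_zero.1 hg (ε / 3) (pos_iff_ne_zero.2 hε3)] with k hk
  have m1 : AEStronglyMeasurable (fun x => mollify k u x - mollify k g x) (volume : Measure E) :=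
    ((contDiff_mollify k (hloc hu)).continuous.sub
      (contDiff_mollify k (hloc hgL)).continuous).aestronglyMeasurable
  have m2 : AEStronglyMeasurable (fun x => mollify k g x - g x) (volume : Measure E) :=
    ((contDiff_mollify k (hloc hgL)).continuous.sub hgc).aestronglyMeasurable
  have m3 : AEStronglyMeasurable (fun x => g x - u x) (volume : Measure E) :=
    hgc.aestronglyMeasurable.sub hu.1
  have a1 : eLpNorm (fun x => mollify k u x - mollify k g x) p ≤ ε / 3 := by
    have : (fun x => mollify k u x - mollify k g x) = mollify k (fun t => u t - g t) := by
      ext x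
      rw [mollify_sub k (hloc hu) (hloc hgL)]
    rw [this]
    have h4 := eLpNorm_mollify_le (u := fun t => u t - g t) hp1 hp k
      (hu.1.sub hgc.aestronglyMeasurable)
    exact h4.trans hgu
  have a3 : eLpNorm (fun x => g x - u x) p ≤ ε / 3 :=
    (eLpNorm_sub_comm g u p volume).trans_le hgu
  exact (eLpNorm_sub_le_of_three hp1 m1 m2 m3 a1 hk a3).trans (ENNReal.add_thirds ε).le

end Mollify

/-! ### Weak derivatives -/

section WeakDeriv

variable {n : ℕ} {F : Type*} [NormedAddCommGroup F] [NormedSpace ℝ F] [CompleteSpace F]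
  {Ω Ω' : Set (EuclideanSpace ℝ (Fin n))} {u u' : EuclideanSpace ℝ (Fin n) → F}
  {G G' : EuclideanSpace ℝ (Fin n) → EuclideanSpace ℝ (Fin n) →L[ℝ] F}

theorem setIntegral_smul_eq_integral_of_tsupport_subset {ψ : EuclideanSpace ℝ (Fin n) → ℝ}
    (hψ : tsupport ψ ⊆ Ω) : ∫ x in Ω, ψ x • u x = ∫ x, ψ x • u x :=
  setIntegral_eq_integral_of_forall_compl_eq_zero fun x hx => by
    rw [image_eq_zero_of_notMem_tsupport fun h => hx (hψ h), zero_smul]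

theorem tsupport_fderiv_apply_subset' (ψ : EuclideanSpace ℝ (Fin n) → ℝ)
    (v : EuclideanSpace ℝ (Fin n)) : tsupport (fun x => fderiv ℝ ψ x v) ⊆ tsupport ψ :=
  (closure_mono fun x hx => by
    simp only [Function.mem_support] at hx ⊢
    exact fun h => hx (by rw [h]; simp)).trans (tsupport_fderiv_subset ℝ (f := ψ))

theorem HasWeakDeriv.integral_eq (h : HasWeakDeriv Ω u G) {ψ : EuclideanSpace ℝ (Fin n) → ℝ}
    (hψ : ContDiff ℝ ∞ ψ) (hc : HasCompactSupport ψ) (hs : tsupport ψ ⊆ Ω)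
    (v : EuclideanSpace ℝ (Fin n)) :
    ∫ x, (fderiv ℝ ψ x v) • u x = - ∫ x, ψ x • G x v := by
  rw [← setIntegral_smul_eq_integral_of_tsupport_subset hs,
    ← setIntegral_smul_eq_integral_of_tsupport_subset
      ((tsupport_fderiv_apply_subset' ψ v).trans hs)]
  exact h.2.2 ψ hψ hc hs v

theorem HasWeakDeriv.mono (h : HasWeakDeriv Ω u G) (hΩ : Ω' ⊆ Ω) : HasWeakDeriv Ω' u G := by
  refine ⟨h.1.mono_set hΩ, h.2.1.mono_set hΩ, fun ψ hψ hc hs v => ?_⟩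
  rw [setIntegral_smul_eq_integral_of_tsupport_subset hs,
    setIntegral_smul_eq_integral_of_tsupport_subset
      ((tsupport_fderiv_apply_subset' ψ v).trans hs)]
  exact h.integral_eq hψ hc (hs.trans hΩ) v

theorem HasWeakDeriv.congr (h : HasWeakDeriv Ω u G) (hu : u =ᵐ[volume.restrict Ω] u')
    (hG : G =ᵐ[volume.restrict Ω] G') : HasWeakDeriv Ω u' G' := by
  refine ⟨h.1.congr hu, h.2.1.congr hG, fun ψ hψ hc hs v => ?_⟩
  have h1 : ∫ x in Ω, (fderiv ℝ ψ x v) • u' x = ∫ x in Ω, (fderiv ℝ ψ x v) • u x :=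
    integral_congr_ae (by filter_upwards [hu] with x hx; rw [hx])
  have h2 : ∫ x in Ω, ψ x • G' x v = ∫ x in Ω, ψ x • G x v :=
    integral_congr_ae (by filter_upwards [hG] with x hx; rw [hx])
  rw [h1, h2]
  exact h.2.2 ψ hψ hc hs v

theorem integrable_smul_of_tsupport_subset {ψ : EuclideanSpace ℝ (Fin n) → ℝ}
    (hψ : Continuous ψ) (hc : HasCompactSupport ψ) (hs : tsupport ψ ⊆ Ω)
    (hu : LocallyIntegrableOn u Ω) : Integrable (fun x => ψ x • u x) := by
  have h2 : IntegrableOn u (tsupport ψ) := hu.integrableOn_compact_subset hs hc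
  have h3 : IntegrableOn (fun x => ψ x • u x) (tsupport ψ) :=
    h2.continuousOn_smul hψ.continuousOn hc
  refine (integrableOn_iff_integrable_of_support_subset fun x hx => ?_).1 h3
  refine subset_tsupport _ fun h => hx ?_
  simp [h]

theorem locallyIntegrableOn_clm_apply (hG : LocallyIntegrableOn G Ω)
    (v : EuclideanSpace ℝ (Fin n)) : LocallyIntegrableOn (fun x => G x v) Ω := fun x hx => by
  obtain ⟨s, hs, hi⟩ := hG x hx
  exact ⟨s, hs, (ContinuousLinearMap.apply ℝ F v).integrable_comp hi⟩

theorem HasWeakDeriv.sub (h : HasWeakDeriv Ω u G) (h' : HasWeakDeriv Ω u' G') :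
    HasWeakDeriv Ω (fun x => u x - u' x) (fun x => G x - G' x) := by
  refine ⟨h.1.sub h'.1, h.2.1.sub h'.2.1, fun ψ hψ hc hs v => ?_⟩
  have hs' := (tsupport_fderiv_apply_subset' ψ v).trans hs
  have hc' : HasCompactSupport fun x => fderiv ℝ ψ x v :=
    hc.mono' (subset_closure.trans (tsupport_fderiv_apply_subset' ψ v))
  have hψ' : Continuous fun x => fderiv ℝ ψ x v :=
    (hψ.continuous_fderiv (by simp)).clm_apply continuous_const
  rw [setIntegral_smul_eq_integral_of_tsupport_subset hs,
    setIntegral_smul_eq_integral_of_tsupport_subset hs']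
  simp only [smul_sub, sub_apply]
  rw [integral_sub (integrable_smul_of_tsupport_subset hψ' hc' hs' h.1)
    (integrable_smul_of_tsupport_subset hψ' hc' hs' h'.1),
    integral_sub (integrable_smul_of_tsupport_subset hψ.continuous hc hs
      (locallyIntegrableOn_clm_apply h.2.1 v))
    (integrable_smul_of_tsupport_subset hψ.continuous hc hs
    (locallyIntegrableOn_clm_apply h'.2.1 v)),
    h.integral_eq hψ hc hs v, h'.integral_eq hψ hc hs v]
  abel

/-- Weak derivatives are unique up to null sets. -/
theorem HasWeakDeriv.unique (hΩ : IsOpen Ω) (h : HasWeakDeriv Ω u G)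
    (h' : HasWeakDeriv Ω u G') : G =ᵐ[volume.restrict Ω] G' := by
  have key : ∀ v, ∀ᵐ x ∂(volume : Measure (EuclideanSpace ℝ (Fin n))), x ∈ Ω → G x v - G' x v = 0 :=
      fun v => by
    refine hΩ.ae_eq_zero_of_integral_contDiff_smul_eq_zero
      ((locallyIntegrableOn_clm_apply h.2.1 v).sub (locallyIntegrableOn_clm_apply h'.2.1 v)) fun ψ
        hψ hc hs => ?_
    simp only [smul_sub]
    rw [integral_sub (integrable_smul_of_tsupport_subset hψ.continuous hc hs
      (locallyIntegrableOn_clm_apply h.2.1 v))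
      (integrable_smul_of_tsupport_subset hψ.continuous hc hs
        (locallyIntegrableOn_clm_apply h'.2.1 v)), sub_eq_zero]
    have e1 := h.integral_eq hψ hc hs v
    rw [h'.integral_eq hψ hc hs v] at e1
    exact (neg_injective e1).symm
  have key2 : ∀ᵐ x ∂(volume : Measure (EuclideanSpace ℝ (Fin n))), ∀ i : Fin n, x ∈ Ω →
      G x (EuclideanSpace.basisFun (Fin n) ℝ i) - G' x (EuclideanSpace.basisFun (Fin n) ℝ i) = 0 :=
    ae_all_iff.2 fun i => key _
  rw [EventuallyEq, ae_restrict_iff' hΩ.measurableSet]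
  filter_upwards [key2] with x hx hxΩ
  refine ContinuousLinearMap.coe_injective
    ((EuclideanSpace.basisFun (Fin n) ℝ).toBasis.ext fun i => ?_)
  simpa [sub_eq_zero] using hx i hxΩ

theorem LpTendsto.tendsto_integral {α : Type*} [MeasurableSpace α] {μ : Measure α}
    {w : ℕ → α → F} {w₀ : α → F} (h : LpTendsto 1 μ w w₀) :
    Tendsto (fun k => ∫ x, w k x ∂μ) atTop (𝓝 (∫ x, w₀ x ∂μ)) := by
  have h0 : ∀ᶠ k in atTop, Integrable (w k) μ := by
    filter_upwards [h.2.1, ENNReal.tendsto_nhds_zero.1 h.2.2 1 zero_lt_one] with k hk hk'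
    have h1 : MemLp (fun x => w k x - w₀ x) 1 μ := ⟨hk.sub h.1.1, hk'.trans_lt ENNReal.one_lt_top⟩
    have h2 := h1.add h.1
    have h3 : (fun x => w k x - w₀ x) + w₀ = w k := by ext x; simp
    rw [h3] at h2
    exact memLp_one_iff_integrable.1 h2
  refine tendsto_integral_of_L1 w₀ h.1.1 h0 ?_
  simpa only [eLpNorm_one_eq_lintegral_enorm] using h.2.2

theorem LpTendsto.tendsto_integral_smul {p : ℝ≥0∞} (hp : 1 ≤ p)
    {w : ℕ → EuclideanSpace ℝ (Fin n) → F} {w₀ : EuclideanSpace ℝ (Fin n) → F}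
    (h : LpTendsto p (volume.restrict Ω) w w₀) {ψ : EuclideanSpace ℝ (Fin n) → ℝ}
    (hψ : Continuous ψ) (hc : HasCompactSupport ψ) (hs : tsupport ψ ⊆ Ω) :
    Tendsto (fun k => ∫ x, ψ x • w k x) atTop (𝓝 (∫ x, ψ x • w₀ x)) := by
  have hfin : IsFiniteMeasure (volume.restrict (tsupport ψ)) :=
    ⟨by simpa using hc.measure_lt_top⟩
  have h1 : LpTendsto 1 (volume.restrict (tsupport ψ)) w w₀ :=
    (h.mono_measure (Measure.restrict_mono hs le_rfl)).mono_exponent hp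
  obtain ⟨C, hC⟩ := hψ.bounded_above_of_compact_support hc
  have h2 : LpTendsto 1 (volume.restrict (tsupport ψ)) (fun _ => ψ) ψ :=
    LpTendsto.const (MemLp.of_bound hψ.aestronglyMeasurable C (Eventually.of_forall hC))
  have h3 := (h2.bilin le_rfl ENNReal.one_ne_top (ContinuousLinearMap.lsmul ℝ ℝ) one_ne_zero h1
    (Eventually.of_forall fun _ => Eventually.of_forall hC)).tendsto_integral
  simp only [ContinuousLinearMap.lsmul_apply] at h3
  simpa only [setIntegral_smul_eq_integral_of_tsupport_subset le_rfl] using h3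

/-- Weak derivatives are closed under convergence in `L^p`. -/
theorem HasWeakDeriv.of_lpTendsto {p : ℝ≥0∞} (hp : 1 ≤ p)
    {w : ℕ → EuclideanSpace ℝ (Fin n) → F}
    {W : ℕ → EuclideanSpace ℝ (Fin n) → EuclideanSpace ℝ (Fin n) →L[ℝ] F}
    (hw : ∀ᶠ k in atTop, HasWeakDeriv Ω (w k) (W k))
    (hu : LpTendsto p (volume.restrict Ω) w u) (hG : LpTendsto p (volume.restrict Ω) W G) :
    HasWeakDeriv Ω u G := by
  have hloc : ∀ {H : Type _} [NormedAddCommGroup H] {f : EuclideanSpace ℝ (Fin n) → H},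
      MemLp f p (volume.restrict Ω) → LocallyIntegrableOn f Ω := fun h =>
    locallyIntegrableOn_of_locallyIntegrable_restrict (h.locallyIntegrable hp)
  refine ⟨hloc hu.1, hloc hG.1, fun ψ hψ hc hs v => ?_⟩
  have hs' := (tsupport_fderiv_apply_subset' ψ v).trans hs
  have hc' : HasCompactSupport fun x => fderiv ℝ ψ x v :=
    hc.mono' (subset_closure.trans (tsupport_fderiv_apply_subset' ψ v))
  have hψ' : Continuous fun x => fderiv ℝ ψ x v :=
    (hψ.continuous_fderiv (by simp)).clm_apply continuous_const
  rw [setIntegral_smul_eq_integral_of_tsupport_subset hs,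
    setIntegral_smul_eq_integral_of_tsupport_subset hs']
  have e1 := hu.tendsto_integral_smul hp hψ' hc' hs'
  have e2 := hG.tendsto_integral_smul hp hψ.continuous hc hs
  have e3 : Tendsto (fun k => (∫ x, ψ x • W k x) v) atTop (𝓝 ((∫ x, ψ x • G x) v)) :=
    ((ContinuousLinearMap.apply ℝ F v).continuous.tendsto _).comp e2
  have e4 : ∀ {V : EuclideanSpace ℝ (Fin n) → EuclideanSpace ℝ (Fin n) →L[ℝ] F},
      LocallyIntegrableOn V Ω → (∫ x, ψ x • V x) v = ∫ x, ψ x • V x v := fun hV =>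
    ContinuousLinearMap.integral_apply
      (integrable_smul_of_tsupport_subset hψ.continuous hc hs hV) v
  rw [e4 (hloc hG.1)] at e3
  refine tendsto_nhds_unique e1 (e3.neg.congr' ?_)
  filter_upwards [hw] with k hk
  rw [hk.integral_eq hψ hc hs v, e4 hk.2.1]

/-- Continuously differentiable functions are weakly differentiable. -/
theorem ContDiffOn.hasWeakDeriv (hΩ : IsOpen Ω) (hu : ContDiffOn ℝ 1 u Ω) :
    HasWeakDeriv Ω u (fderiv ℝ u) := by
  have hd : ContinuousOn (fderiv ℝ u) Ω := hu.continuousOn_fderiv_of_isOpen hΩ le_rfl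
  have h1 : LocallyIntegrableOn u Ω := hu.continuousOn.locallyIntegrableOn hΩ.measurableSet
  have h2 : LocallyIntegrableOn (fderiv ℝ u) Ω := hd.locallyIntegrableOn hΩ.measurableSet
  refine ⟨h1, h2, fun ψ hψ hc hs v => ?_⟩
  have hs' := (tsupport_fderiv_apply_subset' ψ v).trans hs
  have hc' : HasCompactSupport fun x => fderiv ℝ ψ x v :=
    hc.mono' (subset_closure.trans (tsupport_fderiv_apply_subset' ψ v))
  have hψ' : Continuous fun x => fderiv ℝ ψ x v :=
    (hψ.continuous_fderiv (by simp)).clm_apply continuous_const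
  rw [setIntegral_smul_eq_integral_of_tsupport_subset hs,
    setIntegral_smul_eq_integral_of_tsupport_subset hs']
  have key := integral_bilinear_hasFDerivAt_right_eq_neg_left_of_integrable
    (μ := (volume : Measure (EuclideanSpace ℝ (Fin n))))
    (f := ψ) (f' := fderiv ℝ ψ) (g := u) (g' := fderiv ℝ u) (v := v)
    (B := ContinuousLinearMap.lsmul ℝ ℝ)
    (integrable_smul_of_tsupport_subset hψ' hc' hs' h1)
    (integrable_smul_of_tsupport_subset hψ.continuous hc hs (locallyIntegrableOn_clm_apply h2 v))
    (integrable_smul_of_tsupport_subset hψ.continuous hc hs h1)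
    (fun x _ => (hψ.differentiable (by simp) x).hasFDerivAt)
    (fun x hx => ((hu.differentiableOn one_ne_zero).differentiableAt
      (hΩ.mem_nhds (hs hx))).hasFDerivAt)
  simp only [ContinuousLinearMap.lsmul_apply] at key
  rw [key, neg_neg]

end WeakDeriv

/-! ### Derivatives of mollifications -/

section MollifyWeakDeriv

variable {n : ℕ} {F : Type*} [NormedAddCommGroup F] [NormedSpace ℝ F] [CompleteSpace F]
  {Ω Ω' : Set (EuclideanSpace ℝ (Fin n))} {u u' : EuclideanSpace ℝ (Fin n) → F}
  {G G' : EuclideanSpace ℝ (Fin n) → EuclideanSpace ℝ (Fin n) →L[ℝ] F}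

theorem integrable_precompL_fderiv_mollKernel (k : ℕ) (x : EuclideanSpace ℝ (Fin n))
    {w : EuclideanSpace ℝ (Fin n) → F} (hw : LocallyIntegrable w) :
    Integrable (fun t => (ContinuousLinearMap.lsmul ℝ ℝ : ℝ →L[ℝ] F →L[ℝ] F).precompL
      (EuclideanSpace ℝ (Fin n)) (fderiv ℝ (mollKernel (EuclideanSpace ℝ (Fin n)) k) (x - t))
      (w t)) := by
  have h1 : HasCompactSupport (fderiv ℝ (mollKernel (EuclideanSpace ℝ (Fin n)) k)) :=
    (hasCompactSupport_mollKernel k).fderiv ℝ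
  have h2 : Continuous (fderiv ℝ (mollKernel (EuclideanSpace ℝ (Fin n)) k)) :=
    (contDiff_mollKernel k).continuous_fderiv (by simp)
  have h3 := h1.convolutionExists_left (μ := volume)
    ((ContinuousLinearMap.lsmul ℝ ℝ : ℝ →L[ℝ] F →L[ℝ] F).precompL (EuclideanSpace ℝ (Fin n)))
    h2 hw x
  exact h3.integrable_swap

/-- The derivative of a mollification is the mollification of the weak derivative. -/
theorem HasWeakDeriv.hasFDerivAt_mollify (h : HasWeakDeriv Ω u G) {k : ℕ}
    {x : EuclideanSpace ℝ (Fin n)} (hx : closedBall x (mollRadius k) ⊆ Ω)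
    {w : EuclideanSpace ℝ (Fin n) → F}
    {W : EuclideanSpace ℝ (Fin n) → EuclideanSpace ℝ (Fin n) →L[ℝ] F}
    (hw : LocallyIntegrable w) (hW : LocallyIntegrable W)
    (hwu : EqOn w u (closedBall x (mollRadius k))) (hWG : EqOn W G (closedBall x (mollRadius k))) :
    HasFDerivAt (mollify k w) (mollify k W x) x := by
  have h1 := (hasCompactSupport_mollKernel (E := EuclideanSpace ℝ (Fin n)) k
    ).hasFDerivAt_convolution_left (ContinuousLinearMap.lsmul ℝ ℝ : ℝ →L[ℝ] F →L[ℝ] F)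
    ((contDiff_mollKernel k).of_le (by simp)) hw x
  rw [← mollify_eq_convolution] at h1
  refine h1.congr_fderiv (ContinuousLinearMap.ext fun v => Eq.symm ?_)
  let ψ : EuclideanSpace ℝ (Fin n) → ℝ := fun t => mollKernel _ k (x - t)
  have hψ : ContDiff ℝ ∞ ψ := (contDiff_mollKernel k).comp (contDiff_const.sub contDiff_id)
  have hts : tsupport ψ ⊆ closedBall x (mollRadius k) := by
    refine closure_minimal (fun t ht => ?_) isClosed_closedBall
    by_contra hcon
    refine ht (mollKernel_eq_zero k ?_)
    rw [← dist_eq_norm, dist_comm]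
    exact (not_le.1 hcon).le
  have hψc : HasCompactSupport ψ :=
    (isCompact_closedBall x (mollRadius k)).of_isClosed_subset isClosed_closure hts
  have hfd : ∀ t, fderiv ℝ ψ t v = - fderiv ℝ (mollKernel _ k) (x - t) v := fun t => by
    have e1 : HasFDerivAt (fun t : EuclideanSpace ℝ (Fin n) => x - t)
        (-(ContinuousLinearMap.id ℝ (EuclideanSpace ℝ (Fin n)))) t := (hasFDerivAt_id t).const_sub x
    have e2 := (((contDiff_mollKernel (E := EuclideanSpace ℝ (Fin n)) k).differentiable
      (by simp)) (x - t)).hasFDerivAt.comp t e1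
    have e3 : fderiv ℝ ψ t = _ := e2.fderiv
    rw [e3]
    simp
  have e1 : mollify k W x v = ∫ t, ψ t • G t v := by
    rw [mollify, ContinuousLinearMap.integral_apply (integrable_mollKernel_smul k x hW)]
    refine integral_congr_ae (Eventually.of_forall fun t => ?_)
    by_cases ht : t ∈ closedBall x (mollRadius k)
    · change mollKernel _ k (x - t) • W t v = mollKernel _ k (x - t) • G t v
      rw [hWG ht]
    · have : ψ t = 0 := image_eq_zero_of_notMem_tsupport fun h => ht (hts h)
      change ψ t • W t v = ψ t • G t v
      rw [this, zero_smul, zero_smul]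
  have e2 : ∫ t, ψ t • G t v = - ∫ t, (fderiv ℝ ψ t v) • u t := by
    rw [h.integral_eq hψ hψc (hts.trans hx) v, neg_neg]
  have hint := integrable_precompL_fderiv_mollKernel k x hw
  rw [e1, e2, convolution_eq_swap, ContinuousLinearMap.integral_apply hint, ← integral_neg]
  refine integral_congr_ae (Eventually.of_forall fun t => ?_)
  simp only [ContinuousLinearMap.precompL_apply, ContinuousLinearMap.lsmul_apply]
  by_cases ht : t ∈ closedBall x (mollRadius k)
  · rw [hfd, hwu ht]
    simp
  · have h0 : fderiv ℝ ψ t v = 0 := by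
      have := image_eq_zero_of_notMem_tsupport
        (f := fun x => fderiv ℝ ψ x v) fun h => ht (hts (tsupport_fderiv_apply_subset' ψ v h))
      exact this
    have h3 := hfd t
    rw [h0] at h3
    have h5 := neg_eq_zero.1 h3.symm
    simp only [h0, h5, zero_smul, neg_zero]

end MollifyWeakDeriv

/-! ### Mollification of weakly differentiable functions near a compact set -/

section MollifyNearCompact

variable {n : ℕ} {F : Type*} [NormedAddCommGroup F] [NormedSpace ℝ F] [CompleteSpace F]
  {Ω Ω' : Set (EuclideanSpace ℝ (Fin n))} {u : EuclideanSpace ℝ (Fin n) → F}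
  {G G' : EuclideanSpace ℝ (Fin n) → EuclideanSpace ℝ (Fin n) →L[ℝ] F}

theorem oscModulus_congr {f f' : EuclideanSpace ℝ (Fin n) → F}
    (h : f =ᵐ[volume.restrict Ω] f') (r : ℝ) : oscModulus Ω f r = oscModulus Ω f' r := by
  unfold oscModulus
  refine iSup_congr fun x => iSup_congr fun ρ => iSup_congr fun _ => iSup_congr fun _ =>
    iSup_congr fun hb => ?_
  have h' : f =ᵐ[volume.restrict (ball x ρ)] f' := ae_mono (Measure.restrict_mono hb le_rfl) h
  rw [average_congr h']
  refine laverage_congr ?_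
  filter_upwards [h'] with y hy
  rw [hy]

theorem oscModulus_mono_set {f : EuclideanSpace ℝ (Fin n) → F} (h : Ω' ⊆ Ω) (r : ℝ) :
    oscModulus Ω' f r ≤ oscModulus Ω f r :=
  iSup_mono fun _ => iSup_mono fun _ => iSup_mono fun _ => iSup_mono fun _ =>
    iSup_mono' fun hb => ⟨hb.trans h, le_rfl⟩

theorem MemVMO.congr {f f' : EuclideanSpace ℝ (Fin n) → F} (hf : MemVMO Ω f)
    (h : f =ᵐ[volume.restrict Ω] f') : MemVMO Ω f' :=
  ⟨hf.1.congr h, by simpa only [← funext (oscModulus_congr h)] using hf.2⟩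

theorem MemVMO.mono {f : EuclideanSpace ℝ (Fin n) → F} (hf : MemVMO Ω f) (h : Ω' ⊆ Ω) :
    MemVMO Ω' f :=
  ⟨hf.1.mono_set h, tendsto_of_tendsto_of_tendsto_of_le_of_le tendsto_const_nhds hf.2
    (fun _ => zero_le) fun r => oscModulus_mono_set h r⟩

/-- The mollification kernel is at most `2 ^ n` times the normalized indicator of the ball of the
same radius; the constant does not depend on `k`. -/
theorem mollKernel_le (k : ℕ) (x y : EuclideanSpace ℝ (Fin n)) :
    ENNReal.ofReal (mollKernel _ k x) ≤
      2 ^ n * (volume (ball y (mollRadius k)))⁻¹ := by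
  have h1 := (mollBump (EuclideanSpace ℝ (Fin n)) k).normed_le_div_measure_closedBall_rOut volume 2
    (by simp [mollBump]; linarith) x
  have hr : 0 < mollRadius k := mollRadius_pos k
  have h2 : volume (ball y (mollRadius k))
      ≤ volume (closedBall (0 : EuclideanSpace ℝ (Fin n)) (mollRadius k)) := by
    rw [Measure.addHaar_ball_center]
    exact measure_mono ball_subset_closedBall
  have h3 : 0 < volume (closedBall (0 : EuclideanSpace ℝ (Fin n)) (mollRadius k)) :=
    measure_closedBall_pos _ _ hr
  have h4 : volume (closedBall (0 : EuclideanSpace ℝ (Fin n)) (mollRadius k)) ≠ ⊤ :=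
    measure_closedBall_lt_top.ne
  change _ ≤ _ / (volume (closedBall (0 : EuclideanSpace ℝ (Fin n)) (mollRadius k))).toReal at h1
  refine (ENNReal.ofReal_le_ofReal h1).trans ?_
  rw [ENNReal.ofReal_div_of_pos (ENNReal.toReal_pos h3.ne' h4),
    ENNReal.ofReal_toReal h4, finrank_euclideanSpace_fin, ENNReal.ofReal_pow (by norm_num),
    div_eq_mul_inv]
  gcongr
  simp

/-- On small balls a function of vanishing mean oscillation is close in mean to the value of its
mollification at the centre. -/
theorem laverage_enorm_sub_mollify_le {f w : EuclideanSpace ℝ (Fin n) → F}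
    (hw : LocallyIntegrable w) {k : ℕ} {x : EuclideanSpace ℝ (Fin n)}
    (hx : ball x (mollRadius k) ⊆ Ω) (hwf : EqOn w f (ball x (mollRadius k))) :
    ⨍⁻ y in ball x (mollRadius k), ‖f y - mollify k w x‖ₑ ∂volume
      ≤ (1 + 2 ^ n) * oscModulus Ω f (mollRadius k) := by
  have hr : 0 < mollRadius k := mollRadius_pos k
  set B := ball x (mollRadius k)
  set a := ⨍ z in B, f z
  have hB0 : volume B ≠ 0 := (measure_ball_pos _ _ hr).ne'
  have hBt : volume B ≠ ⊤ := measure_ball_lt_top.ne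
  have hfin : IsFiniteMeasure (volume.restrict B) := ⟨by simpa using hBt.lt_top⟩
  have hne : NeZero (volume.restrict B) := ⟨by simpa using hB0⟩
  have h0 : ⨍⁻ y in B, ‖f y - a‖ₑ ∂volume ≤ oscModulus Ω f (mollRadius k) := by
    unfold oscModulus
    exact le_iSup_of_le x (le_iSup_of_le (mollRadius k) (le_iSup_of_le hr
      (le_iSup_of_le le_rfl (le_iSup_of_le hx le_rfl))))
  have h1 : ‖mollify k w x - a‖ₑ ≤ 2 ^ n * ⨍⁻ y in B, ‖f y - a‖ₑ ∂volume := by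
    rw [mollify_sub_eq k x hw, setLAverage_eq]
    calc ‖∫ t, mollKernel _ k (x - t) • (w t - a)‖ₑ
        ≤ ∫⁻ t, ‖mollKernel _ k (x - t) • (w t - a)‖ₑ := enorm_integral_le_lintegral_enorm _
      _ ≤ ∫⁻ t, B.indicator (fun t => 2 ^ n * (volume B)⁻¹ * ‖f t - a‖ₑ) t := by
          refine lintegral_mono fun t => ?_
          by_cases ht : t ∈ B
          · rw [indicator_of_mem ht, enorm_smul, hwf ht,
              Real.enorm_of_nonneg (mollKernel_nonneg k _)]
            gcongr
            exact mollKernel_le k _ _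
          · rw [mollKernel_eq_zero]
            · simp
            · rw [← dist_eq_norm, dist_comm]
              simpa [B] using ht
      _ = 2 ^ n * ((∫⁻ y in B, ‖f y - a‖ₑ) / volume B) := by
          rw [lintegral_indicator measurableSet_ball, lintegral_const_mul' _ _ (ENNReal.mul_ne_top
            (by simp) (ENNReal.inv_ne_top.2 hB0)), div_eq_mul_inv]
          ring
  calc ⨍⁻ y in B, ‖f y - mollify k w x‖ₑ ∂volume
      ≤ ⨍⁻ y in B, (‖f y - a‖ₑ + ‖mollify k w x - a‖ₑ) ∂volume := by
        refine lintegral_mono fun y => ?_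
        rw [← sub_sub_sub_cancel_right (f y) _ a]
        exact enorm_sub_le
    _ = (⨍⁻ y in B, ‖f y - a‖ₑ ∂volume) + ‖mollify k w x - a‖ₑ := by
        rw [laverage, lintegral_add_right _ measurable_const]
        congr 1
        exact laverage_const _ _
    _ ≤ oscModulus Ω f (mollRadius k) + 2 ^ n * oscModulus Ω f (mollRadius k) := by
        gcongr
        exact h1.trans (by gcongr)
    _ = _ := by ring

theorem locallyIntegrable_indicator_of_locallyIntegrableOn {K : Set (EuclideanSpace ℝ (Fin n))}
    (hK : IsCompact K) (hKΩ : K ⊆ Ω) {f : EuclideanSpace ℝ (Fin n) → F}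
    (hf : LocallyIntegrableOn f Ω) : LocallyIntegrable (K.indicator f) :=
  ((hf.integrableOn_compact_subset hKΩ hK).integrable_indicator
    hK.isClosed.measurableSet).locallyIntegrable

/-- Mollification is applied to the extension by zero of the restriction of `f` to `K`. -/
theorem lpTendsto_mollify_indicator {K Q : Set (EuclideanSpace ℝ (Fin n))} {p : ℝ≥0∞}
    (hp1 : 1 ≤ p) (hp : p ≠ ⊤) (hK : MeasurableSet K) (hQ : MeasurableSet Q) (hQK : Q ⊆ K)
    {f : EuclideanSpace ℝ (Fin n) → F} (hf : MemLp f p (volume.restrict K)) :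
    LpTendsto p (volume.restrict Q) (fun k => mollify k (K.indicator f)) f := by
  have h0 : MemLp (K.indicator f) p volume := (memLp_indicator_iff_restrict hK).2 hf
  have h1 := (lpTendsto_mollify hp1 hp h0).mono_measure (Measure.restrict_le_self (s := Q))
  refine h1.congr (Eventually.of_forall fun _ => ae_eq_rfl) ?_
  filter_upwards [ae_restrict_mem hQ] with x hx
  exact indicator_of_mem (hQK hx) _

/-- A continuous function with bounded weak derivative `G` on the open set `Ω` is approximated near
a compact set `Q ⊆ Ω` by smooth functions whose derivatives are mollifications of `G`. -/
theorem exists_mollification (hΩ : IsOpen Ω) {Q : Set (EuclideanSpace ℝ (Fin n))}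
    (hQ : IsCompact Q) (hQΩ : Q ⊆ Ω) (hu : HasWeakDeriv Ω u G) (hc : ContinuousOn u Ω) {L : ℝ}
    (hL : ∀ᵐ x ∂(volume.restrict Ω), ‖G x‖ ≤ L) :
    ∃ v : ℕ → EuclideanSpace ℝ (Fin n) → F, (∀ k, ContDiff ℝ ∞ (v k)) ∧
      (∀ ε > 0, ∀ᶠ k in atTop, ∀ x ∈ Q, ‖v k x - u x‖ ≤ ε) ∧
      (∀ᶠ k in atTop, ∀ x ∈ Q, ‖fderiv ℝ (v k) x‖ ≤ L) ∧
      (∀ p : ℝ≥0∞, 1 ≤ p → p ≠ ⊤ →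
        LpTendsto p (volume.restrict Q) (fun k => fderiv ℝ (v k)) G) ∧
      (∀ H, HasWeakDeriv Ω G H → ∀ p : ℝ≥0∞, 1 ≤ p → p ≠ ⊤ → MemLp H p (volume.restrict Ω) →
        LpTendsto p (volume.restrict Q) (fun k => fderiv ℝ (fderiv ℝ (v k))) H) ∧
      (MemVMO Ω G → ∀ η : ℝ≥0∞, 0 < η → ∀ᶠ k in atTop, ∀ x ∈ Q,
        ball x (mollRadius k) ⊆ Ω ∧
        ⨍⁻ y in ball x (mollRadius k), ‖G y - fderiv ℝ (v k) x‖ₑ ∂volume ≤ η) := by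
  obtain ⟨δ, hδ, hδΩ⟩ := hQ.exists_cthickening_subset_open hΩ hQΩ
  set K := cthickening δ Q with hK
  have hKc : IsCompact K := hQ.cthickening
  have hKm : MeasurableSet K := isClosed_cthickening.measurableSet
  have hQm : MeasurableSet Q := hQ.isClosed.measurableSet
  have hQK : Q ⊆ K := self_subset_cthickening Q
  have hloc := locallyIntegrable_indicator_of_locallyIntegrableOn (F := F) hKc hδΩ hu.1
  have hloc' := locallyIntegrable_indicator_of_locallyIntegrableOn hKc hδΩ hu.2.1
  have hball : ∀ᶠ k in atTop, ∀ x ∈ thickening (δ / 2) Q, closedBall x (mollRadius k) ⊆ K := by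
    filter_upwards [tendsto_mollRadius.eventually (gt_mem_nhds (half_pos hδ))] with k hk x hx y hy
    obtain ⟨q, hq, hxq⟩ := mem_thickening_iff.1 hx
    refine mem_cthickening_of_dist_le y q δ Q hq ?_
    have h1 := dist_triangle y x q
    rw [mem_closedBall] at hy
    linarith
  have hQO : ∀ {x}, x ∈ Q → x ∈ thickening (δ / 2) Q := fun hx =>
    self_subset_thickening (half_pos hδ) Q hx
  have hder : ∀ᶠ k in atTop, ∀ x ∈ thickening (δ / 2) Q,
      HasFDerivAt (mollify k (K.indicator u)) (mollify k (K.indicator G) x) x := by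
    filter_upwards [hball] with k hk x hx
    exact hu.hasFDerivAt_mollify ((hk x hx).trans hδΩ) hloc hloc'
      (fun y hy => indicator_of_mem (hk x hx hy) _) (fun y hy => indicator_of_mem (hk x hx hy) _)
  have hfin : IsFiniteMeasure (volume.restrict K) := ⟨by simpa using hKc.measure_lt_top⟩
  refine ⟨fun k => mollify k (K.indicator u), fun k => contDiff_mollify k hloc,
    fun ε hε => ?_, ?_, fun p hp1 hp => ?_, fun H hH p hp1 hp hHp => ?_, fun hV η hη => ?_⟩
  · have hunif : UniformContinuousOn u K := hKc.uniformContinuousOn_of_continuous (hc.mono hδΩ)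
    obtain ⟨r, hr, hru⟩ := Metric.uniformContinuousOn_iff.1 hunif ε hε
    filter_upwards [hball, tendsto_mollRadius.eventually (gt_mem_nhds hr)] with k hk hkr x hx
    refine norm_mollify_sub_le k x hloc _ (Eventually.of_forall fun t ht => ?_)
    have htK : t ∈ K := hk x (hQO hx) (ball_subset_closedBall ht)
    rw [indicator_of_mem htK, ← dist_eq_norm]
    exact (hru t htK x (hQK hx) (lt_trans ht hkr)).le
  · filter_upwards [hball, hder] with k hk hk' x hx
    rw [(hk' x (hQO hx)).fderiv]
    refine norm_mollify_le k x hloc' ?_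
    filter_upwards [(ae_restrict_iff' hΩ.measurableSet).1 hL] with t ht ht'
    have htK : t ∈ K := hk x (hQO hx) (ball_subset_closedBall ht')
    rw [indicator_of_mem htK]
    exact ht (hδΩ htK)
  · refine (lpTendsto_mollify_indicator hp1 hp (f := G) hKm hQm hQK ?_).congr ?_ ae_eq_rfl
    · exact MemLp.of_bound ((hu.2.1.integrableOn_compact_subset hδΩ hKc)).1 L
        (ae_mono (Measure.restrict_mono hδΩ le_rfl) hL)
    · filter_upwards [hder] with k hk
      filter_upwards [ae_restrict_mem hQm] with x hx
      exact (hk x (hQO hx)).fderiv.symm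
  · refine (lpTendsto_mollify_indicator hp1 hp (f := H) hKm hQm hQK
      (hHp.mono_measure (Measure.restrict_mono hδΩ le_rfl))).congr ?_ ae_eq_rfl
    filter_upwards [hder, hball] with k hk hk'
    filter_upwards [ae_restrict_mem hQm] with x hx
    have e1 : fderiv ℝ (mollify k (K.indicator u)) =ᶠ[𝓝 x] mollify k (K.indicator G) := by
      filter_upwards [isOpen_thickening.mem_nhds (hQO hx)] with y hy using (hk y hy).fderiv
    rw [e1.fderiv_eq]
    exact (hH.hasFDerivAt_mollify ((hk' x (hQO hx)).trans hδΩ) hloc'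
      (locallyIntegrable_indicator_of_locallyIntegrableOn hKc hδΩ hH.2.1)
      (fun y hy => indicator_of_mem (hk' x (hQO hx) hy) _)
      (fun y hy => indicator_of_mem (hk' x (hQO hx) hy) _)).fderiv.symm
  · have h1 : Tendsto (fun r => (1 + 2 ^ n) * oscModulus Ω G r) (𝓝[>] 0) (𝓝 0) := by
      have h2 := ENNReal.Tendsto.const_mul (a := 1 + 2 ^ n) hV.2
        (Or.inr (ENNReal.add_ne_top.2 ⟨ENNReal.one_ne_top, by simp⟩))
      simpa using h2
    have h2 : Tendsto mollRadius atTop (𝓝[>] 0) :=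
      tendsto_nhdsWithin_iff.2 ⟨tendsto_mollRadius, Eventually.of_forall mollRadius_pos⟩
    filter_upwards [hball, hder, h2.eventually (ENNReal.tendsto_nhds_zero.1 h1 η hη)]
      with k hk hk' hk'' x hx
    have hb : ball x (mollRadius k) ⊆ K := ball_subset_closedBall.trans (hk x (hQO hx))
    refine ⟨hb.trans hδΩ, ?_⟩
    rw [(hk' x (hQO hx)).fderiv]
    exact (laverage_enorm_sub_mollify_le hloc' (hb.trans hδΩ)
      (fun y hy => indicator_of_mem (hb hy) _)).trans hk''

/-- A continuous function whose weak derivative is bounded by `L` is `L`-Lipschitz along segments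
contained in its domain. -/
theorem norm_sub_le_of_segment_subset (hΩ : IsOpen Ω) (hu : HasWeakDeriv Ω u G)
    (hc : ContinuousOn u Ω) {L : ℝ} (hL : ∀ᵐ x ∂(volume.restrict Ω), ‖G x‖ ≤ L)
    {a b : EuclideanSpace ℝ (Fin n)} (hab : segment ℝ a b ⊆ Ω) : ‖u b - u a‖ ≤ L * ‖b - a‖ := by
  have hcomp : IsCompact (segment ℝ a b) := by
    rw [segment_eq_image_lineMap]
    exact isCompact_Icc.image (AffineMap.lineMap_continuous)
  obtain ⟨v, hv, hvu, hvL, -⟩ := exists_mollification hΩ hcomp hab hu hc hL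
  refine le_of_forall_pos_le_add fun ε hε => ?_
  obtain ⟨k, h1, h2⟩ := ((hvu (ε / 2) (half_pos hε)).and hvL).exists
  have h3 := (convex_segment a b).norm_image_sub_le_of_norm_fderiv_le (𝕜 := ℝ)
    (fun x _ => (hv k).differentiable (by simp) x) h2 (left_mem_segment ℝ a b)
    (right_mem_segment ℝ a b)
  have h4 := h1 a (left_mem_segment ℝ a b)
  have h5 := h1 b (right_mem_segment ℝ a b)
  have h6 : u b - u a = (v k b - v k a) - (v k b - u b) + (v k a - u a) := by abel
  rw [h6]
  refine (norm_add_le _ _).trans ?_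
  have := norm_sub_le (v k b - v k a) (v k b - u b)
  linarith

end MollifyNearCompact

/-! ### Sequences of smooth functions which converge together with their derivatives in `L^p` -/

section JetConv

variable {n : ℕ} {F F₁ F₂ : Type*} [NormedAddCommGroup F] [NormedSpace ℝ F]
  [NormedAddCommGroup F₁] [NormedSpace ℝ F₁] [NormedAddCommGroup F₂] [NormedSpace ℝ F₂]
  {p : ℝ≥0∞} {A B : Set (EuclideanSpace ℝ (Fin n))} {u u' : ℕ → EuclideanSpace ℝ (Fin n) → F}

/-- For large `k` the functions `u k` are smooth near the points of `A` and bounded on `A` by a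
common constant, and `u k` and its derivative converge in `L^p(A)` as `k → ∞`. The limits are left
unspecified. -/
structure JetConv (p : ℝ≥0∞) (A : Set (EuclideanSpace ℝ (Fin n)))
    (u : ℕ → EuclideanSpace ℝ (Fin n) → F) : Prop where
  smooth : ∀ᶠ k in atTop, ∀ x ∈ A, ContDiffAt ℝ ∞ (u k) x
  bdd : ∃ C, ∀ᶠ k in atTop, ∀ x ∈ A, ‖u k x‖ ≤ C
  conv : ∃ u₀, LpTendsto p (volume.restrict A) u u₀
  conv_fderiv : ∃ G, LpTendsto p (volume.restrict A) (fun k => fderiv ℝ (u k)) G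

theorem ContDiffAt.eventually_differentiableAt {f : EuclideanSpace ℝ (Fin n) → F}
    {x : EuclideanSpace ℝ (Fin n)} (h : ContDiffAt ℝ ∞ f x) :
    ∀ᶠ y in 𝓝 x, DifferentiableAt ℝ f y :=
  ((h.of_le (m := 1) (by simp)).eventually (by simp)).mono fun _ hy =>
    hy.differentiableAt one_ne_zero

theorem aestronglyMeasurable_of_contDiffAt (hA : MeasurableSet A)
    {f : EuclideanSpace ℝ (Fin n) → F} (h : ∀ x ∈ A, ContDiffAt ℝ ∞ f x) :
    AEStronglyMeasurable f (volume.restrict A) :=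
  ContinuousOn.aestronglyMeasurable (fun x hx => (h x hx).continuousAt.continuousWithinAt) hA

theorem ContDiffAt.fderiv_infty {f : EuclideanSpace ℝ (Fin n) → F} {x : EuclideanSpace ℝ (Fin n)}
    (h : ContDiffAt ℝ ∞ f x) : ContDiffAt ℝ ∞ (fderiv ℝ f) x :=
  h.fderiv_right (by simp)

namespace JetConv

theorem ae_bdd (hA : MeasurableSet A) (h : JetConv p A u) :
    ∃ C, ∀ᶠ k in atTop, ∀ᵐ x ∂(volume.restrict A), ‖u k x‖ ≤ C := by
  obtain ⟨C, hC⟩ := h.bdd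
  refine ⟨C, hC.mono fun k hk => ?_⟩
  filter_upwards [ae_restrict_mem hA] with x hx using hk x hx

theorem congr (hA : MeasurableSet A) (h : JetConv p A u)
    (hu : ∀ᶠ k in atTop, ∀ x ∈ A, u k =ᶠ[𝓝 x] u' k) : JetConv p A u' := by
  obtain ⟨C, hC⟩ := h.bdd
  obtain ⟨u₀, hu₀⟩ := h.conv
  obtain ⟨G, hG⟩ := h.conv_fderiv
  refine ⟨?_, ⟨C, ?_⟩, ⟨u₀, hu₀.congr ?_ ae_eq_rfl⟩, ⟨G, hG.congr ?_ ae_eq_rfl⟩⟩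
  · filter_upwards [h.smooth, hu] with k h1 h2 x hx using (h1 x hx).congr_of_eventuallyEq
      (h2 x hx).symm
  · filter_upwards [hC, hu] with k h1 h2 x hx
    rw [← (h2 x hx).eq_of_nhds]
    exact h1 x hx
  · filter_upwards [hu] with k h2
    filter_upwards [ae_restrict_mem hA] with x hx using (h2 x hx).eq_of_nhds
  · filter_upwards [hu] with k h2
    filter_upwards [ae_restrict_mem hA] with x hx using (h2 x hx).fderiv_eq

theorem mono (h : JetConv p A u) (hBA : B ⊆ A) : JetConv p B u := by
  obtain ⟨C, hC⟩ := h.bdd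
  obtain ⟨u₀, hu₀⟩ := h.conv
  obtain ⟨G, hG⟩ := h.conv_fderiv
  have hm : volume.restrict B ≤ volume.restrict A := Measure.restrict_mono hBA le_rfl
  exact ⟨h.smooth.mono fun k hk x hx => hk x (hBA hx), ⟨C, hC.mono fun k hk x hx => hk x (hBA hx)⟩,
    ⟨u₀, hu₀.mono_measure hm⟩, ⟨G, hG.mono_measure hm⟩⟩

theorem comp_subseq (h : JetConv p A u) {σ : ℕ → ℕ} (hσ : Tendsto σ atTop atTop) :
    JetConv p A (fun k => u (σ k)) := by
  obtain ⟨C, hC⟩ := h.bdd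
  obtain ⟨u₀, hu₀⟩ := h.conv
  obtain ⟨G, hG⟩ := h.conv_fderiv
  exact ⟨hσ.eventually h.smooth, ⟨C, hσ.eventually hC⟩, ⟨u₀, hu₀.comp_subseq hσ⟩,
    ⟨G, hG.comp_subseq hσ⟩⟩

theorem union (hp1 : 1 ≤ p) (hp : p ≠ ⊤) (hA : MeasurableSet A) (h : JetConv p A u)
    (h' : JetConv p B u) : JetConv p (A ∪ B) u := by
  obtain ⟨C, hC⟩ := h.bdd
  obtain ⟨u₀, hu₀⟩ := h.conv
  obtain ⟨G, hG⟩ := h.conv_fderiv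
  obtain ⟨C', hC'⟩ := h'.bdd
  obtain ⟨u₀', hu₀'⟩ := h'.conv
  obtain ⟨G', hG'⟩ := h'.conv_fderiv
  refine ⟨?_, ⟨max C C', ?_⟩, exists_lpTendsto_union hp1 hp hA hu₀ hu₀',
    exists_lpTendsto_union hp1 hp hA hG hG'⟩
  · filter_upwards [h.smooth, h'.smooth] with k h1 h2 x hx using hx.elim (h1 x) (h2 x)
  · filter_upwards [hC, hC'] with k h1 h2 x hx using hx.elim
      (fun hx => (h1 x hx).trans (le_max_left _ _)) (fun hx => (h2 x hx).trans (le_max_right _ _))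

/-- A fixed function which is smooth and bounded together with its derivative. -/
theorem of_smooth (hA : MeasurableSet A) (hAfin : volume A ≠ ⊤)
    {f : EuclideanSpace ℝ (Fin n) → F} (hf : ∀ x ∈ A, ContDiffAt ℝ ∞ f x) {C : ℝ}
    (hC : ∀ x ∈ A, ‖f x‖ ≤ C) (hC' : ∀ x ∈ A, ‖fderiv ℝ f x‖ ≤ C) : JetConv p A fun _ => f := by
  have hfin : IsFiniteMeasure (volume.restrict A) := ⟨by simpa using hAfin.lt_top⟩
  refine ⟨Eventually.of_forall fun _ => hf, ⟨C, Eventually.of_forall fun _ => hC⟩,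
    ⟨f, LpTendsto.const (MemLp.of_bound (aestronglyMeasurable_of_contDiffAt hA hf) C ?_)⟩,
    ⟨fderiv ℝ f, LpTendsto.const (MemLp.of_bound (aestronglyMeasurable_of_contDiffAt hA
      fun x hx => (hf x hx).fderiv_infty) C ?_)⟩⟩ <;>
  filter_upwards [ae_restrict_mem hA] with x hx
  exacts [hC x hx, hC' x hx]

theorem add (hp1 : 1 ≤ p) (hA : MeasurableSet A) (h : JetConv p A u) (h' : JetConv p A u') :
    JetConv p A (fun k x => u k x + u' k x) := by
  obtain ⟨C, hC⟩ := h.bdd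
  obtain ⟨u₀, hu₀⟩ := h.conv
  obtain ⟨G, hG⟩ := h.conv_fderiv
  obtain ⟨C', hC'⟩ := h'.bdd
  obtain ⟨u₀', hu₀'⟩ := h'.conv
  obtain ⟨G', hG'⟩ := h'.conv_fderiv
  refine ⟨?_, ⟨C + C', ?_⟩, ⟨_, hu₀.add hp1 hu₀'⟩, ⟨_, (hG.add hp1 hG').congr ?_ ae_eq_rfl⟩⟩
  · filter_upwards [h.smooth, h'.smooth] with k h1 h2 x hx using (h1 x hx).add (h2 x hx)
  · filter_upwards [hC, hC'] with k h1 h2 x hx using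
      (norm_add_le _ _).trans (add_le_add (h1 x hx) (h2 x hx))
  · filter_upwards [h.smooth, h'.smooth] with k h1 h2
    filter_upwards [ae_restrict_mem hA] with x hx
    exact (fderiv_fun_add ((h1 x hx).differentiableAt (by simp))
      ((h2 x hx).differentiableAt (by simp))).symm

/-- Products are controlled because the factors are bounded. -/
theorem bilin (hp1 : 1 ≤ p) (hp : p ≠ ⊤) (hA : MeasurableSet A) (L : F →L[ℝ] F₁ →L[ℝ] F₂)
    {b : ℕ → EuclideanSpace ℝ (Fin n) → F₁} (h : JetConv p A u) (h' : JetConv p A b) :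
    JetConv p A (fun k x => L (u k x) (b k x)) := by
  have hp0 : p ≠ 0 := (zero_lt_one.trans_le hp1).ne'
  obtain ⟨C, hC⟩ := h.bdd
  obtain ⟨C₁, hC₁⟩ := h.ae_bdd hA
  obtain ⟨u₀, hu₀⟩ := h.conv
  obtain ⟨G, hG⟩ := h.conv_fderiv
  obtain ⟨C', hC'⟩ := h'.bdd
  obtain ⟨C₁', hC₁'⟩ := h'.ae_bdd hA
  obtain ⟨b₀, hb₀⟩ := h'.conv
  obtain ⟨H, hH⟩ := h'.conv_fderiv
  have e1 := hu₀.bilin hp1 hp (L.precompR (EuclideanSpace ℝ (Fin n))) hp0 hH hC₁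
  have e2 := hb₀.bilin hp1 hp (L.precompL (EuclideanSpace ℝ (Fin n))).flip hp0 hG hC₁'
  refine ⟨?_, ⟨‖L‖ * C * C', ?_⟩, ⟨_, hu₀.bilin hp1 hp L hp0 hb₀ hC₁⟩,
    ⟨_, (e1.add hp1 e2).congr ?_ ae_eq_rfl⟩⟩
  · filter_upwards [h.smooth, h'.smooth] with k h1 h2 x hx using
      (L.isBoundedBilinearMap.contDiff.contDiffAt).comp x ((h1 x hx).prodMk (h2 x hx))
  · filter_upwards [hC, hC'] with k h1 h2 x hx
    refine (L.le_opNorm₂ _ _).trans ?_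
    have := (norm_nonneg (u k x)).trans (h1 x hx)
    have := h1 x hx
    have := h2 x hx
    gcongr
  · filter_upwards [h.smooth, h'.smooth] with k h1 h2
    filter_upwards [ae_restrict_mem hA] with x hx
    exact (L.hasFDerivAt_of_bilinear ((h1 x hx).differentiableAt (by simp)).hasFDerivAt
      ((h2 x hx).differentiableAt (by simp)).hasFDerivAt).fderiv.symm

/-- Change of variables. -/
theorem comp (hp1 : 1 ≤ p) (hp : p ≠ ⊤) (hA : MeasurableSet A) (hAfin : volume A ≠ ⊤)
    {τ : EuclideanSpace ℝ (Fin n) → EuclideanSpace ℝ (Fin n)} (hτ : ∀ x ∈ A, ContDiffAt ℝ ∞ τ x)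
    (hinj : InjOn τ A) {c C : ℝ} (hc : 0 < c) (hdet : ∀ x ∈ A, c ≤ |(fderiv ℝ τ x).det|)
    (hC : ∀ x ∈ A, ‖fderiv ℝ τ x‖ ≤ C) (hAB : MapsTo τ A B) (h : JetConv p B u) :
    JetConv p A (fun k x => u k (τ x)) := by
  have hp0 : p ≠ 0 := (zero_lt_one.trans_le hp1).ne'
  have hfin : IsFiniteMeasure (volume.restrict A) := ⟨by simpa using hAfin.lt_top⟩
  obtain ⟨D, hD⟩ := h.bdd
  obtain ⟨u₀, hu₀⟩ := h.conv
  obtain ⟨G, hG⟩ := h.conv_fderiv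
  obtain ⟨hm, hmap⟩ := map_restrict_le_of_le_abs_det hA (fun x hx =>
    ((hτ x hx).differentiableAt (by simp)).hasFDerivAt.hasFDerivWithinAt) hinj hc hdet hAB
  have hK : (ENNReal.ofReal c)⁻¹ ≠ ⊤ := ENNReal.inv_ne_top.2 (by simpa using hc)
  have e1 : LpTendsto p (volume.restrict A) (fun _ => fderiv ℝ τ) (fderiv ℝ τ) :=
    LpTendsto.const (MemLp.of_bound (aestronglyMeasurable_of_contDiffAt hA
      fun x hx => (hτ x hx).fderiv_infty) C
      (by filter_upwards [ae_restrict_mem hA] with x hx using hC x hx))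
  have e2 := e1.bilin hp1 hp (ContinuousLinearMap.compL ℝ (EuclideanSpace ℝ (Fin n))
    (EuclideanSpace ℝ (Fin n)) F).flip hp0 (hG.comp_of_map_le hp hK hm hmap) (C := C)
    (Eventually.of_forall fun _ => by
      filter_upwards [ae_restrict_mem hA] with x hx using hC x hx)
  refine ⟨?_, ⟨D, ?_⟩, ⟨_, hu₀.comp_of_map_le hp hK hm hmap⟩, ⟨_, e2.congr ?_ ae_eq_rfl⟩⟩
  · filter_upwards [h.smooth] with k h1 x hx using (h1 _ (hAB hx)).comp x (hτ x hx)
  · filter_upwards [hD] with k h1 x hx using h1 _ (hAB hx)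
  · filter_upwards [h.smooth] with k h1
    filter_upwards [ae_restrict_mem hA] with x hx
    exact (fderiv_comp x ((h1 _ (hAB hx)).differentiableAt (by simp))
      ((hτ x hx).differentiableAt (by simp))).symm

/-- Composition of a bounded, uniformly convergent sequence with a fixed continuous map. -/
theorem exists_bound_and_lpTendsto_comp_continuous [ProperSpace F] (hA : MeasurableSet A)
    (hAfin : volume A ≠ ⊤) {u₀ : EuclideanSpace ℝ (Fin n) → F} {C : ℝ}
    (hs : ∀ᶠ k in atTop, ContinuousOn (u k) A) (hC : ∀ᶠ k in atTop, ∀ x ∈ A, ‖u k x‖ ≤ C)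
    (hu₀ : ∀ ε > 0, ∀ᶠ k in atTop, ∀ x ∈ A, ‖u k x - u₀ x‖ ≤ ε) {Q : F → F₁}
    (hQ : Continuous Q) :
    ∃ D, (∀ᶠ k in atTop, ∀ x ∈ A, ‖Q (u k x)‖ ≤ D) ∧
      LpTendsto p (volume.restrict A) (fun k x => Q (u k x)) (fun x => Q (u₀ x)) := by
  have hfin : IsFiniteMeasure (volume.restrict A) := ⟨by simpa using hAfin.lt_top⟩
  have hlim : ∀ x ∈ A, Tendsto (fun k => u k x) atTop (𝓝 (u₀ x)) := fun x hx => by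
    rw [Metric.tendsto_nhds]
    intro ε hε
    filter_upwards [hu₀ (ε / 2) (half_pos hε)] with k hk
    rw [dist_eq_norm]
    linarith [hk x hx]
  have hC₀ : ∀ x ∈ A, ‖u₀ x‖ ≤ C := fun x hx =>
    le_of_tendsto (hlim x hx).norm (hC.mono fun k hk => hk x hx)
  obtain ⟨D, hD⟩ := ((isCompact_closedBall (0 : F) C).image hQ).isBounded.exists_norm_le
  have hD' : ∀ y, ‖y‖ ≤ C → ‖Q y‖ ≤ D := fun y hy =>
    hD _ ⟨y, by simpa using hy, rfl⟩
  have hb : ∀ᶠ k in atTop, ∀ x ∈ A, ‖Q (u k x)‖ ≤ D := by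
    filter_upwards [hC] with k hk x hx using hD' _ (hk x hx)
  have hm : ∀ᶠ k in atTop, AEStronglyMeasurable (fun x => Q (u k x)) (volume.restrict A) := by
    filter_upwards [hs] with k hk
    exact (hQ.comp_continuousOn hk).aestronglyMeasurable hA
  obtain ⟨N, hN⟩ := eventually_atTop.1 hm
  have hm₀ : AEStronglyMeasurable (fun x => Q (u₀ x)) (volume.restrict A) := by
    refine aestronglyMeasurable_of_tendsto_ae atTop (f := fun k x => Q (u (k + N) x))
      (fun k => hN _ (by omega)) ?_
    filter_upwards [ae_restrict_mem hA] with x hx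
    exact (hQ.tendsto _).comp ((hlim x hx).comp (tendsto_add_atTop_nat N))
  refine ⟨D, hb, LpTendsto.of_uniform hm (MemLp.of_bound hm₀ D ?_) fun ε hε => ?_⟩
  · filter_upwards [ae_restrict_mem hA] with x hx using hD' _ (hC₀ x hx)
  · obtain ⟨r, hr, hru⟩ := Metric.uniformContinuousOn_iff.1
      ((isCompact_closedBall (0 : F) C).uniformContinuousOn_of_continuous hQ.continuousOn) ε hε
    filter_upwards [hC, hu₀ (r / 2) (half_pos hr)] with k h1 h2
    filter_upwards [ae_restrict_mem hA] with x hx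
    rw [← dist_eq_norm]
    refine (hru _ (by simpa using h1 x hx) _ (by simpa using hC₀ x hx) ?_).le
    rw [dist_eq_norm]
    linarith [h2 x hx]

/-- Composition with a fixed smooth map from the left. -/
theorem postcomp [ProperSpace F] (hp1 : 1 ≤ p) (hp : p ≠ ⊤) (hA : MeasurableSet A)
    (hAfin : volume A ≠ ⊤) {P : F → F₁} (hP : ContDiff ℝ ∞ P) (h : JetConv p A u)
    {u₀ : EuclideanSpace ℝ (Fin n) → F}
    (hu₀ : ∀ ε > 0, ∀ᶠ k in atTop, ∀ x ∈ A, ‖u k x - u₀ x‖ ≤ ε) :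
    JetConv p A (fun k x => P (u k x)) := by
  have hp0 : p ≠ 0 := (zero_lt_one.trans_le hp1).ne'
  obtain ⟨C, hC⟩ := h.bdd
  obtain ⟨G, hG⟩ := h.conv_fderiv
  have hs : ∀ᶠ k in atTop, ContinuousOn (u k) A :=
    h.smooth.mono fun k hk x hx => (hk x hx).continuousAt.continuousWithinAt
  obtain ⟨D, hD, hconv⟩ := exists_bound_and_lpTendsto_comp_continuous (p := p) hA hAfin hs hC hu₀
    hP.continuous
  obtain ⟨D', hD', hconv'⟩ := exists_bound_and_lpTendsto_comp_continuous (p := p) hA hAfin hs hC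
    hu₀ (hP.continuous_fderiv (by simp))
  have e := hconv'.bilin hp1 hp (ContinuousLinearMap.compL ℝ (EuclideanSpace ℝ (Fin n)) F F₁) hp0 hG
    (C := D') (by
      filter_upwards [hD'] with k hk
      filter_upwards [ae_restrict_mem hA] with x hx using hk x hx)
  refine ⟨?_, ⟨D, hD⟩, ⟨_, hconv⟩, ⟨_, e.congr ?_ ae_eq_rfl⟩⟩
  · filter_upwards [h.smooth] with k h1 x hx using hP.contDiffAt.comp x (h1 x hx)
  · filter_upwards [h.smooth] with k h1
    filter_upwards [ae_restrict_mem hA] with x hx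
    exact (fderiv_comp x (hP.differentiable (by simp) _)
      ((h1 x hx).differentiableAt (by simp))).symm

end JetConv

end JetConv

/-! ### Convergence of derivatives near a point -/

section JetConvAt

variable {n : ℕ} {F F₁ F₂ : Type*} [NormedAddCommGroup F] [NormedSpace ℝ F]
  [NormedAddCommGroup F₁] [NormedSpace ℝ F₁] [NormedAddCommGroup F₂] [NormedSpace ℝ F₂]
  {p : ℝ≥0∞} {Ω Ω' : Set (EuclideanSpace ℝ (Fin n))} {a : EuclideanSpace ℝ (Fin n)}
  {u u' : ℕ → EuclideanSpace ℝ (Fin n) → F}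

/-- `JetConv` holds on the part of `Ω` in some ball around `a`. The point `a` may lie on the
boundary of `Ω`. -/
def JetConvAt (p : ℝ≥0∞) (Ω : Set (EuclideanSpace ℝ (Fin n))) (a : EuclideanSpace ℝ (Fin n))
    (u : ℕ → EuclideanSpace ℝ (Fin n) → F) : Prop :=
  ∃ r > 0, JetConv p (ball a r ∩ Ω) u

/-- `JetConvAt` for the functions and for their derivatives, that is, local convergence in
`W^{2,p}` with uniform `C^1` bounds. -/
def JetTwoConvAt (p : ℝ≥0∞) (Ω : Set (EuclideanSpace ℝ (Fin n))) (a : EuclideanSpace ℝ (Fin n))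
    (u : ℕ → EuclideanSpace ℝ (Fin n) → F) : Prop :=
  JetConvAt p Ω a u ∧ JetConvAt p Ω a fun k => fderiv ℝ (u k)

theorem volume_ball_inter_ne_top (a : EuclideanSpace ℝ (Fin n)) (r : ℝ) :
    volume (ball a r ∩ Ω) ≠ ⊤ :=
  ne_top_of_le_ne_top measure_ball_lt_top.ne (measure_mono inter_subset_left)

/-- The derivative of a map with a differentiable left inverse is invertible. -/
theorem det_fderiv_ne_zero_of_leftInverse {τ σ : EuclideanSpace ℝ (Fin n) →
    EuclideanSpace ℝ (Fin n)}
    (hτ : DifferentiableAt ℝ τ a) (hσ : DifferentiableAt ℝ σ (τ a))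
    (hστ : ∀ᶠ x in 𝓝 a, σ (τ x) = x) : (fderiv ℝ τ a).det ≠ 0 := by
  have h1 : (fderiv ℝ σ (τ a)).comp (fderiv ℝ τ a) =
      ContinuousLinearMap.id ℝ (EuclideanSpace ℝ (Fin n)) := by
    rw [← fderiv_comp a hσ hτ, ← fderiv_id (x := a)]
    exact Filter.EventuallyEq.fderiv_eq hστ
  have h2 : (fderiv ℝ σ (τ a)).det * (fderiv ℝ τ a).det = 1 := by
    have := congrArg (fun L : EuclideanSpace ℝ (Fin n) →L[ℝ] EuclideanSpace ℝ (Fin n) => L.det) h1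
    simpa [ContinuousLinearMap.det, LinearMap.det_comp] using this
  exact right_ne_zero_of_mul_eq_one h2

namespace JetConvAt

theorem exists_le (h : JetConvAt p Ω a u) {R : ℝ} (hR : 0 < R) :
    ∃ r > 0, r ≤ R ∧ JetConv p (ball a r ∩ Ω) u := by
  obtain ⟨r, hr, h⟩ := h
  exact ⟨min r R, lt_min hr hR, min_le_right _ _,
    h.mono (inter_subset_inter_left _ (ball_subset_ball (min_le_left _ _)))⟩

theorem exists_subset (h : JetConvAt p Ω a u) {s : Set (EuclideanSpace ℝ (Fin n))} (hs : s ∈ 𝓝 a) :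
    ∃ r > 0, ball a r ⊆ s ∧ JetConv p (ball a r ∩ Ω) u := by
  obtain ⟨R, hR, hs⟩ := Metric.mem_nhds_iff.1 hs
  obtain ⟨r, hr, hrR, h⟩ := h.exists_le hR
  exact ⟨r, hr, (ball_subset_ball hrR).trans hs, h⟩

theorem exists_both (h : JetConvAt p Ω a u) {b : ℕ → EuclideanSpace ℝ (Fin n) → F₁}
    (h' : JetConvAt p Ω a b) : ∃ r > 0, JetConv p (ball a r ∩ Ω) u ∧
    JetConv p (ball a r ∩ Ω) b := by
  obtain ⟨R, hR, h'⟩ := h'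
  obtain ⟨r, hr, hrR, h⟩ := h.exists_le hR
  exact ⟨r, hr, h, h'.mono (inter_subset_inter_left _ (ball_subset_ball hrR))⟩

theorem congr (hΩ : MeasurableSet Ω) (h : JetConvAt p Ω a u)
    {s : Set (EuclideanSpace ℝ (Fin n))} (hs : s ∈ 𝓝 a)
    (hu : ∀ᶠ k in atTop, ∀ x ∈ s ∩ Ω, u k =ᶠ[𝓝 x] u' k) : JetConvAt p Ω a u' := by
  obtain ⟨r, hr, hrs, h⟩ := h.exists_subset hs
  exact ⟨r, hr, h.congr (isOpen_ball.measurableSet.inter hΩ) (hu.mono fun k hk x hx =>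
    hk x ⟨hrs hx.1, hx.2⟩)⟩

theorem exists_contDiffAt (h : JetConvAt p Ω a u) :
    ∃ s ∈ 𝓝 a, ∀ᶠ k in atTop, ∀ x ∈ s ∩ Ω, ContDiffAt ℝ ∞ (u k) x := by
  obtain ⟨r, hr, h⟩ := h
  exact ⟨ball a r, ball_mem_nhds a hr, h.smooth⟩

theorem of_smooth (hΩ : MeasurableSet Ω) {f : EuclideanSpace ℝ (Fin n) → F}
    (hf : ∀ᶠ x in 𝓝 a, ContDiffAt ℝ ∞ f x) : JetConvAt p Ω a fun _ => f := by
  have ha := hf.self_of_nhds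
  have h2 : ∀ᶠ x in 𝓝 a, ‖f x‖ < ‖f a‖ + 1 :=
    ha.continuousAt.norm.eventually (gt_mem_nhds (lt_add_one _))
  have h3 : ∀ᶠ x in 𝓝 a, ‖fderiv ℝ f x‖ < ‖fderiv ℝ f a‖ + 1 :=
    ha.fderiv_infty.continuousAt.norm.eventually (gt_mem_nhds (lt_add_one _))
  obtain ⟨r, hr, h⟩ := Metric.eventually_nhds_iff_ball.1 (hf.and (h2.and h3))
  refine ⟨r, hr, JetConv.of_smooth (C := max (‖f a‖ + 1) (‖fderiv ℝ f a‖ + 1))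
    (isOpen_ball.measurableSet.inter hΩ)
    (volume_ball_inter_ne_top a r) (fun x hx => (h x hx.1).1) ?_ ?_⟩
  · exact fun x hx => ((h x hx.1).2.1.le).trans (le_max_left _ _)
  · exact fun x hx => ((h x hx.1).2.2.le).trans (le_max_right _ _)

theorem add (hp1 : 1 ≤ p) (hΩ : MeasurableSet Ω) (h : JetConvAt p Ω a u) (h' : JetConvAt p Ω a u') :
    JetConvAt p Ω a (fun k x => u k x + u' k x) := by
  obtain ⟨r, hr, h1, h2⟩ := h.exists_both h'
  exact ⟨r, hr, h1.add hp1 (isOpen_ball.measurableSet.inter hΩ) h2⟩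

theorem bilin (hp1 : 1 ≤ p) (hp : p ≠ ⊤) (hΩ : MeasurableSet Ω) (L : F →L[ℝ] F₁ →L[ℝ] F₂)
    {b : ℕ → EuclideanSpace ℝ (Fin n) → F₁} (h : JetConvAt p Ω a u) (h' : JetConvAt p Ω a b) :
    JetConvAt p Ω a (fun k x => L (u k x) (b k x)) := by
  obtain ⟨r, hr, h1, h2⟩ := h.exists_both h'
  exact ⟨r, hr, h1.bilin hp1 hp (isOpen_ball.measurableSet.inter hΩ) L h2⟩

theorem comp (hp1 : 1 ≤ p) (hp : p ≠ ⊤) (hΩ : MeasurableSet Ω)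
    {τ σ : EuclideanSpace ℝ (Fin n) → EuclideanSpace ℝ (Fin n)}
    (hτ : ∀ᶠ x in 𝓝 a, ContDiffAt ℝ ∞ τ x) (hσ : DifferentiableAt ℝ σ (τ a))
    (hστ : ∀ᶠ x in 𝓝 a, σ (τ x) = x) (hmaps : ∀ᶠ x in 𝓝 a, x ∈ Ω → τ x ∈ Ω')
    (h : JetConvAt p Ω' (τ a) u) : JetConvAt p Ω a (fun k x => u k (τ x)) := by
  obtain ⟨r', hr', h⟩ := h
  have ha := hτ.self_of_nhds
  have hdet := det_fderiv_ne_zero_of_leftInverse (ha.differentiableAt (by simp)) hσ hστ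
  set c := |(fderiv ℝ τ a).det| / 2 with hc
  have hc0 : 0 < c := half_pos (abs_pos.2 hdet)
  have h1 : ∀ᶠ x in 𝓝 a, c < |(fderiv ℝ τ x).det| := by
    have : ContinuousAt (fun x => |(fderiv ℝ τ x).det|) a :=
      (ContinuousLinearMap.continuous_det.continuousAt.comp ha.fderiv_infty.continuousAt).abs
    exact this.eventually (lt_mem_nhds (half_lt_self (abs_pos.2 hdet)))
  have h2 : ∀ᶠ x in 𝓝 a, ‖fderiv ℝ τ x‖ < ‖fderiv ℝ τ a‖ + 1 :=
    ha.fderiv_infty.continuousAt.norm.eventually (gt_mem_nhds (lt_add_one _))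
  have h3 : ∀ᶠ x in 𝓝 a, τ x ∈ ball (τ a) r' :=
    ha.continuousAt.eventually (ball_mem_nhds _ hr')
  obtain ⟨r, hr, hr2⟩ := Metric.eventually_nhds_iff_ball.1
    (hτ.and (hστ.and (hmaps.and (h1.and (h2.and h3)))))
  refine ⟨r, hr, h.comp hp1 hp (isOpen_ball.measurableSet.inter hΩ) (volume_ball_inter_ne_top a r)
    (fun x hx => (hr2 x hx.1).1) ?_ hc0
    (fun x hx => (hr2 x hx.1).2.2.2.1.le) (fun x hx => (hr2 x hx.1).2.2.2.2.1.le)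
    (B := ball (τ a) r' ∩ Ω') (fun x hx => ⟨(hr2 x hx.1).2.2.2.2.2, (hr2 x hx.1).2.2.1 hx.2⟩)⟩
  intro x hx y hy hxy
  rw [← (hr2 x hx.1).2.1, hxy, (hr2 y hy.1).2.1]

theorem postcomp [ProperSpace F] (hp1 : 1 ≤ p) (hp : p ≠ ⊤) (hΩ : MeasurableSet Ω)
    {P : F → F₁} (hP : ContDiff ℝ ∞ P) (h : JetConvAt p Ω a u) {s : Set (EuclideanSpace ℝ (Fin n))}
    (hs : s ∈ 𝓝 a) {u₀ : EuclideanSpace ℝ (Fin n) → F}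
    (hu₀ : ∀ ε > 0, ∀ᶠ k in atTop, ∀ x ∈ s ∩ Ω, ‖u k x - u₀ x‖ ≤ ε) :
    JetConvAt p Ω a (fun k x => P (u k x)) := by
  obtain ⟨r, hr, hrs, h⟩ := h.exists_subset hs
  exact ⟨r, hr, h.postcomp hp1 hp (isOpen_ball.measurableSet.inter hΩ)
    (volume_ball_inter_ne_top a r) hP fun ε hε => (hu₀ ε hε).mono fun k hk x hx =>
      hk x ⟨hrs hx.1, hx.2⟩⟩

end JetConvAt

namespace JetTwoConvAt

theorem congr (hΩ : MeasurableSet Ω) (h : JetTwoConvAt p Ω a u)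
    {s : Set (EuclideanSpace ℝ (Fin n))} (hs : s ∈ 𝓝 a)
    (hu : ∀ᶠ k in atTop, ∀ x ∈ s ∩ Ω, u k =ᶠ[𝓝 x] u' k) : JetTwoConvAt p Ω a u' :=
  ⟨h.1.congr hΩ hs hu, h.2.congr hΩ hs (hu.mono fun _ hk x hx => (hk x hx).fderiv)⟩

theorem of_smooth (hΩ : MeasurableSet Ω) {f : EuclideanSpace ℝ (Fin n) → F}
    (hf : ∀ᶠ x in 𝓝 a, ContDiffAt ℝ ∞ f x) : JetTwoConvAt p Ω a fun _ => f :=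
  ⟨JetConvAt.of_smooth hΩ hf, JetConvAt.of_smooth hΩ (hf.mono fun _ h => h.fderiv_infty)⟩

theorem add (hp1 : 1 ≤ p) (hΩ : MeasurableSet Ω) (h : JetTwoConvAt p Ω a u)
    (h' : JetTwoConvAt p Ω a u') : JetTwoConvAt p Ω a (fun k x => u k x + u' k x) := by
  refine ⟨h.1.add hp1 hΩ h'.1, ?_⟩
  obtain ⟨s, hs, h1⟩ := h.1.exists_contDiffAt
  obtain ⟨s', hs', h1'⟩ := h'.1.exists_contDiffAt
  refine (h.2.add hp1 hΩ h'.2).congr hΩ (inter_mem hs hs') ?_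
  filter_upwards [h1, h1'] with k h1 h1' x hx
  filter_upwards [(h1 x ⟨hx.1.1, hx.2⟩).eventually_differentiableAt,
    (h1' x ⟨hx.1.2, hx.2⟩).eventually_differentiableAt] with y hy hy'
  exact (fderiv_fun_add hy hy').symm

theorem bilin (hp1 : 1 ≤ p) (hp : p ≠ ⊤) (hΩ : MeasurableSet Ω) (L : F →L[ℝ] F₁ →L[ℝ] F₂)
    {b : ℕ → EuclideanSpace ℝ (Fin n) → F₁} (h : JetTwoConvAt p Ω a u)
    (h' : JetTwoConvAt p Ω a b) : JetTwoConvAt p Ω a (fun k x => L (u k x) (b k x)) := by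
  refine ⟨h.1.bilin hp1 hp hΩ L h'.1, ?_⟩
  obtain ⟨s, hs, h1⟩ := h.1.exists_contDiffAt
  obtain ⟨s', hs', h1'⟩ := h'.1.exists_contDiffAt
  have e1 := h.1.bilin hp1 hp hΩ (L.precompR (EuclideanSpace ℝ (Fin n))) h'.2
  have e2 := h'.1.bilin hp1 hp hΩ (L.precompL (EuclideanSpace ℝ (Fin n))).flip h.2
  refine (e1.add hp1 hΩ e2).congr hΩ (inter_mem hs hs') ?_
  filter_upwards [h1, h1'] with k h1 h1' x hx
  filter_upwards [(h1 x ⟨hx.1.1, hx.2⟩).eventually_differentiableAt,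
    (h1' x ⟨hx.1.2, hx.2⟩).eventually_differentiableAt] with y hy hy'
  exact (L.hasFDerivAt_of_bilinear hy.hasFDerivAt hy'.hasFDerivAt).fderiv.symm

theorem sum {ι : Type*} (s : Finset ι) (hp1 : 1 ≤ p) (hΩ : MeasurableSet Ω)
    {u : ι → ℕ → EuclideanSpace ℝ (Fin n) → F} (h : ∀ i ∈ s, JetTwoConvAt p Ω a (u i)) :
    JetTwoConvAt p Ω a (fun k x => ∑ i ∈ s, u i k x) := by
  classical
  induction s using Finset.induction_on with
  | empty =>
    simp only [Finset.sum_empty]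
    exact of_smooth hΩ (Eventually.of_forall fun _ => contDiffAt_const)
  | insert i s hi ih =>
    simp only [Finset.sum_insert hi]
    exact (h i (Finset.mem_insert_self i s)).add hp1 hΩ
      (ih fun j hj => h j (Finset.mem_insert_of_mem hj))

theorem comp (hp1 : 1 ≤ p) (hp : p ≠ ⊤) (hΩ : MeasurableSet Ω)
    {τ σ : EuclideanSpace ℝ (Fin n) → EuclideanSpace ℝ (Fin n)}
    (hτ : ∀ᶠ x in 𝓝 a, ContDiffAt ℝ ∞ τ x) (hσ : DifferentiableAt ℝ σ (τ a))
    (hστ : ∀ᶠ x in 𝓝 a, σ (τ x) = x) (hmaps : ∀ᶠ x in 𝓝 a, x ∈ Ω → τ x ∈ Ω')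
    (h : JetTwoConvAt p Ω' (τ a) u) : JetTwoConvAt p Ω a (fun k x => u k (τ x)) := by
  refine ⟨h.1.comp hp1 hp hΩ hτ hσ hστ hmaps, ?_⟩
  have e := (h.2.comp hp1 hp hΩ hτ hσ hστ hmaps).bilin hp1 hp hΩ
    (ContinuousLinearMap.compL ℝ (EuclideanSpace ℝ (Fin n)) (EuclideanSpace ℝ (Fin n)) F)
    (JetConvAt.of_smooth hΩ (hτ.mono fun _ h => h.fderiv_infty))
  obtain ⟨s, hs, h1⟩ := h.1.exists_contDiffAt
  have hs' : {x | τ x ∈ s ∧ (x ∈ Ω → τ x ∈ Ω') ∧ ContDiffAt ℝ ∞ τ x} ∈ 𝓝 a :=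
    (hτ.self_of_nhds.continuousAt.eventually hs).and (hmaps.and hτ)
  refine e.congr hΩ hs' ?_
  filter_upwards [h1] with k h1 x hx
  have h2 := h1 (τ x) ⟨hx.1.1, hx.1.2.1 hx.2⟩
  filter_upwards [hx.1.2.2.continuousAt.eventually h2.eventually_differentiableAt,
    hx.1.2.2.eventually_differentiableAt] with y hy hy'
  exact (fderiv_comp y hy hy').symm

theorem postcomp [ProperSpace F] (hp1 : 1 ≤ p) (hp : p ≠ ⊤) (hΩ : MeasurableSet Ω)
    {P : F → F₁} (hP : ContDiff ℝ ∞ P) (h : JetTwoConvAt p Ω a u)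
    {s : Set (EuclideanSpace ℝ (Fin n))} (hs : s ∈ 𝓝 a) {u₀ : EuclideanSpace ℝ (Fin n) → F}
    (hu₀ : ∀ ε > 0, ∀ᶠ k in atTop, ∀ x ∈ s ∩ Ω, ‖u k x - u₀ x‖ ≤ ε) :
    JetTwoConvAt p Ω a (fun k x => P (u k x)) := by
  refine ⟨h.1.postcomp hp1 hp hΩ hP hs hu₀, ?_⟩
  have e := (h.1.postcomp hp1 hp hΩ (P := fderiv ℝ P) (hP.fderiv_right (by simp)) hs hu₀).bilin
    hp1 hp hΩ (ContinuousLinearMap.compL ℝ (EuclideanSpace ℝ (Fin n)) F F₁) h.2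
  obtain ⟨s, hs, h1⟩ := h.1.exists_contDiffAt
  refine e.congr hΩ hs ?_
  filter_upwards [h1] with k h1 x hx
  filter_upwards [(h1 x hx).eventually_differentiableAt] with y hy
  exact (fderiv_comp y (hP.differentiable (by simp) _) hy).symm

end JetTwoConvAt

namespace JetConv

/-- Composition with maps `τ k` which converge to the identity in `C^1`. The functions `v k` need to
be close to the fixed limits `u`, `G` only on sets `Bk k` which contain the image of `τ k`. -/
theorem comp_near_id (hp1 : 1 ≤ p) (hp : p ≠ ⊤) {A B : Set (EuclideanSpace ℝ (Fin n))}
    (hA : MeasurableSet A) (hB : MeasurableSet B) (hAfin : volume A ≠ ⊤) (hAB : A ⊆ B)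
    {τ : ℕ → EuclideanSpace ℝ (Fin n) → EuclideanSpace ℝ (Fin n)}
    {Bk : ℕ → Set (EuclideanSpace ℝ (Fin n))} (hBkm : ∀ᶠ k in atTop, MeasurableSet (Bk k))
    (hBk : ∀ᶠ k in atTop, Bk k ⊆ B)
    (hτ : ∀ᶠ k in atTop, ∀ x ∈ A, ContDiffAt ℝ ∞ (τ k) x)
    (hinj : ∀ᶠ k in atTop, InjOn (τ k) A) (hmaps : ∀ᶠ k in atTop, MapsTo (τ k) A (Bk k))
    {c : ℝ} (hc : 0 < c) (hdet : ∀ᶠ k in atTop, ∀ x ∈ A, c ≤ |(fderiv ℝ (τ k) x).det|)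
    (hid : ∀ ε > 0, ∀ᶠ k in atTop, ∀ x ∈ A, ‖τ k x - x‖ ≤ ε)
    {D : ℝ} (hD : ∀ᶠ k in atTop, ∀ x ∈ A, ‖fderiv ℝ (τ k) x‖ ≤ D)
    {τ' : EuclideanSpace ℝ (Fin n) → EuclideanSpace ℝ (Fin n) →L[ℝ] EuclideanSpace ℝ (Fin n)}
    (hτ' : LpTendsto p (volume.restrict A) (fun k => fderiv ℝ (τ k)) τ')
    {v : ℕ → EuclideanSpace ℝ (Fin n) → F}
    (hv : ∀ᶠ k in atTop, ∀ x ∈ Bk k, ContDiffAt ℝ ∞ (v k) x)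
    {C : ℝ} (hC : ∀ᶠ k in atTop, ∀ x ∈ Bk k, ‖v k x‖ ≤ C)
    {u : EuclideanSpace ℝ (Fin n) → F} (hu : MemLp u p (volume.restrict B))
    (hvu : Tendsto (fun k => eLpNorm (fun x => v k x - u x) p (volume.restrict (Bk k)))
      atTop (𝓝 0))
    {G : EuclideanSpace ℝ (Fin n) → EuclideanSpace ℝ (Fin n) →L[ℝ] F}
    (hG : MemLp G p (volume.restrict B))
    (hvG : Tendsto (fun k => eLpNorm (fun x => fderiv ℝ (v k) x - G x) p (volume.restrict (Bk k)))
      atTop (𝓝 0)) :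
    JetConv p A (fun k x => v k (τ k x)) ∧
      LpTendsto p (volume.restrict A) (fun k x => v k (τ k x)) u ∧
      LpTendsto p (volume.restrict A) (fun k => fderiv ℝ (fun x => v k (τ k x)))
        (fun x => (G x).comp (τ' x)) := by
  have hp0 : p ≠ 0 := (zero_lt_one.trans_le hp1).ne'
  have hK : (ENNReal.ofReal c)⁻¹ ≠ ⊤ := ENNReal.inv_ne_top.2 (by simpa using hc)
  have hmap : ∀ᶠ k in atTop, AEMeasurable (τ k) (volume.restrict A) ∧
      (volume.restrict A).map (τ k) ≤ (ENNReal.ofReal c)⁻¹ • volume.restrict (Bk k) := by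
    filter_upwards [hτ, hinj, hmaps, hdet] with k h1 h2 h3 h4
    exact map_restrict_le_of_le_abs_det hA (fun x hx =>
      ((h1 x hx).differentiableAt (by simp)).hasFDerivAt.hasFDerivWithinAt) h2 hc h4 h3
  have e1 : LpTendsto p (volume.restrict A) (fun k x => v k (τ k x)) u := by
    refine lpTendsto_comp_near_id hp1 hp hA hB hAfin hAB hBk hK hmap hid hu ?_ hvu
    filter_upwards [hBkm, hv] with k h1 h2 using aestronglyMeasurable_of_contDiffAt h1 h2
  have e2 : LpTendsto p (volume.restrict A) (fun k x => fderiv ℝ (v k) (τ k x)) G := by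
    refine lpTendsto_comp_near_id hp1 hp hA hB hAfin hAB hBk hK hmap hid hG ?_ hvG
    filter_upwards [hBkm, hv] with k h1 h2 using
      aestronglyMeasurable_of_contDiffAt h1 fun x hx => (h2 x hx).fderiv_infty
  have e3 : LpTendsto p (volume.restrict A) (fun k => fderiv ℝ (fun x => v k (τ k x)))
      (fun x => (G x).comp (τ' x)) := by
    refine (hτ'.bilin hp1 hp (ContinuousLinearMap.compL ℝ (EuclideanSpace ℝ (Fin n))
      (EuclideanSpace ℝ (Fin n)) F).flip hp0 e2 (C := D) ?_).congr ?_ ae_eq_rfl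
    · filter_upwards [hD] with k h1
      filter_upwards [ae_restrict_mem hA] with x hx using h1 x hx
    · filter_upwards [hv, hτ, hmaps] with k h1 h2 h3
      filter_upwards [ae_restrict_mem hA] with x hx
      exact (fderiv_comp x ((h1 _ (h3 hx)).differentiableAt (by simp))
        ((h2 x hx).differentiableAt (by simp))).symm
  refine ⟨⟨?_, ⟨C, ?_⟩, ⟨u, e1⟩, ⟨_, e3⟩⟩, e1, e3⟩
  · filter_upwards [hv, hτ, hmaps] with k h1 h2 h3 x hx using (h1 _ (h3 hx)).comp x (h2 x hx)
  · filter_upwards [hC, hmaps] with k h1 h3 x hx using h1 _ (h3 hx)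

end JetConv

end JetConvAt

/-! ### Derivatives which are close in the mean on small balls -/

section MeanDerivConv

variable {n : ℕ} {F F₁ : Type*} [NormedAddCommGroup F] [NormedSpace ℝ F]
  [NormedAddCommGroup F₁] [NormedSpace ℝ F₁]
  {a : EuclideanSpace ℝ (Fin n)} {w w' : ℕ → EuclideanSpace ℝ (Fin n) → F}
  {G G' : EuclideanSpace ℝ (Fin n) → EuclideanSpace ℝ (Fin n) →L[ℝ] F}

/-- The derivative of `w k` at `x` is close to `G` in the mean over the ball around `x` whose radius
is a small multiple of the mollification radius, as `k → ∞` and `x → a`. -/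
def MeanDerivConvAt (a : EuclideanSpace ℝ (Fin n)) (w : ℕ → EuclideanSpace ℝ (Fin n) → F)
    (G : EuclideanSpace ℝ (Fin n) → EuclideanSpace ℝ (Fin n) →L[ℝ] F) : Prop :=
  ∃ c₀ : ℝ, 0 < c₀ ∧ ∀ c : ℝ, 0 < c → c ≤ c₀ →
    Tendsto (fun q : ℕ × EuclideanSpace ℝ (Fin n) =>
      ⨍⁻ y in ball q.2 (c * mollRadius q.1), ‖G y - fderiv ℝ (w q.1) q.2‖ₑ ∂volume)
      (atTop ×ˢ 𝓝 a) (𝓝 0)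

theorem laverage_ball_le_add_mul {x : EuclideanSpace ℝ (Fin n)} {r : ℝ} (hr : 0 < r)
    {f g : EuclideanSpace ℝ (Fin n) → ℝ≥0∞} {b d : ℝ≥0∞} (hd : d ≠ ⊤)
    (h : ∀ᵐ y ∂(volume.restrict (ball x r)), f y ≤ b + d * g y) :
    ⨍⁻ y in ball x r, f y ∂volume ≤ b + d * ⨍⁻ y in ball x r, g y ∂volume := by
  have h0 : volume (ball x r) ≠ 0 := (measure_ball_pos _ _ hr).ne'
  have h1 : volume (ball x r) ≠ ⊤ := measure_ball_lt_top.ne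
  calc ⨍⁻ y in ball x r, f y ∂volume ≤ ⨍⁻ y in ball x r, (b + d * g y) ∂volume := by
        rw [setLAverage_eq, setLAverage_eq]
        exact ENNReal.div_le_div_right (lintegral_mono_ae h) _
    _ = b + d * ⨍⁻ y in ball x r, g y ∂volume := by
        rw [setLAverage_eq, setLAverage_eq, lintegral_add_left measurable_const,
          lintegral_const_mul' _ _ hd, lintegral_const, Measure.restrict_apply_univ,
          ENNReal.add_div, ENNReal.mul_div_cancel_right h0 h1, mul_div_assoc]

theorem laverage_ball_le_add_sum {x : EuclideanSpace ℝ (Fin n)} {r : ℝ} (hr : 0 < r)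
    {ι : Type*} (s : Finset ι) {f : EuclideanSpace ℝ (Fin n) → ℝ≥0∞}
    {g : ι → EuclideanSpace ℝ (Fin n) → ℝ≥0∞} {b : ℝ≥0∞} {d : ι → ℝ≥0∞} (hd : ∀ i ∈ s, d i ≠ ⊤)
    (hg : ∀ i ∈ s, AEMeasurable (g i) (volume.restrict (ball x r)))
    (h : ∀ y, f y ≤ b + ∑ i ∈ s, d i * g i y) :
    ⨍⁻ y in ball x r, f y ∂volume ≤ b + ∑ i ∈ s, d i * ⨍⁻ y in ball x r, g i y ∂volume := by
  refine (laverage_ball_le_add_mul hr ENNReal.one_ne_top (g := fun y => ∑ i ∈ s, d i * g i y)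
    (Eventually.of_forall fun y => by simpa using h y)).trans ?_
  rw [one_mul, setLAverage_eq, lintegral_finsetSum' _ fun i hi => (hg i hi).const_mul _]
  simp only [setLAverage_eq, div_eq_mul_inv, Finset.sum_mul]
  refine add_le_add_right (Finset.sum_le_sum fun i hi => ?_) _
  rw [lintegral_const_mul' _ _ (hd i hi), mul_assoc]

theorem enorm_add_le_add_of_le {V : Type*} [NormedAddCommGroup V] {x y : V} {b d : ℝ≥0∞}
    (hx : ‖x‖ₑ ≤ b) (hy : ‖y‖ₑ ≤ d) : ‖x + y‖ₑ ≤ b + d :=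
  (enorm_add_le x y).trans (add_le_add hx hy)

theorem exists_pos_ofReal_mul_le (M : ℝ) {η : ℝ≥0∞} (hη : 0 < η) :
    ∃ ε : ℝ, 0 < ε ∧ ENNReal.ofReal (M * ε) ≤ η := by
  have h1 : Tendsto (fun ε : ℝ => ENNReal.ofReal (M * ε)) (𝓝[>] 0) (𝓝 0) := by
    have := (ENNReal.continuous_ofReal.comp (continuous_const_mul M)).tendsto 0
    simp only [Function.comp_apply, mul_zero, ENNReal.ofReal_zero] at this
    exact this.mono_left nhdsWithin_le_nhds
  obtain ⟨ε, h3, h4⟩ := ((ENNReal.tendsto_nhds_zero.1 h1 η hη).and self_mem_nhdsWithin).exists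
  exact ⟨ε, h4, h3⟩

theorem enorm_neg_add_sum_smul_le {ι V : Type*} [NormedAddCommGroup V] [NormedSpace ℝ V]
    (s : Finset ι) (x : V) (c : ι → ℝ) (f : ι → V) :
    ‖-x + ∑ i ∈ s, c i • f i‖ₑ ≤ ‖x‖ₑ + ∑ i ∈ s, ‖c i‖ₑ * ‖f i‖ₑ := by
  refine (enorm_add_le _ _).trans (add_le_add (enorm_neg x).le ((enorm_sum_le _ _).trans
    (Finset.sum_le_sum fun i _ => (enorm_smul _ _).le)))

theorem tendsto_mul_mollRadius_prod (c : ℝ) (a : EuclideanSpace ℝ (Fin n)) :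
    Tendsto (fun q : ℕ × EuclideanSpace ℝ (Fin n) => c * mollRadius q.1) (atTop ×ˢ 𝓝 a) (𝓝 0) := by
  have := (tendsto_mollRadius.const_mul c).comp (tendsto_fst (f := atTop) (g := 𝓝 a))
  rwa [mul_zero] at this

/-- The balls in `MeanDerivConvAt` shrink to `a`. -/
theorem eventually_ball_mollRadius_subset {s : Set (EuclideanSpace ℝ (Fin n))} (hs : s ∈ 𝓝 a)
    (c : ℝ) : ∀ᶠ q : ℕ × EuclideanSpace ℝ (Fin n) in atTop ×ˢ 𝓝 a,
      ball q.2 (c * mollRadius q.1) ⊆ s := by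
  obtain ⟨r, hr, hrs⟩ := Metric.mem_nhds_iff.1 hs
  have h1 := (tendsto_mul_mollRadius_prod c a).eventually (gt_mem_nhds (half_pos hr))
  have h2 : ∀ᶠ q : ℕ × EuclideanSpace ℝ (Fin n) in atTop ×ˢ 𝓝 a, q.2 ∈ ball a (r / 2) :=
    tendsto_snd.eventually (ball_mem_nhds a (half_pos hr))
  filter_upwards [h1, h2] with q h1 h2 y hy
  refine hrs ?_
  rw [mem_ball] at *
  linarith [dist_triangle y q.2 a]

namespace MeanDerivConvAt

theorem congr (h : MeanDerivConvAt a w G)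
    (hw : ∀ᶠ q : ℕ × EuclideanSpace ℝ (Fin n) in atTop ×ˢ 𝓝 a, w q.1 =ᶠ[𝓝 q.2] w' q.1)
    (hG : ∀ᶠ x in 𝓝 a, G x = G' x) : MeanDerivConvAt a w' G' := by
  obtain ⟨c₀, hc₀, h⟩ := h
  refine ⟨c₀, hc₀, fun c hc hcc => (h c hc hcc).congr' ?_⟩
  filter_upwards [hw, eventually_ball_mollRadius_subset hG c] with q h1 h2
  rw [h1.fderiv_eq, setLAverage_eq, setLAverage_eq]
  congr 1
  refine setLIntegral_congr_fun measurableSet_ball fun y hy => ?_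
  have : G y = G' y := h2 hy
  simp only [this]

/-- The form in which vanishing mean oscillation enters. -/
theorem of_forall_le {Q : Set (EuclideanSpace ℝ (Fin n))} (hQ : Q ∈ 𝓝 a)
    (h : ∀ η : ℝ≥0∞, 0 < η → ∀ᶠ k in atTop, ∀ x ∈ Q,
      ⨍⁻ y in ball x (mollRadius k), ‖G y - fderiv ℝ (w k) x‖ₑ ∂volume ≤ η) :
    MeanDerivConvAt a w G := by
  refine ⟨1, one_pos, fun c hc hc1 => ?_⟩
  set K : ℝ≥0∞ := (ENNReal.ofReal (c ^ n))⁻¹ with hKdef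
  have hK : K ≠ ⊤ := ENNReal.inv_ne_top.2 (by simpa using pow_pos hc n)
  have h0 : Tendsto (fun q : ℕ × EuclideanSpace ℝ (Fin n) =>
      ⨍⁻ y in ball q.2 (mollRadius q.1), ‖G y - fderiv ℝ (w q.1) q.2‖ₑ ∂volume)
      (atTop ×ˢ 𝓝 a) (𝓝 0) := by
    refine ENNReal.tendsto_nhds_zero.2 fun η hη => ?_
    filter_upwards [tendsto_fst.eventually (h η hη), tendsto_snd.eventually hQ] with q h1 h2
    exact h1 _ h2
  have h1 := ENNReal.Tendsto.const_mul h0 (Or.inr hK)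
  rw [mul_zero] at h1
  refine tendsto_of_tendsto_of_tendsto_of_le_of_le tendsto_const_nhds h1 (fun _ => zero_le)
    fun q => ?_
  have hr := mollRadius_pos q.1
  have hsub : ball q.2 (c * mollRadius q.1) ⊆ ball q.2 (mollRadius q.1) :=
    ball_subset_ball (mul_le_of_le_one_left hr.le hc1)
  have hvol : volume (ball q.2 (c * mollRadius q.1)) =
      ENNReal.ofReal (c ^ n) * volume (ball q.2 (mollRadius q.1)) := by
    have := Measure.addHaar_ball_mul_of_pos (volume : Measure (EuclideanSpace ℝ (Fin n))) q.2 hc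
      (mollRadius q.1)
    rw [this, finrank_euclideanSpace_fin, ← Measure.addHaar_ball_center volume q.2]
  change ⨍⁻ y in ball q.2 (c * mollRadius q.1), _ ∂volume ≤ K * _
  rw [setLAverage_eq, setLAverage_eq, hvol, div_eq_mul_inv, div_eq_mul_inv,
    ENNReal.mul_inv (Or.inl (by simpa using pow_pos hc n)) (Or.inl ENNReal.ofReal_ne_top),
    mul_left_comm]
  gcongr

/-- In `D (∑ χᵢ wᵢ) = ∑ χᵢ D wᵢ + ∑ wᵢ Dχᵢ` the last sum tends to zero, since all `wᵢ` have the same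
limit `f₀` and `∑ Dχᵢ = 0`. -/
theorem sum {ι : Type*} (s : Finset ι) {χ : ι → EuclideanSpace ℝ (Fin n) → ℝ}
    {w : ι → ℕ → EuclideanSpace ℝ (Fin n) → F} {f₀ : F}
    (hχ : ∀ i ∈ s, ∀ᶠ x in 𝓝 a, ContDiffAt ℝ ∞ (χ i) x) (hsum : ∀ᶠ x in 𝓝 a, ∑ i ∈ s, χ i x = 1)
    (hw : ∀ i ∈ s, ∀ᶠ q : ℕ × EuclideanSpace ℝ (Fin n) in atTop ×ˢ 𝓝 a,
      DifferentiableAt ℝ (w i q.1) q.2)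
    (hlim : ∀ i ∈ s, Tendsto (fun q : ℕ × EuclideanSpace ℝ (Fin n) => w i q.1 q.2)
      (atTop ×ˢ 𝓝 a) (𝓝 f₀))
    {T : Set (EuclideanSpace ℝ (Fin n))} (hT : T ∈ 𝓝 a)
    (hG : AEStronglyMeasurable G (volume.restrict T))
    (h : ∀ i ∈ s, MeanDerivConvAt a (w i) G) :
    MeanDerivConvAt a (fun k x => ∑ i ∈ s, χ i x • w i k x) G := by
  classical
  choose! c₀ hc₀ h using h
  obtain ⟨c', hc', hcc⟩ : ∃ c' > 0, ∀ i ∈ s, c' ≤ c₀ i := by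
    clear h hlim hw hsum hχ
    induction s using Finset.induction_on with
    | empty => exact ⟨1, one_pos, by simp⟩
    | insert i s hi ih =>
      obtain ⟨c', hc', hcc⟩ := ih fun j hj => hc₀ j (Finset.mem_insert_of_mem hj)
      refine ⟨min c' (c₀ i), lt_min hc' (hc₀ i (Finset.mem_insert_self i s)), fun j hj => ?_⟩
      rcases Finset.mem_insert.1 hj with rfl | hj
      · exact min_le_right _ _
      · exact (min_le_left _ _).trans (hcc j hj)
  refine ⟨c', hc', fun c hc hcc' => ?_⟩
  -- the derivatives of the weights multiply functions with a common limit, and their sum vanishes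
  set R : ℕ × EuclideanSpace ℝ (Fin n) → EuclideanSpace ℝ (Fin n) →L[ℝ] F := fun q =>
    ∑ i ∈ s, (fderiv ℝ (χ i) q.2).smulRight (w i q.1 q.2) with hR
  have hR0 : Tendsto R (atTop ×ˢ 𝓝 a) (𝓝 0) := by
    have h1 : Tendsto R (atTop ×ˢ 𝓝 a) (𝓝 (∑ i ∈ s, (fderiv ℝ (χ i) a).smulRight f₀)) := by
      refine tendsto_finsetSum _ fun i hi => ?_
      have h2 : Tendsto (fun q : ℕ × EuclideanSpace ℝ (Fin n) => fderiv ℝ (χ i) q.2)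
          (atTop ×ˢ 𝓝 a) (𝓝 (fderiv ℝ (χ i) a)) :=
        (hχ i hi).self_of_nhds.fderiv_infty.continuousAt.tendsto.comp tendsto_snd
      exact ((ContinuousLinearMap.smulRightL ℝ (EuclideanSpace ℝ (Fin n)) F).continuous₂.tendsto
        (fderiv ℝ (χ i) a, f₀)).comp (h2.prodMk_nhds (hlim i hi))
    have h3 : ∑ i ∈ s, fderiv ℝ (χ i) a = 0 := by
      rw [← fderiv_fun_sum fun i hi => (hχ i hi).self_of_nhds.differentiableAt (by simp)]
      rw [Filter.EventuallyEq.fderiv_eq (f₁ := fun x => ∑ i ∈ s, χ i x) (f := fun _ => (1 : ℝ))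
        hsum]
      simp
    have h4 : ∑ i ∈ s, (fderiv ℝ (χ i) a).smulRight f₀ = 0 := by
      ext v
      have := congrArg (fun L : EuclideanSpace ℝ (Fin n) →L[ℝ] ℝ => L v • f₀) h3
      simpa [Finset.sum_smul] using this
    rwa [h4] at h1
  have hlim0 : Tendsto (fun q : ℕ × EuclideanSpace ℝ (Fin n) => ‖R q‖ₑ +
      ∑ i ∈ s, ENNReal.ofReal (|χ i a| + 1) * ⨍⁻ y in ball q.2 (c * mollRadius q.1),
        ‖G y - fderiv ℝ (w i q.1) q.2‖ₑ ∂volume) (atTop ×ˢ 𝓝 a) (𝓝 0) := by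
    have h1 : Tendsto (fun q => ‖R q‖ₑ) (atTop ×ˢ 𝓝 a) (𝓝 0) := by
      have := ENNReal.tendsto_ofReal hR0.norm
      simpa only [ofReal_norm, norm_zero, ENNReal.ofReal_zero] using this
    have h2 := h1.add (tendsto_finsetSum s fun i hi => ENNReal.Tendsto.const_mul
      (a := ENNReal.ofReal (|χ i a| + 1))
      (h i hi c hc (hcc'.trans (hcc i hi))) (Or.inr ENNReal.ofReal_ne_top))
    simpa using h2
  refine tendsto_of_tendsto_of_tendsto_of_le_of_le' tendsto_const_nhds hlim0
    (Eventually.of_forall fun _ => zero_le) ?_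
  have e1 : ∀ᶠ q : ℕ × EuclideanSpace ℝ (Fin n) in atTop ×ˢ 𝓝 a, ∀ i ∈ s,
      DifferentiableAt ℝ (w i q.1) q.2 := (Finset.eventually_all s).2 hw
  have e2 : ∀ᶠ x in 𝓝 a, ∀ i ∈ s, ContDiffAt ℝ ∞ (χ i) x ∧ |χ i x| ≤ |χ i a| + 1 := by
    refine (Finset.eventually_all s).2 fun i hi => (hχ i hi).and ?_
    exact ((hχ i hi).self_of_nhds.continuousAt.abs.eventually (gt_mem_nhds (lt_add_one _))).mono
      fun _ h => h.le
  filter_upwards [e1, tendsto_snd.eventually e2, tendsto_snd.eventually hsum,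
    eventually_ball_mollRadius_subset hT c] with q h1 h2 h3 h4
  have hr : 0 < c * mollRadius q.1 := mul_pos hc (mollRadius_pos _)
  refine laverage_ball_le_add_sum hr s (fun _ _ => ENNReal.ofReal_ne_top) (fun i hi => ?_)
    fun y => ?_
  · exact ((hG.mono_measure (Measure.restrict_mono h4 le_rfl)).sub
      aestronglyMeasurable_const).enorm
  · have hD : fderiv ℝ (fun x => ∑ i ∈ s, χ i x • w i q.1 x) q.2 =
        ∑ i ∈ s, χ i q.2 • fderiv ℝ (w i q.1) q.2 + R q := by
      rw [fderiv_fun_sum fun i hi => ((h2 i hi).1.differentiableAt (by simp)).fun_smul (h1 i hi),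
        hR,
        ← Finset.sum_add_distrib]
      exact Finset.sum_congr rfl fun i hi =>
        fderiv_fun_smul ((h2 i hi).1.differentiableAt (by simp)) (h1 i hi)
    have hE : G y - fderiv ℝ (fun x => ∑ i ∈ s, χ i x • w i q.1 x) q.2 =
        -R q + ∑ i ∈ s, χ i q.2 • (G y - fderiv ℝ (w i q.1) q.2) := by
      simp only [hD, smul_sub, Finset.sum_sub_distrib, ← Finset.sum_smul, h3, one_smul]
      abel
    rw [hE]
    refine (enorm_neg_add_sum_smul_le _ _ _ _).trans
      (add_le_add_right (Finset.sum_le_sum fun i hi => ?_) _)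
    gcongr
    rw [Real.enorm_eq_ofReal_abs]
    exact ENNReal.ofReal_le_ofReal (h2 i hi).2

end MeanDerivConvAt

end MeanDerivConv

section MeanDerivConv

variable {n : ℕ} {F F₁ : Type*} [NormedAddCommGroup F] [NormedSpace ℝ F]
  [NormedAddCommGroup F₁] [NormedSpace ℝ F₁]
  {a : EuclideanSpace ℝ (Fin n)} {w w' : ℕ → EuclideanSpace ℝ (Fin n) → F}
  {G G' : EuclideanSpace ℝ (Fin n) → EuclideanSpace ℝ (Fin n) →L[ℝ] F}

namespace MeanDerivConvAt

/-- Composition with a smooth map `P` which, to first order, fixes the limit. -/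
theorem postcomp (h : MeanDerivConvAt a w G) {P : F → F} (hP : ContDiff ℝ ∞ P)
    {u₀ : EuclideanSpace ℝ (Fin n) → F} (hu₀ : ContinuousAt u₀ a)
    (hw : ∀ᶠ q : ℕ × EuclideanSpace ℝ (Fin n) in atTop ×ˢ 𝓝 a, DifferentiableAt ℝ (w q.1) q.2)
    (hlim : Tendsto (fun q : ℕ × EuclideanSpace ℝ (Fin n) => w q.1 q.2)
      (atTop ×ˢ 𝓝 a) (𝓝 (u₀ a)))
    {T : Set (EuclideanSpace ℝ (Fin n))} (hT : T ∈ 𝓝 a) {L : ℝ}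
    (hG : ∀ᵐ y ∂(volume.restrict T), ‖G y‖ ≤ L ∧ (fderiv ℝ P (u₀ y)).comp (G y) = G y) :
    MeanDerivConvAt a (fun k x => P (w k x)) G := by
  obtain ⟨c₀, hc₀, h⟩ := h
  refine ⟨c₀, hc₀, fun c hc hcc => ?_⟩
  have hPc : Continuous (fderiv ℝ P) := hP.continuous_fderiv (by simp)
  set D : ℝ := ‖fderiv ℝ P (u₀ a)‖ + 1 with hD
  have hlimP : Tendsto (fun q : ℕ × EuclideanSpace ℝ (Fin n) => fderiv ℝ P (w q.1 q.2))
      (atTop ×ˢ 𝓝 a) (𝓝 (fderiv ℝ P (u₀ a))) := (hPc.tendsto _).comp hlim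
  refine ENNReal.tendsto_nhds_zero.2 fun η hη => ?_
  obtain ⟨ε, hε, hεη⟩ := exists_pos_ofReal_mul_le (2 * max L 0) (ENNReal.half_pos hη.ne')
  have h1 := ENNReal.Tendsto.const_mul (a := ENNReal.ofReal D) (h c hc hcc)
    (Or.inr ENNReal.ofReal_ne_top)
  rw [mul_zero] at h1
  have h2 : ∀ᶠ y in 𝓝 a, ‖fderiv ℝ P (u₀ y) - fderiv ℝ P (u₀ a)‖ < ε := by
    have := (hPc.continuousAt.comp hu₀).eventually (ball_mem_nhds (fderiv ℝ P (u₀ a)) hε)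
    filter_upwards [this] with y hy using by simpa [dist_eq_norm] using hy
  have h3 : ∀ᶠ q : ℕ × EuclideanSpace ℝ (Fin n) in atTop ×ˢ 𝓝 a,
      ‖fderiv ℝ P (w q.1 q.2) - fderiv ℝ P (u₀ a)‖ < ε := by
    filter_upwards [hlimP.eventually (ball_mem_nhds (fderiv ℝ P (u₀ a)) hε)] with q hq
      using by simpa [dist_eq_norm] using hq
  have h4 : ∀ᶠ q : ℕ × EuclideanSpace ℝ (Fin n) in atTop ×ˢ 𝓝 a, ‖fderiv ℝ P (w q.1 q.2)‖ ≤ D :=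
    (hlimP.norm.eventually (gt_mem_nhds (lt_add_one _))).mono fun _ h => h.le
  filter_upwards [ENNReal.tendsto_nhds_zero.1 h1 (η / 2) (ENNReal.half_pos hη.ne'), h3, h4, hw,
    eventually_ball_mollRadius_subset (inter_mem hT h2) c] with q h1 h3 h4 h5 h6
  have hr : 0 < c * mollRadius q.1 := mul_pos hc (mollRadius_pos _)
  have hD' : fderiv ℝ (fun x => P (w q.1 x)) q.2 =
      (fderiv ℝ P (w q.1 q.2)).comp (fderiv ℝ (w q.1) q.2) :=
    fderiv_comp q.2 (hP.differentiable (by simp) _) h5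
  refine (laverage_ball_le_add_mul hr ENNReal.ofReal_ne_top (g := fun y =>
    ‖G y - fderiv ℝ (w q.1) q.2‖ₑ) (b := η / 2) (d := ENNReal.ofReal D) ?_).trans
    ((add_le_add_right h1 _).trans (ENNReal.add_halves η).le)
  filter_upwards [ae_restrict_of_ae_restrict_of_subset (h6.trans inter_subset_left) hG,
    ae_restrict_mem measurableSet_ball] with y hy hyb
  have h7 : ‖fderiv ℝ P (u₀ y) - fderiv ℝ P (u₀ a)‖ < ε := (h6 hyb).2
  have hE : G y - fderiv ℝ (fun x => P (w q.1 x)) q.2 =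
      (fderiv ℝ P (u₀ y) - fderiv ℝ P (w q.1 q.2)).comp (G y) +
        (fderiv ℝ P (w q.1 q.2)).comp (G y - fderiv ℝ (w q.1) q.2) := by
    rw [hD', ContinuousLinearMap.sub_comp, ContinuousLinearMap.comp_sub, hy.2]
    abel
  rw [hE]
  refine enorm_add_le_add_of_le ?_ ?_
  · refine le_trans ?_ hεη
    rw [← ofReal_norm]
    refine ENNReal.ofReal_le_ofReal ((ContinuousLinearMap.opNorm_comp_le _ _).trans ?_)
    have h8 : ‖fderiv ℝ P (u₀ y) - fderiv ℝ P (w q.1 q.2)‖ ≤ 2 * ε := by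
      have := norm_sub_le_norm_sub_add_norm_sub (fderiv ℝ P (u₀ y)) (fderiv ℝ P (u₀ a))
        (fderiv ℝ P (w q.1 q.2))
      rw [norm_sub_rev (fderiv ℝ P (u₀ a))] at this
      linarith
    calc _ ≤ 2 * ε * max L 0 :=
          mul_le_mul h8 (hy.1.trans (le_max_left _ _)) (norm_nonneg _) (by positivity)
      _ = _ := by ring
  · rw [← ofReal_norm, ← ofReal_norm, ← ENNReal.ofReal_mul (by positivity)]
    refine ENNReal.ofReal_le_ofReal ((ContinuousLinearMap.opNorm_comp_le _ _).trans ?_)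
    gcongr

/-- Change of variables. -/
theorem comp {τ σ : EuclideanSpace ℝ (Fin n) → EuclideanSpace ℝ (Fin n)}
    (hτ : ∀ᶠ x in 𝓝 a, ContDiffAt ℝ ∞ τ x) (hσ : DifferentiableAt ℝ σ (τ a))
    (hστ : ∀ᶠ x in 𝓝 a, σ (τ x) = x)
    (hw : ∀ᶠ q : ℕ × EuclideanSpace ℝ (Fin n) in atTop ×ˢ 𝓝 (τ a),
      DifferentiableAt ℝ (w q.1) q.2)
    {T : Set (EuclideanSpace ℝ (Fin n))} (hT : T ∈ 𝓝 (τ a))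
    (hG : AEStronglyMeasurable G (volume.restrict T)) {L : ℝ}
    (hL : ∀ᵐ y ∂(volume.restrict T), ‖G y‖ ≤ L) (h : MeanDerivConvAt (τ a) w G) :
    MeanDerivConvAt a (fun k x => w k (τ x)) (fun x => (G (τ x)).comp (fderiv ℝ τ x)) := by
  obtain ⟨c₀, hc₀, h⟩ := h
  have ha := hτ.self_of_nhds
  have hdet := det_fderiv_ne_zero_of_leftInverse (ha.differentiableAt (by simp)) hσ hστ
  set d := |(fderiv ℝ τ a).det| / 2 with hd
  have hd0 : 0 < d := half_pos (abs_pos.2 hdet)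
  have h1 : ∀ᶠ x in 𝓝 a, d < |(fderiv ℝ τ x).det| := by
    have : ContinuousAt (fun x => |(fderiv ℝ τ x).det|) a :=
      (ContinuousLinearMap.continuous_det.continuousAt.comp ha.fderiv_infty.continuousAt).abs
    exact this.eventually (lt_mem_nhds (half_lt_self (abs_pos.2 hdet)))
  set D : ℝ := ‖fderiv ℝ τ a‖ + 1 with hD
  have hD0 : 0 < D := by positivity
  have h2 : ∀ᶠ x in 𝓝 a, ‖fderiv ℝ τ x‖ < D :=
    ha.fderiv_infty.continuousAt.norm.eventually (gt_mem_nhds (lt_add_one _))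
  refine ⟨c₀ / D, div_pos hc₀ hD0, fun c hc hcc => ?_⟩
  have hDc : 0 < D * c := mul_pos hD0 hc
  have hτq : Tendsto (fun q : ℕ × EuclideanSpace ℝ (Fin n) => (q.1, τ q.2)) (atTop ×ˢ 𝓝 a)
      (atTop ×ˢ 𝓝 (τ a)) := tendsto_fst.prodMk (ha.continuousAt.tendsto.comp tendsto_snd)
  have hlim := (h (D * c) hDc (by rw [mul_comm]; exact (le_div_iff₀ hD0).1 hcc)).comp hτq
  set K : ℝ≥0∞ := ENNReal.ofReal D * ((ENNReal.ofReal d)⁻¹ * ENNReal.ofReal (D ^ n)) with hK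
  have hKt : K ≠ ⊤ := by
    refine ENNReal.mul_ne_top ENNReal.ofReal_ne_top (ENNReal.mul_ne_top
      (ENNReal.inv_ne_top.2 (by simpa using hd0)) ENNReal.ofReal_ne_top)
  have hlim' := ENNReal.Tendsto.const_mul (a := K) hlim (Or.inr hKt)
  rw [mul_zero] at hlim'
  refine ENNReal.tendsto_nhds_zero.2 fun η hη => ?_
  obtain ⟨ε, hε, hεη⟩ := exists_pos_ofReal_mul_le (2 * max L 0) (ENNReal.half_pos hη.ne')
  have h3 : ∀ᶠ x in 𝓝 a, ‖fderiv ℝ τ x - fderiv ℝ τ a‖ < ε := by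
    filter_upwards [ha.fderiv_infty.continuousAt.eventually (ball_mem_nhds (fderiv ℝ τ a) hε)]
      with x hx using by simpa [dist_eq_norm] using hx
  have hgood := hτ.and (hστ.and (h1.and (h2.and h3)))
  filter_upwards [ENNReal.tendsto_nhds_zero.1 hlim' (η / 2) (ENNReal.half_pos hη.ne'),
    hτq.eventually hw, tendsto_snd.eventually (hτ.and h3), tendsto_snd.eventually h2,
    eventually_ball_mollRadius_subset hgood c, hτq.eventually
      (eventually_ball_mollRadius_subset hT (D * c))] with q hq hwq hq1 hq2 hsub hsubT
  have hr : 0 < c * mollRadius q.1 := mul_pos hc (mollRadius_pos _)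
  set B := ball q.2 (c * mollRadius q.1) with hB
  set B' := ball (τ q.2) (D * c * mollRadius q.1) with hB'
  have hmaps : MapsTo τ B B' := fun y hy => by
    have := (convex_ball q.2 (c * mollRadius q.1)).norm_image_sub_le_of_norm_fderiv_le (𝕜 := ℝ)
      (f := τ) (C := D) (fun z hz => (hsub hz).1.differentiableAt (by simp))
      (fun z hz => (hsub hz).2.2.2.1.le) (mem_ball_self hr) hy
    rw [hB, mem_ball, dist_eq_norm] at hy
    rw [hB', mem_ball, dist_eq_norm, mul_assoc]
    exact this.trans_lt (by gcongr)
  have hinj : InjOn τ B := fun x hx y hy hxy => by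
    rw [← (hsub hx).2.1, hxy, (hsub hy).2.1]
  obtain ⟨hm, hmap⟩ := map_restrict_le_of_le_abs_det (measurableSet_ball (x := q.2)
    (ε := c * mollRadius q.1)) (fun x hx =>
      ((hsub hx).1.differentiableAt (by simp)).hasFDerivAt.hasFDerivWithinAt) hinj hd0
      (fun x hx => (hsub hx).2.2.1.le) hmaps
  have hGB : AEStronglyMeasurable G (volume.restrict B') :=
    hG.mono_measure (Measure.restrict_mono hsubT le_rfl)
  have hLB : ∀ᵐ y ∂(volume.restrict B), ‖G (τ y)‖ ≤ L :=
    ae_comp_of_map_le hm hmap (ae_restrict_of_ae_restrict_of_subset hsubT hL)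
  -- the pushforward of normalized measure on `B` is controlled by normalized measure on `B'`
  have hpush : ⨍⁻ y in B, ‖G (τ y) - fderiv ℝ (w q.1) (τ q.2)‖ₑ ∂volume ≤
      ((ENNReal.ofReal d)⁻¹ * ENNReal.ofReal (D ^ n)) *
        ⨍⁻ y in B', ‖G y - fderiv ℝ (w q.1) (τ q.2)‖ₑ ∂volume := by
    have hvol : volume B' = ENNReal.ofReal (D ^ n) * volume B := by
      have := Measure.addHaar_ball_mul_of_pos (volume : Measure (EuclideanSpace ℝ (Fin n)))
        (τ q.2) hD0 (c * mollRadius q.1)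
      rw [hB', mul_assoc, this, finrank_euclideanSpace_fin, hB,
        ← Measure.addHaar_ball_center volume q.2]
    have hint : ∫⁻ y in B, ‖G (τ y) - fderiv ℝ (w q.1) (τ q.2)‖ₑ ≤ (ENNReal.ofReal d)⁻¹ *
        ∫⁻ y in B', ‖G y - fderiv ℝ (w q.1) (τ q.2)‖ₑ := by
      have hmeas : AEMeasurable (fun y => ‖G y - fderiv ℝ (w q.1) (τ q.2)‖ₑ)
          (volume.restrict B') := (hGB.sub aestronglyMeasurable_const).enorm
      have hac : (volume.restrict B).map τ ≪ volume.restrict B' :=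
        (Measure.absolutelyContinuous_of_le hmap).trans
          (Measure.AbsolutelyContinuous.rfl.smul_left _)
      rw [← lintegral_map' (hmeas.mono_ac hac) hm, ← smul_eq_mul, ← lintegral_smul_measure]
      exact lintegral_mono' hmap le_rfl
    have hB0 : volume B ≠ 0 := (measure_ball_pos _ _ hr).ne'
    have hD0' : ENNReal.ofReal (D ^ n) ≠ 0 := by simpa using pow_pos hD0 n
    rw [setLAverage_eq, setLAverage_eq, hvol, div_eq_mul_inv, div_eq_mul_inv,
      ENNReal.mul_inv (Or.inl hD0') (Or.inl ENNReal.ofReal_ne_top)]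
    calc _ ≤ ((ENNReal.ofReal d)⁻¹ * ∫⁻ y in B', ‖G y - fderiv ℝ (w q.1) (τ q.2)‖ₑ) *
          (volume B)⁻¹ := by gcongr
      _ = (ENNReal.ofReal d)⁻¹ * (ENNReal.ofReal (D ^ n) * (ENNReal.ofReal (D ^ n))⁻¹) *
          ((∫⁻ y in B', ‖G y - fderiv ℝ (w q.1) (τ q.2)‖ₑ) * (volume B)⁻¹) := by
        rw [ENNReal.mul_inv_cancel hD0' ENNReal.ofReal_ne_top, mul_one, mul_assoc]
      _ = _ := by ring
  have hD' : fderiv ℝ (fun x => w q.1 (τ x)) q.2 =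
      (fderiv ℝ (w q.1) (τ q.2)).comp (fderiv ℝ τ q.2) :=
    fderiv_comp q.2 hwq (hq1.1.differentiableAt (by simp))
  refine (laverage_ball_le_add_mul hr ENNReal.ofReal_ne_top (g := fun y =>
    ‖G (τ y) - fderiv ℝ (w q.1) (τ q.2)‖ₑ) (b := η / 2) (d := ENNReal.ofReal D) ?_).trans
    ((add_le_add_right ?_ _).trans (ENNReal.add_halves η).le)
  · filter_upwards [hLB, ae_restrict_mem measurableSet_ball] with y hy hyb
    have h8 : ‖fderiv ℝ τ y - fderiv ℝ τ q.2‖ ≤ 2 * ε := by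
      have := norm_sub_le_norm_sub_add_norm_sub (fderiv ℝ τ y) (fderiv ℝ τ a) (fderiv ℝ τ q.2)
      rw [norm_sub_rev (fderiv ℝ τ a)] at this
      have h9 := (hsub hyb).2.2.2.2
      linarith [hq1.2]
    have hE : (G (τ y)).comp (fderiv ℝ τ y) - fderiv ℝ (fun x => w q.1 (τ x)) q.2 =
        (G (τ y)).comp (fderiv ℝ τ y - fderiv ℝ τ q.2) +
          (G (τ y) - fderiv ℝ (w q.1) (τ q.2)).comp (fderiv ℝ τ q.2) := by
      rw [hD', ContinuousLinearMap.sub_comp, ContinuousLinearMap.comp_sub]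
      abel
    rw [hE]
    refine enorm_add_le_add_of_le ?_ ?_
    · refine le_trans ?_ hεη
      rw [← ofReal_norm]
      refine ENNReal.ofReal_le_ofReal ((ContinuousLinearMap.opNorm_comp_le _ _).trans ?_)
      calc _ ≤ max L 0 * (2 * ε) :=
            mul_le_mul (hy.trans (le_max_left _ _)) h8 (norm_nonneg _) (le_max_right _ _)
        _ = _ := by ring
    · rw [← ofReal_norm, ← ofReal_norm, ← ENNReal.ofReal_mul (by positivity)]
      refine ENNReal.ofReal_le_ofReal ((ContinuousLinearMap.opNorm_comp_le _ _).trans ?_)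
      rw [mul_comm]
      gcongr
  · refine le_trans ?_ hq
    simp only [hK, Function.comp_apply]
    rw [mul_assoc]
    gcongr

/-- A derivative which is close to `G` in the mean is close to some value of `G` at a nearby point
outside a given null set. -/
theorem exists_norm_sub_le (h : MeanDerivConvAt a w G) {T : Set (EuclideanSpace ℝ (Fin n))}
    (hT : T ∈ 𝓝 a) {p : EuclideanSpace ℝ (Fin n) → Prop} (hp : ∀ᵐ y ∂(volume.restrict T), p y)
    {η : ℝ} (hη : 0 < η) :
    ∀ᶠ q : ℕ × EuclideanSpace ℝ (Fin n) in atTop ×ˢ 𝓝 a, ∃ y ∈ T, p y ∧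
      ‖G y - fderiv ℝ (w q.1) q.2‖ ≤ η := by
  obtain ⟨c₀, hc₀, h⟩ := h
  filter_upwards [ENNReal.tendsto_nhds_zero.1 (h c₀ hc₀ le_rfl) (ENNReal.ofReal (η / 2))
    (by simpa using hη), eventually_ball_mollRadius_subset hT c₀] with q h1 h2
  have hr : 0 < c₀ * mollRadius q.1 := mul_pos hc₀ (mollRadius_pos _)
  by_contra! hcon
  have h3 : ∀ᵐ y ∂(volume.restrict (ball q.2 (c₀ * mollRadius q.1))),
      ENNReal.ofReal η ≤ ‖G y - fderiv ℝ (w q.1) q.2‖ₑ := by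
    filter_upwards [ae_restrict_of_ae_restrict_of_subset h2 hp,
      ae_restrict_mem measurableSet_ball] with y hy hyb
    rw [← ofReal_norm]
    exact ENNReal.ofReal_le_ofReal (hcon y (h2 hyb) hy).le
  have h4 : ENNReal.ofReal η ≤ ⨍⁻ y in ball q.2 (c₀ * mollRadius q.1),
      ‖G y - fderiv ℝ (w q.1) q.2‖ₑ ∂volume := by
    rw [setLAverage_eq, ENNReal.le_div_iff_mul_le (Or.inl (measure_ball_pos _ _ hr).ne')
      (Or.inl measure_ball_lt_top.ne)]
    calc _ = ∫⁻ _ in ball q.2 (c₀ * mollRadius q.1), ENNReal.ofReal η := by simp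
      _ ≤ _ := lintegral_mono_ae h3
  have h5 := h4.trans h1
  rw [ENNReal.ofReal_le_ofReal_iff (half_pos hη).le] at h5
  linarith

end MeanDerivConvAt

end MeanDerivConv

/-! ### Retractions and lifts for smooth embeddings -/

section Retraction

variable {l m : ℕ} {M : Type*} [TopologicalSpace M] [ChartedSpace (EuclideanSpace ℝ (Fin l)) M]
  [IsManifold (𝓡 l) ∞ M] {ι : M → EuclideanSpace ℝ (Fin m)}

/-- In adapted charts an embedding is `u ↦ (u, 0)`, so that the first component is a left
inverse. -/
theorem Manifold.IsSmoothEmbedding.exists_local_leftInverse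
    (hι : Manifold.IsSmoothEmbedding (𝓡 l) (𝓡 m) ∞ ι) (x₀ : M) :
    ∃ (O : Set (EuclideanSpace ℝ (Fin m))) (s : EuclideanSpace ℝ (Fin m) → M), IsOpen O ∧
      ι x₀ ∈ O ∧ ContMDiffOn (𝓡 m) (𝓡 l) ∞ s O ∧ ∀ x, ι x ∈ O → s (ι x) = x := by
  have h := hι.isImmersion.isImmersionAt x₀
  obtain ⟨O', hO', hO'eq⟩ := hι.isEmbedding.isInducing.isOpen_iff.1 h.domChart.open_source
  set π : EuclideanSpace ℝ (Fin m) → EuclideanSpace ℝ (Fin l) := fun y => (h.equiv.symm y).1 with hπ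
  have hπs : ContDiff ℝ ∞ π := contDiff_fst.comp h.equiv.symm.contDiff
  have hleft : ∀ x ∈ h.domChart.source, π (h.codChart (ι x)) = h.domChart x := fun x hx => by
    have h0 : h.domChart x ∈ (h.domChart.extend (𝓡 l)).target := by
      simpa using h.domChart.map_source hx
    have h1 := h.writtenInCharts h0
    have h2 : h.codChart (ι x) = h.equiv (h.domChart x, 0) := by
      simpa [h.domChart.left_inv hx] using h1
    simp only [hπ, h2, ContinuousLinearEquiv.symm_apply_apply]
  set O₁ : Set (EuclideanSpace ℝ (Fin m)) :=
    h.codChart.source ∩ h.codChart ⁻¹' (π ⁻¹' h.domChart.target) with hO₁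
  have hO₁o : IsOpen O₁ := h.codChart.isOpen_inter_preimage
    (h.domChart.open_target.preimage hπs.continuous)
  refine ⟨O₁ ∩ O', fun y => h.domChart.symm (π (h.codChart y)), hO₁o.inter hO', ⟨⟨?_, ?_⟩, ?_⟩,
    ?_, fun x hx => ?_⟩
  · exact h.mem_codChart_source
  · change π (h.codChart (ι x₀)) ∈ h.domChart.target
    rw [hleft x₀ h.mem_domChart_source]
    exact h.domChart.map_source h.mem_domChart_source
  · have : x₀ ∈ ι ⁻¹' O' := hO'eq ▸ h.mem_domChart_source
    exact this
  · have h1 := contMDiffOn_of_mem_maximalAtlas h.codChart_mem_maximalAtlas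
    have h2 := contMDiffOn_symm_of_mem_maximalAtlas h.domChart_mem_maximalAtlas
    exact h2.comp ((hπs.contMDiff.comp_contMDiffOn (h1.mono fun y hy => hy.1.1)))
      fun y hy => hy.1.2
  · have hx' : x ∈ h.domChart.source := hO'eq ▸ (show x ∈ ι ⁻¹' O' from hx.2)
    simp only [hleft x hx', h.domChart.left_inv hx']

/-- Close to a compact subset of an embedded submanifold there is a smooth retraction; it extends to
a smooth map of the whole space which still fixes the submanifold. -/
theorem Manifold.IsSmoothEmbedding.exists_retraction
    (hι : Manifold.IsSmoothEmbedding (𝓡 l) (𝓡 m) ∞ ι) {K : Set (EuclideanSpace ℝ (Fin m))}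
    (hK : IsCompact K) (hKι : K ⊆ range ι) :
    ∃ P : EuclideanSpace ℝ (Fin m) → EuclideanSpace ℝ (Fin m), ContDiff ℝ ∞ P ∧
      (∀ x, P (ι x) = ι x) ∧ ∀ y ∈ K, ∀ᶠ z in 𝓝 y, P z ∈ range ι := by
  have key : ∃ P : EuclideanSpace ℝ (Fin m) → EuclideanSpace ℝ (Fin m), ContDiff ℝ ∞ P ∧
      (∀ x, P (ι x) = ι x) ∧ ∀ y ∈ K ∩ range ι, ∀ᶠ z in 𝓝 y, P z ∈ range ι := by
    refine hK.induction_on (p := fun S => ∃ P : EuclideanSpace ℝ (Fin m) →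
      EuclideanSpace ℝ (Fin m), ContDiff ℝ ∞ P ∧ (∀ x, P (ι x) = ι x) ∧
      ∀ y ∈ S ∩ range ι, ∀ᶠ z in 𝓝 y, P z ∈ range ι) ?_ ?_ ?_ ?_
    · exact ⟨id, contDiff_id, fun _ => rfl, by simp⟩
    · rintro S T hST ⟨P, hP, hPι, h⟩
      exact ⟨P, hP, hPι, fun y hy => h y ⟨hST hy.1, hy.2⟩⟩
    · rintro S T ⟨P, hP, hPι, h⟩ ⟨Q, hQ, hQι, h'⟩
      refine ⟨Q ∘ P, hQ.comp hP, fun x => by simp [hPι, hQι], ?_⟩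
      rintro _ ⟨hy | hy, x, rfl⟩
      · filter_upwards [h _ ⟨hy, x, rfl⟩] with z hz
        obtain ⟨x', hx'⟩ := hz
        exact ⟨x', by simp [← hx', hQι]⟩
      · have h1 : Tendsto P (𝓝 (ι x)) (𝓝 (ι x)) := by
          simpa [hPι] using hP.continuous.tendsto (ι x)
        exact h1.eventually (h' _ ⟨hy, x, rfl⟩)
    · intro y hy
      obtain ⟨x₀, rfl⟩ := hKι hy
      obtain ⟨O, s, hO, hx₀, hs, hsι⟩ := hι.exists_local_leftInverse x₀
      obtain ⟨R, hR, hRO⟩ := Metric.nhds_basis_closedBall.mem_iff.1 (hO.mem_nhds hx₀)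
      let θ : ContDiffBump (ι x₀) := ⟨R / 2, R, half_pos hR, half_lt_self hR⟩
      have hr : ContDiffOn ℝ ∞ (fun y => ι (s y)) O :=
        contMDiffOn_iff_contDiffOn.1 (hι.contMDiff.comp_contMDiffOn hs)
      have hθO : tsupport θ ⊆ O := by rw [θ.tsupport_eq]; exact hRO
      refine ⟨ball (ι x₀) (R / 2), mem_nhdsWithin_of_mem_nhds (ball_mem_nhds _ (half_pos hR)),
        fun y => y + θ y • (ι (s y) - y), contDiff_iff_contDiffAt.2 fun y => ?_, fun x => ?_, ?_⟩
      · by_cases hyO : y ∈ O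
        · exact contDiffAt_id.add (θ.contDiff.contDiffAt.smul
            ((hr.contDiffAt (hO.mem_nhds hyO)).sub contDiffAt_id))
        · refine contDiffAt_id.congr_of_eventuallyEq ?_
          filter_upwards [(isClosed_tsupport θ).isOpen_compl.mem_nhds fun h => hyO (hθO h)]
            with z hz
          simp [image_eq_zero_of_notMem_tsupport hz]
      · by_cases hxO : ι x ∈ O
        · simp [hsι x hxO]
        · simp [image_eq_zero_of_notMem_tsupport fun h => hxO (hθO h)]
      · intro y hy
        filter_upwards [isOpen_ball.mem_nhds hy.1] with z hz
        rw [θ.one_of_mem_closedBall (ball_subset_closedBall hz)]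
        exact ⟨s z, by simp⟩
  obtain ⟨P, hP, hPι, h⟩ := key
  exact ⟨P, hP, hPι, fun y hy => h y ⟨hy, hKι hy⟩⟩

/-- A smooth map with values in the image of an embedding lifts to a smooth map. -/
theorem Manifold.IsSmoothEmbedding.contMDiffAt_of_comp
    (hι : Manifold.IsSmoothEmbedding (𝓡 l) (𝓡 m) ∞ ι) {n : ℕ} {N : Type*} [TopologicalSpace N]
    [ChartedSpace (EuclideanSpace ℝ (Fin n)) N] {f : N → M} {x : N}
    (hf : ContMDiffAt (𝓡 n) (𝓡 m) ∞ (fun y => ι (f y)) x) : ContMDiffAt (𝓡 n) (𝓡 l) ∞ f x :=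
  (ContMDiffAt.iff_comp_isImmersionAt (hι.isImmersion.isImmersionAt (f x))).2
    ⟨hι.isEmbedding.isInducing.continuousAt_iff.2 hf.continuousAt, hf⟩

end Retraction

/-! ### Differentials and the metric in charts -/

section Charts

variable {n : ℕ} {N : Type*} [TopologicalSpace N] [ChartedSpace (EuclideanSpace ℝ (Fin n)) N]
  [IsManifold (𝓡 n) ∞ N] {F : Type*} [NormedAddCommGroup F] [NormedSpace ℝ F]
  {φ ψ : OpenPartialHomeomorph N (EuclideanSpace ℝ (Fin n))} {U : Set N}

/-- The representation in the chart `φ` of a section `df` of `T*N ⊗ F`. -/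
def chartDeriv (df : ∀ x : N, TangentSpace (𝓡 n) x →L[ℝ] F)
    (φ : OpenPartialHomeomorph N (EuclideanSpace ℝ (Fin n))) (z : EuclideanSpace ℝ (Fin n)) :
    EuclideanSpace ℝ (Fin n) →L[ℝ] F :=
  (df (φ.symm z)).comp (mfderiv (𝓡 n) (𝓡 n) φ.symm z)

theorem chartImage_eq (φ : OpenPartialHomeomorph N (EuclideanSpace ℝ (Fin n))) (U : Set N) :
    chartImage φ U = φ.target ∩ φ.symm ⁻¹' U :=
  φ.image_source_inter_eq' U

theorem isOpen_chartImage (φ : OpenPartialHomeomorph N (EuclideanSpace ℝ (Fin n)))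
    (hU : IsOpen U) : IsOpen (chartImage φ U) := by
  rw [chartImage_eq]
  exact φ.symm.isOpen_inter_preimage hU

theorem contDiffAt_transition (hφ : φ ∈ IsManifold.maximalAtlas (𝓡 n) ∞ N)
    (hψ : ψ ∈ IsManifold.maximalAtlas (𝓡 n) ∞ N) {a : EuclideanSpace ℝ (Fin n)}
    (ha : a ∈ ψ.target) (haφ : ψ.symm a ∈ φ.source) :
    ContDiffAt ℝ ∞ (fun z => φ (ψ.symm z)) a := by
  rw [← contMDiffAt_iff_contDiffAt]
  exact (contMDiffAt_of_mem_maximalAtlas hφ haφ).comp a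
    (contMDiffAt_symm_of_mem_maximalAtlas hψ ha)

theorem eventually_mem_transition {a : EuclideanSpace ℝ (Fin n)}
    (ha : a ∈ ψ.target) (haφ : ψ.symm a ∈ φ.source) :
    ∀ᶠ z in 𝓝 a, z ∈ ψ.target ∧ ψ.symm z ∈ φ.source :=
  Filter.Eventually.and (ψ.open_target.mem_nhds ha)
    ((ψ.continuousAt_symm ha).eventually (φ.open_source.mem_nhds haφ))

theorem mdifferentiableAt_chart (hφ : φ ∈ IsManifold.maximalAtlas (𝓡 n) ∞ N) {x : N}
    (hx : x ∈ φ.source) : MDifferentiableAt (𝓡 n) (𝓡 n) φ x :=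
  (contMDiffAt_of_mem_maximalAtlas hφ hx).mdifferentiableAt (by simp)

theorem mdifferentiableAt_chart_symm (hφ : φ ∈ IsManifold.maximalAtlas (𝓡 n) ∞ N)
    {a : EuclideanSpace ℝ (Fin n)} (ha : a ∈ φ.target) :
    MDifferentiableAt (𝓡 n) (𝓡 n) φ.symm a :=
  (contMDiffAt_symm_of_mem_maximalAtlas hφ ha).mdifferentiableAt (by simp)

/-- The transformation rule of the chart representation under a change of charts. -/
theorem chartDeriv_transition (df : ∀ x : N, TangentSpace (𝓡 n) x →L[ℝ] F)
    (hφ : φ ∈ IsManifold.maximalAtlas (𝓡 n) ∞ N)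
    (hψ : ψ ∈ IsManifold.maximalAtlas (𝓡 n) ∞ N) {a : EuclideanSpace ℝ (Fin n)}
    (ha : a ∈ ψ.target) (haφ : ψ.symm a ∈ φ.source) :
    chartDeriv df ψ a =
      (chartDeriv df φ (φ (ψ.symm a))).comp (fderiv ℝ (fun z => φ (ψ.symm z)) a) := by
  have h1 : φ.symm (φ (ψ.symm a)) = ψ.symm a := φ.left_inv haφ
  have h2 : (fun z => φ.symm (φ (ψ.symm z))) =ᶠ[𝓝 a] ψ.symm := by
    filter_upwards [eventually_mem_transition ha haφ] with z hz using φ.left_inv hz.2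
  have h3 := mfderiv_comp (I := 𝓡 n) (I' := 𝓡 n) (I'' := 𝓡 n) (g := φ.symm)
    (f := fun z => φ (ψ.symm z)) a
    (mdifferentiableAt_chart_symm hφ (φ.map_source haφ))
    ((contDiffAt_transition hφ hψ ha haφ).differentiableAt (by simp)).mdifferentiableAt
  have h4 : mfderiv (𝓡 n) (𝓡 n) (φ.symm ∘ fun z => φ (ψ.symm z)) a =
      mfderiv (𝓡 n) (𝓡 n) ψ.symm a := h2.mfderiv_eq
  let D : N → EuclideanSpace ℝ (Fin n) →L[ℝ] F := df
  have h5 : D (φ.symm (φ (ψ.symm a))) = D (ψ.symm a) := congrArg D h1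
  rw [mfderiv_eq_fderiv] at h3
  change (D (ψ.symm a)).comp (mfderiv (𝓡 n) (𝓡 n) ψ.symm a) =
    ((D (φ.symm (φ (ψ.symm a)))).comp (mfderiv (𝓡 n) (𝓡 n) φ.symm (φ (ψ.symm a)))).comp _
  rw [h5, ← h4, h3]
  rfl

theorem fderiv_comp_chart_symm {h : N → F} (hφ : φ ∈ IsManifold.maximalAtlas (𝓡 n) ∞ N)
    {a : EuclideanSpace ℝ (Fin n)} (ha : a ∈ φ.target)
    (hh : MDifferentiableAt (𝓡 n) 𝓘(ℝ, F) h (φ.symm a)) :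
    fderiv ℝ (fun z => h (φ.symm z)) a = chartDeriv (classicalDifferential h) φ a := by
  rw [← mfderiv_eq_fderiv]
  exact mfderiv_comp a hh (mdifferentiableAt_chart_symm hφ ha)

theorem mfderiv_chart_symm_apply (hφ : φ ∈ IsManifold.maximalAtlas (𝓡 n) ∞ N)
    {x : N} (hx : x ∈ φ.source) (v : TangentSpace (𝓡 n) x) :
    (mfderiv (𝓡 n) (𝓡 n) φ.symm (φ x) (mfderiv (𝓡 n) (𝓡 n) φ x v) : EuclideanSpace ℝ (Fin n)) =
      v := by
  have h1 := mfderiv_comp (I := 𝓡 n) (I' := 𝓡 n) (I'' := 𝓡 n) (g := φ.symm) (f := φ) x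
    (mdifferentiableAt_chart_symm hφ (φ.map_source hx)) (mdifferentiableAt_chart hφ hx)
  have h2 : (φ.symm ∘ φ) =ᶠ[𝓝 x] id := by
    filter_upwards [φ.open_source.mem_nhds hx] with y hy using φ.left_inv hy
  have h3 := h2.mfderiv_eq (I := 𝓡 n) (I' := 𝓡 n)
  rw [mfderiv_id] at h3
  exact DFunLike.congr_fun (h1.symm.trans h3) v

/-- The derivative of the inverse of the chart `φ`, as a map between model spaces. -/
def chartSymmDeriv (φ : OpenPartialHomeomorph N (EuclideanSpace ℝ (Fin n)))
    (z : EuclideanSpace ℝ (Fin n)) : EuclideanSpace ℝ (Fin n) →L[ℝ] EuclideanSpace ℝ (Fin n) :=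
  mfderiv (𝓡 n) (𝓡 n) φ.symm z

/-- The inner product on `T_x N`, as a bilinear form on the model space. -/
def modelInner (g : Bundle.ContMDiffRiemannianMetric (𝓡 n) ∞ (EuclideanSpace ℝ (Fin n))
      (fun x : N => TangentSpace (𝓡 n) x)) (x : N) :
    EuclideanSpace ℝ (Fin n) →L[ℝ] EuclideanSpace ℝ (Fin n) →L[ℝ] ℝ :=
  g.inner x

/-- The Riemannian metric in the chart `φ`. -/
def chartMetric (g : Bundle.ContMDiffRiemannianMetric (𝓡 n) ∞ (EuclideanSpace ℝ (Fin n))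
      (fun x : N => TangentSpace (𝓡 n) x))
    (φ : OpenPartialHomeomorph N (EuclideanSpace ℝ (Fin n))) (z : EuclideanSpace ℝ (Fin n)) :
    EuclideanSpace ℝ (Fin n) →L[ℝ] EuclideanSpace ℝ (Fin n) →L[ℝ] ℝ :=
  ContinuousLinearMap.bilinearComp (modelInner g (φ.symm z)) (chartSymmDeriv φ z)
    (chartSymmDeriv φ z)

variable (g : Bundle.ContMDiffRiemannianMetric (𝓡 n) ∞ (EuclideanSpace ℝ (Fin n))
      (fun x : N => TangentSpace (𝓡 n) x))

theorem one_add_one_le_infty : (1 : WithTop ℕ∞) + 1 ≤ ((⊤ : ℕ∞) : WithTop ℕ∞) := by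
  rw [one_add_one_eq_two]
  exact WithTop.coe_le_coe.2 (le_top : (2 : ℕ∞) ≤ ⊤)

theorem continuousAt_chartMetric (hφ : φ ∈ IsManifold.maximalAtlas (𝓡 n) ∞ N)
    {a : EuclideanSpace ℝ (Fin n)} (ha : a ∈ φ.target) : ContinuousAt (chartMetric g φ) a := by
  have h1 : (1 : WithTop ℕ∞) ≤ ((⊤ : ℕ∞) : WithTop ℕ∞) := by simp
  have hφa : ContMDiffAt (𝓡 n) (𝓡 n) 1 φ.symm a :=
    (contMDiffAt_symm_of_mem_maximalAtlas hφ ha).of_le h1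
  have hsec : ∀ w : EuclideanSpace ℝ (Fin n), ContMDiffAt (𝓡 n) (𝓡 n).tangent 1
      (fun z => (⟨φ.symm z, mfderiv (𝓡 n) (𝓡 n) φ.symm z w⟩ : TangentBundle (𝓡 n) N)) a := by
    intro w
    have h2 := (contMDiffOn_symm_of_mem_maximalAtlas hφ).contMDiffOn_tangentMapWithin
      one_add_one_le_infty φ.open_target.uniqueMDiffOn
    have h3 : ContMDiffAt (𝓡 n) (𝓡 n).tangent 1
        (fun z => (⟨z, w⟩ : TangentBundle (𝓡 n) (EuclideanSpace ℝ (Fin n)))) a :=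
      contMDiffAt_vectorSpace_iff_contDiffAt.2 contDiffAt_const
    have h4 := ((h2 ⟨a, w⟩ ha).comp a (h3.contMDiffWithinAt (s := φ.target))
      (fun z hz => hz)).contMDiffAt (φ.open_target.mem_nhds ha)
    refine h4.congr_of_eventuallyEq ?_
    filter_upwards [φ.open_target.mem_nhds ha] with z hz
    simp only [Function.comp_apply, tangentMapWithin, mfderivWithin_of_isOpen φ.open_target hz]
  have hg : ContMDiff (𝓡 n) ((𝓡 n).prod 𝓘(ℝ, EuclideanSpace ℝ (Fin n) →L[ℝ]
      EuclideanSpace ℝ (Fin n) →L[ℝ] ℝ)) 1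
        (fun b => Bundle.TotalSpace.mk' (EuclideanSpace ℝ (Fin n) →L[ℝ]
      EuclideanSpace ℝ (Fin n) →L[ℝ] ℝ) b (g.inner b)) := g.contMDiff.of_le h1
  refine continuousAt_clm_apply.2 fun v => continuousAt_clm_apply.2 fun w => ?_
  have h2 : ContMDiffAt (𝓡 n) ((𝓡 n).prod 𝓘(ℝ)) 1 (fun z => Bundle.TotalSpace.mk' ℝ
      (E := Bundle.Trivial N ℝ) (φ.symm z) (g.inner (φ.symm z)
        (mfderiv (𝓡 n) (𝓡 n) φ.symm z v) (mfderiv (𝓡 n) (𝓡 n) φ.symm z w))) a := by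
    apply ContMDiffAt.clm_bundle_apply₂ (F₁ := EuclideanSpace ℝ (Fin n))
      (F₂ := EuclideanSpace ℝ (Fin n))
    · exact hg.contMDiffAt.comp a hφa
    · exact hsec v
    · exact hsec w
  simp only [Bundle.contMDiffAt_totalSpace] at h2
  exact h2.2.continuousAt

theorem chartMetric_pos (hφ : φ ∈ IsManifold.maximalAtlas (𝓡 n) ∞ N)
    {a : EuclideanSpace ℝ (Fin n)} (ha : a ∈ φ.target) {w : EuclideanSpace ℝ (Fin n)}
    (hw : w ≠ 0) : 0 < chartMetric g φ a w w := by
  refine g.pos (φ.symm a) (chartSymmDeriv φ a w) fun h0 => hw ?_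
  have h1 := mfderiv_comp (I := 𝓡 n) (I' := 𝓡 n) (I'' := 𝓡 n) (g := φ) (f := φ.symm) a
    (mdifferentiableAt_chart hφ (φ.map_target ha)) (mdifferentiableAt_chart_symm hφ ha)
  have h2 : (φ ∘ φ.symm) =ᶠ[𝓝 a] id := by
    filter_upwards [φ.open_target.mem_nhds ha] with y hy using φ.right_inv hy
  have h3 := h2.mfderiv_eq (I := 𝓡 n) (I' := 𝓡 n)
  rw [mfderiv_id] at h3
  have h4 : mfderiv (𝓡 n) (𝓡 n) φ (φ.symm a) (chartSymmDeriv φ a w) = w :=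
    DFunLike.congr_fun (h1.symm.trans h3) w
  rw [← h4, h0]
  exact map_zero _

end Charts

theorem exists_pos_mul_norm_sq_le {E : Type*} [NormedAddCommGroup E] [NormedSpace ℝ E]
    [FiniteDimensional ℝ E] {B : E →L[ℝ] E →L[ℝ] ℝ} (hB : ∀ w, w ≠ 0 → 0 < B w w) :
    ∃ c > 0, ∀ w, c * ‖w‖ ^ 2 ≤ B w w := by
  have : ProperSpace E := FiniteDimensional.proper ℝ E
  have hc : Continuous fun w => B w w := by fun_prop
  obtain ⟨c, hc, h⟩ := (isCompact_sphere (0 : E) 1).exists_forall_le' hc.continuousOn (a := 0)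
    fun w hw => hB w (ne_zero_of_mem_unit_sphere ⟨w, hw⟩)
  refine ⟨c, hc, fun w => ?_⟩
  rcases eq_or_ne w 0 with rfl | hw
  · simp
  have hw' : 0 < ‖w‖ := norm_pos_iff.2 hw
  have h1 := h (‖w‖⁻¹ • w) (by simp [norm_smul, hw'.ne'])
  simp only [map_smul, smul_apply, smul_eq_mul] at h1
  calc c * ‖w‖ ^ 2 ≤ (‖w‖⁻¹ * (‖w‖⁻¹ * B w w)) * ‖w‖ ^ 2 := by gcongr
    _ = B w w := by field_simp

/-- A positive definite form and a nearby one are comparable. -/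
theorem ContinuousAt.eventually_bilinForm_le {E X : Type*} [NormedAddCommGroup E] [NormedSpace ℝ E]
    [FiniteDimensional ℝ E] [TopologicalSpace X] {B : X → E →L[ℝ] E →L[ℝ] ℝ} {a : X}
    (hB : ContinuousAt B a) (hpos : ∀ w, w ≠ 0 → 0 < B a w w) :
    ∀ᶠ z in 𝓝 a, ∀ w, B z w w ≤ 2 * B a w w ∧ B a w w ≤ 2 * B z w w := by
  obtain ⟨c, hc, h⟩ := exists_pos_mul_norm_sq_le hpos
  have hcont : ContinuousAt (fun z => ‖B z - B a‖) a := (hB.sub continuousAt_const).norm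
  have hev : ∀ᶠ z in 𝓝 a, ‖B z - B a‖ < c / 2 :=
    hcont.eventually (gt_mem_nhds (by simpa only [sub_self, norm_zero] using half_pos hc))
  filter_upwards [hev] with z hz w
  have h1 := (B z - B a).le_opNorm₂ w w
  have h2 : ‖B z - B a‖ * ‖w‖ * ‖w‖ ≤ c / 2 * ‖w‖ * ‖w‖ := by gcongr
  have h3 := abs_le.1 ((Real.norm_eq_abs _).symm.le.trans (h1.trans h2))
  have h4 : (B z - B a) w w = B z w w - B a w w := rfl
  have h5 := h w
  rw [h4] at h3
  constructor <;> nlinarith [h3.1, h3.2]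

theorem eventually_chartMetric_le {n : ℕ} {N : Type*} [TopologicalSpace N]
    [ChartedSpace (EuclideanSpace ℝ (Fin n)) N] [IsManifold (𝓡 n) ∞ N]
    (g : Bundle.ContMDiffRiemannianMetric (𝓡 n) ∞ (EuclideanSpace ℝ (Fin n))
      (fun x : N => TangentSpace (𝓡 n) x))
    {φ : OpenPartialHomeomorph N (EuclideanSpace ℝ (Fin n))}
    (hφ : φ ∈ IsManifold.maximalAtlas (𝓡 n) ∞ N)
    {a : EuclideanSpace ℝ (Fin n)} (ha : a ∈ φ.target) :
    ∀ᶠ z in 𝓝 a, ∀ w, chartMetric g φ z w w ≤ 2 * chartMetric g φ a w w ∧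
      chartMetric g φ a w w ≤ 2 * chartMetric g φ z w w :=
  (continuousAt_chartMetric g hφ ha).eventually_bilinForm_le fun _ hw => chartMetric_pos g hφ ha hw

/-! ### Pushing a Lipschitz domain into itself -/

section Push

variable {n : ℕ} {N : Type*} [TopologicalSpace N] [ChartedSpace (EuclideanSpace ℝ (Fin n)) N]
  {F : Type*} [NormedAddCommGroup F] [NormedSpace ℝ F] {U W W' : Set N} {h : N → F}
  {Φ Ψ : ℝ → N → N}

variable (n) in
/-- A smooth isotopy `Φ` starting at the identity which, for positive time, maps `closure U` into
`U` except for points outside `W`, which it fixes. Along the isotopy the function `h` changes at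
most linearly on `U`. -/
structure IsPush (U W : Set N) (h : N → F) (Φ : ℝ → N → N) : Prop where
  smooth : ContMDiffOn (𝓘(ℝ, ℝ).prod (𝓡 n)) (𝓡 n) ∞ (fun q : ℝ × N => Φ q.1 q.2)
    (Ioo (-1) 1 ×ˢ univ)
  zero : ∀ x, Φ 0 x = x
  push : ∀ ε ∈ Ioo (0 : ℝ) 1, ∀ x ∈ closure U, Φ ε x ∈ U ∨ Φ ε x = x ∧ x ∉ W
  conv : ∃ L : ℝ, ∀ ε ∈ Ioo (0 : ℝ) 1, ∀ x ∈ U, ‖h (Φ ε x) - h x‖ ≤ L * ε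

namespace IsPush

theorem mapsTo (hΦ : IsPush n U W h Φ) {ε : ℝ} (hε : ε ∈ Ioo (0 : ℝ) 1) : MapsTo (Φ ε) U U :=
  fun x hx => (hΦ.push ε hε x (subset_closure hx)).elim id fun h => by rwa [h.1]

theorem mono (hΦ : IsPush n U W h Φ) (hW : W' ⊆ W) : IsPush n U W' h Φ :=
  ⟨hΦ.smooth, hΦ.zero, fun ε hε x hx => (hΦ.push ε hε x hx).imp_right fun h =>
    ⟨h.1, fun hx => h.2 (hW hx)⟩, hΦ.conv⟩

theorem const : IsPush n U U h fun _ x => x :=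
  ⟨contMDiff_snd.contMDiffOn, fun _ => rfl,
    fun _ _ x _ => (em (x ∈ U)).imp_right fun h => ⟨rfl, h⟩, 0, by simp⟩

/-- Composing isotopies enlarges the set which is pushed into `U`. -/
theorem comp (hΨ : IsPush n U W' h Ψ) (hΦ : IsPush n U W h Φ) :
    IsPush n U (W ∪ W') h fun ε x => Ψ ε (Φ ε x) := by
  obtain ⟨L, hL⟩ := hΦ.conv
  obtain ⟨L', hL'⟩ := hΨ.conv
  refine ⟨hΨ.smooth.comp (contMDiffOn_fst.prodMk hΦ.smooth) fun q hq => ⟨hq.1, mem_univ _⟩,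
    fun x => by rw [hΦ.zero, hΨ.zero],
    fun ε hε x hx => ?_, L' + L, fun ε hε x hx => ?_⟩
  · rcases hΦ.push ε hε x hx with h1 | ⟨h1, h2⟩
    · exact Or.inl (hΨ.mapsTo hε h1)
    · rw [h1]
      exact (hΨ.push ε hε x hx).imp_right fun h3 => ⟨h3.1, fun h4 => h4.elim h2 h3.2⟩
  · have h1 := hL ε hε x hx
    have h2 := hL' ε hε (Φ ε x) (hΦ.mapsTo hε hx)
    calc _ ≤ ‖h (Ψ ε (Φ ε x)) - h (Φ ε x)‖ + ‖h (Φ ε x) - h x‖ :=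
            norm_sub_le_norm_sub_add_norm_sub _ _ _
      _ ≤ _ := by linarith

theorem contMDiffAt (hΦ : IsPush n U W h Φ) {ε : ℝ} (hε : ε ∈ Ioo (-1 : ℝ) 1) (x : N) :
    ContMDiffAt (𝓘(ℝ, ℝ).prod (𝓡 n)) (𝓡 n) ∞ (fun q : ℝ × N => Φ q.1 q.2) (ε, x) :=
  hΦ.smooth.contMDiffAt ((isOpen_Ioo.prod isOpen_univ).mem_nhds ⟨hε, mem_univ _⟩)

theorem contMDiff (hΦ : IsPush n U W h Φ) {ε : ℝ} (hε : ε ∈ Ioo (-1 : ℝ) 1) :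
    ContMDiff (𝓡 n) (𝓡 n) ∞ (Φ ε) := fun x =>
  (hΦ.contMDiffAt hε x).comp x (contMDiffAt_const.prodMk contMDiffAt_id)

end IsPush

/-- Near a point of the closure of `Ω`, points of the closure of the region above a graph move into
the region when they are shifted upwards. -/
theorem add_smul_mem_of_isLipschitzGraph {Ω : Set (EuclideanSpace ℝ (Fin n))}
    {a e : EuclideanSpace ℝ (Fin n)} {r : ℝ} (he : ‖e‖ = 1) {γ : (ℝ ∙ e)ᗮ → ℝ} (hγ : Continuous γ)
    (hΩ : ∀ x ∈ ball a r, x ∈ Ω ↔ γ ((ℝ ∙ e)ᗮ.orthogonalProjectionOnto x) < ⟪e, x⟫)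
    {z : EuclideanSpace ℝ (Fin n)} (hz : z ∈ closure Ω) (hza : z ∈ ball a r) {t : ℝ} (ht : 0 < t)
    (hzt : z + t • e ∈ ball a r) : z + t • e ∈ Ω := by
  have h1 : γ ((ℝ ∙ e)ᗮ.orthogonalProjectionOnto z) ≤ ⟪e, z⟫ := by
    have hcl : IsClosed {x : EuclideanSpace ℝ (Fin n) |
        γ ((ℝ ∙ e)ᗮ.orthogonalProjectionOnto x) ≤ ⟪e, x⟫} :=
      isClosed_le (hγ.comp (ContinuousLinearMap.continuous _)) (by fun_prop)
    have h2 : z ∈ closure (ball a r ∩ Ω) := by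
      exact isOpen_ball.inter_closure ⟨hza, hz⟩
    exact closure_minimal (fun x hx => ((hΩ x hx.1).1 hx.2).le) hcl h2
  have h2 : (ℝ ∙ e)ᗮ.orthogonalProjectionOnto (t • e) = 0 :=
    Submodule.orthogonalProjectionOnto_orthogonal_apply_eq_zero
      (Submodule.smul_mem _ _ (Submodule.mem_span_singleton_self e))
  rw [hΩ _ hzt, map_add, h2, add_zero, inner_add_right, inner_smul_right,
   
    real_inner_self_eq_norm_sq, he]
  linarith

/-- A local push, supported in a chart in which `U` lies above a Lipschitz graph. -/
theorem exists_isPush_of_isLipschitzGraphNear [CompleteSpace F] [T2Space N] [IsManifold (𝓡 n) ∞ N]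
    {φ : OpenPartialHomeomorph N (EuclideanSpace ℝ (Fin n))}
    (hφ : φ ∈ IsManifold.maximalAtlas (𝓡 n) ∞ N) (hU : IsOpen U) {y : N} (hy : y ∈ φ.source)
    (hgraph : IsLipschitzGraphNear (chartImage φ U) (φ y))
    {G : EuclideanSpace ℝ (Fin n) → EuclideanSpace ℝ (Fin n) →L[ℝ] F}
    (hG : HasWeakDeriv (chartImage φ U) (fun z => h (φ.symm z)) G)
    (hc : ContinuousOn (fun z => h (φ.symm z)) (chartImage φ U)) {L : ℝ}
    {T : Set (EuclideanSpace ℝ (Fin n))}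
    (hT : T ∈ 𝓝 (φ y)) (hL : ∀ᵐ z ∂(volume.restrict (chartImage φ U ∩ T)), ‖G z‖ ≤ L) :
    ∃ W ∈ 𝓝 y, ∃ Φ : ℝ → N → N, IsPush n U W h Φ := by
  obtain ⟨r, hr, e, he, γ, ⟨Kγ, hγ⟩, hΩ⟩ := hgraph
  set a := φ y with ha
  have hat : a ∈ φ.target := φ.map_source hy
  obtain ⟨R, hR, hRsub⟩ := Metric.mem_nhds_iff.1
    (inter_mem (inter_mem (ball_mem_nhds a hr) (φ.open_target.mem_nhds hat)) hT)
  set ρ := R / 2 with hρ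
  have hρ0 : 0 < ρ := half_pos hR
  let χ : ContDiffBump a := ⟨ρ / 2, ρ, half_pos hρ0, half_lt_self hρ0⟩
  set S : ℝ → EuclideanSpace ℝ (Fin n) → EuclideanSpace ℝ (Fin n) := fun ε z =>
    z + (ε * ρ * χ z) • e with hS
  have hS0 : ∀ ε z, z ∉ ball a ρ → S ε z = z := fun ε z hz => by
    have : χ z = 0 := by
      rw [← Function.notMem_support, χ.support_eq]; exact hz
    simp [hS, this]
  have hSball : ∀ ε ∈ Ioo (-1 : ℝ) 1, ∀ z ∈ ball a ρ, S ε z ∈ ball a R := fun ε hε z hz => by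
    rw [mem_ball, dist_eq_norm] at hz ⊢
    have h1 : ‖(ε * ρ * χ z) • e‖ ≤ ρ := by
      rw [norm_smul, he, mul_one, Real.norm_eq_abs, abs_mul, abs_mul, abs_of_pos hρ0,
        abs_of_nonneg χ.nonneg]
      calc |ε| * ρ * χ z ≤ 1 * ρ * 1 := by
            gcongr
            · exact χ.nonneg
            · exact (abs_lt.2 hε).le
            · exact χ.le_one
        _ = ρ := by ring
    calc ‖S ε z - a‖ = ‖(z - a) + (ε * ρ * χ z) • e‖ := by rw [hS, add_sub_right_comm]
      _ ≤ ‖z - a‖ + ‖(ε * ρ * χ z) • e‖ := norm_add_le _ _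
      _ < ρ + ρ := by linarith
      _ = R := by rw [hρ]; ring
  have hStarget : ∀ ε ∈ Ioo (-1 : ℝ) 1, ∀ z ∈ φ.target, S ε z ∈ φ.target := fun ε hε z hz => by
    by_cases hzb : z ∈ ball a ρ
    · exact (hRsub (hSball ε hε z hzb)).1.2
    · rwa [hS0 ε z hzb]
  classical
  set Φ : ℝ → N → N := fun ε x => if x ∈ φ.source then φ.symm (S ε (φ x)) else x with hΦ
  have hΦs : ∀ ε x, x ∈ φ.source → Φ ε x = φ.symm (S ε (φ x)) := fun ε x hx => if_pos hx
  have hΦn : ∀ ε x, x ∉ φ.source → Φ ε x = x := fun ε x hx => if_neg hx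
  have hΦid : ∀ ε x, x ∈ φ.source → φ x ∉ ball a ρ → Φ ε x = x := fun ε x hx hxb => by
    rw [hΦs ε x hx, hS0 ε _ hxb, φ.left_inv hx]
  -- along an upward shift the segment stays in `U`
  have hseg : ∀ ε ∈ Ioo (0 : ℝ) 1, ∀ z ∈ closure (chartImage φ U), z ∈ ball a ρ → ∀ t, 0 < t →
      t ≤ 1 → z + (t * (ε * ρ * χ z)) • e ∈ chartImage φ U ∩ ball a R :=
        fun ε hε z hz hzb t ht ht1 => by
    have hpos : 0 < χ z := χ.pos_of_mem_ball hzb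
    have htε : t * ε ∈ Ioo (-1 : ℝ) 1 := by
      have := mul_pos ht hε.1
      have := mul_le_of_le_one_left hε.1.le ht1
      exact ⟨by linarith, by linarith [hε.2]⟩
    have h1 : z + (t * (ε * ρ * χ z)) • e ∈ ball a R := by
      have := hSball (t * ε) htε z hzb
      simpa only [hS, mul_assoc] using this
    exact ⟨add_smul_mem_of_isLipschitzGraph he hγ.continuous hΩ hz
      ((hRsub (ball_subset_ball (by linarith) hzb)).1.1)
      (mul_pos ht (mul_pos (mul_pos hε.1 hρ0) hpos)) (hRsub h1).1.1, h1⟩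
  refine ⟨φ.source ∩ φ ⁻¹' ball a ρ, (φ.isOpen_inter_preimage isOpen_ball).mem_nhds
    ⟨hy, mem_ball_self hρ0⟩, Φ, ?_, ?_, ?_, max L 0 * ρ, ?_⟩
  · rintro ⟨ε, x⟩ ⟨hε, -⟩
    refine ContMDiffAt.contMDiffWithinAt ?_
    by_cases hx : x ∈ φ.source
    · have h1 : ContDiff ℝ ∞ (fun q : ℝ × EuclideanSpace ℝ (Fin n) => S q.1 q.2) :=
        contDiff_snd.add (((contDiff_fst.mul contDiff_const).mul
          (χ.contDiff.comp contDiff_snd)).smul contDiff_const)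
      have h2 : ContMDiffAt (𝓘(ℝ, ℝ).prod (𝓡 n)) 𝓘(ℝ, ℝ × EuclideanSpace ℝ (Fin n)) ∞
          (fun q : ℝ × N => (q.1, φ q.2)) (ε, x) :=
        contMDiffAt_fst.prodMk_space ((contMDiffAt_of_mem_maximalAtlas hφ hx).comp (ε, x)
          contMDiffAt_snd)
      have h3 := (contMDiffAt_symm_of_mem_maximalAtlas hφ (hStarget ε hε _ (φ.map_source hx))).comp
        (ε, x) (h1.contMDiff.contMDiffAt.comp (ε, x) h2)
      refine h3.congr_of_eventuallyEq ?_
      filter_upwards [(continuous_snd.tendsto (ε, x)).eventually (φ.open_source.mem_nhds hx)]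
        with q hq using hΦs _ _ hq
    · refine contMDiffAt_snd.congr_of_eventuallyEq ?_
      have hcomp : IsCompact (φ.symm '' closedBall a ρ) :=
        (isCompact_closedBall a ρ).image_of_continuousOn (φ.continuousOn_symm.mono fun z hz =>
          (hRsub (closedBall_subset_ball (by linarith) hz)).1.2)
      have hx' : x ∉ φ.symm '' closedBall a ρ := by
        rintro ⟨z, hz, rfl⟩
        exact hx (φ.map_target (hRsub (closedBall_subset_ball (by linarith) hz)).1.2)
      filter_upwards [(continuous_snd.tendsto (ε, x)).eventually
        (hcomp.isClosed.isOpen_compl.mem_nhds hx')] with q hq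
      by_cases hqs : q.2 ∈ φ.source
      · exact hΦid _ _ hqs fun hb => hq ⟨φ q.2, ball_subset_closedBall hb, φ.left_inv hqs⟩
      · exact hΦn _ _ hqs
  · intro x
    by_cases hx : x ∈ φ.source
    · simp [hΦs 0 x hx, hS, φ.left_inv hx]
    · exact hΦn 0 x hx
  · intro ε hε x hx
    by_cases hxW : x ∈ φ.source ∩ φ ⁻¹' ball a ρ
    · left
      have h1 : φ x ∈ closure (chartImage φ U) := by
        have h2 : x ∈ closure (φ.source ∩ U) := φ.open_source.inter_closure ⟨hxW.1, hx⟩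
        exact mem_closure_image (φ.continuousAt hxW.1) h2
      have h2 := (hseg ε hε (φ x) h1 hxW.2 1 one_pos le_rfl).1
      rw [one_mul, chartImage_eq] at h2
      rw [hΦs ε x hxW.1]
      exact h2.2
    · right
      refine ⟨?_, hxW⟩
      by_cases hxs : x ∈ φ.source
      · exact hΦid ε x hxs fun hb => hxW ⟨hxs, hb⟩
      · exact hΦn ε x hxs
  · intro ε hε x hx
    by_cases hxW : x ∈ φ.source ∩ φ ⁻¹' ball a ρ
    · have hmem : φ x ∈ chartImage φ U := ⟨x, ⟨hxW.1, hx⟩, rfl⟩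
      have hsub : segment ℝ (φ x) (S ε (φ x)) ⊆ chartImage φ U ∩ ball a R := by
        rw [segment_eq_image']
        rintro _ ⟨t, ht, rfl⟩
        rcases ht.1.eq_or_lt with rfl | ht0
        · simp only [zero_smul, add_zero]
          exact ⟨hmem, ball_subset_ball (by linarith) hxW.2⟩
        · have := hseg ε hε (φ x) (subset_closure hmem) hxW.2 t ht0 ht.2
          simpa only [hS, add_sub_cancel_left, smul_smul] using this
      have hopen : IsOpen (chartImage φ U ∩ ball a R) := (isOpen_chartImage φ hU).inter isOpen_ball
      have h1 := norm_sub_le_of_segment_subset hopen (hG.mono inter_subset_left)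
        (hc.mono inter_subset_left) (L := max L 0) (by
          have := ae_restrict_of_ae_restrict_of_subset (inter_subset_inter_right (chartImage φ U)
            (hRsub.trans inter_subset_right)) hL
          filter_upwards [this] with z hz using hz.trans (le_max_left _ _)) hsub
      rw [φ.left_inv hxW.1] at h1
      rw [hΦs ε x hxW.1]
      refine h1.trans ?_
      have h2 : ‖S ε (φ x) - φ x‖ ≤ ρ * ε := by
        rw [hS, add_sub_cancel_left, norm_smul, he, mul_one, Real.norm_of_nonneg
          (mul_nonneg (mul_nonneg hε.1.le hρ0.le) χ.nonneg)]
        calc ε * ρ * χ (φ x) ≤ ε * ρ * 1 := by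
              gcongr
              · exact mul_nonneg hε.1.le hρ0.le
              · exact χ.le_one
          _ = ρ * ε := by ring
      rw [mul_assoc]
      gcongr
    · have : Φ ε x = x := by
        by_cases hxs : x ∈ φ.source
        · exact hΦid ε x hxs fun hb => hxW ⟨hxs, hb⟩
        · exact hΦn ε x hxs
      rw [this, sub_self, norm_zero]
      have := hε.1
      positivity

end Push

/-! ### Maps converging to the identity -/

section NearId

variable {n : ℕ} {F : Type*} [NormedAddCommGroup F] [NormedSpace ℝ F]
  {a : EuclideanSpace ℝ (Fin n)} {r : ℝ} {p : ℝ≥0∞}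

/-- The derivative with respect to the second variable. -/
def partialDeriv (Ψ : ℝ × EuclideanSpace ℝ (Fin n) → F) (q : ℝ × EuclideanSpace ℝ (Fin n)) :
    EuclideanSpace ℝ (Fin n) →L[ℝ] F :=
  fderiv ℝ (fun z => Ψ (q.1, z)) q.2

theorem partialDeriv_eq {Ψ : ℝ × EuclideanSpace ℝ (Fin n) → F}
    {q : ℝ × EuclideanSpace ℝ (Fin n)} (h : DifferentiableAt ℝ Ψ q) :
    partialDeriv Ψ q = (fderiv ℝ Ψ q).comp
      (ContinuousLinearMap.inr ℝ ℝ (EuclideanSpace ℝ (Fin n))) :=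
  (h.hasFDerivAt.comp q.2 (hasFDerivAt_prodMk_right q.1 q.2)).fderiv

theorem eventually_contDiffAt_partialDeriv {Ψ : ℝ × EuclideanSpace ℝ (Fin n) → F}
    {q : ℝ × EuclideanSpace ℝ (Fin n)} (h : ∀ᶠ q' in 𝓝 q, ContDiffAt ℝ ∞ Ψ q') :
    ∀ᶠ q' in 𝓝 q, ContDiffAt ℝ ∞ (partialDeriv Ψ) q' := by
  filter_upwards [h.eventually_nhds] with q' hq'
  have h1 : ContDiffAt ℝ ∞ (fun q => (fderiv ℝ Ψ q).comp
      (ContinuousLinearMap.inr ℝ ℝ (EuclideanSpace ℝ (Fin n)))) q' :=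
    (hq'.self_of_nhds.fderiv_right (by simp)).clm_comp contDiffAt_const
  refine h1.congr_of_eventuallyEq ?_
  filter_upwards [hq'] with q'' h2 using partialDeriv_eq (h2.differentiableAt (by simp))

/-- A map which is smooth in time and space near `(0, a)` converges, as time tends to zero,
uniformly on every ball around `a` of sufficiently small radius. -/
theorem exists_uniform_ball {Ψ : ℝ × EuclideanSpace ℝ (Fin n) → F}
    (h : ∀ᶠ q in 𝓝 ((0 : ℝ), a), ContDiffAt ℝ ∞ Ψ q) {Ψ₀ : EuclideanSpace ℝ (Fin n) → F}
    (h0 : ∀ᶠ z in 𝓝 a, Ψ (0, z) = Ψ₀ z) :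
    ∃ r > 0, ∀ r' ≤ r, ∀ η > 0, ∀ᶠ ε in 𝓝 (0 : ℝ), ∀ x ∈ ball a r', ContDiffAt ℝ ∞ Ψ (ε, x) ∧
      ‖Ψ (ε, x) - Ψ₀ x‖ ≤ η := by
  have hcurve : Tendsto (fun y : EuclideanSpace ℝ (Fin n) => ((0 : ℝ), y)) (𝓝 a) (𝓝 (0, a)) :=
    (Continuous.prodMk_right (0 : ℝ)).tendsto a
  obtain ⟨r, hr, h1⟩ := Metric.nhds_basis_closedBall.eventually_iff.1
    ((hcurve.eventually h.eventually_nhds).and h0.eventually_nhds)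
  refine ⟨r, hr, fun r' hr' η hη => ?_⟩
  have key : ∀ᶠ ε in 𝓝 (0 : ℝ), ∀ x ∈ closedBall a r, ContDiffAt ℝ ∞ Ψ (ε, x) ∧
      ‖Ψ (ε, x) - Ψ₀ x‖ ≤ η := by
    refine (isCompact_closedBall a r).eventually_forall_of_forall_eventually fun y hy => ?_
    obtain ⟨h2, h3⟩ := h1 hy
    refine h2.and ?_
    have h4 : ContinuousAt Ψ (0, y) := h2.self_of_nhds.continuousAt
    have h5 : ContinuousAt (fun q : ℝ × EuclideanSpace ℝ (Fin n) => Ψ (0, q.2)) (0, y) :=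
      ContinuousAt.comp (f := fun q : ℝ × EuclideanSpace ℝ (Fin n) => ((0 : ℝ), q.2)) h4
        (by fun_prop)
    have h6 : ∀ᶠ q in 𝓝 ((0 : ℝ), y), ‖Ψ q - Ψ (0, q.2)‖ < η :=
      (h4.sub h5).norm.eventually (gt_mem_nhds (by simpa using hη))
    filter_upwards [h6, (continuous_snd.tendsto ((0 : ℝ), y)).eventually h3] with q hq hq'
    rw [← hq']
    exact hq.le
  filter_upwards [key] with ε hε x hx
  exact hε x (ball_subset_closedBall (ball_subset_ball hr' hx))

/-- The maps `τ k` converge to the identity in `C^2` on the ball of radius `r` around `a`. -/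
def TendstoIdC2 (a : EuclideanSpace ℝ (Fin n)) (r : ℝ)
    (τ : ℕ → EuclideanSpace ℝ (Fin n) → EuclideanSpace ℝ (Fin n)) : Prop :=
  ∀ η > 0, ∀ᶠ k in atTop, ∀ x ∈ ball a r, ContDiffAt ℝ ∞ (τ k) x ∧ ‖τ k x - x‖ ≤ η ∧
    ‖fderiv ℝ (τ k) x - ContinuousLinearMap.id ℝ _‖ ≤ η ∧ ‖fderiv ℝ (fderiv ℝ (τ k)) x‖ ≤ η

/-- A smooth isotopy which starts at the identity is close to it in `C^2` for small times. -/
theorem exists_tendstoIdC2 {Ψ : ℝ × EuclideanSpace ℝ (Fin n) → EuclideanSpace ℝ (Fin n)}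
    (h : ∀ᶠ q in 𝓝 ((0 : ℝ), a), ContDiffAt ℝ ∞ Ψ q) (h0 : ∀ᶠ z in 𝓝 a, Ψ (0, z) = z) :
    ∃ r > 0, ∀ r' ≤ r, ∀ ε : ℕ → ℝ, Tendsto ε atTop (𝓝 0) →
      TendstoIdC2 a r' fun k x => Ψ (ε k, x) := by
  have h' := eventually_contDiffAt_partialDeriv h
  have h0' : ∀ᶠ z in 𝓝 a, partialDeriv Ψ (0, z) =
      ContinuousLinearMap.id ℝ (EuclideanSpace ℝ (Fin n)) := by
    filter_upwards [h0.eventually_nhds] with z hz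
    have : (fun y => Ψ (0, y)) =ᶠ[𝓝 z] id := hz
    simp only [partialDeriv, this.fderiv_eq, fderiv_id]
  have h0'' : ∀ᶠ z in 𝓝 a, partialDeriv (partialDeriv Ψ) (0, z) = 0 := by
    filter_upwards [h0'.eventually_nhds] with z hz
    have : (fun y => partialDeriv Ψ (0, y)) =ᶠ[𝓝 z]
      fun _ => ContinuousLinearMap.id ℝ (EuclideanSpace ℝ (Fin n)) := hz
    simp only [partialDeriv] at this ⊢
    rw [this.fderiv_eq]
    simp
  obtain ⟨r₁, hr₁, h1⟩ := exists_uniform_ball h h0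
  obtain ⟨r₂, hr₂, h2⟩ := exists_uniform_ball h' h0'
  obtain ⟨r₃, hr₃, h3⟩ := exists_uniform_ball (Ψ₀ := fun _ => 0)
    (eventually_contDiffAt_partialDeriv h') h0''
  refine ⟨min r₁ (min r₂ r₃), by positivity, fun r' hr' ε hε η hη => ?_⟩
  filter_upwards [hε.eventually (h1 r' (hr'.trans (min_le_left _ _)) η hη),
    hε.eventually (h2 r' (hr'.trans ((min_le_right _ _).trans (min_le_left _ _))) η hη),
    hε.eventually (h3 r' (hr'.trans ((min_le_right _ _).trans (min_le_right _ _))) η hη)]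
    with k e1 e2 e3 x hx
  refine ⟨(e1 x hx).1.comp x (contDiffAt_const.prodMk contDiffAt_id), (e1 x hx).2, (e2 x hx).2, ?_⟩
  have := (e3 x hx).2
  rwa [sub_zero] at this

namespace TendstoIdC2

variable {τ : ℕ → EuclideanSpace ℝ (Fin n) → EuclideanSpace ℝ (Fin n)}

theorem eventually_injOn (h : TendstoIdC2 a r τ) : ∀ᶠ k in atTop, InjOn (τ k) (ball a r) := by
  filter_upwards [h (1 / 2) (by norm_num)] with k hk x hx y hy hxy
  have h1 := (convex_ball a r).norm_image_sub_le_of_norm_hasFDerivWithin_le (𝕜 := ℝ) (C := 1 / 2)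
    (f := fun x => τ k x - x) (f' := fun x => fderiv ℝ (τ k) x - ContinuousLinearMap.id ℝ _)
    (fun z hz => ((((hk z hz).1.differentiableAt (by simp)).hasFDerivAt.sub
      (hasFDerivAt_id z)).hasFDerivWithinAt)) (fun z hz => (hk z hz).2.2.1) hx hy
  have h2 : τ k y - y - (τ k x - x) = -(y - x) := by rw [hxy]; abel
  rw [h2, norm_neg] at h1
  have h3 : ‖y - x‖ = 0 := by linarith [norm_nonneg (y - x)]
  exact (sub_eq_zero.1 (norm_eq_zero.1 h3)).symm

theorem eventually_le_abs_det (h : TendstoIdC2 a r τ) :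
    ∀ᶠ k in atTop, ∀ x ∈ ball a r, 1 / 2 ≤ |(fderiv ℝ (τ k) x).det| := by
  have h1 : ∀ᶠ L in 𝓝 (ContinuousLinearMap.id ℝ (EuclideanSpace ℝ (Fin n))), 1 / 2 < |L.det| := by
    refine (ContinuousLinearMap.continuous_det.abs.tendsto _).eventually (lt_mem_nhds ?_)
    simp only [ContinuousLinearMap.det, ContinuousLinearMap.coe_id, LinearMap.det_id]
    norm_num
  obtain ⟨η, hη, h2⟩ := Metric.nhds_basis_closedBall.eventually_iff.1 h1
  filter_upwards [h η hη] with k hk x hx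
  exact (h2 (by rw [mem_closedBall, dist_eq_norm]; exact (hk x hx).2.2.1)).le

/-- Composition of functions which converge on the varying sets `Bk k` with near-identity maps which
map into these sets. -/
theorem jetConv_comp (hr : TendstoIdC2 a r τ) (hp1 : 1 ≤ p) (hp : p ≠ ⊤)
    {Ω B : Set (EuclideanSpace ℝ (Fin n))} (hΩ : MeasurableSet Ω) (hB : MeasurableSet B)
    (hAB : ball a r ∩ Ω ⊆ B) {Bk : ℕ → Set (EuclideanSpace ℝ (Fin n))}
    (hBkm : ∀ᶠ k in atTop, MeasurableSet (Bk k)) (hBk : ∀ᶠ k in atTop, Bk k ⊆ B)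
    (hmaps : ∀ᶠ k in atTop, MapsTo (τ k) (ball a r ∩ Ω) (Bk k))
    {v : ℕ → EuclideanSpace ℝ (Fin n) → F}
    (hv : ∀ᶠ k in atTop, ∀ x ∈ Bk k, ContDiffAt ℝ ∞ (v k) x)
    {C : ℝ} (hC : ∀ᶠ k in atTop, ∀ x ∈ Bk k, ‖v k x‖ ≤ C)
    {u : EuclideanSpace ℝ (Fin n) → F} (hu : MemLp u p (volume.restrict B))
    (hvu : Tendsto (fun k => eLpNorm (fun x => v k x - u x) p (volume.restrict (Bk k)))
      atTop (𝓝 0))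
    {G : EuclideanSpace ℝ (Fin n) → EuclideanSpace ℝ (Fin n) →L[ℝ] F}
    (hG : MemLp G p (volume.restrict B))
    (hvG : Tendsto (fun k => eLpNorm (fun x => fderiv ℝ (v k) x - G x) p (volume.restrict (Bk k)))
      atTop (𝓝 0)) :
    JetConv p (ball a r ∩ Ω) (fun k x => v k (τ k x)) ∧
      LpTendsto p (volume.restrict (ball a r ∩ Ω)) (fun k x => v k (τ k x)) u ∧
      LpTendsto p (volume.restrict (ball a r ∩ Ω))
        (fun k => fderiv ℝ (fun x => v k (τ k x))) G := by
  have hA : MeasurableSet (ball a r ∩ Ω) := measurableSet_ball.inter hΩ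
  have hfin : IsFiniteMeasure (volume.restrict (ball a r ∩ Ω)) :=
    ⟨by simpa using (volume_ball_inter_ne_top a r).lt_top⟩
  have hτ' : LpTendsto p (volume.restrict (ball a r ∩ Ω)) (fun k => fderiv ℝ (τ k))
      (fun _ => ContinuousLinearMap.id ℝ (EuclideanSpace ℝ (Fin n))) := by
    refine LpTendsto.of_uniform ?_ (memLp_const _) fun η hη => ?_
    · filter_upwards [hr 1 one_pos] with k hk
      exact aestronglyMeasurable_of_contDiffAt hA fun x hx => (hk x hx.1).1.fderiv_infty
    · filter_upwards [hr η hη] with k hk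
      filter_upwards [ae_restrict_mem hA] with x hx using (hk x hx.1).2.2.1
  have := JetConv.comp_near_id hp1 hp hA hB (volume_ball_inter_ne_top a r) hAB hBkm hBk
    ((hr 1 one_pos).mono fun k hk x hx => (hk x hx.1).1)
    (hr.eventually_injOn.mono fun k hk => hk.mono inter_subset_left) hmaps (c := 1 / 2)
    (by norm_num)
    (hr.eventually_le_abs_det.mono fun k hk x hx => hk x hx.1)
    (fun ε hε => (hr ε hε).mono fun k hk x hx => (hk x hx.1).2.1)
    (D := ‖ContinuousLinearMap.id ℝ (EuclideanSpace ℝ (Fin n))‖ + 1) ?_ hτ' hv hC hu hvu hG hvG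
  · simpa only [ContinuousLinearMap.comp_id] using this
  · filter_upwards [hr 1 one_pos] with k hk x hx
    have h1 := (hk x hx.1).2.2.1
    have h2 := norm_le_norm_add_norm_sub' (fderiv ℝ (τ k) x)
      (ContinuousLinearMap.id ℝ (EuclideanSpace ℝ (Fin n)))
    linarith

/-- The derivatives of the maps `τ k` converge together with their own derivatives. -/
theorem jetConv_fderiv (hr : TendstoIdC2 a r τ)
    {Ω : Set (EuclideanSpace ℝ (Fin n))} (hΩ : MeasurableSet Ω) :
    JetConv p (ball a r ∩ Ω) (fun k => fderiv ℝ (τ k)) := by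
  have hA : MeasurableSet (ball a r ∩ Ω) := measurableSet_ball.inter hΩ
  have hfin : IsFiniteMeasure (volume.restrict (ball a r ∩ Ω)) :=
    ⟨by simpa using (volume_ball_inter_ne_top a r).lt_top⟩
  refine ⟨(hr 1 one_pos).mono fun k hk x hx => (hk x hx.1).1.fderiv_infty,
    ⟨‖ContinuousLinearMap.id ℝ (EuclideanSpace ℝ (Fin n))‖ + 1, ?_⟩,
    ⟨fun _ => ContinuousLinearMap.id ℝ (EuclideanSpace ℝ (Fin n)), ?_⟩, ⟨fun _ => 0, ?_⟩⟩
  · filter_upwards [hr 1 one_pos] with k hk x hx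
    have h1 := (hk x hx.1).2.2.1
    have h2 := norm_le_norm_add_norm_sub' (fderiv ℝ (τ k) x)
      (ContinuousLinearMap.id ℝ (EuclideanSpace ℝ (Fin n)))
    linarith
  · refine LpTendsto.of_uniform ?_ (memLp_const _) fun η hη => ?_
    · filter_upwards [hr 1 one_pos] with k hk
      exact aestronglyMeasurable_of_contDiffAt hA fun x hx => (hk x hx.1).1.fderiv_infty
    · filter_upwards [hr η hη] with k hk
      filter_upwards [ae_restrict_mem hA] with x hx using (hk x hx.1).2.2.1
  · refine LpTendsto.of_uniform ?_ (memLp_const _) fun η hη => ?_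
    · filter_upwards [hr 1 one_pos] with k hk
      exact aestronglyMeasurable_of_contDiffAt hA fun x hx =>
        (hk x hx.1).1.fderiv_infty.fderiv_infty
    · filter_upwards [hr η hη] with k hk
      filter_upwards [ae_restrict_mem hA] with x hx
      rw [sub_zero]
      exact (hk x hx.1).2.2.2

/-- The chain rule `D (v ∘ τ) = (D v ∘ τ) ∘ D τ` on the level of convergence. -/
theorem jetConv_fderiv_comp (hr : TendstoIdC2 a r τ) (hp1 : 1 ≤ p) (hp : p ≠ ⊤)
    {Ω : Set (EuclideanSpace ℝ (Fin n))} (hΩ : MeasurableSet Ω)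
    {Bk : ℕ → Set (EuclideanSpace ℝ (Fin n))}
    (hmaps : ∀ᶠ k in atTop, MapsTo (τ k) (ball a r ∩ Ω) (Bk k))
    {v : ℕ → EuclideanSpace ℝ (Fin n) → F}
    (hv : ∀ᶠ k in atTop, ∀ x ∈ Bk k, ContDiffAt ℝ ∞ (v k) x)
    (h : JetConv p (ball a r ∩ Ω) (fun k x => fderiv ℝ (v k) (τ k x))) :
    JetConv p (ball a r ∩ Ω) (fun k => fderiv ℝ (fun x => v k (τ k x))) := by
  have hA : MeasurableSet (ball a r ∩ Ω) := measurableSet_ball.inter hΩ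
  refine (h.bilin hp1 hp hA (ContinuousLinearMap.compL ℝ (EuclideanSpace ℝ (Fin n))
    (EuclideanSpace ℝ (Fin n)) F) (hr.jetConv_fderiv hΩ)).congr hA ?_
  filter_upwards [hmaps, hv, hr 1 one_pos] with k h1 h2 h3 x hx
  filter_upwards [(h3 x hx.1).1.continuousAt.eventually (h2 _ (h1 hx)).eventually_differentiableAt,
    (h3 x hx.1).1.eventually_differentiableAt] with y hy hy'
  exact (fderiv_comp y hy hy').symm

end TendstoIdC2

end NearId

/-! ### Bounds in charts and the global isotopy -/

theorem ContinuousAt.bilinearComp_self {E X : Type*} [NormedAddCommGroup E] [NormedSpace ℝ E]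
    [FiniteDimensional ℝ E] [TopologicalSpace X] {B : X → E →L[ℝ] E →L[ℝ] ℝ} {D : X → E →L[ℝ] E}
    {a : X} (hB : ContinuousAt B a) (hD : ContinuousAt D a) :
    ContinuousAt (fun q => ContinuousLinearMap.bilinearComp (B q) (D q) (D q)) a := by
  refine continuousAt_clm_apply.2 fun v => continuousAt_clm_apply.2 fun w => ?_
  exact (hB.clm_apply (hD.clm_apply continuousAt_const)).clm_apply
    (hD.clm_apply continuousAt_const)

section WeakImmersion

variable {n : ℕ} {N : Type*} [TopologicalSpace N] [ChartedSpace (EuclideanSpace ℝ (Fin n)) N]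
  {F : Type*} [NormedAddCommGroup F] [NormedSpace ℝ F]
  {φ : OpenPartialHomeomorph N (EuclideanSpace ℝ (Fin n))} {U W : Set N} {h : N → F}
  {Φ : ℝ → N → N}

theorem ContinuousOn.comp_chart_symm [IsManifold (𝓡 n) ∞ N] (hh : ContinuousOn h U) :
    ContinuousOn (fun z => h (φ.symm z)) (chartImage φ U) := by
  rw [chartImage_eq]
  exact hh.comp (φ.continuousOn_symm.mono inter_subset_left) fun z hz => hz.2

variable [IsManifold (𝓡 n) ∞ N]
  {g : Bundle.ContMDiffRiemannianMetric (𝓡 n) ∞ (EuclideanSpace ℝ (Fin n))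
      (fun x : N => TangentSpace (𝓡 n) x)}
  {df : ∀ x : N, TangentSpace (𝓡 n) x →L[ℝ] F} {Λ : ℝ}

theorem ae_chartMetric_le
    (hb : AlmostEverywhereOn n U fun x => ∀ v : TangentSpace (𝓡 n) x,
      Λ⁻¹ * g.inner x v v ≤ ‖df x v‖ ^ 2 ∧ ‖df x v‖ ^ 2 ≤ Λ * g.inner x v v)
    (hφ : φ ∈ IsManifold.maximalAtlas (𝓡 n) ∞ N) :
    ∀ᵐ z ∂(volume.restrict (chartImage φ U)), ∀ w,
      Λ⁻¹ * chartMetric g φ z w w ≤ ‖chartDeriv df φ z w‖ ^ 2 ∧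
        ‖chartDeriv df φ z w‖ ^ 2 ≤ Λ * chartMetric g φ z w w := by
  filter_upwards [hb φ hφ] with z hz w using hz (chartSymmDeriv φ z w)

theorem exists_ae_norm_chartDeriv_le (hΛ : 0 < Λ)
    (hb : AlmostEverywhereOn n U fun x => ∀ v : TangentSpace (𝓡 n) x,
      Λ⁻¹ * g.inner x v v ≤ ‖df x v‖ ^ 2 ∧ ‖df x v‖ ^ 2 ≤ Λ * g.inner x v v)
    (hφ : φ ∈ IsManifold.maximalAtlas (𝓡 n) ∞ N) {a : EuclideanSpace ℝ (Fin n)}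
    (ha : a ∈ φ.target) : ∃ T ∈ 𝓝 a, ∃ L : ℝ,
      ∀ᵐ z ∂(volume.restrict (chartImage φ U ∩ T)), ‖chartDeriv df φ z‖ ≤ L := by
  obtain ⟨r, hr, h1⟩ := Metric.eventually_nhds_iff_ball.1 (eventually_chartMetric_le g hφ ha)
  refine ⟨ball a r, ball_mem_nhds a hr, √(Λ * (2 * ‖chartMetric g φ a‖)), ?_⟩
  have h2 : ∀ᵐ z ∂(volume.restrict (chartImage φ U ∩ ball a r)), z ∈ ball a r :=
    ae_restrict_of_ae_restrict_of_subset inter_subset_right (ae_restrict_mem measurableSet_ball)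
  filter_upwards [ae_restrict_of_ae_restrict_of_subset inter_subset_left (ae_chartMetric_le hb hφ),
    h2] with z hz hzr
  refine ContinuousLinearMap.opNorm_le_bound _ (Real.sqrt_nonneg _) fun w => ?_
  have h3 : chartMetric g φ a w w ≤ ‖chartMetric g φ a‖ * ‖w‖ * ‖w‖ :=
    (le_abs_self _).trans ((chartMetric g φ a).le_opNorm₂ w w)
  have h4 : ‖chartDeriv df φ z w‖ ^ 2 ≤ Λ * (2 * ‖chartMetric g φ a‖) * ‖w‖ ^ 2 := by
    calc _ ≤ Λ * chartMetric g φ z w w := (hz w).2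
      _ ≤ Λ * (2 * (‖chartMetric g φ a‖ * ‖w‖ * ‖w‖)) := by
        gcongr; linarith [((h1 z hzr) w).1]
      _ = _ := by ring
  refine (sq_le_sq₀ (norm_nonneg _) (by positivity)).1 ?_
  rwa [mul_pow, Real.sq_sqrt (by positivity)]

/-- The closure of a domain with Lipschitz boundary can be pushed into the domain by a small
isotopy. -/
theorem exists_isPush [T2Space N] [CompleteSpace F] (hU : IsOpen U) (hUc : IsCompact (closure U))
    (hLip : HasLipschitzBoundary (n := n) U) (hh : ContinuousOn h U)
    (hdf : IsWeakDifferential U h df) (hΛ : 0 < Λ)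
    (hb : AlmostEverywhereOn n U fun x => ∀ v : TangentSpace (𝓡 n) x,
      Λ⁻¹ * g.inner x v v ≤ ‖df x v‖ ^ 2 ∧ ‖df x v‖ ^ 2 ≤ Λ * g.inner x v v) :
    ∃ Φ, IsPush n U (closure U) h Φ := by
  refine hUc.induction_on (p := fun W => ∃ Φ, IsPush n U W h Φ)
    ⟨_, IsPush.const.mono (empty_subset _)⟩ (fun s t hst ⟨Φ, hΦ⟩ => ⟨Φ, hΦ.mono hst⟩)
    (fun s t ⟨Φ, hΦ⟩ ⟨Ψ, hΨ⟩ => ⟨_, hΨ.comp hΦ⟩) fun x hx => ?_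
  by_cases hxU : x ∈ U
  · exact ⟨U, mem_nhdsWithin_of_mem_nhds (hU.mem_nhds hxU), _, IsPush.const⟩
  · have hxf : x ∈ frontier U := ⟨hx, fun h => hxU (interior_subset h)⟩
    obtain ⟨φ, hφ, hxφ, hgr⟩ := hLip x hxf
    obtain ⟨T, hT, L, hL⟩ := exists_ae_norm_chartDeriv_le hΛ hb hφ (φ.map_source hxφ)
    obtain ⟨W, hW, Φ, hΦ⟩ := exists_isPush_of_isLipschitzGraphNear hφ hU hxφ hgr (hdf φ hφ)
      hh.comp_chart_symm hT hL
    exact ⟨W, mem_nhdsWithin_of_mem_nhds hW, Φ, hΦ⟩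

namespace IsPush

theorem contMDiffAt_chart (hΦ : IsPush n U W h Φ) (hφ : φ ∈ IsManifold.maximalAtlas (𝓡 n) ∞ N)
    {ε : ℝ} (hε : ε ∈ Ioo (-1 : ℝ) 1) {z : EuclideanSpace ℝ (Fin n)} (hz : z ∈ φ.target)
    (hz' : Φ ε (φ.symm z) ∈ φ.source) :
    ContDiffAt ℝ ∞ (fun q : ℝ × EuclideanSpace ℝ (Fin n) => φ (Φ q.1 (φ.symm q.2))) (ε, z) := by
  rw [← contMDiffAt_iff_contDiffAt]
  have h1 : ContMDiffAt 𝓘(ℝ, ℝ × EuclideanSpace ℝ (Fin n)) (𝓘(ℝ, ℝ).prod (𝓡 n)) ∞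
      (fun q : ℝ × EuclideanSpace ℝ (Fin n) => (q.1, φ.symm q.2)) (ε, z) :=
    contDiffAt_fst.contMDiffAt.prodMk ((contMDiffAt_symm_of_mem_maximalAtlas hφ hz).comp (ε, z)
      contDiffAt_snd.contMDiffAt)
  exact (contMDiffAt_of_mem_maximalAtlas hφ hz').comp (ε, z)
    ((hΦ.contMDiffAt hε (φ.symm z)).comp (ε, z) h1)

theorem contDiffAt_chart_slice (hΦ : IsPush n U W h Φ)
    (hφ : φ ∈ IsManifold.maximalAtlas (𝓡 n) ∞ N)
    {ε : ℝ} (hε : ε ∈ Ioo (-1 : ℝ) 1) {z : EuclideanSpace ℝ (Fin n)} (hz : z ∈ φ.target)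
    (hz' : Φ ε (φ.symm z) ∈ φ.source) :
    ContDiffAt ℝ ∞ (fun z => φ (Φ ε (φ.symm z))) z :=
  ContDiffAt.comp (g := fun q : ℝ × EuclideanSpace ℝ (Fin n) => φ (Φ q.1 (φ.symm q.2)))
    (f := fun z => (ε, z)) z
    (hΦ.contMDiffAt_chart hφ hε hz hz') (contDiffAt_const.prodMk contDiffAt_id)

theorem eventually_mem_chart (hΦ : IsPush n U W h Φ) {z : EuclideanSpace ℝ (Fin n)}
    (hz : z ∈ φ.target) : ∀ᶠ q : ℝ × EuclideanSpace ℝ (Fin n) in 𝓝 (0, z),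
      q.1 ∈ Ioo (-1 : ℝ) 1 ∧ q.2 ∈ φ.target ∧ Φ q.1 (φ.symm q.2) ∈ φ.source := by
  have h1 : ContinuousAt (fun q : ℝ × N => Φ q.1 q.2) (0, φ.symm z) :=
    (hΦ.contMDiffAt (by norm_num) _).continuousAt
  have h2 : ContinuousAt (fun q : ℝ × EuclideanSpace ℝ (Fin n) => (q.1, φ.symm q.2)) (0, z) :=
    continuousAt_fst.prodMk ((φ.continuousAt_symm hz).comp continuousAt_snd)
  have h3 : ContinuousAt (fun q : ℝ × EuclideanSpace ℝ (Fin n) => Φ q.1 (φ.symm q.2)) (0, z) :=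
    ContinuousAt.comp (g := fun q : ℝ × N => Φ q.1 q.2)
      (f := fun q : ℝ × EuclideanSpace ℝ (Fin n) => (q.1, φ.symm q.2)) h1 h2
  refine (continuousAt_fst.eventually (Ioo_mem_nhds (by norm_num) (by norm_num))).and
    ((continuousAt_snd.eventually (φ.open_target.mem_nhds hz)).and
      (h3.eventually (φ.open_source.mem_nhds ?_)))
  simpa only [hΦ.zero] using φ.map_target hz

theorem eventually_contDiffAt_chart (hΦ : IsPush n U W h Φ)
    (hφ : φ ∈ IsManifold.maximalAtlas (𝓡 n) ∞ N) {z : EuclideanSpace ℝ (Fin n)}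
    (hz : z ∈ φ.target) : ∀ᶠ q : ℝ × EuclideanSpace ℝ (Fin n) in 𝓝 (0, z),
      ContDiffAt ℝ ∞ (fun q : ℝ × EuclideanSpace ℝ (Fin n) => φ (Φ q.1 (φ.symm q.2))) q := by
  filter_upwards [hΦ.eventually_mem_chart hz] with q hq
  exact hΦ.contMDiffAt_chart hφ hq.1 hq.2.1 hq.2.2

theorem eventually_chart_zero (hΦ : IsPush n U W h Φ) {z : EuclideanSpace ℝ (Fin n)}
    (hz : z ∈ φ.target) : ∀ᶠ y in 𝓝 z, φ (Φ 0 (φ.symm y)) = y := by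
  filter_upwards [φ.open_target.mem_nhds hz] with y hy
  rw [hΦ.zero, φ.right_inv hy]

/-- In charts, the isotopy tends to the identity in `C^2`. -/
theorem exists_tendstoIdC2 (hΦ : IsPush n U W h Φ)
    (hφ : φ ∈ IsManifold.maximalAtlas (𝓡 n) ∞ N) {z : EuclideanSpace ℝ (Fin n)}
    (hz : z ∈ φ.target) : ∃ r > 0, ∀ r' ≤ r, ∀ ε : ℕ → ℝ, Tendsto ε atTop (𝓝 0) →
      TendstoIdC2 z r' fun k y => φ (Φ (ε k) (φ.symm y)) :=
  _root_.exists_tendstoIdC2 (hΦ.eventually_contDiffAt_chart hφ hz) (hΦ.eventually_chart_zero hz)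

end IsPush

theorem inner_eq_chartMetric (g : Bundle.ContMDiffRiemannianMetric (𝓡 n) ∞
      (EuclideanSpace ℝ (Fin n)) (fun x : N => TangentSpace (𝓡 n) x))
    (hφ : φ ∈ IsManifold.maximalAtlas (𝓡 n) ∞ N) {x : N} (hx : x ∈ φ.source)
    (v : TangentSpace (𝓡 n) x) : g.inner x v v =
      chartMetric g φ (φ x) (mfderiv (𝓡 n) (𝓡 n) φ x v) (mfderiv (𝓡 n) (𝓡 n) φ x v) := by
  change modelInner g x v v = modelInner g (φ.symm (φ x))
    (mfderiv (𝓡 n) (𝓡 n) φ.symm (φ x) (mfderiv (𝓡 n) (𝓡 n) φ x v))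
    (mfderiv (𝓡 n) (𝓡 n) φ.symm (φ x) (mfderiv (𝓡 n) (𝓡 n) φ x v))
  rw [φ.left_inv hx]
  erw [mfderiv_chart_symm_apply hφ hx v]

/-- For small times the differential of the isotopy is nearly an isometry. -/
theorem IsPush.eventually_inner_le (hΦ : IsPush n U W h Φ) (g : Bundle.ContMDiffRiemannianMetric
      (𝓡 n) ∞ (EuclideanSpace ℝ (Fin n)) (fun x : N => TangentSpace (𝓡 n) x)) (x₀ : N) :
    ∀ᶠ q : ℝ × N in 𝓝 (0, x₀), ∀ v : TangentSpace (𝓡 n) q.2,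
      g.inner (Φ q.1 q.2) (mfderiv (𝓡 n) (𝓡 n) (Φ q.1) q.2 v) (mfderiv (𝓡 n) (𝓡 n) (Φ q.1) q.2 v)
        ≤ 4 * g.inner q.2 v v ∧ g.inner q.2 v v ≤ 4 * g.inner (Φ q.1 q.2)
          (mfderiv (𝓡 n) (𝓡 n) (Φ q.1) q.2 v) (mfderiv (𝓡 n) (𝓡 n) (Φ q.1) q.2 v) := by
  set φ := chartAt (EuclideanSpace ℝ (Fin n)) x₀ with hφdef
  have hφ : φ ∈ IsManifold.maximalAtlas (𝓡 n) ∞ N := IsManifold.chart_mem_maximalAtlas x₀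
  have hx₀ : x₀ ∈ φ.source := mem_chart_source _ x₀
  have ha : φ x₀ ∈ φ.target := φ.map_source hx₀
  set Ψ : ℝ × EuclideanSpace ℝ (Fin n) → EuclideanSpace ℝ (Fin n) :=
    fun q => φ (Φ q.1 (φ.symm q.2)) with hΨ
  set B : ℝ × EuclideanSpace ℝ (Fin n) → EuclideanSpace ℝ (Fin n) →L[ℝ] EuclideanSpace ℝ (Fin n)
    →L[ℝ] ℝ := fun q => ContinuousLinearMap.bilinearComp (chartMetric g φ (Ψ q)) (partialDeriv Ψ q)
      (partialDeriv Ψ q) with hB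
  have hsm := hΦ.eventually_contDiffAt_chart hφ ha
  have hΨ0 : Ψ (0, φ x₀) = φ x₀ := (hΦ.eventually_chart_zero ha).self_of_nhds
  have hD0 : partialDeriv Ψ (0, φ x₀) = ContinuousLinearMap.id ℝ _ := by
    have : (fun y => Ψ (0, y)) =ᶠ[𝓝 (φ x₀)] id := hΦ.eventually_chart_zero ha
    simp only [partialDeriv, this.fderiv_eq, fderiv_id]
  have hB0 : B (0, φ x₀) = chartMetric g φ (φ x₀) := by
    simp only [hB, hΨ0, hD0]
    rfl
  have hBc : ContinuousAt B (0, φ x₀) := by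
    have h1 : ContinuousAt (fun q => chartMetric g φ (Ψ q)) (0, φ x₀) := by
      refine ContinuousAt.comp (g := chartMetric g φ) ?_ hsm.self_of_nhds.continuousAt
      rw [hΨ0]
      exact continuousAt_chartMetric g hφ ha
    have h2 := (eventually_contDiffAt_partialDeriv hsm).self_of_nhds.continuousAt
    exact h1.bilinearComp_self h2
  have h1 := hBc.eventually_bilinForm_le fun w hw => by
    rw [hB0]; exact chartMetric_pos g hφ ha hw
  have h2 := eventually_chartMetric_le g hφ ha
  have hcx : ContinuousAt (fun q : ℝ × N => φ q.2) (0, x₀) :=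
    (φ.continuousAt hx₀).comp continuousAt_snd
  have hc : ContinuousAt (fun q : ℝ × N => (q.1, φ q.2)) (0, x₀) := continuousAt_fst.prodMk hcx
  filter_upwards [hc.eventually (h1.and (hΦ.eventually_mem_chart ha)), hcx.eventually h2,
    continuousAt_snd.eventually (φ.open_source.mem_nhds hx₀)] with q hq hq2 hqs v
  obtain ⟨hq1, hqI, -, hqm⟩ := hq
  have hinv : φ.symm (φ q.2) = q.2 := φ.left_inv hqs
  simp only [hinv] at hqm
  have hΦd : MDifferentiableAt (𝓡 n) (𝓡 n) (Φ q.1) q.2 :=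
    (hΦ.contMDiff hqI).mdifferentiableAt (by simp)
  have hΨd : DifferentiableAt ℝ (fun z => Ψ (q.1, z)) (φ q.2) := by
    have h2 : Φ q.1 (φ.symm (φ q.2)) ∈ φ.source := by rw [hinv]; exact hqm
    exact (hΦ.contDiffAt_chart_slice hφ hqI (φ.map_source hqs) h2).differentiableAt (by simp)
  have hkey : (mfderiv (𝓡 n) (𝓡 n) φ (Φ q.1 q.2) (mfderiv (𝓡 n) (𝓡 n) (Φ q.1) q.2 v) :
      EuclideanSpace ℝ (Fin n)) = partialDeriv Ψ (q.1, φ q.2) (mfderiv (𝓡 n) (𝓡 n) φ q.2 v) := by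
    have e1 := mfderiv_comp (I := 𝓡 n) (I' := 𝓡 n) (I'' := 𝓡 n) (g := φ) (f := Φ q.1) q.2
      (mdifferentiableAt_chart hφ hqm) hΦd
    have e2 := mfderiv_comp (I := 𝓡 n) (I' := 𝓡 n) (I'' := 𝓡 n) (g := fun z => Ψ (q.1, z)) (f := φ)
      q.2 hΨd.mdifferentiableAt (mdifferentiableAt_chart hφ hqs)
    have e3 : (fun z => Ψ (q.1, z)) ∘ φ =ᶠ[𝓝 q.2] φ ∘ Φ q.1 := by
      filter_upwards [φ.open_source.mem_nhds hqs] with y hy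
      simp only [hΨ, Function.comp_apply, φ.left_inv hy]
    have e4 := e3.mfderiv_eq (I := 𝓡 n) (I' := 𝓡 n)
    rw [e1, e2, mfderiv_eq_fderiv] at e4
    exact (DFunLike.congr_fun e4 v).symm
  rw [inner_eq_chartMetric g hφ hqm, inner_eq_chartMetric g hφ hqs, hkey]
  set w : EuclideanSpace ℝ (Fin n) := mfderiv (𝓡 n) (𝓡 n) φ q.2 v with hw
  have h3 := hq1 w
  have h4 := hq2 w
  rw [hB0] at h3
  have h5 : B (q.1, φ q.2) w w = chartMetric g φ (φ (Φ q.1 q.2))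
      (partialDeriv Ψ (q.1, φ q.2) w) (partialDeriv Ψ (q.1, φ q.2) w) := by
    simp only [hB, hΨ, hinv]
    rfl
  rw [h5] at h3
  constructor <;> linarith [h3.1, h3.2, h4.1, h4.2]

end WeakImmersion

/-! ### Local approximation by smooth functions -/

theorem LpTendsto.union {α F : Type*} [MeasurableSpace α] [NormedAddCommGroup F] {μ : Measure α}
    {p : ℝ≥0∞} (hp1 : 1 ≤ p) (hp : p ≠ ⊤) {A B : Set α} {w : ℕ → α → F}
    {w₀ : α → F} (h₁ : LpTendsto p (μ.restrict A) w w₀) (h₂ : LpTendsto p (μ.restrict B) w w₀) :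
    LpTendsto p (μ.restrict (A ∪ B)) w w₀ := by
  have hle : μ.restrict (A ∪ B) ≤ μ.restrict A + μ.restrict B := Measure.restrict_union_le _ _
  refine ⟨⟨aestronglyMeasurable_union_iff.2 ⟨h₁.1.1, h₂.1.1⟩, ?_⟩, ?_, ?_⟩
  · exact ((eLpNorm_mono_measure _ hle).trans (eLpNorm_add_measure_le hp1 hp _)).trans_lt
      (ENNReal.add_lt_top.2 ⟨h₁.1.2, h₂.1.2⟩)
  · filter_upwards [h₁.2.1, h₂.2.1] with k hk hk' using aestronglyMeasurable_union_iff.2 ⟨hk, hk'⟩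
  · have h0 := h₁.2.2.add h₂.2.2
    rw [add_zero] at h0
    exact tendsto_of_tendsto_of_tendsto_of_le_of_le tendsto_const_nhds h0 (fun _ => zero_le)
      fun k => (eLpNorm_mono_measure _ hle).trans (eLpNorm_add_measure_le hp1 hp _)

theorem JetConvAt.sum {n : ℕ} {F ι : Type*} [NormedAddCommGroup F] [NormedSpace ℝ F] {p : ℝ≥0∞}
    {Ω : Set (EuclideanSpace ℝ (Fin n))} {a : EuclideanSpace ℝ (Fin n)} (s : Finset ι)
    (hp1 : 1 ≤ p) (hΩ : MeasurableSet Ω) {u : ι → ℕ → EuclideanSpace ℝ (Fin n) → F}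
    (h : ∀ i ∈ s, JetConvAt p Ω a (u i)) : JetConvAt p Ω a (fun k x => ∑ i ∈ s, u i k x) := by
  classical
  induction s using Finset.induction_on with
  | empty =>
    simp only [Finset.sum_empty]
    exact of_smooth hΩ (Eventually.of_forall fun _ => contDiffAt_const)
  | insert i s hi ih =>
    simp only [Finset.sum_insert hi]
    exact (h i (Finset.mem_insert_self i s)).add hp1 hΩ
      (ih fun j hj => h j (Finset.mem_insert_of_mem hj))

section LocalApprox

variable {n : ℕ} {F : Type*} [NormedAddCommGroup F] [NormedSpace ℝ F] {S : ℝ≥0∞ → Prop}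
  {a : EuclideanSpace ℝ (Fin n)} {w w' : ℕ → EuclideanSpace ℝ (Fin n) → F}
  {u u' : EuclideanSpace ℝ (Fin n) → F}
  {G G' : EuclideanSpace ℝ (Fin n) → EuclideanSpace ℝ (Fin n) →L[ℝ] F}

/-- Near `a` the smooth functions `w k` approximate `u` uniformly and in every `W^{1,p}` with
`p < ∞`, with locally bounded derivatives, and the second derivatives converge in `L^p` for the
exponents `p` in `S`. Moreover the derivative of `w k` is, at every point, close to a mean of `G`
over small balls. -/
structure LocalApprox (S : ℝ≥0∞ → Prop) (a : EuclideanSpace ℝ (Fin n))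
    (w : ℕ → EuclideanSpace ℝ (Fin n) → F) (u : EuclideanSpace ℝ (Fin n) → F)
    (G : EuclideanSpace ℝ (Fin n) → EuclideanSpace ℝ (Fin n) →L[ℝ] F) : Prop where
  smooth : ∃ s ∈ 𝓝 a, ∀ k, ∀ x ∈ s, ContDiffAt ℝ ∞ (w k) x
  unif : ∃ s ∈ 𝓝 a, ∀ ε > 0, ∀ᶠ k in atTop, ∀ x ∈ s, ‖w k x - u x‖ ≤ ε
  cont : ContinuousAt u a
  jet : ∀ p : ℝ≥0∞, 1 ≤ p → p ≠ ⊤ → JetConvAt p univ a w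
  jetTwo : ∀ p : ℝ≥0∞, 1 ≤ p → p ≠ ⊤ → S p → JetTwoConvAt p univ a w
  mean : MeanDerivConvAt a w G

namespace LocalApprox

theorem eventually_differentiableAt (h : LocalApprox S a w u G) :
    ∀ᶠ q : ℕ × EuclideanSpace ℝ (Fin n) in atTop ×ˢ 𝓝 a, DifferentiableAt ℝ (w q.1) q.2 := by
  obtain ⟨s, hs, h1⟩ := h.smooth
  filter_upwards [tendsto_snd.eventually hs] with q hq
  exact (h1 q.1 q.2 hq).differentiableAt (by simp)

theorem tendsto (h : LocalApprox S a w u G) :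
    Tendsto (fun q : ℕ × EuclideanSpace ℝ (Fin n) => w q.1 q.2) (atTop ×ˢ 𝓝 a) (𝓝 (u a)) := by
  obtain ⟨s, hs, h1⟩ := h.unif
  have h2 : Tendsto (fun q : ℕ × EuclideanSpace ℝ (Fin n) => w q.1 q.2 - u q.2)
      (atTop ×ˢ 𝓝 a) (𝓝 0) := by
    refine Metric.nhds_basis_closedBall.tendsto_right_iff.2 fun ε hε => ?_
    filter_upwards [tendsto_fst.eventually (h1 ε hε), tendsto_snd.eventually hs] with q hq hq'
    rw [mem_closedBall_zero_iff]
    exact hq _ hq'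
  have h3 : Tendsto (fun q : ℕ × EuclideanSpace ℝ (Fin n) => u q.2) (atTop ×ˢ 𝓝 a) (𝓝 (u a)) :=
    h.cont.tendsto.comp tendsto_snd
  simpa using h2.add h3

theorem congr (h : LocalApprox S a w u G) {s : Set (EuclideanSpace ℝ (Fin n))} (hs : s ∈ 𝓝 a)
    (hw : ∀ k, ∀ x ∈ s, w k x = w' k x) (hu : ∀ x ∈ s, u x = u' x)
    (hG : ∀ x ∈ s, G x = G' x) : LocalApprox S a w' u' G' := by
  have hw' : ∀ k, ∀ x ∈ interior s, w k =ᶠ[𝓝 x] w' k := fun k x hx => by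
    filter_upwards [mem_interior_iff_mem_nhds.1 hx] with y hy using hw k y hy
  have hs' := interior_mem_nhds.2 hs
  refine ⟨?_, ?_, ?_, fun p hp1 hp => ?_, fun p hp1 hp hS => ?_, ?_⟩
  · obtain ⟨t, ht, h1⟩ := h.smooth
    exact ⟨t ∩ interior s, inter_mem ht hs', fun k x hx =>
      (h1 k x hx.1).congr_of_eventuallyEq (hw' k x hx.2).symm⟩
  · obtain ⟨t, ht, h1⟩ := h.unif
    refine ⟨t ∩ s, inter_mem ht hs, fun ε hε => (h1 ε hε).mono fun k hk x hx => ?_⟩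
    rw [← hw k x hx.2, ← hu x hx.2]
    exact hk x hx.1
  · exact h.cont.congr (by filter_upwards [hs] with x hx using hu x hx)
  · exact (h.jet p hp1 hp).congr MeasurableSet.univ hs'
      (Eventually.of_forall fun k x hx => hw' k x hx.1)
  · exact (h.jetTwo p hp1 hp hS).congr MeasurableSet.univ hs'
      (Eventually.of_forall fun k x hx => hw' k x hx.1)
  · refine h.mean.congr ?_ ?_
    · filter_upwards [tendsto_snd.eventually hs'] with q hq using hw' _ _ hq
    · filter_upwards [hs] with x hx using hG x hx

/-- Change of coordinates. -/
theorem comp {τ σ : EuclideanSpace ℝ (Fin n) → EuclideanSpace ℝ (Fin n)}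
    (hτ : ∀ᶠ x in 𝓝 a, ContDiffAt ℝ ∞ τ x) (hσ : DifferentiableAt ℝ σ (τ a))
    (hστ : ∀ᶠ x in 𝓝 a, σ (τ x) = x) {T : Set (EuclideanSpace ℝ (Fin n))} (hT : T ∈ 𝓝 (τ a))
    (hG : AEStronglyMeasurable G (volume.restrict T)) {L : ℝ}
    (hL : ∀ᵐ y ∂(volume.restrict T), ‖G y‖ ≤ L) (h : LocalApprox S (τ a) w u G) :
    LocalApprox S a (fun k x => w k (τ x)) (fun x => u (τ x))
      (fun x => (G (τ x)).comp (fderiv ℝ τ x)) := by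
  have hc : ContinuousAt τ a := hτ.self_of_nhds.continuousAt
  have hmaps : ∀ᶠ x in 𝓝 a, x ∈ (univ : Set (EuclideanSpace ℝ (Fin n))) →
    τ x ∈ (univ : Set (EuclideanSpace ℝ (Fin n))) := Eventually.of_forall fun _ _ => mem_univ _
  refine ⟨?_, ?_, ?_, fun p hp1 hp => ?_, fun p hp1 hp hS => ?_, ?_⟩
  · obtain ⟨t, ht, h1⟩ := h.smooth
    exact ⟨{x | τ x ∈ t ∧ ContDiffAt ℝ ∞ τ x}, (hc.eventually ht).and hτ, fun k x hx =>
      (h1 k _ hx.1).comp x hx.2⟩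
  · obtain ⟨t, ht, h1⟩ := h.unif
    exact ⟨τ ⁻¹' t, hc.eventually ht, fun ε hε => (h1 ε hε).mono fun k hk x hx => hk _ hx⟩
  · exact ContinuousAt.comp (g := u) h.cont hc
  · exact (h.jet p hp1 hp).comp hp1 hp MeasurableSet.univ hτ hσ hστ hmaps
  · exact (h.jetTwo p hp1 hp hS).comp hp1 hp MeasurableSet.univ hτ hσ hστ hmaps
  · exact h.mean.comp hτ hσ hστ h.eventually_differentiableAt hT hG hL

/-- Gluing by a partition of unity of approximations of the same function `u`. -/
theorem sum {ι : Type*} {s : Finset ι} (hs : s.Nonempty) {χ : ι → EuclideanSpace ℝ (Fin n) → ℝ}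
    {w : ι → ℕ → EuclideanSpace ℝ (Fin n) → F}
    (hχ : ∀ i ∈ s, ∀ᶠ x in 𝓝 a, ContDiffAt ℝ ∞ (χ i) x) (hsum : ∀ᶠ x in 𝓝 a, ∑ i ∈ s, χ i x = 1)
    (hχ0 : ∀ i ∈ s, ∀ x, χ i x ∈ Icc 0 1)
    {T : Set (EuclideanSpace ℝ (Fin n))} (hT : T ∈ 𝓝 a)
    (hG : AEStronglyMeasurable G (volume.restrict T))
    (h : ∀ i ∈ s, LocalApprox S a (w i) u G) :
    LocalApprox S a (fun k x => ∑ i ∈ s, χ i x • w i k x) u G := by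
  obtain ⟨i₀, hi₀⟩ := hs
  refine ⟨?_, ?_, (h i₀ hi₀).cont, fun p hp1 hp => ?_, fun p hp1 hp hS => ?_, ?_⟩
  · have h1 : ∀ i ∈ s, ∀ᶠ x in 𝓝 a, ∀ k, ContDiffAt ℝ ∞ (fun x => χ i x • w i k x) x :=
      fun i hi => by
      obtain ⟨t, ht, h1⟩ := (h i hi).smooth
      filter_upwards [ht, hχ i hi] with x hx hx' k using hx'.smul (h1 k x hx)
    exact ⟨_, (Filter.eventually_all_finset s).2 h1, fun k x hx =>
      ContDiffAt.sum fun i hi => hx i hi k⟩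
  · have h1 : ∀ i : ι, ∃ t ∈ 𝓝 a, i ∈ s → ∀ ε > 0, ∀ᶠ k in atTop, ∀ x ∈ t, ‖w i k x - u x‖ ≤ ε := by
      intro i
      by_cases hi : i ∈ s
      · obtain ⟨t, ht, h1⟩ := (h i hi).unif
        exact ⟨t, ht, fun _ => h1⟩
      · exact ⟨univ, univ_mem, fun h => absurd h hi⟩
    choose t ht h1 using h1
    refine ⟨(⋂ i ∈ s, t i) ∩ {x | ∑ i ∈ s, χ i x = 1},
      inter_mem ((Filter.biInter_finset_mem s).2 fun i _ => ht i) hsum, fun ε hε => ?_⟩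
    filter_upwards [(Filter.eventually_all_finset s).2 fun i hi => h1 i hi ε hε] with k hk x hx
    have hx1 : ∑ i ∈ s, χ i x = 1 := hx.2
    have h2 : ∑ i ∈ s, χ i x • w i k x - u x = ∑ i ∈ s, χ i x • (w i k x - u x) := by
      simp only [smul_sub, Finset.sum_sub_distrib, ← Finset.sum_smul, hx1, one_smul]
    rw [h2]
    calc ‖∑ i ∈ s, χ i x • (w i k x - u x)‖ ≤ ∑ i ∈ s, χ i x * ε := by
          refine norm_sum_le_of_le _ fun i hi => ?_
          rw [norm_smul, Real.norm_of_nonneg (hχ0 i hi x).1]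
          exact mul_le_mul_of_nonneg_left (hk i hi x (mem_iInter₂.1 hx.1 i hi)) (hχ0 i hi x).1
      _ = ε := by rw [← Finset.sum_mul, hx1, one_mul]
  · have h1 : ∀ i ∈ s, JetConvAt p univ a (fun k x => χ i x • w i k x) := fun i hi =>
      (JetConvAt.of_smooth MeasurableSet.univ (hχ i hi)).bilin hp1 hp MeasurableSet.univ
        (ContinuousLinearMap.lsmul ℝ ℝ) ((h i hi).jet p hp1 hp)
    exact JetConvAt.sum s hp1 MeasurableSet.univ h1
  · exact JetTwoConvAt.sum s hp1 MeasurableSet.univ fun i hi =>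
      (JetTwoConvAt.of_smooth MeasurableSet.univ (hχ i hi)).bilin hp1 hp MeasurableSet.univ
        (ContinuousLinearMap.lsmul ℝ ℝ) ((h i hi).jetTwo p hp1 hp hS)
  · exact MeanDerivConvAt.sum s hχ hsum (fun i hi => (h i hi).eventually_differentiableAt)
      (fun i hi => (h i hi).tendsto) hT hG fun i hi => (h i hi).mean

/-- The limit of the derivatives is the weak derivative of `u`. -/
theorem exists_lpTendsto_fderiv [CompleteSpace F] (h : LocalApprox S a w u G)
    {T : Set (EuclideanSpace ℝ (Fin n))} (hT : T ∈ 𝓝 a) (hu : HasWeakDeriv T u G) {p : ℝ≥0∞}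
    (hp1 : 1 ≤ p) (hp : p ≠ ⊤) : ∃ s ∈ 𝓝 a, LpTendsto p (volume.restrict s)
    (fun k => fderiv ℝ (w k)) G := by
  obtain ⟨s₁, hs₁, h1⟩ := h.smooth
  obtain ⟨s₂, hs₂, h2⟩ := h.unif
  obtain ⟨r, hr, hrs, hj⟩ := (h.jet p hp1 hp).exists_subset (inter_mem hT (inter_mem hs₁ hs₂))
  rw [inter_univ] at hj
  obtain ⟨u₀, hu₀⟩ := hj.conv
  obtain ⟨G₀, hG₀⟩ := hj.conv_fderiv
  refine ⟨ball a r, ball_mem_nhds a hr, hG₀.congr (Eventually.of_forall fun k => ae_eq_rfl) ?_⟩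
  have hw : ∀ k, HasWeakDeriv (ball a r) (w k) (fderiv ℝ (w k)) := fun k =>
    ContDiffOn.hasWeakDeriv isOpen_ball fun x hx =>
      ((h1 k x (hrs hx).2.1).of_le (by simp)).contDiffWithinAt
  have hlim := HasWeakDeriv.of_lpTendsto hp1 (Eventually.of_forall hw) hu₀ hG₀
  have hub : ∀ᵐ x ∂(volume.restrict (ball a r)), u₀ x = u x := by
    obtain ⟨ns, hns, hae⟩ := (hu₀.tendstoInMeasure
      (zero_lt_one.trans_le hp1).ne').exists_seq_tendsto_ae
    filter_upwards [hae, ae_restrict_mem measurableSet_ball] with x hx hxr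
    refine tendsto_nhds_unique hx ?_
    refine Metric.tendsto_atTop.2 fun ε hε => ?_
    obtain ⟨N, hN⟩ := eventually_atTop.1 (hns.tendsto_atTop.eventually (h2 (ε / 2) (half_pos hε)))
    refine ⟨N, fun k hk => ?_⟩
    rw [dist_eq_norm]
    exact (hN k hk x (hrs hxr).2.2).trans_lt (half_lt_self hε)
  exact (hlim.congr hub ae_eq_rfl).unique isOpen_ball
    (hu.mono fun x hx => (hrs hx).1)

/-- The limit of the second derivatives is the second weak derivative of `u`. -/
theorem exists_lpTendsto_fderiv_two [CompleteSpace F] (h : LocalApprox S a w u G)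
    {T : Set (EuclideanSpace ℝ (Fin n))} (hT : T ∈ 𝓝 a) (hu : HasWeakDeriv T u G)
    {H : EuclideanSpace ℝ (Fin n) → EuclideanSpace ℝ (Fin n) →L[ℝ] EuclideanSpace ℝ (Fin n) →L[ℝ] F}
    (hH : HasWeakDeriv T G H) {p : ℝ≥0∞} (hp1 : 1 ≤ p) (hp : p ≠ ⊤) (hS : S p) :
    ∃ s ∈ 𝓝 a, LpTendsto p (volume.restrict s) (fun k => fderiv ℝ (fderiv ℝ (w k))) H := by
  obtain ⟨s₁, hs₁, h1⟩ := h.smooth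
  obtain ⟨s₂, hs₂, h2⟩ := h.exists_lpTendsto_fderiv hT hu hp1 hp
  obtain ⟨r, hr, hrs, hj⟩ := (h.jetTwo p hp1 hp hS).2.exists_subset
    (inter_mem hT (inter_mem hs₁ hs₂))
  rw [inter_univ] at hj
  obtain ⟨G₀, hG₀⟩ := hj.conv_fderiv
  refine ⟨ball a r, ball_mem_nhds a hr, hG₀.congr (Eventually.of_forall fun k => ae_eq_rfl) ?_⟩
  have hw : ∀ k, HasWeakDeriv (ball a r) (fderiv ℝ (w k)) (fderiv ℝ (fderiv ℝ (w k))) := fun k =>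
    ContDiffOn.hasWeakDeriv isOpen_ball fun x hx =>
      ((h1 k x (hrs hx).2.1).fderiv_infty.of_le (by simp)).contDiffWithinAt
  have h2' := h2.mono_measure (Measure.restrict_mono (fun x hx => (hrs hx).2.2 :
    ball a r ⊆ s₂) le_rfl)
  exact (HasWeakDeriv.of_lpTendsto hp1 (Eventually.of_forall hw) h2' hG₀).unique
    isOpen_ball (hH.mono fun x hx => (hrs hx).1)

/-- Composition with a smooth map `P` which fixes the values of `u`. -/
theorem postcomp [ProperSpace F] (h : LocalApprox S a w u G) {P : F → F} (hP : ContDiff ℝ ∞ P)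
    {T : Set (EuclideanSpace ℝ (Fin n))} (hT : T ∈ 𝓝 a) (hPu : ∀ x ∈ T, P (u x) = u x)
    (hu : HasWeakDeriv T u G) {L : ℝ} (hL : ∀ᵐ y ∂(volume.restrict T), ‖G y‖ ≤ L) :
    LocalApprox S a (fun k x => P (w k x)) u G := by
  obtain ⟨s₁, hs₁, h1⟩ := h.smooth
  obtain ⟨s₂, hs₂, h2⟩ := h.unif
  have hbig : ∃ s ∈ 𝓝 a, s ⊆ s₂ ∩ T ∧ ∃ C, ∀ᶠ k in atTop, ∀ x ∈ s, ‖w k x‖ ≤ C ∧ ‖u x‖ ≤ C := by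
    have h3 : ∀ᶠ x in 𝓝 a, ‖u x‖ < ‖u a‖ + 1 :=
      h.cont.norm.eventually (gt_mem_nhds (lt_add_one _))
    refine ⟨{x | ‖u x‖ < ‖u a‖ + 1} ∩ (s₂ ∩ T), inter_mem h3 (inter_mem hs₂ hT),
      inter_subset_right, ‖u a‖ + 2, ?_⟩
    filter_upwards [h2 1 one_pos] with k hk x hx
    have e1 : ‖u x‖ < ‖u a‖ + 1 := hx.1
    have e2 := norm_le_norm_add_norm_sub' (w k x) (u x)
    have e3 := hk x hx.2.1
    constructor <;> linarith
  obtain ⟨s₃, hs₃, hs₃sub, C, hC⟩ := hbig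
  have hunif : ∃ s ∈ 𝓝 a, ∀ ε > 0, ∀ᶠ k in atTop, ∀ x ∈ s, ‖P (w k x) - u x‖ ≤ ε := by
    refine ⟨s₃, hs₃, fun ε hε => ?_⟩
    have huc := (isCompact_closedBall (0 : F) C).uniformContinuousOn_of_continuous
      hP.continuous.continuousOn
    obtain ⟨δ, hδ, h4⟩ := Metric.uniformContinuousOn_iff.1 huc ε hε
    filter_upwards [hC, h2 (δ / 2) (half_pos hδ)] with k hk hk2 x hx
    have h5 := h4 (w k x) (mem_closedBall_zero_iff.2 (hk x hx).1) (u x)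
      (mem_closedBall_zero_iff.2 (hk x hx).2) (by
        rw [dist_eq_norm]
        exact (hk2 x (hs₃sub hx).1).trans_lt (half_lt_self hδ))
    rw [hPu x (hs₃sub hx).2, dist_eq_norm] at h5
    exact h5.le
  have hjet : ∀ p : ℝ≥0∞, 1 ≤ p → p ≠ ⊤ → JetConvAt p univ a (fun k x => P (w k x)) :=
    fun p hp1 hp => (h.jet p hp1 hp).postcomp hp1 hp MeasurableSet.univ hP hs₂
      fun ε hε => (h2 ε hε).mono fun k hk x hx => hk x hx.1
  have hsm : ∃ s ∈ 𝓝 a, ∀ k, ∀ x ∈ s, ContDiffAt ℝ ∞ (fun x => P (w k x)) x :=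
    ⟨s₁, hs₁, fun k x hx => hP.contDiffAt.comp x (h1 k x hx)⟩
  -- the derivatives of `P ∘ w k` converge to `G` and to `DP(u) G`
  have hfix : ∃ s ∈ 𝓝 a, ∀ᵐ y ∂(volume.restrict s), (fderiv ℝ P (u y)).comp (G y) = G y := by
    obtain ⟨s₄, hs₄, h4⟩ := h.exists_lpTendsto_fderiv hT hu le_rfl ENNReal.one_ne_top
    obtain ⟨r, hr, hrs, hj⟩ := (hjet 1 le_rfl ENNReal.one_ne_top).exists_subset
      (inter_mem (inter_mem hs₁ hs₃) (inter_mem hs₄ hT))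
    rw [inter_univ] at hj
    have hfin : IsFiniteMeasure (volume.restrict (ball a r)) :=
      ⟨by simpa using measure_ball_lt_top⟩
    have hw : ∀ k, HasWeakDeriv (ball a r) (fun x => P (w k x)) (fderiv ℝ fun x => P (w k x)) :=
      fun k => ContDiffOn.hasWeakDeriv isOpen_ball fun x hx =>
        ((hP.contDiffAt.comp x (h1 k x (hrs hx).1.1)).of_le (by simp)).contDiffWithinAt
    have hwc : ∀ᶠ k in atTop, ContinuousOn (w k) (ball a r) := Eventually.of_forall fun k x hx =>
      (h1 k x (hrs hx).1.1).continuousAt.continuousWithinAt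
    have hCb : ∀ᶠ k in atTop, ∀ x ∈ ball a r, ‖w k x‖ ≤ C :=
      hC.mono fun k hk x hx => (hk x (hrs hx).1.2).1
    have hub : ∀ ε > 0, ∀ᶠ k in atTop, ∀ x ∈ ball a r, ‖w k x - u x‖ ≤ ε := fun ε hε =>
      (h2 ε hε).mono fun k hk x hx => hk x (hs₃sub (hrs hx).1.2).1
    obtain ⟨D, hD, hQ⟩ := JetConv.exists_bound_and_lpTendsto_comp_continuous (p := 1)
      measurableSet_ball measure_ball_lt_top.ne hwc hCb hub
      (hP.continuous_fderiv (by simp))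
    obtain ⟨-, -, hQ0⟩ := JetConv.exists_bound_and_lpTendsto_comp_continuous (p := 1)
      measurableSet_ball measure_ball_lt_top.ne hwc hCb hub hP.continuous
    have h5 := hQ.bilin le_rfl ENNReal.one_ne_top (ContinuousLinearMap.compL ℝ
      (EuclideanSpace ℝ (Fin n)) F F) one_ne_zero (h4.mono_measure (Measure.restrict_mono
        (fun x hx => (hrs hx).2.1 : ball a r ⊆ s₄) le_rfl))
      (hD.mono fun k hk => by
        filter_upwards [ae_restrict_mem measurableSet_ball] with x hx using hk x hx)
    have h6 : LpTendsto 1 (volume.restrict (ball a r)) (fun k => fderiv ℝ fun x => P (w k x))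
        (fun x => (fderiv ℝ P (u x)).comp (G x)) := by
      refine h5.congr (Eventually.of_forall fun k => ?_) ae_eq_rfl
      filter_upwards [ae_restrict_mem measurableSet_ball] with x hx
      exact (fderiv_comp x (hP.differentiable (by simp) _)
        ((h1 k x (hrs hx).1.1).differentiableAt (by simp))).symm
    have h7 := HasWeakDeriv.of_lpTendsto le_rfl (Eventually.of_forall hw) hQ0 h6
    have h8 : HasWeakDeriv (ball a r) u (fun x => (fderiv ℝ P (u x)).comp (G x)) := by
      refine h7.congr ?_ ae_eq_rfl
      filter_upwards [ae_restrict_mem measurableSet_ball] with x hx using hPu x (hrs hx).2.2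
    exact ⟨ball a r, ball_mem_nhds a hr, h8.unique isOpen_ball (hu.mono fun x hx => (hrs hx).2.2)⟩
  refine ⟨hsm, hunif, h.cont, hjet, fun p hp1 hp hS => ?_, ?_⟩
  · exact (h.jetTwo p hp1 hp hS).postcomp hp1 hp MeasurableSet.univ hP hs₂
      fun ε hε => (h2 ε hε).mono fun k hk x hx => hk x hx.1
  · obtain ⟨s, hs, hfix⟩ := hfix
    refine h.mean.postcomp hP h.cont h.eventually_differentiableAt h.tendsto (inter_mem hs hT) ?_
      (L := L)
    filter_upwards [ae_restrict_of_ae_restrict_of_subset inter_subset_left hfix,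
      ae_restrict_of_ae_restrict_of_subset inter_subset_right hL] with y hy hy' using ⟨hy', hy⟩

end LocalApprox

end LocalApprox

/-! ### Approximation in a chart -/

section Interior

variable {n : ℕ} {N : Type*} [TopologicalSpace N] [ChartedSpace (EuclideanSpace ℝ (Fin n)) N]
  [IsManifold (𝓡 n) ∞ N] {F : Type*} [NormedAddCommGroup F] [NormedSpace ℝ F]
  {φ ψ : OpenPartialHomeomorph N (EuclideanSpace ℝ (Fin n))} {U : Set N} {h : N → F}
  {g : Bundle.ContMDiffRiemannianMetric (𝓡 n) ∞ (EuclideanSpace ℝ (Fin n))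
      (fun x : N => TangentSpace (𝓡 n) x)}
  {df : ∀ x : N, TangentSpace (𝓡 n) x →L[ℝ] F} {Λ : ℝ}

theorem locallyCompactSpace_of_chartedSpace_euclidean (n : ℕ) (N : Type*) [TopologicalSpace N]
    [ChartedSpace (EuclideanSpace ℝ (Fin n)) N] : LocallyCompactSpace N :=
  ChartedSpace.locallyCompactSpace (EuclideanSpace ℝ (Fin n)) N

/-- A cutoff function in the domain of a chart which equals one near a compact set. -/
theorem exists_isCutoff_eq_one [T2Space N] [SecondCountableTopology N] {C : Set N}
    (hC : IsCompact C) (hCφ : C ⊆ φ.source) : ∃ ξ : N → ℝ, IsCutoff φ ξ ∧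
      ∃ W, IsOpen W ∧ C ⊆ W ∧ W ⊆ φ.source ∧ ∀ x ∈ W, ξ x = 1 := by
  have := locallyCompactSpace_of_chartedSpace_euclidean n N
  obtain ⟨D, hD, hCD, hDφ⟩ := exists_compact_between hC φ.open_source hCφ
  obtain ⟨ξ, h1, h0, -⟩ := exists_contMDiffMap_one_nhds_of_subset_interior (n := (⊤ : ℕ∞)) (𝓡 n)
    hC.isClosed hCD
  have hts : tsupport ξ ⊆ D := closure_minimal (fun x hx => by
    by_contra hxD
    exact hx (h0 x hxD)) hD.isClosed
  obtain ⟨W, hW, hCW, hW1⟩ := eventually_nhdsSet_iff_exists.1 h1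
  exact ⟨ξ, ⟨ξ.contMDiff, hD.of_isClosed_subset (isClosed_tsupport _) hts, hts.trans hDφ⟩,
    W ∩ φ.source, hW.inter φ.open_source, subset_inter hCW hCφ, inter_subset_right,
    fun x hx => hW1 x hx.1⟩

theorem localRep_eq_of_eq_one {ξ : N → ℝ} {W : Set N} (hξ : ∀ x ∈ W, ξ x = 1) (h : N → F)
    {z : EuclideanSpace ℝ (Fin n)} (hz : φ.symm z ∈ W) : localRep φ ξ h z = h (φ.symm z) := by
  rw [localRep, hξ _ hz, one_smul]

theorem chartImage_mono {V W : Set N} (h : V ⊆ W) : chartImage φ V ⊆ chartImage φ W :=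
  image_mono (inter_subset_inter_right _ h)

/-- Where the cutoff equals one, the weak derivative of the localized representation is that of
`h`. -/
theorem HasWeakDeriv.chartDeriv_eq_of_localRep [CompleteSpace F] (hU : IsOpen U)
    (hdf : IsWeakDifferential U h df) (hφ : φ ∈ IsManifold.maximalAtlas (𝓡 n) ∞ N) {ξ : N → ℝ}
    {W : Set N} (hW : IsOpen W) (hξ : ∀ x ∈ W, ξ x = 1)
    {G : EuclideanSpace ℝ (Fin n) → EuclideanSpace ℝ (Fin n) →L[ℝ] F}
    (hG : HasWeakDeriv (chartImage φ U) (localRep φ ξ h) G) :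
    G =ᵐ[volume.restrict (chartImage φ (U ∩ W))] chartDeriv df φ := by
  have ho := isOpen_chartImage φ (hU.inter hW)
  have h1 := hG.mono (chartImage_mono (φ := φ) (inter_subset_left : U ∩ W ⊆ U))
  have h2 : HasWeakDeriv (chartImage φ (U ∩ W)) (fun z => h (φ.symm z)) G := by
    refine h1.congr ?_ ae_eq_rfl
    filter_upwards [ae_restrict_mem ho.measurableSet] with z hz
    rw [chartImage_eq] at hz
    exact localRep_eq_of_eq_one hξ h hz.2.2
  exact h2.unique ho ((hdf φ hφ).mono (chartImage_mono inter_subset_left))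

theorem exists_weakDeriv_of_sobolevNormTwo_lt_top {Ω : Set (EuclideanSpace ℝ (Fin n))}
    {p : ℝ≥0∞} {u : EuclideanSpace ℝ (Fin n) → F} (hu : sobolevNormTwo p Ω u < ⊤) :
    ∃ G H, HasWeakDeriv Ω u G ∧ HasWeakDeriv Ω G H ∧ MemLp H p (volume.restrict Ω) := by
  simp only [sobolevNormTwo, sobolevNormOne, iInf_lt_iff] at hu
  obtain ⟨G, hG, hlt⟩ := hu
  have h2 := (ENNReal.add_lt_top.1 hlt).2
  simp only [iInf_lt_iff] at h2
  obtain ⟨H, hH, hlt⟩ := h2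
  exact ⟨G, H, hG, hH, hH.2.1.aestronglyMeasurable, (ENNReal.add_lt_top.1 hlt).2⟩

/-- The part of the localized second derivative where the cutoff equals one. -/
theorem exists_hasWeakDeriv_chartDeriv [CompleteSpace F] (hU : IsOpen U)
    (hdf : IsWeakDifferential U h df) (hφ : φ ∈ IsManifold.maximalAtlas (𝓡 n) ∞ N) {ξ : N → ℝ}
    (hξφ : IsCutoff φ ξ) {W : Set N} (hW : IsOpen W) (hξ : ∀ x ∈ W, ξ x = 1) {p : ℝ≥0∞}
    (hp : MemSobolevTwo n p U h) : ∃ H, HasWeakDeriv (chartImage φ (U ∩ W)) (chartDeriv df φ) H ∧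
      MemLp H p (volume.restrict (chartImage φ (U ∩ W))) := by
  obtain ⟨G, H, hG, hH, hHp⟩ := exists_weakDeriv_of_sobolevNormTwo_lt_top
    (hp φ hφ ξ hξφ)
  have hsub := chartImage_mono (φ := φ) (inter_subset_left : U ∩ W ⊆ U)
  exact ⟨H, (hH.mono hsub).congr (hG.chartDeriv_eq_of_localRep hU hdf hφ hW hξ) ae_eq_rfl,
    hHp.mono_measure (Measure.restrict_mono hsub le_rfl)⟩

/-- Near a compact subset of a chart domain, `df` is bounded. -/
theorem exists_isOpen_ae_norm_chartDeriv_le (hΛ : 0 < Λ)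
    (hb : AlmostEverywhereOn n U fun x => ∀ v : TangentSpace (𝓡 n) x,
      Λ⁻¹ * g.inner x v v ≤ ‖df x v‖ ^ 2 ∧ ‖df x v‖ ^ 2 ≤ Λ * g.inner x v v)
    (hφ : φ ∈ IsManifold.maximalAtlas (𝓡 n) ∞ N) {C : Set (EuclideanSpace ℝ (Fin n))}
    (hC : IsCompact C) (hCφ : C ⊆ φ.target) : ∃ T, IsOpen T ∧ C ⊆ T ∧ ∃ L : ℝ,
      ∀ᵐ z ∂(volume.restrict (chartImage φ U ∩ T)), ‖chartDeriv df φ z‖ ≤ L := by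
  refine hC.induction_on (p := fun C => ∃ T, IsOpen T ∧ C ⊆ T ∧ ∃ L : ℝ,
      ∀ᵐ z ∂(volume.restrict (chartImage φ U ∩ T)), ‖chartDeriv df φ z‖ ≤ L)
    ⟨∅, isOpen_empty, subset_rfl, 0, by simp⟩ (fun s t hst ⟨T, h1, h2, h3⟩ =>
      ⟨T, h1, hst.trans h2, h3⟩) ?_ fun a ha => ?_
  · rintro s t ⟨T, h1, h2, L, h3⟩ ⟨T', h1', h2', L', h3'⟩
    refine ⟨T ∪ T', h1.union h1', union_subset_union h2 h2', max L L', ?_⟩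
    rw [inter_union_distrib_left, ae_restrict_union_iff]
    exact ⟨h3.mono fun z hz => hz.trans (le_max_left _ _),
      h3'.mono fun z hz => hz.trans (le_max_right _ _)⟩
  · obtain ⟨T, hT, L, hL⟩ := exists_ae_norm_chartDeriv_le hΛ hb hφ (hCφ ha)
    exact ⟨interior T, mem_nhdsWithin_of_mem_nhds (interior_mem_nhds.2 hT), interior T,
      isOpen_interior, subset_rfl, L, ae_restrict_of_ae_restrict_of_subset
        (inter_subset_inter_right _ interior_subset) hL⟩

/-- In a single chart, mollification approximates near a compact subset of `U`. -/
theorem exists_localApprox_chart [T2Space N] [SecondCountableTopology N] [ProperSpace F]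
    (hU : IsOpen U) (hh : ContinuousOn h U) (hdf : IsWeakDifferential U h df) (hΛ : 0 < Λ)
    (hb : AlmostEverywhereOn n U fun x => ∀ v : TangentSpace (𝓡 n) x,
      Λ⁻¹ * g.inner x v v ≤ ‖df x v‖ ^ 2 ∧ ‖df x v‖ ^ 2 ≤ Λ * g.inner x v v)
    (hVMO : DifferentialMemVMO n U h) (hφ : φ ∈ IsManifold.maximalAtlas (𝓡 n) ∞ N)
    {C : Set N} (hC : IsCompact C) (hCφ : C ⊆ φ.source ∩ U) :
    ∃ v : ℕ → EuclideanSpace ℝ (Fin n) → F, (∀ k, ContDiff ℝ ∞ (v k)) ∧ ∀ x ∈ C,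
      LocalApprox (fun p => MemSobolevTwo n p U h) (φ x) v (fun z => h (φ.symm z))
        (chartDeriv df φ) := by
  obtain ⟨ξ, hξφ, W₀, hW₀, hCW₀, hWφ, hξ⟩ := exists_isCutoff_eq_one hC fun x hx => (hCφ hx).1
  have hC' : IsCompact (φ '' C) := hC.image_of_continuousOn
    (φ.continuousOn.mono fun x hx => (hCφ hx).1)
  obtain ⟨T, hT, hCT, L, hL⟩ := exists_isOpen_ae_norm_chartDeriv_le (U := U) hΛ hb hφ hC' (by
    rintro _ ⟨x, hx, rfl⟩
    exact φ.map_source (hCφ hx).1)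
  set Ω := chartImage φ (U ∩ W₀) ∩ T with hΩdef
  have hΩ : IsOpen Ω := (isOpen_chartImage φ (hU.inter hW₀)).inter hT
  have hΩU : Ω ⊆ chartImage φ U := inter_subset_left.trans (chartImage_mono inter_subset_left)
  have hCΩ : φ '' C ⊆ Ω := by
    refine subset_inter ?_ hCT
    rintro _ ⟨x, hx, rfl⟩
    exact ⟨x, ⟨(hCφ hx).1, (hCφ hx).2, hCW₀ hx⟩, rfl⟩
  obtain ⟨Q, hQ, hCQ, hQΩ⟩ := exists_compact_between hC' hΩ hCΩ
  have hu : HasWeakDeriv Ω (fun z => h (φ.symm z)) (chartDeriv df φ) := (hdf φ hφ).mono hΩU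
  have hc : ContinuousOn (fun z => h (φ.symm z)) Ω := hh.comp_chart_symm.mono hΩU
  have hLΩ : ∀ᵐ z ∂(volume.restrict Ω), ‖chartDeriv df φ z‖ ≤ L :=
    ae_restrict_of_ae_restrict_of_subset
      (inter_subset_inter_left _ (chartImage_mono inter_subset_left)) hL
  have hV : MemVMO Ω (chartDeriv df φ) := by
    obtain ⟨G, hG, hGV⟩ := hVMO φ hφ ξ hξφ
    exact ((hGV.mono (chartImage_mono inter_subset_left)).congr
      (hG.chartDeriv_eq_of_localRep hU hdf hφ hW₀ hξ)).mono inter_subset_left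
  obtain ⟨v, hv1, hv2, hv3, hv4, hv5, hv6⟩ := exists_mollification hΩ hQ hQΩ hu hc hLΩ
  refine ⟨v, hv1, fun x hx => ?_⟩
  have hQn : Q ∈ 𝓝 (φ x) := mem_interior_iff_mem_nhds.1 (hCQ ⟨x, hx, rfl⟩)
  obtain ⟨r, hr, hrQ⟩ := Metric.mem_nhds_iff.1 hQn
  have hle : volume.restrict (ball (φ x) r) ≤ volume.restrict Q := Measure.restrict_mono hrQ le_rfl
  have hfin : IsFiniteMeasure (volume.restrict (ball (φ x) r)) :=
    ⟨by simpa using measure_ball_lt_top⟩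
  obtain ⟨D, hD⟩ := (hQ.image_of_continuousOn (hc.mono hQΩ)).isBounded.exists_norm_le
  have hD' : ∀ z ∈ Q, ‖h (φ.symm z)‖ ≤ D := fun z hz => hD _ ⟨z, hz, rfl⟩
  have hjet : ∀ p : ℝ≥0∞, 1 ≤ p → p ≠ ⊤ → JetConvAt p univ (φ x) v := fun p hp1 hp => by
    refine ⟨r, hr, ?_⟩
    rw [inter_univ]
    refine ⟨Eventually.of_forall fun k z _ => (hv1 k).contDiffAt, ⟨D + 1, ?_⟩,
      ⟨fun z => h (φ.symm z), ?_⟩, ⟨_, (hv4 p hp1 hp).mono_measure hle⟩⟩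
    · filter_upwards [hv2 1 one_pos] with k hk z hz
      have e1 := hk z (hrQ hz)
      have e2 := norm_le_norm_add_norm_sub' (v k z) (h (φ.symm z))
      linarith [hD' z (hrQ hz)]
    · refine LpTendsto.of_uniform (Eventually.of_forall fun k =>
        (hv1 k).continuous.aestronglyMeasurable) ?_ fun ε hε => ?_
      · refine MemLp.of_bound ((hc.mono (hrQ.trans hQΩ)).aestronglyMeasurable
          measurableSet_ball) D ?_
        filter_upwards [ae_restrict_mem measurableSet_ball] with z hz using hD' z (hrQ hz)
      · filter_upwards [hv2 ε hε] with k hk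
        filter_upwards [ae_restrict_mem measurableSet_ball] with z hz using hk z (hrQ hz)
  refine ⟨⟨univ, univ_mem, fun k z _ => (hv1 k).contDiffAt⟩, ⟨Q, hQn, hv2⟩,
    hc.continuousAt (hΩ.mem_nhds (hCΩ ⟨x, hx, rfl⟩)), hjet, fun p hp1 hp hS =>
      ⟨hjet p hp1 hp, r, hr, ?_⟩, MeanDerivConvAt.of_forall_le hQn fun η hη =>
        (hv6 hV η hη).mono fun k hk z hz => (hk z hz).2⟩
  rw [inter_univ]
  obtain ⟨H, hH, hHp⟩ := exists_hasWeakDeriv_chartDeriv hU hdf hφ hξφ hW₀ hξ hS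
  exact ⟨Eventually.of_forall fun k z _ => (hv1 k).contDiffAt.fderiv_infty,
    ⟨L, hv3.mono fun k hk z hz => hk z (hrQ hz)⟩, ⟨_, (hv4 p hp1 hp).mono_measure hle⟩,
    ⟨_, (hv5 H (hH.mono inter_subset_left) p hp1 hp (hHp.mono_measure
      (Measure.restrict_mono inter_subset_left le_rfl))).mono_measure hle⟩⟩

/-- Passing from one chart to another. -/
theorem LocalApprox.transition {S : ℝ≥0∞ → Prop} (hU : IsOpen U) (hdf : IsWeakDifferential U h df)
    (hΛ : 0 < Λ)
    (hb : AlmostEverywhereOn n U fun x => ∀ v : TangentSpace (𝓡 n) x,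
      Λ⁻¹ * g.inner x v v ≤ ‖df x v‖ ^ 2 ∧ ‖df x v‖ ^ 2 ≤ Λ * g.inner x v v)
    (hφ : φ ∈ IsManifold.maximalAtlas (𝓡 n) ∞ N) (hψ : ψ ∈ IsManifold.maximalAtlas (𝓡 n) ∞ N)
    {a : EuclideanSpace ℝ (Fin n)} (ha : a ∈ ψ.target) (haφ : ψ.symm a ∈ φ.source)
    (haU : ψ.symm a ∈ U) {v : ℕ → EuclideanSpace ℝ (Fin n) → F}
    (hv : LocalApprox S (φ (ψ.symm a)) v (fun z => h (φ.symm z)) (chartDeriv df φ)) :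
    LocalApprox S a (fun k z => v k (φ (ψ.symm z))) (fun z => h (ψ.symm z)) (chartDeriv df ψ) := by
  have hev := eventually_mem_transition ha haφ
  obtain ⟨T, hT, L, hL⟩ := exists_ae_norm_chartDeriv_le (U := U) hΛ hb hφ (φ.map_source haφ)
  have hmem : chartImage φ U ∈ 𝓝 (φ (ψ.symm a)) :=
    (isOpen_chartImage φ hU).mem_nhds ⟨_, ⟨haφ, haU⟩, rfl⟩
  have hsymm : ψ.symm (a) = φ.symm (φ (ψ.symm a)) := (φ.left_inv haφ).symm
  have h1 := hv.comp (τ := fun z => φ (ψ.symm z)) (σ := fun z => ψ (φ.symm z)) (a := a)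
    (by filter_upwards [hev] with z hz using contDiffAt_transition hφ hψ hz.1 hz.2)
    ((contDiffAt_transition hψ hφ (φ.map_source haφ) (by
      rw [← hsymm]; exact ψ.map_target ha)).differentiableAt (by simp))
    (by filter_upwards [hev] with z hz; rw [φ.left_inv hz.2, ψ.right_inv hz.1])
    (inter_mem hmem hT) ((hdf φ hφ).2.1.mono_set inter_subset_left).aestronglyMeasurable hL
  refine h1.congr hev (fun k z hz => rfl) (fun z hz => ?_) fun z hz => ?_
  · simp only [φ.left_inv hz.2]
  · exact (chartDeriv_transition df hφ hψ hz.1 hz.2).symm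

end Interior

/-! ### Gluing and bounds for the differential -/

section Gluing

variable {n : ℕ} {N : Type*} [TopologicalSpace N] [ChartedSpace (EuclideanSpace ℝ (Fin n)) N]
  [IsManifold (𝓡 n) ∞ N] {F : Type*} [NormedAddCommGroup F] [NormedSpace ℝ F]
  {φ ψ : OpenPartialHomeomorph N (EuclideanSpace ℝ (Fin n))} {U : Set N} {h : N → F}
  {g : Bundle.ContMDiffRiemannianMetric (𝓡 n) ∞ (EuclideanSpace ℝ (Fin n))
      (fun x : N => TangentSpace (𝓡 n) x)}
  {df : ∀ x : N, TangentSpace (𝓡 n) x →L[ℝ] F} {Λ : ℝ}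

/-- Approximation by smooth maps near a compact subset of `U`: the mollifications in charts are
glued by a partition of unity. -/
theorem exists_localApprox [T2Space N] [SecondCountableTopology N] [ProperSpace F]
    (hU : IsOpen U) (hh : ContinuousOn h U) (hdf : IsWeakDifferential U h df) (hΛ : 0 < Λ)
    (hb : AlmostEverywhereOn n U fun x => ∀ v : TangentSpace (𝓡 n) x,
      Λ⁻¹ * g.inner x v v ≤ ‖df x v‖ ^ 2 ∧ ‖df x v‖ ^ 2 ≤ Λ * g.inner x v v)
    (hVMO : DifferentialMemVMO n U h) {K : Set N} (hK : IsCompact K) (hKU : K ⊆ U) :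
    ∃ w : ℕ → N → F, (∀ k, ContMDiff (𝓡 n) 𝓘(ℝ, F) ∞ (w k)) ∧
      ∀ ψ ∈ IsManifold.maximalAtlas (𝓡 n) ∞ N, ∀ a ∈ ψ.target, ψ.symm a ∈ K →
        LocalApprox (fun p => MemSobolevTwo n p U h) a (fun k z => w k (ψ.symm z))
          (fun z => h (ψ.symm z)) (chartDeriv df ψ) := by
  classical
  have := locallyCompactSpace_of_chartedSpace_euclidean n N
  obtain ⟨K', hK', hKK', hK'U⟩ := exists_compact_between hK hU hKU
  have hchart : ∀ x : N, chartAt (EuclideanSpace ℝ (Fin n)) x ∈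
      IsManifold.maximalAtlas (𝓡 n) ∞ N := fun x => IsManifold.chart_mem_maximalAtlas x
  have hB : ∀ x : N, ∃ B : Set N, IsCompact B ∧
      B ⊆ (chartAt (EuclideanSpace ℝ (Fin n)) x).source ∩ U ∧ (x ∈ K' → B ∈ 𝓝 x) := fun x => by
    by_cases hx : x ∈ K'
    · obtain ⟨B, h1, h2, h3⟩ := local_compact_nhds (inter_mem (chart_source_mem_nhds
        (EuclideanSpace ℝ (Fin n)) x) (hU.mem_nhds (hK'U hx)))
      exact ⟨B, h3, h2, fun _ => h1⟩
    · exact ⟨∅, isCompact_empty, empty_subset _, fun h => absurd h hx⟩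
  choose B hBc hBs hBn using hB
  obtain ⟨t, -, ht⟩ := hK'.elim_nhds_subcover (fun x => interior (B x))
    fun x hx => interior_mem_nhds.2 (hBn x hx)
  obtain ⟨ρ, hρ⟩ := SmoothPartitionOfUnity.exists_isSubordinate (𝓡 n) hK'.isClosed
    (fun i : t => interior (B i)) (fun i => isOpen_interior) (fun x hx => by
      obtain ⟨i, hi, hxi⟩ := mem_iUnion₂.1 (ht hx)
      exact mem_iUnion.2 ⟨⟨i, hi⟩, hxi⟩)
  have hρB : ∀ i : t, tsupport (ρ i) ⊆ B i := fun i => (hρ i).trans interior_subset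
  choose v hv hvL using fun i : t => exists_localApprox_chart hU hh hdf hΛ hb hVMO (hchart i)
    (hBc i) (hBs i)
  refine ⟨fun k x => ∑ i : t, ρ i x • v i k (chartAt (EuclideanSpace ℝ (Fin n)) (i : N) x),
    fun k => ?_, fun ψ hψ a ha haK => ?_⟩
  · refine ContMDiff.sum fun i _ => ρ.contMDiff_smul fun x hx => ?_
    exact (hv i k).contMDiff.contMDiffAt.comp x
      (contMDiffAt_of_mem_maximalAtlas (hchart i) (hBs i (hρB i hx)).1)
  · set x₀ := ψ.symm a with hx₀
    have hx₀U : x₀ ∈ U := hKU haK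
    set s : Finset t := Finset.univ.filter fun i => x₀ ∈ tsupport (ρ i) with hs
    have hψc : ContinuousAt ψ.symm a := ψ.continuousAt_symm ha
    have hoff : ∀ᶠ z in 𝓝 a, ∀ i ∉ s, ρ i (ψ.symm z) = 0 := by
      refine Filter.eventually_all.2 fun i => ?_
      by_cases hi : i ∈ s
      · exact Eventually.of_forall fun _ h => absurd hi h
      · have h1 : x₀ ∉ tsupport (ρ i) := fun h => hi (by simp [hs, h])
        filter_upwards [hψc.eventually (notMem_tsupport_iff_eventuallyEq.1 h1)] with z hz _ using hz
    have hone : ∀ᶠ z in 𝓝 a, ∑ i ∈ s, ρ i (ψ.symm z) = 1 := by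
      filter_upwards [hoff, hψc.eventually (mem_interior_iff_mem_nhds.1 (hKK' haK))] with z hz hzK
      rw [← ρ.sum_eq_one hzK, finsum_eq_sum_of_fintype]
      exact Finset.sum_subset (Finset.subset_univ s) fun i _ hi => hz i hi
    have hne : s.Nonempty := by
      by_contra hcon
      rw [Finset.not_nonempty_iff_eq_empty] at hcon
      have := hone.self_of_nhds
      rw [hcon] at this
      simp at this
    have hsum := LocalApprox.sum (S := fun p => MemSobolevTwo n p U h) (a := a)
      (u := fun z => h (ψ.symm z)) (G := chartDeriv df ψ) hne
      (χ := fun i z => ρ i (ψ.symm z))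
      (w := fun i k z => v i k (chartAt (EuclideanSpace ℝ (Fin n)) (i : N) (ψ.symm z)))
      (fun i _ => by
        filter_upwards [ψ.open_target.mem_nhds ha] with z hz
        rw [← contMDiffAt_iff_contDiffAt]
        exact (ρ i).contMDiff.contMDiffAt.comp z (contMDiffAt_symm_of_mem_maximalAtlas hψ hz))
      hone (fun i _ z => ⟨ρ.nonneg i _, ρ.le_one i _⟩)
      ((isOpen_chartImage ψ hU).mem_nhds (by rw [chartImage_eq]; exact ⟨ha, hx₀U⟩))
      (hdf ψ hψ).2.1.aestronglyMeasurable
      (fun i hi => by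
        have h1 : x₀ ∈ B i := hρB i (Finset.mem_filter.1 hi).2
        exact LocalApprox.transition hU hdf hΛ hb (hchart i) hψ ha (hBs i h1).1 hx₀U (hvL i x₀ h1))
    refine hsum.congr hoff (fun k z hz => ?_) (fun _ _ => rfl) fun _ _ => rfl
    refine Finset.sum_subset (Finset.subset_univ s) fun i _ hi => ?_
    rw [hz i hi, zero_smul]

/-- A uniform consequence of `MeanDerivConvAt`: where `G` is comparable to the metric, so is the
derivative of the approximating functions. -/
theorem LocalApprox.eventually_bounds {S : ℝ≥0∞ → Prop} (hU : IsOpen U) (hΛ : 0 < Λ)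
    (hb : AlmostEverywhereOn n U fun x => ∀ v : TangentSpace (𝓡 n) x,
      Λ⁻¹ * g.inner x v v ≤ ‖df x v‖ ^ 2 ∧ ‖df x v‖ ^ 2 ≤ Λ * g.inner x v v)
    (hψ : ψ ∈ IsManifold.maximalAtlas (𝓡 n) ∞ N) {a : EuclideanSpace ℝ (Fin n)}
    (ha : a ∈ ψ.target) (haU : ψ.symm a ∈ U) {w : ℕ → EuclideanSpace ℝ (Fin n) → F}
    {u : EuclideanSpace ℝ (Fin n) → F} (hw : LocalApprox S a w u (chartDeriv df ψ)) :
    ∀ᶠ q : ℕ × EuclideanSpace ℝ (Fin n) in atTop ×ˢ 𝓝 a, ∀ v,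
      (16 * Λ)⁻¹ * chartMetric g ψ q.2 v v ≤ ‖fderiv ℝ (w q.1) q.2 v‖ ^ 2 ∧
        ‖fderiv ℝ (w q.1) q.2 v‖ ^ 2 ≤ 16 * Λ * chartMetric g ψ q.2 v v := by
  obtain ⟨c, hc, hcB⟩ := exists_pos_mul_norm_sq_le (B := chartMetric g ψ a)
    fun v hv => chartMetric_pos g hψ ha hv
  have hcmp := eventually_chartMetric_le g hψ ha
  obtain ⟨T, hT, hTc⟩ := hcmp.exists_mem
  have hUn : chartImage ψ U ∈ 𝓝 a :=
    (isOpen_chartImage ψ hU).mem_nhds (by rw [chartImage_eq]; exact ⟨ha, haU⟩)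
  -- `η` is chosen such that `2 η² / c` is at most `Λ⁻¹ / 16` and at most `Λ`
  set η : ℝ := √(c / 2 * min (Λ⁻¹ / 16) Λ) with hηdef
  have hη2 : η ^ 2 = c / 2 * min (Λ⁻¹ / 16) Λ := Real.sq_sqrt (by positivity)
  have hη : 0 < η := Real.sqrt_pos.2 (by positivity)
  have hae : ∀ᵐ z ∂(volume.restrict (chartImage ψ U ∩ T)), ∀ v,
      Λ⁻¹ * chartMetric g ψ z v v ≤ ‖chartDeriv df ψ z v‖ ^ 2 ∧
        ‖chartDeriv df ψ z v‖ ^ 2 ≤ Λ * chartMetric g ψ z v v :=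
    ae_restrict_of_ae_restrict_of_subset inter_subset_left (ae_chartMetric_le hb hψ)
  filter_upwards [hw.mean.exists_norm_sub_le (inter_mem hUn hT) hae hη,
    tendsto_snd.eventually hcmp] with q ⟨y, hyT, hy, hyη⟩ hq v
  obtain ⟨h1, h2⟩ := hy v
  obtain ⟨h3, h4⟩ := hTc y hyT.2 v
  obtain ⟨h5, h6⟩ := hq v
  have h7 := hcB v
  set A := chartDeriv df ψ y v
  set D := fderiv ℝ (w q.1) q.2 v
  have h8 : ‖A - D‖ ≤ η * ‖v‖ :=
    ((chartDeriv df ψ y - fderiv ℝ (w q.1) q.2).le_opNorm v).trans (by gcongr)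
  have hΛi : 0 < Λ⁻¹ := inv_pos.2 hΛ
  have hB0 : 0 ≤ chartMetric g ψ a v v := (by positivity : 0 ≤ c * ‖v‖ ^ 2).trans h7
  have hBq : 0 ≤ chartMetric g ψ q.2 v v := by linarith
  have h9 : ‖A - D‖ ^ 2 ≤ min (Λ⁻¹ / 16) Λ * chartMetric g ψ q.2 v v := by
    calc ‖A - D‖ ^ 2 ≤ (η * ‖v‖) ^ 2 := by gcongr
      _ = min (Λ⁻¹ / 16) Λ / 2 * (c * ‖v‖ ^ 2) := by rw [mul_pow, hη2]; ring
      _ ≤ min (Λ⁻¹ / 16) Λ / 2 * (2 * chartMetric g ψ q.2 v v) :=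
        mul_le_mul_of_nonneg_left (h7.trans h6) (by positivity)
      _ = _ := by ring
  have h10 : ‖A - D‖ ^ 2 ≤ Λ⁻¹ / 16 * chartMetric g ψ q.2 v v :=
    h9.trans (mul_le_mul_of_nonneg_right (min_le_left _ _) hBq)
  have h11 : ‖A - D‖ ^ 2 ≤ Λ * chartMetric g ψ q.2 v v :=
    h9.trans (mul_le_mul_of_nonneg_right (min_le_right _ _) hBq)
  have h12 : ‖A‖ ^ 2 ≤ 2 * ‖D‖ ^ 2 + 2 * ‖A - D‖ ^ 2 := by
    have e := norm_le_norm_add_norm_sub' A D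
    nlinarith [sq_nonneg (‖D‖ - ‖A - D‖), norm_nonneg A, norm_nonneg D, norm_nonneg (A - D)]
  have h13 : ‖D‖ ^ 2 ≤ 2 * ‖A‖ ^ 2 + 2 * ‖A - D‖ ^ 2 := by
    have e := norm_le_norm_add_norm_sub A D
    nlinarith [sq_nonneg (‖A‖ - ‖A - D‖), norm_nonneg A, norm_nonneg D, norm_nonneg (A - D)]
  have hyq : chartMetric g ψ y v v ≤ 4 * chartMetric g ψ q.2 v v := by linarith
  have hqy : chartMetric g ψ q.2 v v ≤ 4 * chartMetric g ψ y v v := by linarith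
  constructor
  · rw [mul_inv]
    have e1 : Λ⁻¹ * chartMetric g ψ q.2 v v ≤ 4 * (Λ⁻¹ * chartMetric g ψ y v v) := by
      nlinarith
    nlinarith
  · have e1 : Λ * chartMetric g ψ y v v ≤ 4 * (Λ * chartMetric g ψ q.2 v v) := by nlinarith
    nlinarith

end Gluing

/-! ### Approximation on compact subsets of the domain -/

theorem IsCompact.eventually_forall_of_prod {α X : Type*} [TopologicalSpace X] {l : Filter α}
    {K : Set X} (hK : IsCompact K) {p : α → X → Prop}
    (h : ∀ x ∈ K, ∀ᶠ q : α × X in l ×ˢ 𝓝 x, p q.1 q.2) : ∀ᶠ k in l, ∀ x ∈ K, p k x := by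
  obtain ⟨pa, ha, pb, hb, hab⟩ := Filter.eventually_prod_iff.1 (hK.mem_prod_nhdsSet_of_forall h)
  filter_upwards [ha] with k hk x hx
  exact hab hk (hb.self_of_nhdsSet x hx)

theorem LpTendsto.of_isCompact {X F : Type*} [TopologicalSpace X] [MeasurableSpace X]
    [NormedAddCommGroup F] {μ : Measure X} {p : ℝ≥0∞} (hp1 : 1 ≤ p) (hp : p ≠ ⊤) {w : ℕ → X → F}
    {w₀ : X → F} {S : Set X} (hS : IsCompact S)
    (h : ∀ a ∈ S, ∃ s ∈ 𝓝 a, LpTendsto p (μ.restrict s) w w₀) :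
    LpTendsto p (μ.restrict S) w w₀ := by
  refine hS.induction_on (p := fun A => LpTendsto p (μ.restrict A) w w₀) ?_
    (fun s t hst ht => ht.mono_measure (Measure.restrict_mono hst le_rfl))
    (fun s t hs ht => hs.union hp1 hp ht) fun a ha => ?_
  · rw [Measure.restrict_empty]
    exact ⟨⟨aestronglyMeasurable_zero_measure _, by simp⟩,
      Eventually.of_forall fun _ => aestronglyMeasurable_zero_measure _, by simp⟩
  · obtain ⟨s, hs, h1⟩ := h a ha
    exact ⟨s, mem_nhdsWithin_of_mem_nhds hs, h1⟩

section InteriorApprox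

variable {n : ℕ} {N : Type*} [TopologicalSpace N] [ChartedSpace (EuclideanSpace ℝ (Fin n)) N]
  [IsManifold (𝓡 n) ∞ N] {F : Type*} [NormedAddCommGroup F] [NormedSpace ℝ F]
  {φ ψ : OpenPartialHomeomorph N (EuclideanSpace ℝ (Fin n))} {U : Set N} {h : N → F}
  {g : Bundle.ContMDiffRiemannianMetric (𝓡 n) ∞ (EuclideanSpace ℝ (Fin n))
      (fun x : N => TangentSpace (𝓡 n) x)}
  {df : ∀ x : N, TangentSpace (𝓡 n) x →L[ℝ] F} {Λ : ℝ}

theorem classicalDifferential_apply_eq (hφ : φ ∈ IsManifold.maximalAtlas (𝓡 n) ∞ N) {x : N}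
    (hx : x ∈ φ.source) (hh : MDifferentiableAt (𝓡 n) 𝓘(ℝ, F) h x) (v : TangentSpace (𝓡 n) x) :
    classicalDifferential h x v =
      fderiv ℝ (fun z => h (φ.symm z)) (φ x) (mfderiv (𝓡 n) (𝓡 n) φ x v) := by
  have hinv : φ.symm (φ x) = x := φ.left_inv hx
  rw [fderiv_comp_chart_symm hφ (φ.map_source hx) (by rwa [hinv])]
  let D : N → EuclideanSpace ℝ (Fin n) →L[ℝ] F := classicalDifferential h
  change D x v = D (φ.symm (φ x)) (mfderiv (𝓡 n) (𝓡 n) φ.symm (φ x) (mfderiv (𝓡 n) (𝓡 n) φ x v))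
  rw [hinv]
  erw [mfderiv_chart_symm_apply hφ hx v]

theorem contDiffAt_comp_chart_symm (hφ : φ ∈ IsManifold.maximalAtlas (𝓡 n) ∞ N)
    {z : EuclideanSpace ℝ (Fin n)} (hz : z ∈ φ.target)
    (hh : ContMDiffAt (𝓡 n) 𝓘(ℝ, F) ∞ h (φ.symm z)) : ContDiffAt ℝ ∞ (fun z => h (φ.symm z)) z := by
  rw [← contMDiffAt_iff_contDiffAt]
  exact hh.comp z (contMDiffAt_symm_of_mem_maximalAtlas hφ hz)

variable (n) in
/-- Maps `w k` which approximate `h` on the compact set `K`. -/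
structure InteriorApprox (g : Bundle.ContMDiffRiemannianMetric (𝓡 n) ∞ (EuclideanSpace ℝ (Fin n))
      (fun x : N => TangentSpace (𝓡 n) x)) (U : Set N) (h : N → F)
    (df : ∀ x : N, TangentSpace (𝓡 n) x →L[ℝ] F) (Λ : ℝ) (R : Set F) (K : Set N)
    (w : ℕ → N → F) : Prop where
  smooth : ∀ k, ContMDiff (𝓡 n) 𝓘(ℝ, F) ∞ (w k)
  range : ∀ᶠ k in atTop, ∀ x ∈ K, ∀ᶠ y in 𝓝 x, w k y ∈ R
  unif : ∀ ε > 0, ∀ᶠ k in atTop, ∀ x ∈ K, ‖w k x - h x‖ ≤ ε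
  bounds : ∀ᶠ k in atTop, ∀ x ∈ K, ∀ v : TangentSpace (𝓡 n) x,
    Λ⁻¹ * g.inner x v v ≤ ‖classicalDifferential (w k) x v‖ ^ 2 ∧
      ‖classicalDifferential (w k) x v‖ ^ 2 ≤ Λ * g.inner x v v
  fderiv : ∀ ψ ∈ IsManifold.maximalAtlas (𝓡 n) ∞ N, ∀ S, IsCompact S → S ⊆ ψ.target →
    MapsTo ψ.symm S K → ∀ p : ℝ≥0∞, 1 ≤ p → p ≠ ⊤ →
      LpTendsto p (volume.restrict S) (fun k => fderiv ℝ fun z => w k (ψ.symm z)) (chartDeriv df ψ)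
  fderivTwo : ∀ ψ ∈ IsManifold.maximalAtlas (𝓡 n) ∞ N, ∀ S, IsCompact S → S ⊆ ψ.target →
    MapsTo ψ.symm S K → ∀ p : ℝ≥0∞, 1 ≤ p → p ≠ ⊤ → MemSobolevTwo n p U h → ∀ T, IsOpen T → S ⊆ T →
      ∀ H, HasWeakDeriv (chartImage ψ U ∩ T) (chartDeriv df ψ) H →
        LpTendsto p (volume.restrict S)
          (fun k => _root_.fderiv ℝ (_root_.fderiv ℝ fun z => w k (ψ.symm z))) H

/-- The smooth approximations of `exists_localApprox`, projected to `R` by `P`. -/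
theorem exists_interiorApprox [T2Space N] [SecondCountableTopology N] [ProperSpace F]
    (hU : IsOpen U) (hh : ContinuousOn h U) (hdf : IsWeakDifferential U h df) (hΛ : 0 < Λ)
    (hb : AlmostEverywhereOn n U fun x => ∀ v : TangentSpace (𝓡 n) x,
      Λ⁻¹ * g.inner x v v ≤ ‖df x v‖ ^ 2 ∧ ‖df x v‖ ^ 2 ≤ Λ * g.inner x v v)
    (hVMO : DifferentialMemVMO n U h) {P : F → F} (hP : ContDiff ℝ ∞ P)
    (hPU : ∀ x ∈ U, P (h x) = h x) {K : Set N} (hK : IsCompact K) (hKU : K ⊆ U)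
    {R : Set F} (hR : ∀ x ∈ K, ∀ᶠ z in 𝓝 (h x), P z ∈ R) :
    ∃ w : ℕ → N → F, InteriorApprox n g U h df (16 * Λ) R K w := by
  obtain ⟨v, hv, hvL⟩ := exists_localApprox (g := g) hU hh hdf hΛ hb hVMO hK hKU
  have hchart : ∀ x : N, chartAt (EuclideanSpace ℝ (Fin n)) x ∈
      IsManifold.maximalAtlas (𝓡 n) ∞ N := fun x => IsManifold.chart_mem_maximalAtlas x
  have hUn : ∀ {ψ : OpenPartialHomeomorph N (EuclideanSpace ℝ (Fin n))}
      {a : EuclideanSpace ℝ (Fin n)}, a ∈ ψ.target → ψ.symm a ∈ K → chartImage ψ U ∈ 𝓝 a :=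
    fun ha haK => (isOpen_chartImage _ hU).mem_nhds (by rw [chartImage_eq]; exact ⟨ha, hKU haK⟩)
  have hwL : ∀ ψ ∈ IsManifold.maximalAtlas (𝓡 n) ∞ N, ∀ a ∈ ψ.target, ψ.symm a ∈ K →
      LocalApprox (fun p => MemSobolevTwo n p U h) a (fun k z => P (v k (ψ.symm z)))
        (fun z => h (ψ.symm z)) (chartDeriv df ψ) := fun ψ hψ a ha haK => by
    obtain ⟨T, hT, L, hL⟩ := exists_ae_norm_chartDeriv_le (U := U) hΛ hb hψ ha
    refine (hvL ψ hψ a ha haK).postcomp hP (inter_mem (hUn ha haK) hT) (fun x hx => ?_)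
      ((hdf ψ hψ).mono inter_subset_left) hL
    have h1 := hx.1
    rw [chartImage_eq] at h1
    exact hPU _ h1.2
  have hprod : ∀ (x : N) {p : ℕ → EuclideanSpace ℝ (Fin n) → Prop},
      (∀ᶠ q : ℕ × EuclideanSpace ℝ (Fin n) in
        atTop ×ˢ 𝓝 (chartAt (EuclideanSpace ℝ (Fin n)) x x), p q.1 q.2) →
      ∀ᶠ q : ℕ × N in atTop ×ˢ 𝓝 x, q.2 ∈ (chartAt (EuclideanSpace ℝ (Fin n)) x).source ∧
        p q.1 (chartAt (EuclideanSpace ℝ (Fin n)) x q.2) := fun x p hp => by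
    refine (tendsto_snd.eventually (chart_source_mem_nhds (EuclideanSpace ℝ (Fin n)) x)).and ?_
    exact (tendsto_id.prodMap ((chartAt (EuclideanSpace ℝ (Fin n)) x).continuousAt
      (mem_chart_source _ x))).eventually hp
  have hinv : ∀ x : N, (chartAt (EuclideanSpace ℝ (Fin n)) x).symm
      (chartAt (EuclideanSpace ℝ (Fin n)) x x) = x :=
    fun x => (chartAt (EuclideanSpace ℝ (Fin n)) x).left_inv (mem_chart_source _ x)
  have hpt : ∀ x ∈ K, LocalApprox (fun p => MemSobolevTwo n p U h)
      (chartAt (EuclideanSpace ℝ (Fin n)) x x)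
      (fun k z => P (v k ((chartAt (EuclideanSpace ℝ (Fin n)) x).symm z)))
      (fun z => h ((chartAt (EuclideanSpace ℝ (Fin n)) x).symm z))
      (chartDeriv df (chartAt (EuclideanSpace ℝ (Fin n)) x)) := fun x hx =>
    hwL _ (hchart x) _ (mem_chart_target _ x) (by rwa [hinv])
  have hsm : ∀ k, ContMDiff (𝓡 n) 𝓘(ℝ, F) ∞ fun x => P (v k x) := fun k =>
    hP.contMDiff.comp (hv k)
  refine ⟨fun k x => P (v k x), hsm, ?_, fun ε hε => ?_, ?_, fun ψ hψ S hS hSψ hSK p hp1 hp => ?_,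
    fun ψ hψ S hS hSψ hSK p hp1 hp hp2 T hT hST H hH => ?_⟩
  · refine hK.eventually_forall_of_prod fun x hx => ?_
    have h1 := (hvL _ (hchart x) _ (mem_chart_target _ x) (by rwa [hinv])).tendsto
    simp only [hinv] at h1
    filter_upwards [hprod x (p := fun k z => ∀ᶠ z' in
      𝓝 (v k ((chartAt (EuclideanSpace ℝ (Fin n)) x).symm z)), P z' ∈ R)
      (h1.eventually (hR x hx).eventually_nhds)] with q hq
    rw [(chartAt (EuclideanSpace ℝ (Fin n)) x).left_inv hq.1] at hq
    exact (hv q.1).continuous.continuousAt.eventually hq.2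
  · refine hK.eventually_forall_of_prod fun x hx => ?_
    obtain ⟨s, hs, h1⟩ := (hpt x hx).unif
    filter_upwards [hprod x (p := fun k z => (∀ y ∈ s,
      ‖P (v k ((chartAt (EuclideanSpace ℝ (Fin n)) x).symm y)) -
        h ((chartAt (EuclideanSpace ℝ (Fin n)) x).symm y)‖ ≤ ε) ∧ z ∈ s)
      ((tendsto_fst.eventually (h1 ε hε)).and (tendsto_snd.eventually hs))] with q hq
    have := hq.2.1 _ hq.2.2
    rwa [(chartAt (EuclideanSpace ℝ (Fin n)) x).left_inv hq.1] at this
  · refine hK.eventually_forall_of_prod fun x hx => ?_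
    have h1 := LocalApprox.eventually_bounds hU hΛ hb (hchart x) (mem_chart_target _ x)
      (by rw [hinv]; exact hKU hx) (hpt x hx)
    filter_upwards [hprod x (p := fun k z => ∀ v', (16 * Λ)⁻¹ * chartMetric g _ z v' v' ≤
      ‖fderiv ℝ (fun z => P (v k ((chartAt (EuclideanSpace ℝ (Fin n)) x).symm z))) z v'‖ ^ 2 ∧
      ‖fderiv ℝ (fun z => P (v k ((chartAt (EuclideanSpace ℝ (Fin n)) x).symm z))) z v'‖ ^ 2 ≤
        16 * Λ * chartMetric g _ z v' v') h1] with q hq v'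
    rw [classicalDifferential_apply_eq (hchart x) hq.1 ((hsm q.1).mdifferentiableAt (by simp)) v',
      inner_eq_chartMetric g (hchart x) hq.1 v']
    exact hq.2 _
  · exact LpTendsto.of_isCompact hp1 hp hS fun a ha =>
      (hwL ψ hψ a (hSψ ha) (hSK ha)).exists_lpTendsto_fderiv (hUn (hSψ ha) (hSK ha)) (hdf ψ hψ)
        hp1 hp
  · exact LpTendsto.of_isCompact hp1 hp hS fun a ha =>
      (hwL ψ hψ a (hSψ ha) (hSK ha)).exists_lpTendsto_fderiv_two
        (inter_mem (hUn (hSψ ha) (hSK ha)) (hT.mem_nhds (hST ha)))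
        ((hdf ψ hψ).mono inter_subset_left) hH hp1 hp hp2

end InteriorApprox

/-! ### Convergence up to the boundary -/

/-- A countable cofinal family of exponents: convergence for all exponents in `S` at once is a
countable requirement. -/
theorem exists_seq_cofinal {S : Set ℝ≥0∞} (hS : S.Nonempty) :
    ∃ q : ℕ → ℝ≥0∞, (∀ j, q j ∈ S) ∧ ∀ p ∈ S, ∃ j, p ≤ q j := by
  by_cases h : sSup S ∈ S
  · exact ⟨fun _ => sSup S, fun _ => h, fun p hp => ⟨0, le_sSup hp⟩⟩
  · obtain ⟨q, -, hq, hqS⟩ := exists_seq_tendsto_sSup hS (OrderTop.bddAbove S)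
    refine ⟨q, hqS, fun p hp => ?_⟩
    have hlt : p < sSup S := (le_sSup hp).lt_of_ne fun h' => h (h' ▸ hp)
    obtain ⟨j, hj⟩ := (hq.eventually (lt_mem_nhds hlt)).exists
    exact ⟨j, hj.le⟩

/-- On sets contained in a set of finite measure, convergence to zero in `L^q` implies convergence
in `L^p` for `p ≤ q`. -/
theorem tendsto_eLpNorm_zero_mono_exponent {α F : Type*} [MeasurableSpace α] [NormedAddCommGroup F]
    {μ : Measure α} {p q : ℝ≥0∞} (hp1 : 1 ≤ p) (hpq : p ≤ q) (hq : q ≠ ⊤) {B : Set α} (hB : μ B ≠ ⊤)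
    {S : ℕ → Set α} (hS : ∀ k, S k ⊆ B) {f : ℕ → α → F}
    (hf : ∀ k, AEStronglyMeasurable (f k) (μ.restrict (S k)))
    (h : Tendsto (fun k => eLpNorm (f k) q (μ.restrict (S k))) atTop (𝓝 0)) :
    Tendsto (fun k => eLpNorm (f k) p (μ.restrict (S k))) atTop (𝓝 0) := by
  have hp : p ≠ ⊤ := ne_top_of_le_ne_top hq hpq
  have he : 0 ≤ 1 / p.toReal - 1 / q.toReal := sub_nonneg.2
    (one_div_le_one_div_of_le (ENNReal.toReal_pos (zero_lt_one.trans_le hp1).ne' hp)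
      (ENNReal.toReal_mono hq hpq))
  have h0 : Tendsto (fun k => eLpNorm (f k) q (μ.restrict (S k)) *
      μ B ^ (1 / p.toReal - 1 / q.toReal)) atTop (𝓝 0) := by
    have := ENNReal.Tendsto.mul_const h (b := μ B ^ (1 / p.toReal - 1 / q.toReal))
      (Or.inr (ENNReal.rpow_lt_top_of_nonneg he hB).ne)
    rwa [zero_mul] at this
  refine tendsto_of_tendsto_of_tendsto_of_le_of_le tendsto_const_nhds h0 (fun _ => zero_le)
    fun k => (eLpNorm_le_eLpNorm_mul_rpow_measure_univ hpq (hf k)).trans ?_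
  rw [Measure.restrict_apply_univ]
  gcongr
  exact hS k

section LocalConvergence

variable {n : ℕ} {N : Type*} [TopologicalSpace N] [ChartedSpace (EuclideanSpace ℝ (Fin n)) N]
  [IsManifold (𝓡 n) ∞ N] {F : Type*} [NormedAddCommGroup F] [NormedSpace ℝ F]
  {φ ψ : OpenPartialHomeomorph N (EuclideanSpace ℝ (Fin n))} {U W : Set N} {h : N → F}
  {g : Bundle.ContMDiffRiemannianMetric (𝓡 n) ∞ (EuclideanSpace ℝ (Fin n))
      (fun x : N => TangentSpace (𝓡 n) x)}
  {df : ∀ x : N, TangentSpace (𝓡 n) x →L[ℝ] F} {Λ : ℝ}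

/-- A ball of radius `R` around `a` in the target of a chart, where `df` and the metric are bounded
and where `df` has the weak derivative `H`, in `L^p` whenever `h` belongs to `W^{2,p}`. -/
structure ChartBall (g : Bundle.ContMDiffRiemannianMetric (𝓡 n) ∞ (EuclideanSpace ℝ (Fin n))
      (fun x : N => TangentSpace (𝓡 n) x)) (U : Set N) (h : N → F)
    (df : ∀ x : N, TangentSpace (𝓡 n) x →L[ℝ] F)
    (φ : OpenPartialHomeomorph N (EuclideanSpace ℝ (Fin n))) (a : EuclideanSpace ℝ (Fin n))
    (R L : ℝ)
    (H : EuclideanSpace ℝ (Fin n) →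
      EuclideanSpace ℝ (Fin n) →L[ℝ] EuclideanSpace ℝ (Fin n) →L[ℝ] F) : Prop where
  pos : 0 < R
  subset_target : closedBall a R ⊆ φ.target
  norm_chartDeriv_le : ∀ᵐ z ∂(volume.restrict (chartImage φ U ∩ closedBall a R)),
    ‖chartDeriv df φ z‖ ≤ L
  chartMetric_le : ∀ z ∈ closedBall a R, ∀ v, chartMetric g φ z v v ≤ L * ‖v‖ ^ 2
  hasWeakDeriv : ∃ T, IsOpen T ∧ closedBall a R ⊆ T ∧ ∀ p, MemSobolevTwo n p U h →
    HasWeakDeriv (chartImage φ U ∩ T) (chartDeriv df φ) H ∧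
      MemLp H p (volume.restrict (chartImage φ U ∩ closedBall a R))

/-- Such balls exist around every point; `H` is the second derivative of `h` times a cutoff
function, and does not depend on the exponent by uniqueness of weak derivatives. -/
theorem exists_chartBall [T2Space N] [SecondCountableTopology N] [CompleteSpace F] (hU : IsOpen U)
    (hdf : IsWeakDifferential U h df) (hΛ : 0 < Λ)
    (hb : AlmostEverywhereOn n U fun x => ∀ v : TangentSpace (𝓡 n) x,
      Λ⁻¹ * g.inner x v v ≤ ‖df x v‖ ^ 2 ∧ ‖df x v‖ ^ 2 ≤ Λ * g.inner x v v)
    (hφ : φ ∈ IsManifold.maximalAtlas (𝓡 n) ∞ N) {a : EuclideanSpace ℝ (Fin n)}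
    (ha : a ∈ φ.target) : ∃ R L H, ChartBall g U h df φ a R L H := by
  obtain ⟨T₁, hT₁, L, hL⟩ := exists_ae_norm_chartDeriv_le (U := U) hΛ hb hφ ha
  obtain ⟨ξ, hξφ, W, hW, haW, hWφ, hξ⟩ := exists_isCutoff_eq_one (φ := φ) (C := {φ.symm a})
    isCompact_singleton (singleton_subset_iff.2 (φ.map_target ha))
  set T := φ.target ∩ φ.symm ⁻¹' W with hTdef
  have hT : IsOpen T := φ.symm.isOpen_inter_preimage hW
  have hUT : chartImage φ (U ∩ W) = chartImage φ U ∩ T := by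
    ext z
    simp only [chartImage_eq, hTdef, mem_inter_iff, mem_preimage]
    tauto
  have haT : a ∈ T := ⟨ha, haW rfl⟩
  obtain ⟨R, hR, hRsub⟩ := Metric.nhds_basis_closedBall.mem_iff.1 (inter_mem (hT.mem_nhds haT)
    (inter_mem hT₁ (eventually_chartMetric_le g hφ ha)))
  have hmeas : chartImage φ U ∩ closedBall a R ⊆ chartImage φ U ∩ T :=
    inter_subset_inter_right _ fun z hz => (hRsub hz).1
  have hH : ∃ H, ∀ p, MemSobolevTwo n p U h →
    HasWeakDeriv (chartImage φ U ∩ T) (chartDeriv df φ) H ∧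
      MemLp H p (volume.restrict (chartImage φ U ∩ closedBall a R)) := by
    by_cases hex : ∃ p, MemSobolevTwo n p U h
    · obtain ⟨p₀, hp₀⟩ := hex
      obtain ⟨H, hH, -⟩ := exists_hasWeakDeriv_chartDeriv hU hdf hφ hξφ hW hξ hp₀
      rw [hUT] at hH
      refine ⟨H, fun p hp => ⟨hH, ?_⟩⟩
      obtain ⟨H', hH', hHp⟩ := exists_hasWeakDeriv_chartDeriv hU hdf hφ hξφ hW hξ hp
      rw [hUT] at hH' hHp
      have := hH'.unique ((isOpen_chartImage φ hU).inter hT) hH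
      exact ((memLp_congr_ae this).1 hHp).mono_measure (Measure.restrict_mono hmeas le_rfl)
    · exact ⟨fun _ => 0, fun p hp => absurd ⟨p, hp⟩ hex⟩
  obtain ⟨H, hH⟩ := hH
  refine ⟨R, max L (2 * ‖chartMetric g φ a‖), H, hR, fun z hz => (hRsub hz).1.1, ?_,
    fun z hz v => ?_,
    T, hT, fun z hz => (hRsub hz).1, hH⟩
  · filter_upwards [ae_restrict_of_ae_restrict_of_subset (inter_subset_inter_right _
      fun z hz => (hRsub hz).2.1) hL] with z hz using hz.trans (le_max_left _ _)
  · have h1 := ((hRsub hz).2.2 v).1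
    have h3 : chartMetric g φ a v v ≤ ‖chartMetric g φ a‖ * ‖v‖ * ‖v‖ :=
      (le_abs_self _).trans ((chartMetric g φ a).le_opNorm₂ v v)
    calc chartMetric g φ z v v ≤ 2 * ‖chartMetric g φ a‖ * ‖v‖ ^ 2 := by linarith
      _ ≤ _ := by gcongr; exact le_max_right _ _

/-- In a chart, the isotopy maps a small ball into a given larger ball for small times. -/
theorem IsPush.exists_ball (hΦ : IsPush n U W h Φ)
    (hφ : φ ∈ IsManifold.maximalAtlas (𝓡 n) ∞ N) {a : EuclideanSpace ℝ (Fin n)}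
    (ha : a ∈ φ.target) {R : ℝ} (hR : 0 < R) : ∃ r > 0, r ≤ R ∧ ∀ ε : ℕ → ℝ,
      Tendsto ε atTop (𝓝 0) → TendstoIdC2 a r (fun k z => φ (Φ (ε k) (φ.symm z))) ∧
        ∀ᶠ k in atTop, ∀ z ∈ ball a r, z ∈ φ.target ∧ Φ (ε k) (φ.symm z) ∈ φ.source ∧
          φ (Φ (ε k) (φ.symm z)) ∈ closedBall a R := by
  obtain ⟨r₁, hr₁, h1⟩ := hΦ.exists_tendstoIdC2 hφ ha
  have h2 := hΦ.eventually_mem_chart ha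
  rw [nhds_prod_eq] at h2
  obtain ⟨pa, hpa, pb, hpb, hab⟩ := Filter.eventually_prod_iff.1 h2
  obtain ⟨r₂, hr₂, h3⟩ := Metric.eventually_nhds_iff_ball.1 hpb
  refine ⟨min r₁ (min r₂ (R / 2)), by positivity,
    (min_le_right _ _).trans ((min_le_right _ _).trans (half_le_self hR.le)), fun ε hε => ?_⟩
  have h4 := h1 _ (min_le_left r₁ (min r₂ (R / 2))) ε hε
  refine ⟨h4, ?_⟩
  filter_upwards [hε.eventually hpa, h4 (R / 2) (half_pos hR)] with k hk hk' z hz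
  have h5 := hab hk (h3 z (ball_subset_ball ((min_le_right _ _).trans (min_le_left _ _)) hz))
  refine ⟨h5.2.1, h5.2.2, ?_⟩
  have h6 := (hk' z hz).2.1
  have h7 : dist z a < R / 2 := hz.trans_le ((min_le_right _ _).trans (min_le_right _ _))
  rw [mem_closedBall]
  rw [← dist_eq_norm] at h6
  linarith [dist_triangle (φ (Φ (ε k) (φ.symm z))) z a]

/-- The points of the ball `closedBall a R` which belong, in the chart `φ`, to the set `K`. -/
def chartPart (φ : OpenPartialHomeomorph N (EuclideanSpace ℝ (Fin n)))
    (a : EuclideanSpace ℝ (Fin n)) (R : ℝ) (K : Set N) : Set (EuclideanSpace ℝ (Fin n)) :=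
  closedBall a R ∩ φ.symm ⁻¹' K

theorem isCompact_chartPart [T2Space N] {a : EuclideanSpace ℝ (Fin n)} {R : ℝ}
    (hR : closedBall a R ⊆ φ.target) {K : Set N} (hK : IsCompact K) :
    IsCompact (chartPart φ a R K) :=
  (isCompact_closedBall a R).of_isClosed_subset
    ((φ.continuousOn_symm.mono hR).preimage_isClosed_of_isClosed isClosed_closedBall hK.isClosed)
    inter_subset_left

/-- Convergence near a point of a composition of approximating functions `w k`, close to `h` on
compact sets `K k`, with the isotopy at times `ε k`. -/
theorem ChartBall.jetConv [T2Space N] [CompleteSpace F] {a : EuclideanSpace ℝ (Fin n)} {R L : ℝ}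
    {H : EuclideanSpace ℝ (Fin n) →
      EuclideanSpace ℝ (Fin n) →L[ℝ] EuclideanSpace ℝ (Fin n) →L[ℝ] F}
    (hball : ChartBall g U h df φ a R L H) (hU : IsOpen U) (hh : ContinuousOn h U)
    (hdf : IsWeakDifferential U h df)
    (hφ : φ ∈ IsManifold.maximalAtlas (𝓡 n) ∞ N) {C : ℝ} (hC : ∀ x ∈ U, ‖h x‖ ≤ C)
    {Φ : ℕ → N → N} {K : ℕ → Set N} (hK : ∀ k, IsCompact (K k)) (hKU : ∀ k, K k ⊆ U)
    (hΦK : ∀ k, MapsTo (Φ k) U (K k)) {r : ℝ} (hrR : r ≤ R)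
    (hr : TendstoIdC2 a r (fun k z => φ (Φ k (φ.symm z))))
    (hΦr : ∀ᶠ k in atTop, ∀ z ∈ ball a r, z ∈ φ.target ∧ Φ k (φ.symm z) ∈ φ.source ∧
      φ (Φ k (φ.symm z)) ∈ closedBall a R)
    {w : ℕ → N → F} (hw : ∀ k, ContMDiff (𝓡 n) 𝓘(ℝ, F) ∞ (w k))
    (hunif : ∀ ε > 0, ∀ᶠ k in atTop, ∀ x ∈ K k, ‖w k x - h x‖ ≤ ε) (hΛ : 0 < Λ)
    (hbd : ∀ k, ∀ x ∈ K k, ∀ v : TangentSpace (𝓡 n) x,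
      ‖classicalDifferential (w k) x v‖ ^ 2 ≤ Λ * g.inner x v v)
    {p : ℝ≥0∞} (hp1 : 1 ≤ p) (hp : p ≠ ⊤)
    (hD : Tendsto (fun k => eLpNorm (fun z => fderiv ℝ (fun z => w k (φ.symm z)) z -
      chartDeriv df φ z) p (volume.restrict (chartPart φ a R (K k)))) atTop (𝓝 0)) :
    JetConv p (ball a r ∩ chartImage φ U) (fun k z => w k (Φ k (φ.symm z))) ∧
      LpTendsto p (volume.restrict (ball a r ∩ chartImage φ U))
        (fun k => fderiv ℝ fun z => w k (Φ k (φ.symm z))) (chartDeriv df φ) ∧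
      (MemSobolevTwo n p U h → Tendsto (fun k => eLpNorm (fun z => fderiv ℝ
        (fderiv ℝ (fun z => w k (φ.symm z))) z - H z) p
          (volume.restrict (chartPart φ a R (K k)))) atTop (𝓝 0) →
        JetConv p (ball a r ∩ chartImage φ U) (fun k => fderiv ℝ fun z =>
          w k (Φ k (φ.symm z)))) := by
  have hΩo := isOpen_chartImage φ hU
  have hΩ : MeasurableSet (chartImage φ U) := hΩo.measurableSet
  set B := chartImage φ U ∩ closedBall a R with hB
  have hBm : MeasurableSet B := hΩ.inter measurableSet_closedBall
  have hBfin : volume B ≠ ⊤ := ne_top_of_le_ne_top measure_closedBall_lt_top.ne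
    (measure_mono inter_subset_right)
  have : IsFiniteMeasure (volume.restrict B) := ⟨by simpa using hBfin.lt_top⟩
  have hBk : ∀ k, chartPart φ a R (K k) ⊆ B := fun k z hz =>
    ⟨by rw [chartImage_eq]; exact ⟨hball.subset_target hz.1, hKU k hz.2⟩, hz.1⟩
  have hBkm : ∀ k, MeasurableSet (chartPart φ a R (K k)) := fun k =>
    (isCompact_chartPart hball.subset_target (hK k)).measurableSet
  have hAB : ball a r ∩ chartImage φ U ⊆ B := fun z hz =>
    ⟨hz.2, (ball_subset_ball hrR).trans ball_subset_closedBall hz.1⟩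
  have hmaps : ∀ᶠ k in atTop, MapsTo (fun z => φ (Φ k (φ.symm z))) (ball a r ∩ chartImage φ U)
      (chartPart φ a R (K k)) := by
    filter_upwards [hΦr] with k hk z hz
    have h1 := hz.2
    rw [chartImage_eq] at h1
    refine ⟨(hk z hz.1).2.2, ?_⟩
    rw [mem_preimage, φ.left_inv (hk z hz.1).2.1]
    exact hΦK k h1.2
  have hv : ∀ k, ∀ z ∈ chartPart φ a R (K k), ContDiffAt ℝ ∞ (fun z => w k (φ.symm z)) z :=
    fun k z hz => contDiffAt_comp_chart_symm hφ (hball.subset_target hz.1) (hw k).contMDiffAt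
  have hvC : ∀ᶠ k in atTop, ∀ z ∈ chartPart φ a R (K k), ‖w k (φ.symm z)‖ ≤ C + 1 := by
    filter_upwards [hunif 1 one_pos] with k hk z hz
    have e1 := hk _ hz.2
    have e2 := hC _ (hKU k hz.2)
    linarith [norm_le_norm_add_norm_sub' (w k (φ.symm z)) (h (φ.symm z))]
  have hu : MemLp (fun z => h (φ.symm z)) p (volume.restrict B) := by
    refine MemLp.of_bound
      ((hh.comp_chart_symm.mono inter_subset_left).aestronglyMeasurable hBm) C ?_
    filter_upwards [ae_restrict_mem hBm] with z hz
    have h1 := hz.1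
    rw [chartImage_eq] at h1
    exact hC _ h1.2
  have hGm : AEStronglyMeasurable (chartDeriv df φ) (volume.restrict B) :=
    ((hdf φ hφ).2.1.mono_set inter_subset_left).aestronglyMeasurable
  have hG : MemLp (chartDeriv df φ) p (volume.restrict B) :=
    MemLp.of_bound hGm L hball.norm_chartDeriv_le
  have hvu : Tendsto (fun k => eLpNorm (fun z => w k (φ.symm z) - h (φ.symm z)) p
      (volume.restrict (chartPart φ a R (K k)))) atTop (𝓝 0) := by
    have h1 : Tendsto (fun η : ℝ => volume B ^ p.toReal⁻¹ * ENNReal.ofReal η) (𝓝[>] 0) (𝓝 0) := by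
      have h2 := ENNReal.Tendsto.const_mul (a := volume B ^ p.toReal⁻¹)
        ((ENNReal.continuous_ofReal.tendsto 0).mono_left (nhdsWithin_le_nhds (s := Ioi (0 : ℝ))))
        (Or.inr (ENNReal.rpow_lt_top_of_nonneg (by positivity) hBfin).ne)
      simpa using h2
    refine ENNReal.tendsto_nhds_zero.2 fun e he => ?_
    obtain ⟨η, hη, hη0⟩ := ((ENNReal.tendsto_nhds_zero.1 h1 e he).and
      (eventually_mem_nhdsWithin (s := Ioi (0 : ℝ)))).exists
    filter_upwards [hunif η hη0] with k hk
    refine (eLpNorm_le_of_ae_bound (C := η) ?_).trans (le_trans ?_ hη)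
    · filter_upwards [ae_restrict_mem (hBkm k)] with z hz using hk _ hz.2
    · rw [Measure.restrict_apply_univ]
      gcongr
      exact hBk k
  obtain ⟨j1, -, j2⟩ := hr.jetConv_comp hp1 hp hΩ hBm hAB (Eventually.of_forall hBkm)
    (Eventually.of_forall hBk) hmaps (Eventually.of_forall hv) hvC hu hvu hG hD
  have hcongr : ∀ᶠ k in atTop, ∀ z ∈ ball a r ∩ chartImage φ U,
      (fun z => w k (φ.symm (φ (Φ k (φ.symm z))))) =ᶠ[𝓝 z] fun z => w k (Φ k (φ.symm z)) := by
    filter_upwards [hΦr] with k hk z hz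
    filter_upwards [isOpen_ball.mem_nhds hz.1] with y hy
    simp only [φ.left_inv (hk y hy).2.1]
  have hA : MeasurableSet (ball a r ∩ chartImage φ U) := measurableSet_ball.inter hΩ
  refine ⟨j1.congr hA hcongr, j2.congr ?_ ae_eq_rfl, fun hS hD2 => ?_⟩
  · filter_upwards [hcongr] with k hk
    filter_upwards [ae_restrict_mem hA] with z hz using (hk z hz).fderiv_eq
  · obtain ⟨T, hT, hTs, hTH⟩ := hball.hasWeakDeriv
    have hvb : ∀ k, ∀ z ∈ chartPart φ a R (K k),
        ‖fderiv ℝ (fun z => w k (φ.symm z)) z‖ ≤ √(Λ * max L 0) := fun k z hz => by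
      refine ContinuousLinearMap.opNorm_le_bound _ (Real.sqrt_nonneg _) fun v => ?_
      refine (sq_le_sq₀ (norm_nonneg _) (by positivity)).1 ?_
      rw [fderiv_comp_chart_symm hφ (hball.subset_target hz.1)
        ((hw k).mdifferentiableAt (by simp)), mul_pow, Real.sq_sqrt (by positivity)]
      calc ‖chartDeriv (classicalDifferential (w k)) φ z v‖ ^ 2
          ≤ Λ * chartMetric g φ z v v := hbd k _ hz.2 (chartSymmDeriv φ z v)
        _ ≤ Λ * (L * ‖v‖ ^ 2) := by
          gcongr
          exact hball.chartMetric_le z hz.1 v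
        _ ≤ Λ * (max L 0 * ‖v‖ ^ 2) := by
          gcongr
          exact le_max_left _ _
        _ = _ := by ring
    obtain ⟨j3, -, -⟩ := hr.jetConv_comp hp1 hp hΩ hBm hAB (Eventually.of_forall hBkm)
      (Eventually.of_forall hBk) hmaps
      (Eventually.of_forall fun k z hz => (hv k z hz).fderiv_infty) (Eventually.of_forall hvb) hG hD
      (hTH p hS).2 hD2
    exact (hr.jetConv_fderiv_comp hp1 hp hΩ hmaps (Eventually.of_forall hv) j3).congr hA
      (hcongr.mono fun k hk z hz => (hk z hz).fderiv)

end LocalConvergence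

/-! ### The approximating sequence -/

section ApproxSeq

variable {n : ℕ} {N : Type*} [TopologicalSpace N] [ChartedSpace (EuclideanSpace ℝ (Fin n)) N]
  [IsManifold (𝓡 n) ∞ N] {F : Type*} [NormedAddCommGroup F] [NormedSpace ℝ F]
  {φ ψ : OpenPartialHomeomorph N (EuclideanSpace ℝ (Fin n))} {U W : Set N} {h : N → F}
  {g : Bundle.ContMDiffRiemannianMetric (𝓡 n) ∞ (EuclideanSpace ℝ (Fin n))
      (fun x : N => TangentSpace (𝓡 n) x)}
  {df : ∀ x : N, TangentSpace (𝓡 n) x →L[ℝ] F} {Λ : ℝ} {R : Set F} {Φ : ℝ → N → N}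

/-- Smooth maps `f k`, with values in `R` near `closure U`, which approximate `h` on `U`. They are
defined on all of `N`, but controlled only on `closure U`. Convergence of the derivatives is
required near each point of `closure U` in one chart only; in the field `conv` the derivatives
converge in `L^1`, and the second derivatives in `L^p` whenever `h` belongs to `W^{2,p}`. -/
structure ApproxSeq (g : Bundle.ContMDiffRiemannianMetric (𝓡 n) ∞ (EuclideanSpace ℝ (Fin n))
      (fun x : N => TangentSpace (𝓡 n) x)) (U : Set N) (h : N → F)
    (df : ∀ x : N, TangentSpace (𝓡 n) x →L[ℝ] F) (Λ : ℝ) (R : Set F) (f : ℕ → N → F) : Prop where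
  smooth : ∀ k, ContMDiff (𝓡 n) 𝓘(ℝ, F) ∞ (f k)
  range : ∀ k, ∀ x ∈ closure U, ∀ᶠ y in 𝓝 x, f k y ∈ R
  unif : ∀ ε > 0, ∀ᶠ k in atTop, ∀ x ∈ U, ‖f k x - h x‖ ≤ ε
  bounds : ∀ k, ∀ x ∈ closure U, ∀ v : TangentSpace (𝓡 n) x,
    Λ⁻¹ * g.inner x v v ≤ ‖classicalDifferential (f k) x v‖ ^ 2 ∧
      ‖classicalDifferential (f k) x v‖ ^ 2 ≤ Λ * g.inner x v v
  conv : ∀ x ∈ closure U, ∃ φ ∈ IsManifold.maximalAtlas (𝓡 n) ∞ N, x ∈ φ.source ∧ ∃ r > 0,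
    LpTendsto 1 (volume.restrict (ball (φ x) r ∩ chartImage φ U))
      (fun k => fderiv ℝ fun z => f k (φ.symm z)) (chartDeriv df φ) ∧
    ∀ p : ℝ≥0∞, 1 ≤ p → p ≠ ⊤ → MemSobolevTwo n p U h →
      JetConv p (ball (φ x) r ∩ chartImage φ U) (fun k z => f k (φ.symm z)) ∧
      JetConv p (ball (φ x) r ∩ chartImage φ U) (fun k => fderiv ℝ fun z => f k (φ.symm z))

theorem ApproxSeq.comp_subseq {f : ℕ → N → F} (h' : ApproxSeq g U h df Λ R f) {σ : ℕ → ℕ}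
    (hσ : Tendsto σ atTop atTop) : ApproxSeq g U h df Λ R (fun k => f (σ k)) := by
  refine ⟨fun k => h'.smooth _, fun k => h'.range _, fun ε hε => hσ.eventually (h'.unif ε hε),
    fun k => h'.bounds _, fun x hx => ?_⟩
  obtain ⟨φ, hφ, hxφ, r, hr, h1, h2⟩ := h'.conv x hx
  exact ⟨φ, hφ, hxφ, r, hr, h1.comp_subseq hσ, fun p hp1 hp hS =>
    ⟨(h2 p hp1 hp hS).1.comp_subseq hσ, (h2 p hp1 hp hS).2.comp_subseq hσ⟩⟩

/-- Arbitrarily small times at which the isotopy is nearly isometric on `closure U`. -/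
theorem IsPush.exists_seq (hΦ : IsPush n U W h Φ) (hUc : IsCompact (closure U))
    (g : Bundle.ContMDiffRiemannianMetric (𝓡 n) ∞ (EuclideanSpace ℝ (Fin n))
      (fun x : N => TangentSpace (𝓡 n) x)) :
    ∃ ε : ℕ → ℝ, (∀ k, ε k ∈ Ioo 0 1) ∧ Tendsto ε atTop (𝓝 0) ∧
      ∀ k, ∀ x ∈ closure U, ∀ v : TangentSpace (𝓡 n) x,
        g.inner (Φ (ε k) x) (mfderiv (𝓡 n) (𝓡 n) (Φ (ε k)) x v)
          (mfderiv (𝓡 n) (𝓡 n) (Φ (ε k)) x v) ≤ 4 * g.inner x v v ∧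
        g.inner x v v ≤ 4 * g.inner (Φ (ε k) x) (mfderiv (𝓡 n) (𝓡 n) (Φ (ε k)) x v)
          (mfderiv (𝓡 n) (𝓡 n) (Φ (ε k)) x v) := by
  have h1 : ∀ᶠ e in 𝓝 (0 : ℝ), ∀ x ∈ closure U, ∀ v : TangentSpace (𝓡 n) x,
      g.inner (Φ e x) (mfderiv (𝓡 n) (𝓡 n) (Φ e) x v) (mfderiv (𝓡 n) (𝓡 n) (Φ e) x v) ≤
        4 * g.inner x v v ∧ g.inner x v v ≤ 4 * g.inner (Φ e x)
          (mfderiv (𝓡 n) (𝓡 n) (Φ e) x v) (mfderiv (𝓡 n) (𝓡 n) (Φ e) x v) :=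
    hUc.eventually_forall_of_forall_eventually (fun x _ => hΦ.eventually_inner_le g x)
  obtain ⟨δ, hδ, h2⟩ := Metric.eventually_nhds_iff_ball.1 h1
  have hpos : 0 < min δ 1 := lt_min hδ one_pos
  have hlt : ∀ k : ℕ, min δ 1 / ((k + 2 : ℕ) : ℝ) < min δ 1 := fun k =>
    div_lt_self hpos (by push_cast; linarith [k.cast_nonneg (α := ℝ)])
  have hpos' : ∀ k : ℕ, 0 < min δ 1 / ((k + 2 : ℕ) : ℝ) := fun k => by positivity
  refine ⟨fun k => min δ 1 / ((k + 2 : ℕ) : ℝ), fun k =>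
    ⟨hpos' k, (hlt k).trans_le (min_le_right _ _)⟩,
    (tendsto_const_div_atTop_nhds_zero_nat (min δ 1)).comp (tendsto_add_atTop_nat 2), fun k => ?_⟩
  refine h2 _ ?_
  rw [mem_ball, Real.dist_eq, sub_zero, abs_of_pos (hpos' k)]
  exact (hlt k).trans_le (min_le_left _ _)

/-- The approximation is a composition of an approximation in the interior with an isotopy which
pushes `closure U` into `U`. The approximation in the interior at step `k` is chosen after the time
of the isotopy, since it is only valid on the image of `closure U` at that time. -/
theorem exists_approxSeq [T2Space N] [SecondCountableTopology N] [ProperSpace F]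
    (hU : IsOpen U) (hUc : IsCompact (closure U)) (hLip : HasLipschitzBoundary (n := n) U)
    (hh : ContinuousOn h U) (hdf : IsWeakDifferential U h df) (hΛ : 0 < Λ)
    (hb : AlmostEverywhereOn n U fun x => ∀ v : TangentSpace (𝓡 n) x,
      Λ⁻¹ * g.inner x v v ≤ ‖df x v‖ ^ 2 ∧ ‖df x v‖ ^ 2 ≤ Λ * g.inner x v v)
    (hVMO : DifferentialMemVMO n U h)
    (hP : ∀ K, IsCompact K → K ⊆ U → ∃ P : F → F, ContDiff ℝ ∞ P ∧ (∀ x ∈ U, P (h x) = h x) ∧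
      ∀ x ∈ K, ∀ᶠ z in 𝓝 (h x), P z ∈ R) :
    ∃ f, ApproxSeq g U h df (64 * Λ) R f := by
  obtain ⟨Φ, hΦ⟩ := exists_isPush (g := g) hU hUc hLip hh hdf hΛ hb
  obtain ⟨ε, hε, hε0, hεg⟩ := hΦ.exists_seq hUc g
  have hε' : ∀ k, ε k ∈ Ioo (-1 : ℝ) 1 := fun k => ⟨by linarith [(hε k).1], (hε k).2⟩
  have hΦc : ∀ k, ContMDiff (𝓡 n) (𝓡 n) ∞ (Φ (ε k)) := fun k => hΦ.contMDiff (hε' k)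
  set K : ℕ → Set N := fun k => Φ (ε k) '' closure U with hKdef
  have hK : ∀ k, IsCompact (K k) := fun k => hUc.image (hΦc k).continuous
  have hKU : ∀ k, K k ⊆ U := by
    rintro k _ ⟨x, hx, rfl⟩
    exact (hΦ.push _ (hε k) x hx).elim id fun h' => absurd hx h'.2
  have hΦK : ∀ k, MapsTo (Φ (ε k)) U (K k) := fun k x hx => ⟨x, subset_closure hx, rfl⟩
  obtain ⟨L₀, hL₀⟩ := hΦ.conv
  -- `h` is bounded: it is bounded on a compact set, and the isotopy changes it by a bounded amount
  obtain ⟨C, hC⟩ : ∃ C, ∀ x ∈ U, ‖h x‖ ≤ C := by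
    obtain ⟨D, hD⟩ := ((hK 0).image_of_continuousOn (hh.mono (hKU 0))).isBounded.exists_norm_le
    refine ⟨D + L₀ * ε 0, fun x hx => ?_⟩
    have h1 := hL₀ _ (hε 0) x hx
    have h2 := hD _ ⟨_, hΦK 0 hx, rfl⟩
    rw [norm_sub_rev] at h1
    linarith [norm_le_norm_add_norm_sub' (h x) (h (Φ (ε 0) x))]
  have hchart : ∀ x : N, chartAt (EuclideanSpace ℝ (Fin n)) x ∈
      IsManifold.maximalAtlas (𝓡 n) ∞ N := fun x => IsManifold.chart_mem_maximalAtlas x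
  choose ρ L H hball using fun x : N => exists_chartBall hU hdf hΛ hb (hchart x)
    (mem_chart_target (EuclideanSpace ℝ (Fin n)) x)
  choose r hr hrρ hrε using fun x : N => hΦ.exists_ball (hchart x)
    (mem_chart_target (EuclideanSpace ℝ (Fin n)) x) (hball x).pos
  obtain ⟨J, -, hJ⟩ := hUc.elim_nhds_subcover
    (fun x => (chartAt (EuclideanSpace ℝ (Fin n)) x).source ∩
      chartAt (EuclideanSpace ℝ (Fin n)) x ⁻¹' ball (chartAt (EuclideanSpace ℝ (Fin n)) x x) (r x))
    fun x _ => ((chartAt (EuclideanSpace ℝ (Fin n)) x).isOpen_inter_preimage isOpen_ball).mem_nhds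
      ⟨mem_chart_source _ x, mem_ball_self (hr x)⟩
  obtain ⟨q, hqS, hq⟩ := exists_seq_cofinal (S := {p : ℝ≥0∞ | (1 ≤ p ∧ p ≠ ⊤) ∧
    (p = 1 ∨ MemSobolevTwo n p U h)}) ⟨1, ⟨le_rfl, ENNReal.one_ne_top⟩, Or.inl rfl⟩
  have hw : ∀ k, ∃ w : ℕ → N → F, InteriorApprox n g U h df (16 * Λ) R (K k) w := fun k => by
    obtain ⟨P, hP, hPU, hPR⟩ := hP (K k) (hK k) (hKU k)
    exact exists_interiorApprox hU hh hdf hΛ hb hVMO hP hPU (hK k) (hKU k) hPR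
  choose w hw using hw
  set S : N → ℕ → Set (EuclideanSpace ℝ (Fin n)) := fun c k =>
    chartPart (chartAt (EuclideanSpace ℝ (Fin n)) c) (chartAt (EuclideanSpace ℝ (Fin n)) c c) (ρ c)
      (K k) with hSdef
  have hSc : ∀ c k, IsCompact (S c k) := fun c k =>
    isCompact_chartPart (hball c).subset_target (hK k)
  have hpos : ∀ k : ℕ, (0 : ℝ≥0∞) < ((k + 1 : ℕ) : ℝ≥0∞)⁻¹ := fun k =>
    ENNReal.inv_pos.2 (ENNReal.natCast_ne_top _)
  -- at step `k` the error is at most `1 / (k + 1)`, for the first `k + 1` exponents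
  have hm : ∀ k, ∃ m, (∀ x ∈ K k, ∀ᶠ y in 𝓝 x, w k m y ∈ R) ∧
      (∀ x ∈ K k, ‖w k m x - h x‖ ≤ 1 / ((k : ℝ) + 1)) ∧
      (∀ x ∈ K k, ∀ v : TangentSpace (𝓡 n) x,
        (16 * Λ)⁻¹ * g.inner x v v ≤ ‖classicalDifferential (w k m) x v‖ ^ 2 ∧
          ‖classicalDifferential (w k m) x v‖ ^ 2 ≤ 16 * Λ * g.inner x v v) ∧
      ∀ c ∈ J, ∀ j ∈ Finset.range (k + 1),
        eLpNorm (fun z =>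
          fderiv ℝ (fun z => w k m ((chartAt (EuclideanSpace ℝ (Fin n)) c).symm z)) z -
            chartDeriv df (chartAt (EuclideanSpace ℝ (Fin n)) c) z) (q j)
          (volume.restrict (S c k)) ≤ ((k + 1 : ℕ) : ℝ≥0∞)⁻¹ ∧
        (MemSobolevTwo n (q j) U h → eLpNorm (fun z => fderiv ℝ (fderiv ℝ
          (fun z => w k m ((chartAt (EuclideanSpace ℝ (Fin n)) c).symm z))) z - H c z) (q j)
            (volume.restrict (S c k)) ≤ ((k + 1 : ℕ) : ℝ≥0∞)⁻¹) := fun k => by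
    have hmaps : ∀ c, MapsTo (chartAt (EuclideanSpace ℝ (Fin n)) c).symm (S c k) (K k) :=
      fun c z hz => hz.2
    have hSt : ∀ c, S c k ⊆ (chartAt (EuclideanSpace ℝ (Fin n)) c).target :=
      fun c z hz => (hball c).subset_target hz.1
    refine (((hw k).range.and (((hw k).unif (1 / ((k : ℝ) + 1)) (by positivity)).and
      ((hw k).bounds.and ((Filter.eventually_all_finset J).2 fun c _ =>
        (Filter.eventually_all_finset _).2 fun j _ => Filter.Eventually.and ?_ ?_))))).exists
    · exact ENNReal.tendsto_nhds_zero.1 ((hw k).fderiv _ (hchart c) _ (hSc c k) (hSt c) (hmaps c)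
        (q j) (hqS j).1.1 (hqS j).1.2).2.2 _ (hpos k)
    · by_cases hS : MemSobolevTwo n (q j) U h
      · obtain ⟨T, hT, hTs, hTH⟩ := (hball c).hasWeakDeriv
        exact (ENNReal.tendsto_nhds_zero.1 ((hw k).fderivTwo _ (hchart c) _ (hSc c k) (hSt c)
          (hmaps c) (q j) (hqS j).1.1 (hqS j).1.2 hS T hT (inter_subset_left.trans hTs) _
          (hTH _ hS).1).2.2 _ (hpos k)).mono fun m hm _ => hm
      · exact Eventually.of_forall fun _ hS' => absurd hS' hS
  choose m hm1 hm2 hm3 hm4 using hm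
  have hinv0 : Tendsto (fun k : ℕ => ((k + 1 : ℕ) : ℝ≥0∞)⁻¹) atTop (𝓝 0) :=
    ENNReal.tendsto_inv_nat_nhds_zero.comp (tendsto_add_atTop_nat 1)
  have hunif : ∀ e > 0, ∀ᶠ k in atTop, ∀ x ∈ K k, ‖w k (m k) x - h x‖ ≤ e := fun e he => by
    filter_upwards [tendsto_one_div_add_atTop_nhds_zero_nat.eventually (gt_mem_nhds he)]
      with k hk x hx
    exact (hm2 k x hx).trans hk.le
  have hsm : ∀ k, ContMDiff (𝓡 n) 𝓘(ℝ, F) ∞ (w k (m k)) := fun k => (hw k).smooth _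
  have hSB : ∀ c k, S c k ⊆ chartImage (chartAt (EuclideanSpace ℝ (Fin n)) c) U ∩
      closedBall (chartAt (EuclideanSpace ℝ (Fin n)) c c) (ρ c) := fun c k z hz =>
    ⟨by rw [chartImage_eq]; exact ⟨(hball c).subset_target hz.1, hKU k hz.2⟩, hz.1⟩
  have hBfin : ∀ c, volume (chartImage (chartAt (EuclideanSpace ℝ (Fin n)) c) U ∩
      closedBall (chartAt (EuclideanSpace ℝ (Fin n)) c c) (ρ c)) ≠ ⊤ := fun c =>
    ne_top_of_le_ne_top measure_closedBall_lt_top.ne (measure_mono inter_subset_right)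
  have hcd : ∀ c k, ∀ z ∈ S c k, ContDiffAt ℝ ∞
      (fun z => w k (m k) ((chartAt (EuclideanSpace ℝ (Fin n)) c).symm z)) z := fun c k z hz =>
    contDiffAt_comp_chart_symm (hchart c) ((hball c).subset_target hz.1) (hsm k).contMDiffAt
  have hD : ∀ c ∈ J, ∀ p : ℝ≥0∞, 1 ≤ p → p ≠ ⊤ → (p = 1 ∨ MemSobolevTwo n p U h) →
      Tendsto (fun k => eLpNorm (fun z => fderiv ℝ
        (fun z => w k (m k) ((chartAt (EuclideanSpace ℝ (Fin n)) c).symm z)) z -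
          chartDeriv df (chartAt (EuclideanSpace ℝ (Fin n)) c) z) p
          (volume.restrict (S c k))) atTop (𝓝 0) := fun c hc p hp1 hp hpS => by
    obtain ⟨j, hj⟩ := hq p ⟨⟨hp1, hp⟩, hpS⟩
    refine tendsto_eLpNorm_zero_mono_exponent hp1 hj (hqS j).1.2 (hBfin c) (hSB c) (fun k => ?_) ?_
    · refine (aestronglyMeasurable_of_contDiffAt (hSc c k).measurableSet fun z hz =>
        (hcd c k z hz).fderiv_infty).sub ?_
      exact ((hdf _ (hchart c)).2.1.mono_set
        ((hSB c k).trans inter_subset_left)).aestronglyMeasurable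
    · refine tendsto_of_tendsto_of_tendsto_of_le_of_le' tendsto_const_nhds hinv0
        (Eventually.of_forall fun _ => zero_le) ?_
      filter_upwards [eventually_ge_atTop j] with k hk
      exact (hm4 k c hc j (Finset.mem_range.2 (by omega))).1
  have hD2 : ∀ c ∈ J, ∀ p : ℝ≥0∞, 1 ≤ p → p ≠ ⊤ → MemSobolevTwo n p U h →
      Tendsto (fun k => eLpNorm (fun z => fderiv ℝ (fderiv ℝ
        (fun z => w k (m k) ((chartAt (EuclideanSpace ℝ (Fin n)) c).symm z))) z - H c z) p
          (volume.restrict (S c k))) atTop (𝓝 0) := fun c hc p hp1 hp hpS => by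
    obtain ⟨j, hj⟩ := hq p ⟨⟨hp1, hp⟩, Or.inr hpS⟩
    have hjS : MemSobolevTwo n (q j) U h := by
      rcases (hqS j).2 with h1 | h1
      · rwa [h1, ← le_antisymm (hj.trans_eq h1) hp1]
      · exact h1
    refine tendsto_eLpNorm_zero_mono_exponent hp1 hj (hqS j).1.2 (hBfin c) (hSB c) (fun k => ?_) ?_
    · refine (aestronglyMeasurable_of_contDiffAt (hSc c k).measurableSet fun z hz =>
        (hcd c k z hz).fderiv_infty.fderiv_infty).sub ?_
      obtain ⟨T, hT, hTs, hTH⟩ := (hball c).hasWeakDeriv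
      exact (hTH _ hjS).2.1.mono_measure (Measure.restrict_mono (hSB c k) le_rfl)
    · refine tendsto_of_tendsto_of_tendsto_of_le_of_le' tendsto_const_nhds hinv0
        (Eventually.of_forall fun _ => zero_le) ?_
      filter_upwards [eventually_ge_atTop j] with k hk
      exact (hm4 k c hc j (Finset.mem_range.2 (by omega))).2 hjS
  refine ⟨fun k x => w k (m k) (Φ (ε k) x), fun k => (hsm k).comp (hΦc k), fun k x hx => ?_,
    fun e he => ?_, fun k x hx v => ?_, fun x hx => ?_⟩
  · exact (hΦc k).continuous.continuousAt.eventually (hm1 k _ ⟨x, hx, rfl⟩)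
  · have h1 : ∀ᶠ k in atTop, L₀ * ε k < e / 2 := by
      have := hε0.const_mul L₀
      rw [mul_zero] at this
      exact this.eventually (gt_mem_nhds (half_pos he))
    filter_upwards [hunif (e / 2) (half_pos he), h1] with k hk hk' x hx
    have e1 := hk _ (hΦK k hx)
    have e2 := hL₀ _ (hε k) x hx
    linarith [norm_sub_le_norm_sub_add_norm_sub (w k (m k) (Φ (ε k) x)) (h (Φ (ε k) x)) (h x)]
  · have h1 := mfderiv_comp (I := 𝓡 n) (I' := 𝓡 n) (I'' := 𝓘(ℝ, F)) (g := w k (m k))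
      (f := Φ (ε k)) x ((hsm k).mdifferentiableAt (by simp))
      ((hΦc k).mdifferentiableAt (by simp))
    have h2 : classicalDifferential (fun x => w k (m k) (Φ (ε k) x)) x v =
        classicalDifferential (w k (m k)) (Φ (ε k) x) (mfderiv (𝓡 n) (𝓡 n) (Φ (ε k)) x v) :=
      DFunLike.congr_fun h1 v
    obtain ⟨h3, h4⟩ := hεg k x hx v
    obtain ⟨h5, h6⟩ := hm3 k _ ⟨x, hx, rfl⟩ (mfderiv (𝓡 n) (𝓡 n) (Φ (ε k)) x v)
    rw [h2]
    have hΛi : 0 < (16 * Λ)⁻¹ := by positivity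
    constructor
    · have e1 : (64 * Λ)⁻¹ = (16 * Λ)⁻¹ / 4 := by
        rw [show (64 : ℝ) * Λ = 16 * Λ * 4 by ring, mul_inv, div_eq_mul_inv]
      rw [e1]
      nlinarith
    · nlinarith
  · obtain ⟨c, hcJ, hxc, hxr⟩ := mem_iUnion₂.1 (hJ hx)
    obtain ⟨s, hs, hsr⟩ := Metric.isOpen_ball.mem_nhds hxr |> Metric.mem_nhds_iff.1
    have hsub := inter_subset_inter_left (chartImage (chartAt (EuclideanSpace ℝ (Fin n)) c) U) hsr
    obtain ⟨hid, hev⟩ := hrε c ε hε0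
    have hlocal := fun (p : ℝ≥0∞) hp1 hp hD => (hball c).jetConv (p := p) hU hh hdf (hchart c) hC hK
      hKU hΦK (hrρ c) hid hev hsm hunif (by positivity : 0 < 16 * Λ) (fun k x hx v =>
        (hm3 k x hx v).2)
      hp1 hp hD
    refine ⟨_, hchart c, hxc, s, hs, ?_, fun p hp1 hp hpS => ?_⟩
    · exact (hlocal 1 le_rfl ENNReal.one_ne_top (hD c hcJ 1 le_rfl ENNReal.one_ne_top
        (Or.inl rfl))).2.1.mono_measure (Measure.restrict_mono hsub le_rfl)
    · obtain ⟨j1, -, j2⟩ := hlocal p hp1 hp (hD c hcJ p hp1 hp (Or.inr hpS))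
      exact ⟨j1.mono hsub, (j2 hpS (hD2 c hcJ p hp1 hp hpS)).mono hsub⟩

end ApproxSeq

/-! ### Almost everywhere and Sobolev convergence -/

/-- Finitely many sequences which converge in measure have a common subsequence converging almost
everywhere. -/
theorem exists_subseq_ae_tendsto {ι α F : Type*} [MeasurableSpace α] [NormedAddCommGroup F]
    {μ : ι → Measure α} {w : ι → ℕ → α → F} {w₀ : ι → α → F} (s : Finset ι)
    (h : ∀ i ∈ s, TendstoInMeasure (μ i) (w i) atTop (w₀ i)) :
    ∃ σ : ℕ → ℕ, StrictMono σ ∧ ∀ i ∈ s, ∀ᵐ x ∂(μ i),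
      Tendsto (fun k => w i (σ k) x) atTop (𝓝 (w₀ i x)) := by
  classical
  induction s using Finset.induction_on with
  | empty => exact ⟨id, strictMono_id, by simp⟩
  | insert i s hi ih =>
    obtain ⟨σ, hσ, h1⟩ := ih fun j hj => h j (Finset.mem_insert_of_mem hj)
    have h2 : TendstoInMeasure (μ i) (fun k => w i (σ k)) atTop (w₀ i) := fun ε hε =>
      (h i (Finset.mem_insert_self i s) ε hε).comp hσ.tendsto_atTop
    obtain ⟨τ, hτ, h3⟩ := h2.exists_seq_tendsto_ae
    refine ⟨σ ∘ τ, hσ.comp hτ, fun j hj => ?_⟩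
    rcases Finset.mem_insert.1 hj with rfl | hj
    · exact h3
    · filter_upwards [h1 j hj] with x hx using hx.comp hτ.tendsto_atTop

theorem LpTendsto.of_ae_eq_zero {α F : Type*} [MeasurableSpace α] [NormedAddCommGroup F]
    {μ : Measure α} {p : ℝ≥0∞} {w : ℕ → α → F} (h : ∀ k, ∀ᵐ x ∂μ, w k x = 0) :
    LpTendsto p μ w fun _ => 0 := by
  have h0 : MemLp (fun _ : α => (0 : F)) p μ := by simp
  exact (LpTendsto.const h0).congr
    (Eventually.of_forall fun k => (h k).mono fun _ hx => hx.symm) ae_eq_rfl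

section Euclidean

variable {n : ℕ} {F : Type*} [NormedAddCommGroup F] [NormedSpace ℝ F] {p : ℝ≥0∞}
  {A C Ω : Set (EuclideanSpace ℝ (Fin n))} {v : ℕ → EuclideanSpace ℝ (Fin n) → F}
  {u : EuclideanSpace ℝ (Fin n) → F}

theorem JetConv.of_eventuallyEq_zero (h : ∀ k, ∀ x ∈ A, v k =ᶠ[𝓝 x] fun _ => 0)
    (hA : MeasurableSet A) : JetConv p A v := by
  have h1 : ∀ k, ∀ᵐ x ∂(volume.restrict A), v k x = 0 := fun k => by
    filter_upwards [ae_restrict_mem hA] with x hx using (h k x hx).self_of_nhds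
  have h2 : ∀ k, ∀ᵐ x ∂(volume.restrict A), fderiv ℝ (v k) x = 0 := fun k => by
    filter_upwards [ae_restrict_mem hA] with x hx
    rw [(h k x hx).fderiv_eq, fderiv_const_apply]
  refine ⟨Eventually.of_forall fun k x hx => contDiffAt_const.congr_of_eventuallyEq (h k x hx),
    ⟨0, Eventually.of_forall fun k x hx => ?_⟩, ⟨fun _ => 0, ?_⟩, ⟨fun _ => 0, ?_⟩⟩
  · rw [(h k x hx).self_of_nhds, norm_zero]
  · exact LpTendsto.of_ae_eq_zero h1
  · exact LpTendsto.of_ae_eq_zero h2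

/-- Local convergence near the points of a compact set is convergence on a neighbourhood of it. -/
theorem JetConv.exists_of_isCompact (hp1 : 1 ≤ p) (hp : p ≠ ⊤) (hC : IsCompact C)
    (hΩ : MeasurableSet Ω) (h : ∀ a ∈ C, JetConvAt p Ω a v) :
    ∃ A, IsOpen A ∧ C ⊆ A ∧ JetConv p (A ∩ Ω) v := by
  refine hC.induction_on (p := fun C => ∃ A, IsOpen A ∧ C ⊆ A ∧ JetConv p (A ∩ Ω) v)
    ⟨∅, isOpen_empty, subset_rfl, JetConv.of_eventuallyEq_zero (by simp) (by simp)⟩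
    (fun s t hst ⟨A, h1, h2, h3⟩ => ⟨A, h1, hst.trans h2, h3⟩) ?_ fun a ha => ?_
  · rintro s t ⟨A, h1, h2, h3⟩ ⟨A', h1', h2', h3'⟩
    refine ⟨A ∪ A', h1.union h1', union_subset_union h2 h2', ?_⟩
    rw [union_inter_distrib_right]
    exact h3.union hp1 hp (h1.measurableSet.inter hΩ) h3'
  · obtain ⟨r, hr, h1⟩ := h a ha
    exact ⟨ball a r, mem_nhdsWithin_of_mem_nhds (ball_mem_nhds a hr), ball a r, isOpen_ball,
      subset_rfl, h1⟩

/-- A global criterion: local convergence near a compact set outside of which all functions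
vanish. -/
theorem JetConv.of_isCompact (hp1 : 1 ≤ p) (hp : p ≠ ⊤) (hC : IsCompact C) (hΩ : MeasurableSet Ω)
    (h : ∀ a ∈ C, JetConvAt p Ω a v) (h0 : ∀ k, ∀ x ∈ Ω \ C, v k =ᶠ[𝓝 x] fun _ => 0) :
    JetConv p Ω v := by
  obtain ⟨A, hA, hCA, h1⟩ := JetConv.exists_of_isCompact hp1 hp hC hΩ h
  have h2 : JetConv p (Ω \ A) v := JetConv.of_eventuallyEq_zero
    (fun k x hx => h0 k x ⟨hx.1, fun hxC => hx.2 (hCA hxC)⟩) (hΩ.diff hA.measurableSet)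
  have h3 : (A ∩ Ω) ∪ (Ω \ A) = Ω := by rw [inter_comm, inter_union_sdiff]
  rw [← h3]
  exact h1.union hp1 hp (hA.measurableSet.inter hΩ) h2

/-- The limits in `L^p` of the first and second derivatives are the weak derivatives of the limit
`u`. -/
theorem tendsto_sobolevNormTwo_of_jetConv [CompleteSpace F] (hp1 : 1 ≤ p) (hΩ : IsOpen Ω)
    (h : JetConv p Ω v) (h' : JetConv p Ω fun k => fderiv ℝ (v k))
    (hu : ∀ x ∈ Ω, Tendsto (fun k => v k x) atTop (𝓝 (u x))) :
    Tendsto (fun k => sobolevNormTwo p Ω (fun x => v k x - u x)) atTop (𝓝 0) := by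
  obtain ⟨u₀, hu₀⟩ := h.conv
  obtain ⟨G, hG⟩ := h.conv_fderiv
  obtain ⟨H, hH⟩ := h'.conv_fderiv
  have hw : ∀ᶠ k in atTop, HasWeakDeriv Ω (v k) (fderiv ℝ (v k)) := by
    filter_upwards [h.smooth] with k hk
    exact ContDiffOn.hasWeakDeriv hΩ fun x hx => ((hk x hx).of_le (by simp)).contDiffWithinAt
  have hw' : ∀ᶠ k in atTop, HasWeakDeriv Ω (fderiv ℝ (v k)) (fderiv ℝ (fderiv ℝ (v k))) := by
    filter_upwards [h'.smooth] with k hk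
    exact ContDiffOn.hasWeakDeriv hΩ fun x hx => ((hk x hx).of_le (by simp)).contDiffWithinAt
  have hae : u₀ =ᵐ[volume.restrict Ω] u := by
    obtain ⟨σ, hσ, h1⟩ := (hu₀.tendstoInMeasure
      (zero_lt_one.trans_le hp1).ne').exists_seq_tendsto_ae
    filter_upwards [h1, ae_restrict_mem hΩ.measurableSet] with x hx hxΩ
    exact tendsto_nhds_unique hx ((hu x hxΩ).comp hσ.tendsto_atTop)
  have hu' : LpTendsto p (volume.restrict Ω) v u :=
    hu₀.congr (Eventually.of_forall fun _ => ae_eq_rfl) hae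
  have hG' := HasWeakDeriv.of_lpTendsto hp1 hw hu' hG
  have hH' := HasWeakDeriv.of_lpTendsto hp1 hw' hG hH
  have h0 := hu'.2.2.add (hG.2.2.add hH.2.2)
  rw [add_zero, add_zero] at h0
  refine tendsto_of_tendsto_of_tendsto_of_le_of_le' tendsto_const_nhds h0
    (Eventually.of_forall fun _ => zero_le) ?_
  filter_upwards [hw, hw'] with k hk hk'
  refine iInf₂_le_of_le _ (hk.sub hG') (add_le_add le_rfl ?_)
  exact iInf₂_le_of_le _ (hk'.sub hH') le_rfl

end Euclidean

section Limits

variable {n : ℕ} {N : Type*} [TopologicalSpace N] [ChartedSpace (EuclideanSpace ℝ (Fin n)) N]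
  [IsManifold (𝓡 n) ∞ N] {F : Type*} [NormedAddCommGroup F] [NormedSpace ℝ F]
  {φ ψ : OpenPartialHomeomorph N (EuclideanSpace ℝ (Fin n))} {U : Set N} {h : N → F}
  {g : Bundle.ContMDiffRiemannianMetric (𝓡 n) ∞ (EuclideanSpace ℝ (Fin n))
      (fun x : N => TangentSpace (𝓡 n) x)}
  {df : ∀ x : N, TangentSpace (𝓡 n) x →L[ℝ] F} {Λ : ℝ} {R : Set F} {f : ℕ → N → F}

/-- Null sets are mapped to null sets by changes of coordinates. -/
theorem volume_transition_eq_zero (hφ : φ ∈ IsManifold.maximalAtlas (𝓡 n) ∞ N)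
    (hψ : ψ ∈ IsManifold.maximalAtlas (𝓡 n) ∞ N) {Z : Set (EuclideanSpace ℝ (Fin n))}
    (hZ : volume Z = 0) :
    volume {z | z ∈ ψ.target ∧ ψ.symm z ∈ φ.source ∧ φ (ψ.symm z) ∈ Z} = 0 := by
  have h1 : volume ((fun z => ψ (φ.symm z)) '' (Z ∩ {z | z ∈ φ.target ∧ φ.symm z ∈ ψ.source}))
      = 0 :=
    addHaar_image_eq_zero_of_differentiableOn_of_addHaar_eq_zero volume
      (fun z hz => ((contDiffAt_transition hψ hφ hz.2.1 hz.2.2).differentiableAt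
        (by simp)).differentiableWithinAt) (measure_mono_null inter_subset_left hZ)
  refine measure_mono_null ?_ h1
  rintro z ⟨hz, hzφ, hzZ⟩
  refine ⟨φ (ψ.symm z), ⟨hzZ, φ.map_source hzφ, ?_⟩, ?_⟩
  · rw [φ.left_inv hzφ]
    exact ψ.map_target hz
  · simp only [φ.left_inv hzφ, ψ.right_inv hz]

namespace ApproxSeq

/-- `L^1` convergence on finitely many chart balls which cover `closure U` gives, for a subsequence,
convergence almost everywhere. The result is transported to all other charts. -/
theorem exists_subseq_ae (hf : ApproxSeq g U h df Λ R f) (hU : IsOpen U)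
    (hUc : IsCompact (closure U)) : ∃ σ : ℕ → ℕ, StrictMono σ ∧ AlmostEverywhereOn n U fun x =>
      ∀ v : TangentSpace (𝓡 n) x,
        Tendsto (fun k => classicalDifferential (f (σ k)) x v) atTop (𝓝 (df x v)) := by
  choose φ hφ hxφ r hr hconv _ using hf.conv
  obtain ⟨J, hJ⟩ := hUc.elim_nhds_subcover'
    (fun x hx => (φ x hx).source ∩ φ x hx ⁻¹' ball (φ x hx x) (r x hx))
    fun x hx => ((φ x hx).isOpen_inter_preimage isOpen_ball).mem_nhds
      ⟨hxφ x hx, mem_ball_self (hr x hx)⟩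
  obtain ⟨σ, hσ, h1⟩ := exists_subseq_ae_tendsto J (fun x _ =>
    (hconv x x.2).tendstoInMeasure one_ne_zero)
  refine ⟨σ, hσ, fun ψ hψ => ?_⟩
  have hΩ : ∀ (φ : OpenPartialHomeomorph N (EuclideanSpace ℝ (Fin n)))
      (a : EuclideanSpace ℝ (Fin n)) (r : ℝ), MeasurableSet (ball a r ∩ chartImage φ U) :=
    fun φ a r => measurableSet_ball.inter (isOpen_chartImage φ hU).measurableSet
  rw [ae_restrict_iff' (isOpen_chartImage ψ hU).measurableSet, ae_iff]
  refine measure_mono_null (t := ⋃ x ∈ J, {z | z ∈ ψ.target ∧ ψ.symm z ∈ (φ x x.2).source ∧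
    φ x x.2 (ψ.symm z) ∈ {y | ¬ (y ∈ ball (φ x x.2 x) (r x x.2) ∩ chartImage (φ x x.2) U →
      Tendsto (fun k => fderiv ℝ (fun z => f (σ k) ((φ x x.2).symm z)) y) atTop
        (𝓝 (chartDeriv df (φ x x.2) y)))}}) ?_ ?_
  · intro z hz
    simp only [mem_ofPred_eq, Classical.not_imp] at hz
    obtain ⟨hzU, hzt⟩ := hz
    rw [chartImage_eq] at hzU
    obtain ⟨x, hxJ, hzs, hzr⟩ := mem_iUnion₂.1 (hJ (subset_closure hzU.2))
    refine mem_iUnion₂.2 ⟨x, hxJ, hzU.1, hzs, fun himp => hzt fun v => ?_⟩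
    have h2 := himp ⟨hzr, ⟨_, ⟨hzs, hzU.2⟩, rfl⟩⟩
    let v' : EuclideanSpace ℝ (Fin n) := mfderiv (𝓡 n) (𝓡 n) (φ x x.2) (ψ.symm z) v
    have h3 := ((ContinuousLinearMap.apply ℝ F v').continuous.tendsto _).comp h2
    have h4 : ∀ k, classicalDifferential (f (σ k)) (ψ.symm z) v = fderiv ℝ
        (fun z => f (σ k) ((φ x x.2).symm z)) (φ x x.2 (ψ.symm z))
          (mfderiv (𝓡 n) (𝓡 n) (φ x x.2) (ψ.symm z) v) := fun k =>
      classicalDifferential_apply_eq (hφ x x.2) hzs ((hf.smooth _).mdifferentiableAt (by simp)) v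
    have h5 : chartDeriv df (φ x x.2) (φ x x.2 (ψ.symm z))
        (mfderiv (𝓡 n) (𝓡 n) (φ x x.2) (ψ.symm z) v) = df (ψ.symm z) v := by
      let D : N → EuclideanSpace ℝ (Fin n) →L[ℝ] F := df
      change D ((φ x x.2).symm (φ x x.2 (ψ.symm z))) (mfderiv (𝓡 n) (𝓡 n) (φ x x.2).symm
        (φ x x.2 (ψ.symm z)) (mfderiv (𝓡 n) (𝓡 n) (φ x x.2) (ψ.symm z) v)) = D (ψ.symm z) v
      rw [(φ x x.2).left_inv hzs]
      erw [mfderiv_chart_symm_apply (hφ x x.2) hzs v]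
    rw [← h5]
    simp only [h4]
    exact h3
  · refine (measure_biUnion_null_iff J.countable_toSet).2 fun x hx =>
      volume_transition_eq_zero (hφ x x.2) hψ ?_
    rw [← ae_iff, ← ae_restrict_iff' (hΩ _ _ _)]
    exact h1 x hx

/-- The convergence in the charts of `ApproxSeq.conv`, transported to an arbitrary chart. At points
away from `closure U` there is nothing to prove. -/
theorem jetTwoConvAt (hf : ApproxSeq g U h df Λ R f) (hU : IsOpen U) {p : ℝ≥0∞} (hp1 : 1 ≤ p)
    (hp : p ≠ ⊤) (hS : MemSobolevTwo n p U h) (hφ : φ ∈ IsManifold.maximalAtlas (𝓡 n) ∞ N)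
    {a : EuclideanSpace ℝ (Fin n)} (ha : a ∈ φ.target) :
    JetTwoConvAt p (chartImage φ U) a fun k z => f k (φ.symm z) := by
  have hΩ : MeasurableSet (chartImage φ U) := (isOpen_chartImage φ hU).measurableSet
  by_cases haU : φ.symm a ∈ closure U
  · obtain ⟨ψ, hψ, haψ, r, hr, -, h1⟩ := hf.conv _ haU
    obtain ⟨j1, j2⟩ := h1 p hp1 hp hS
    have hev := eventually_mem_transition ha haψ
    have h2 : JetTwoConvAt p (chartImage ψ U) (ψ (φ.symm a)) fun k z => f k (ψ.symm z) :=
      ⟨⟨r, hr, j1⟩, r, hr, j2⟩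
    have h3 := h2.comp hp1 hp hΩ (τ := fun z => ψ (φ.symm z)) (σ := fun z => φ (ψ.symm z))
      (by filter_upwards [hev] with z hz using contDiffAt_transition hψ hφ hz.1 hz.2)
      ((contDiffAt_transition hφ hψ (ψ.map_source haψ) (by
        rw [ψ.left_inv haψ]; exact φ.map_target ha)).differentiableAt (by simp))
      (by filter_upwards [hev] with z hz; rw [ψ.left_inv hz.2, φ.right_inv hz.1])
      (by
        filter_upwards [hev] with z hz hzU
        rw [chartImage_eq] at hzU
        exact ⟨_, ⟨hz.2, hzU.2⟩, rfl⟩)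
    refine h3.congr hΩ (interior_mem_nhds.2 hev) (Eventually.of_forall fun k x hx => ?_)
    filter_upwards [mem_interior_iff_mem_nhds.1 hx.1] with z hz
    simp only [ψ.left_inv hz.2]
  · have hev : ∀ᶠ z in 𝓝 a, z ∉ chartImage φ U := by
      filter_upwards [(φ.continuousAt_symm ha).eventually
        (isClosed_closure.isOpen_compl.mem_nhds haU)] with z hz hzU
      rw [chartImage_eq] at hzU
      exact hz (subset_closure hzU.2)
    obtain ⟨r, hr, hrU⟩ := Metric.eventually_nhds_iff_ball.1 hev
    have hempty : ball a r ∩ chartImage φ U = ∅ := by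
      ext z
      simp only [mem_inter_iff, mem_empty_iff_false, iff_false, not_and]
      exact hrU z
    refine ⟨⟨r, hr, ?_⟩, r, hr, ?_⟩ <;> rw [hempty] <;>
      exact JetConv.of_eventuallyEq_zero (by simp) MeasurableSet.empty

/-- Convergence in `W^{2,p}`. The maps `f k` may be changed outside `U`. -/
theorem tendstoSobolevTwo [T2Space N] [CompleteSpace F] (hf : ApproxSeq g U h df Λ R f)
    (hU : IsOpen U) {f' : ℕ → N → F} (hf' : ∀ k, EqOn (f k) (f' k) U) {p : ℝ≥0∞} (hp1 : 1 ≤ p)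
    (hp : p ≠ ⊤) (hS : MemSobolevTwo n p U h) : TendstoSobolevTwo n p U f' h := by
  rintro φ hφ ξ ⟨hξ, hξc, hξφ⟩
  have hΩo := isOpen_chartImage φ hU
  have hΩ : MeasurableSet (chartImage φ U) := hΩo.measurableSet
  have hC : IsCompact (φ '' tsupport ξ) := hξc.isCompact.image_of_continuousOn
    (φ.continuousOn.mono hξφ)
  have hCt : φ '' tsupport ξ ⊆ φ.target := by
    rintro _ ⟨x, hx, rfl⟩
    exact φ.map_source (hξφ hx)
  have hj : ∀ a ∈ φ '' tsupport ξ, JetTwoConvAt p (chartImage φ U) a fun k => localRep φ ξ (f k) :=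
    fun a ha => by
    refine (JetTwoConvAt.of_smooth hΩ (f := fun z => ξ (φ.symm z)) ?_).bilin hp1 hp hΩ
      (ContinuousLinearMap.lsmul ℝ ℝ) (hf.jetTwoConvAt hU hp1 hp hS hφ (hCt ha))
    filter_upwards [φ.open_target.mem_nhds (hCt ha)] with z hz
    exact contDiffAt_comp_chart_symm hφ hz hξ.contMDiffAt
  have h0 : ∀ k, ∀ z ∈ chartImage φ U \ (φ '' tsupport ξ),
      localRep φ ξ (f k) =ᶠ[𝓝 z] fun _ => 0 := fun k z hz => by
    have h1 := hz.1
    rw [chartImage_eq] at h1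
    have h2 : φ.symm z ∉ tsupport ξ := fun h => hz.2 ⟨_, h, φ.right_inv h1.1⟩
    filter_upwards [(φ.continuousAt_symm h1.1).eventually
      (notMem_tsupport_iff_eventuallyEq.1 h2)] with y hy
    rw [localRep, hy, Pi.zero_apply, zero_smul]
  have h0' : ∀ k, ∀ z ∈ chartImage φ U \ (φ '' tsupport ξ),
      fderiv ℝ (localRep φ ξ (f k)) =ᶠ[𝓝 z] fun _ => 0 := fun k z hz => by
    filter_upwards [(h0 k z hz).fderiv (𝕜 := ℝ)] with y hy
    rw [hy, fderiv_const_apply]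
  have hcongr : ∀ k, ∀ z ∈ chartImage φ U, localRep φ ξ (f k) =ᶠ[𝓝 z] localRep φ ξ (f' k) :=
    fun k z hz => by
    filter_upwards [hΩo.mem_nhds hz] with y hy
    rw [chartImage_eq] at hy
    simp only [localRep, hf' k hy.2]
  have j1 := (JetConv.of_isCompact hp1 hp hC hΩ (fun a ha => (hj a ha).1) h0).congr hΩ
    (Eventually.of_forall hcongr)
  have j2 := (JetConv.of_isCompact hp1 hp hC hΩ (fun a ha => (hj a ha).2) h0').congr hΩ
    (Eventually.of_forall fun k z hz => (hcongr k z hz).fderiv)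
  have hlim : ∀ z ∈ chartImage φ U,
      Tendsto (fun k => localRep φ ξ (f' k) z) atTop (𝓝 (localRep φ ξ h z)) := fun z hz => by
    rw [chartImage_eq] at hz
    refine Tendsto.const_smul ?_ _
    refine Metric.tendsto_nhds.2 fun ε hε => ?_
    filter_upwards [hf.unif (ε / 2) (half_pos hε)] with k hk
    rw [dist_eq_norm, ← hf' k hz.2]
    exact (hk _ hz.2).trans_lt (half_lt_self hε)
  refine (tendsto_sobolevNormTwo_of_jetConv hp1 hΩo j1 j2 hlim).congr fun k => ?_
  congr 1
  funext z
  simp only [localRep, Pi.sub_apply, smul_sub]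

end ApproxSeq

end Limits

end

/-! ### Approximation by immersions -/

theorem mainTheorem3 {n l m : ℕ}
    {N : Type*} [TopologicalSpace N] [T2Space N] [SecondCountableTopology N]
    [ChartedSpace (EuclideanSpace ℝ (Fin n)) N] [IsManifold (𝓡 n) ∞ N]
    (g : Bundle.ContMDiffRiemannianMetric (𝓡 n) ∞ (EuclideanSpace ℝ (Fin n))
      (fun x : N => TangentSpace (𝓡 n) x))
    {M : Type*} [TopologicalSpace M]
    [ChartedSpace (EuclideanSpace ℝ (Fin l)) M] [IsManifold (𝓡 l) ∞ M]
    (ι : M → EuclideanSpace ℝ (Fin m)) (hι : Manifold.IsSmoothEmbedding (𝓡 l) (𝓡 m) ∞ ι)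
    (U : Set N) (hUopen : IsOpen U) (hUcompact : IsCompact (closure U))
    (hULip : HasLipschitzBoundary (n := n) U)
    (f : N → M) (hfcont : ContinuousOn f U)
    (df : ∀ x : N, TangentSpace (𝓡 n) x →L[ℝ] EuclideanSpace ℝ (Fin m))
    (hf : IsWeakImmersion g U (ι ∘ f) df)
    (hVMO : DifferentialMemVMO n U (ι ∘ f)) :
    ∃ (fk : ℕ → N → M) (Λ : ℝ), 0 < Λ ∧
      -- each `fk k` is a smooth immersion of the closure of `U` into `M`
      (∀ k, (∃ O : Set N, IsOpen O ∧ closure U ⊆ O ∧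
          ContMDiffOn (𝓡 n) (𝓡 l) ∞ (fk k) O) ∧
        ∀ x ∈ closure U, Function.Injective (mfderiv (𝓡 n) (𝓡 l) (fk k) x)) ∧
      TendstoUniformlyOn (fun k => ι ∘ fk k) (ι ∘ f) atTop U ∧
      (AlmostEverywhereOn n U fun x => ∀ v : TangentSpace (𝓡 n) x,
        Tendsto (fun k => classicalDifferential (ι ∘ fk k) x v) atTop (𝓝 (df x v))) ∧
      (∀ k, ∀ x ∈ U, ∀ v : TangentSpace (𝓡 n) x,
        Λ⁻¹ * √(g.inner x v v) ≤ ‖classicalDifferential (ι ∘ fk k) x v‖ ∧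
          ‖classicalDifferential (ι ∘ fk k) x v‖ ≤ Λ * √(g.inner x v v)) ∧
      ∀ p : ℝ≥0∞, 1 ≤ p → p ≠ ⊤ → MemSobolevTwo n p U (ι ∘ f) →
        TendstoSobolevTwo n p U (fun k => ι ∘ fk k) (ι ∘ f) := by
  classical
  obtain ⟨Λ, hΛ, hb⟩ := hf.bounds
  have hιc : Continuous ι := hι.contMDiff.continuous
  have hh : ContinuousOn (ι ∘ f) U := hιc.comp_continuousOn hfcont
  obtain ⟨F, hF⟩ := exists_approxSeq (R := range ι) hUopen hUcompact hULip hh hf.isWeakDifferential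
    hΛ hb hVMO fun K hK hKU => by
      obtain ⟨P, hP, hPι, hPR⟩ := hι.exists_retraction
        (hK.image_of_continuousOn (hh.mono hKU)) (by
          rintro _ ⟨x, -, rfl⟩
          exact ⟨f x, rfl⟩)
      exact ⟨P, hP, fun x _ => hPι (f x), fun x hx => hPR _ ⟨x, hx, rfl⟩⟩
  obtain ⟨σ, hσ, hae⟩ := hF.exists_subseq_ae hUopen hUcompact
  have hFσ := hF.comp_subseq hσ.tendsto_atTop
  -- lift the approximating maps to `M`; the value where no lift exists, away from `closure U`, is
  -- irrelevant
  set fk : ℕ → N → M := fun k x => if hx : F (σ k) x ∈ range ι then hx.choose else f x with hfk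
  have hlift : ∀ k x, F (σ k) x ∈ range ι → ι (fk k x) = F (σ k) x := fun k x hx => by
    simp only [hfk, dif_pos hx]
    exact hx.choose_spec
  have hev : ∀ k, ∀ x ∈ closure U, (ι ∘ fk k) =ᶠ[𝓝 x] F (σ k) := fun k x hx => by
    filter_upwards [hFσ.range k x hx] with y hy using hlift k y hy
  have hEq : ∀ k, EqOn (F (σ k)) ((ι ∘ fk k)) U := fun k x hx =>
    (hev k x (subset_closure hx)).self_of_nhds.symm
  have hcd : ∀ k, ∀ x ∈ closure U,
      classicalDifferential (n := n) (ι ∘ fk k) x = classicalDifferential (F (σ k)) x :=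
    fun k x hx => (hev k x hx).mfderiv_eq
  have hsm : ∀ k, ∀ x ∈ closure U, ContMDiffAt (𝓡 n) (𝓡 l) ∞ (fk k) x := fun k x hx =>
    hι.contMDiffAt_of_comp ((hFσ.smooth k).contMDiffAt.congr_of_eventuallyEq (hev k x hx))
  refine ⟨fk, √(64 * Λ), by positivity, fun k => ⟨⟨interior {x | F (σ k) x ∈ range ι},
    isOpen_interior, fun x hx => mem_interior_iff_mem_nhds.2 (hFσ.range k x hx), fun x hx => ?_⟩,
    fun x hx v v' hvv => ?_⟩, ?_, fun φ hφ => ?_, fun k x hx v => ?_, fun p hp1 hp hS =>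
      hFσ.tendstoSobolevTwo hUopen hEq hp1 hp hS⟩
  · refine (hι.contMDiffAt_of_comp ((hFσ.smooth k).contMDiffAt.congr_of_eventuallyEq
      ?_)).contMDiffWithinAt
    filter_upwards [mem_interior_iff_mem_nhds.1 hx] with y hy using hlift k y hy
  · have h1 : classicalDifferential (n := n) (ι ∘ fk k) x (v - v') = 0 := by
      have h2 := mfderiv_comp (I := 𝓡 n) (I' := 𝓡 l) (I'' := 𝓡 m) (g := ι) (f := fk k) x
        (hι.contMDiff.mdifferentiableAt (by simp)) ((hsm k x hx).mdifferentiableAt (by simp))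
      have h3 : ∀ w, classicalDifferential (n := n) (ι ∘ fk k) x w =
          mfderiv (𝓡 l) (𝓡 m) ι (fk k x) (mfderiv (𝓡 n) (𝓡 l) (fk k) x w) :=
        fun w => DFunLike.congr_fun h2 w
      rw [map_sub, h3, h3, hvv]
      exact sub_self (_ : EuclideanSpace ℝ (Fin m))
    by_contra hne
    have h2 := (hFσ.bounds k x hx (v - v')).1
    rw [← hcd k x hx, h1, norm_zero] at h2
    have h3 := g.pos x (v - v') (sub_ne_zero.2 hne)
    have h4 : 0 < (64 * Λ)⁻¹ * g.inner x (v - v') (v - v') := mul_pos (by positivity) h3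
    linarith [h2.trans_eq (by norm_num : (0 : ℝ) ^ 2 = 0)]
  · refine Metric.tendstoUniformlyOn_iff.2 fun ε hε => ?_
    filter_upwards [hFσ.unif (ε / 2) (half_pos hε)] with k hk x hx
    rw [dist_comm, dist_eq_norm, ← hEq k hx]
    exact (hk x hx).trans_lt (half_lt_self hε)
  · filter_upwards [hae φ hφ, ae_restrict_mem (isOpen_chartImage φ hUopen).measurableSet]
      with z hz hzU v
    rw [chartImage_eq] at hzU
    exact (hz v).congr fun k => by rw [hcd k _ (subset_closure hzU.2)]
  · obtain ⟨h1, h2⟩ := hFσ.bounds k x (subset_closure hx) v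
    rw [← hcd k x (subset_closure hx)] at h1 h2
    constructor
    · rw [← Real.sqrt_inv, ← Real.sqrt_mul (by positivity)]
      exact Real.sqrt_le_iff.2 ⟨norm_nonneg _, h1⟩
    · rw [← Real.sqrt_mul (by positivity)]
      exact Real.le_sqrt_of_sq_le h2
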